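/- **Theorem 3.1.** Let $\lambda>0$ and let $a:[0,1]\times[0,1)\to\mathbb R$, $(x,t)\mapsto a(x,t)$, be continuous in $x\in[0,1]$ for each $t$ and analytic in $t\in[0,1)$ uniformly in $x$ (around each $t_1\in[0,1)$, $a(x,t)=\sum_n c_n(x)(t-t_1)^n$ for $t\in[0,1)$, $|t-t_1|<\rho$, with $\rho>0$ and $\sup_{n,x}|c_n(x)|\rho^n<\infty$). Then the kernel problem $$\begin{cases}k_{xx}-k_{yy}-k_t=(a(y,t)+\lambda)\,k, & 0<y<x<1,\ 0\le t<1,\\ k_y(x,0,t)=0,\quad k(0,0,t)=0, & 0\le x\le 1,\ 0\le t<1,\\ k_x(x,x,t)+k_y(x,x,t)+\frac{d}{dx}\big(k(x,x,t)\big)=a(x,t)+\lambda, & 0\le x\le 1,\ 0\le t<1,\end{cases}$$ has a solution $k$ that is $C^1$ on $\{0\le y\le x\le1,\ 0\le t<1\}$, where $k_{xx}-k_{yy}$ is understood as $(\partial_x-\partial_y)(k_x+k_y)$, the derivative of $k_x+k_y$ in the direction $(1,-1)$. Moreover, for every such solution $k$ and for each of the two feedback laws $$\text{(D)}\quad u(1,t)=-\int_0^1k(1,y,t)u(y,t)\,dy,\qquad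 \text{(N)}\quad u_x(1,t)=-k(1,1,t)u(1,t)-\int_0^1k_x(1,y,t)u(y,t)\,dy$$ there are constants $M=M(t_0)>0$ ($0<t_0<1$), independent of $u^0$, such that the following holds for every $u^0\in H^1(0,1)$, which in the case of (D) is also assumed to satisfy the compatibility condition $u^0(1)=-\int_0^1k(1,y,0)u^0(y)\,dy$. The problem $$u_t=u_{xx}+a(x,t)u\ \text{ in }(0,1)\times(0,1),\qquad u_x(0,t)=0,\qquad u(x,0)=u^0(x),$$ with the chosen feedback law at $x=1$, has a solution $u$ on $[0,1)$, which on each interval $[0,t_0]$ with $0<t_0<1$ is the unique strong solution and satisfies $$\|u(t)\|_{H^1}\le M(t_0)\,\|u^0\|_{H^1}\,e^{-\lambda t},\qquad t\in(0,t_0).$$ Here a strong solution on $[0,t_0]$ is a function in $C([0,t_0];H^1(0,1))\cap L^2(0,t_0;H^2(0,1))\cap H^1(0,t_0;L^2(0,1))$ which satisfies the equation almost everywhere, the boundary conditions for almost every $t$, and the initial condition. -/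

import Mathlib

open Set Filter Topology MeasureTheory
open scoped ContDiff

/-- `a(x,t)` is analytic in `t ∈ [0,1)` uniformly in `x ∈ [0,1]`: around every `t₁ ∈ [0,1)` it has a
power series in `t - t₁`, with a radius `ρ` and a geometric bound on the coefficients that do not
depend on `x`. -/
def AnalyticInTimeUniformly (a : ℝ → ℝ → ℝ) : Prop :=
  ∀ t₁ ∈ Ico (0 : ℝ) 1, ∃ ρ > 0, ∃ C : ℝ, ∃ c : ℕ → ℝ → ℝ,
    (∀ n, ∀ x ∈ Icc (0 : ℝ) 1, |c n x| * ρ ^ n ≤ C) ∧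
    ∀ x ∈ Icc (0 : ℝ) 1, ∀ t ∈ Ico (0 : ℝ) 1, |t - t₁| < ρ →
      HasSum (fun n : ℕ => c n x * (t - t₁) ^ n) (a x t)

/-- The set of all `(x, y, t)` with `0 ≤ y ≤ x ≤ 1` and `0 ≤ t < 1`. -/
def kernelDomain : Set (ℝ × ℝ × ℝ) :=
  {p | 0 ≤ p.2.1 ∧ p.2.1 ≤ p.1 ∧ p.1 ≤ 1 ∧ 0 ≤ p.2.2 ∧ p.2.2 < 1}

/-- `k_x` (one-sided at the boundary of the domain). -/
noncomputable def kernelDx (k : ℝ × ℝ × ℝ → ℝ) (p : ℝ × ℝ × ℝ) : ℝ :=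
  fderivWithin ℝ k kernelDomain p (1, 0, 0)

/-- `k_y` (one-sided at the boundary of the domain). -/
noncomputable def kernelDy (k : ℝ × ℝ × ℝ → ℝ) (p : ℝ × ℝ × ℝ) : ℝ :=
  fderivWithin ℝ k kernelDomain p (0, 1, 0)

/-- `k_t` (one-sided at the boundary of the domain). -/
noncomputable def kernelDt (k : ℝ × ℝ × ℝ → ℝ) (p : ℝ × ℝ × ℝ) : ℝ :=
  fderivWithin ℝ k kernelDomain p (0, 0, 1)

/-- `k(x,y,t)` solves the kernel problem
`k_xx - k_yy - k_t = (a(y,t) + λ) k` for `0 < y < x < 1`, `k_y(x,0,t) = 0`,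
`k_x(x,x,t) + k_y(x,x,t) + d/dx (k(x,x,t)) = a(x,t) + λ`, `k(0,0,t) = 0`, for `0 ≤ t < 1`.

As `a` is only continuous in `x`, the solution is `C¹` up to the boundary but in general not `C²`.
The wave operator `k_xx - k_yy = (∂_x - ∂_y)(k_x + k_y)` is therefore taken as the derivative of
`k_x + k_y` in the direction `(1,-1)`; where `k` is `C²` this is the classical expression. -/
structure IsNeumannKernel (a : ℝ → ℝ → ℝ) (lam : ℝ) (k : ℝ × ℝ × ℝ → ℝ) : Prop where
  contDiffOn : ContDiffOn ℝ 1 k kernelDomain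
  wave : ∀ x y t : ℝ, 0 < y → y < x → x < 1 → t ∈ Ico (0 : ℝ) 1 →
    HasDerivAt (fun s : ℝ => kernelDx k (x + s, y - s, t) + kernelDy k (x + s, y - s, t))
      (kernelDt k (x, y, t) + (a y t + lam) * k (x, y, t)) 0
  bottom : ∀ x ∈ Icc (0 : ℝ) 1, ∀ t ∈ Ico (0 : ℝ) 1, kernelDy k (x, 0, t) = 0
  diagonal : ∀ x ∈ Icc (0 : ℝ) 1, ∀ t ∈ Ico (0 : ℝ) 1,
    kernelDx k (x, x, t) + kernelDy k (x, x, t)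
      + derivWithin (fun s : ℝ => k (s, s, t)) (Icc (0 : ℝ) 1) x = a x t + lam
  corner : ∀ t ∈ Ico (0 : ℝ) 1, k (0, 0, t) = 0

/-- `g` is the weak derivative of `f` on `(0,1)`. -/
def HasWeakDeriv (f g : ℝ → ℝ) : Prop :=
  ∀ φ : ℝ → ℝ, ContDiff ℝ ∞ φ → HasCompactSupport φ → tsupport φ ⊆ Ioo (0 : ℝ) 1 →
    ∫ x in Ioo (0 : ℝ) 1, f x * deriv φ x = - ∫ x in Ioo (0 : ℝ) 1, g x * φ x

/-- `g ∈ L²(0,1)` is the weak derivative of `f`, where `f` is continuous on `[0,1]`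
(elements of `H¹(0,1)` are represented by their continuous representatives). -/
def HasH1Deriv (f g : ℝ → ℝ) : Prop :=
  ContinuousOn f (Icc (0 : ℝ) 1) ∧ MemLp g 2 (volume.restrict (Ioo (0 : ℝ) 1)) ∧ HasWeakDeriv f g

/-- `f ∈ H¹(0,1)`, as a continuous representative on `[0,1]`. -/
def MemH1 (f : ℝ → ℝ) : Prop := ∃ g, HasH1Deriv f g

open Classical in
/-- The `L²` weak derivative of an `f ∈ H¹(0,1)` (a version of it, unique almost everywhere). -/
noncomputable def weakDeriv (f : ℝ → ℝ) : ℝ → ℝ :=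
  if h : MemH1 f then Classical.choose h else 0

/-- The norm of `H¹(0,1)`; used only for functions with `MemH1`. -/
noncomputable def h1Norm (f : ℝ → ℝ) : ℝ :=
  Real.sqrt ((∫ x in Ioo (0 : ℝ) 1, f x ^ 2) + ∫ x in Ioo (0 : ℝ) 1, weakDeriv f x ^ 2)

/-- The Dirichlet feedback law `u(1,t) = -∫₀¹ k(1,y,t) u(y,t) dy` at time `t`
(`ux` stands for `u_x` and is not used here). -/
def DirichletFeedback (k : ℝ × ℝ × ℝ → ℝ) (u _ux : ℝ → ℝ → ℝ) (t : ℝ) : Prop :=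
  u 1 t = - ∫ y in (0 : ℝ)..1, k (1, y, t) * u y t

/-- The Neumann feedback law `u_x(1,t) = -k(1,1,t) u(1,t) - ∫₀¹ k_x(1,y,t) u(y,t) dy`
at time `t`; `ux` stands for `u_x`. -/
def NeumannFeedback (k : ℝ × ℝ × ℝ → ℝ) (u ux : ℝ → ℝ → ℝ) (t : ℝ) : Prop :=
  ux 1 t = - k (1, 1, t) * u 1 t - ∫ y in (0 : ℝ)..1, kernelDx k (1, y, t) * u y t

/-- `u(x,t)` is a strong solution on the time interval `[0,τ]` of
`u_t = u_xx + a u` in `(0,1) × (0,τ)`, `u_x(0,t) = 0`, `u(x,0) = u⁰(x)`,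
with the feedback law `law` at `x = 1`: it belongs to
`C([0,τ]; H¹(0,1)) ∩ L²(0,τ; H²(0,1)) ∩ H¹(0,τ; L²(0,1))`, the equation holds almost everywhere
and the boundary conditions hold for almost every `t`. -/
structure IsStrongSolutionWith (a : ℝ → ℝ → ℝ)
    (law : (ℝ → ℝ → ℝ) → (ℝ → ℝ → ℝ) → ℝ → Prop) (u₀ : ℝ → ℝ) (τ : ℝ)
    (u ux uxx ut : ℝ → ℝ → ℝ) : Prop where
  /-- For every `t`, `u(·,t) ∈ H¹(0,1)` with weak derivative `ux(·,t)`. -/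
  memH1 : ∀ t ∈ Icc (0 : ℝ) τ, HasH1Deriv (fun x => u x t) (fun x => ux x t)
  /-- `t ↦ u(·,t)` is continuous from `[0,τ]` to `H¹(0,1)`. -/
  continuous_H1 : ∀ s ∈ Icc (0 : ℝ) τ,
    Tendsto (fun t => ∫ x in Ioo (0 : ℝ) 1, ((u x t - u x s) ^ 2 + (ux x t - ux x s) ^ 2))
      (𝓝[Icc (0 : ℝ) τ] s) (𝓝 0)
  /-- For almost every `t`, `ux(·,t)` is the continuous representative of `u_x(·,t) ∈ H¹(0,1)`,
  and its weak derivative is `uxx(·,t)`. -/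
  memH2 : ∀ᵐ t ∂(volume.restrict (Ioo (0 : ℝ) τ)),
    HasH1Deriv (fun x => ux x t) (fun x => uxx x t)
  uxx_memLp : MemLp (fun p : ℝ × ℝ => uxx p.1 p.2) 2
    (volume.restrict (Ioo (0 : ℝ) 1 ×ˢ Ioo (0 : ℝ) τ))
  ut_memLp : MemLp (fun p : ℝ × ℝ => ut p.1 p.2) 2
    (volume.restrict (Ioo (0 : ℝ) 1 ×ˢ Ioo (0 : ℝ) τ))
  /-- `ut` is the weak time derivative of `u`. -/
  weak_time_deriv : ∀ φ : ℝ × ℝ → ℝ, ContDiff ℝ ∞ φ → HasCompactSupport φ →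
    tsupport φ ⊆ Ioo (0 : ℝ) 1 ×ˢ Ioo (0 : ℝ) τ →
    ∫ p in Ioo (0 : ℝ) 1 ×ˢ Ioo (0 : ℝ) τ, u p.1 p.2 * fderiv ℝ φ p (0, 1)
      = - ∫ p in Ioo (0 : ℝ) 1 ×ˢ Ioo (0 : ℝ) τ, ut p.1 p.2 * φ p
  equation : ∀ᵐ p : ℝ × ℝ ∂(volume.restrict (Ioo (0 : ℝ) 1 ×ˢ Ioo (0 : ℝ) τ)),
    ut p.1 p.2 = uxx p.1 p.2 + a p.1 p.2 * u p.1 p.2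
  left_boundary : ∀ᵐ t ∂(volume.restrict (Ioo (0 : ℝ) τ)), ux 0 t = 0
  right_boundary : ∀ᵐ t ∂(volume.restrict (Ioo (0 : ℝ) τ)), law u ux t
  initial : ∀ x ∈ Icc (0 : ℝ) 1, u x 0 = u₀ x

/-- `u` is a strong solution on `[0,τ]` (the derivatives `u_x`, `u_xx`, `u_t` are determined by `u`
up to null sets). -/
def IsStrongSolution (a : ℝ → ℝ → ℝ) (law : (ℝ → ℝ → ℝ) → (ℝ → ℝ → ℝ) → ℝ → Prop)
    (u₀ : ℝ → ℝ) (τ : ℝ) (u : ℝ → ℝ → ℝ) : Prop :=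
  ∃ ux uxx ut : ℝ → ℝ → ℝ, IsStrongSolutionWith a law u₀ τ u ux uxx ut

/-! The feedback laws are ordinary boundary conditions in disguise. Put z(x,t) = u(x,t) + ∫₀ˣ
k(x,y,t) u(y,t) dy, in short z = (1 + K)u. The kernel equations are what is needed to turn u_t =
u_xx + a u, u_x(0,t) = 0 into z_t = z_xx − λz, z_x(0,t) = 0, and (D) reads z(1,t) = 0 while (N)
reads z_x(1,t) = 0. The target problem decays like e^{-λt} in H¹. As 1 + K is a Volterra operator of
the second kind, it is invertible on C([0,1]), with an inverse that depends continuously on t in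
[0,t₀]; this gives M(t₀).

Existence of the kernel. With ξ = x + y, η = x − y and k = G(ξ,η,t), the equation becomes 4G_ξη =
G_t + bG with b = a(|ξ−η|/2, t) + λ, the diagonal condition prescribes G_ξ on η = 0, and k_y = 0 on
y = 0 means that G may be taken symmetric in ξ and η. Integrated, this is G = `edge` b + `goursat`
(G_t + bG). The right-hand side loses a time derivative, so plain successive approximation does not
close. Analyticity in t repairs this: the iteration runs on all Taylor coefficients in t at once,
measured in weights whose radius of convergence shrinks as |ξ| + |η| grows, a Cauchy–Kovalevskaya
argument (`abs_goursatIter_le`).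

Low regularity of the kernel. As k is only C¹, (Ku)_xx cannot be computed by differentiating twice
under the integral. But k_x + k_y is differentiable along the characteristics x + y = const, and k_y
can be removed by integrating by parts in y. Together these show that (Ku)_x is a primitive of the
expected expression (`SpaceKernel.deriv_integral_kernel_mul`).

Existence and decay. The target solution is a cosine series with frequencies nπ for (N) and (n + ½)π
for (D); Parseval's identity for the sine series of its gradient yields continuity in H¹ and the
exponential bound, and a telescoping energy argument yields L² in time of the second derivative.
Applying (1 + K)⁻¹ produces u (`TimeKernel.isStrongSolution`,
`TimeKernel.exists_h1Norm_plantSol_le`).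

Uniqueness. A strong solution v is paired with (1 + K)* cos(ν·), which moves the transformation onto
a smooth test function. The pairing Z satisfies Z' = −(λ + ν²)Z, so all cosine coefficients of (1 +
K)v are determined by the initial value (`TimeKernel.integral_mul_cos_eq`); completeness of the
cosines and injectivity of 1 + K determine v. -/

/-! ### Fubini on triangles, products of primitives, weak derivatives on an interval -/

theorem integral_triangle_swap {h : ℝ → ℝ → ℝ} {c x : ℝ} (hcx : c ≤ x)
    (hint : Integrable (Function.uncurry h)
      ((volume.restrict (Ioc c x)).prod (volume.restrict (Ioc c x)))) :
    ∫ z in c..x, ∫ s in z..x, h s z = ∫ s in c..x, ∫ z in c..s, h s z := by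
  have hm : MeasurableSet {p : ℝ × ℝ | p.2 ≤ p.1} := measurableSet_le measurable_snd measurable_fst
  have key := integral_integral_swap (μ := volume.restrict (Ioc c x))
    (ν := volume.restrict (Ioc c x))
    (f := fun s z => ({p : ℝ × ℝ | p.2 ≤ p.1}.indicator (Function.uncurry h)) (s, z))
    (hint.indicator hm)
  rw [intervalIntegral.integral_of_le hcx, intervalIntegral.integral_of_le hcx]
  refine Eq.trans ?_ (key.symm.trans ?_)
  · refine setIntegral_congr_fun measurableSet_Ioc fun z hz => ?_
    rw [intervalIntegral.integral_of_le hz.2, ← integral_Icc_eq_integral_Ioc]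
    have : (fun s => ({p : ℝ × ℝ | p.2 ≤ p.1}.indicator (Function.uncurry h)) (s, z))
        = (Ici z).indicator (fun s => h s z) := by
      ext s; simp [indicator, Function.uncurry]
    rw [this, setIntegral_indicator measurableSet_Ici]
    congr 2
    ext s; simp only [mem_Icc, mem_inter_iff, mem_Ioc, mem_Ici]
    constructor
    · rintro ⟨h1, h2⟩; exact ⟨⟨hz.1.trans_le h1, h2⟩, h1⟩
    · rintro ⟨⟨_, h2⟩, h1⟩; exact ⟨h1, h2⟩
  · refine setIntegral_congr_fun measurableSet_Ioc fun s hs => ?_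
    rw [intervalIntegral.integral_of_le hs.1.le]
    have : (fun z => ({p : ℝ × ℝ | p.2 ≤ p.1}.indicator (Function.uncurry h)) (s, z))
        = (Iic s).indicator (fun z => h s z) := by
      ext z; simp [indicator, Function.uncurry]
    rw [this, setIntegral_indicator measurableSet_Iic]
    congr 2
    ext z; simp only [mem_inter_iff, mem_Ioc, mem_Iic]
    constructor
    · rintro ⟨⟨h1, h2⟩, h3⟩; exact ⟨h1, h3⟩
    · rintro ⟨h1, h3⟩; exact ⟨⟨h1, h3.trans hs.2⟩, h3⟩

theorem integrable_prod_of_continuous_mul {h : ℝ → ℝ → ℝ} (hh : Continuous (Function.uncurry h))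
    {c x : ℝ} {g : ℝ → ℝ} (hg : IntegrableOn g (Ioc c x)) :
    Integrable (Function.uncurry fun s z => h s z * g z)
      ((volume.restrict (Ioc c x)).prod (volume.restrict (Ioc c x))) := by
  have h1 : Integrable (fun p : ℝ × ℝ => (fun _ => (1 : ℝ)) p.1 * g p.2)
      ((volume.restrict (Ioc c x)).prod (volume.restrict (Ioc c x))) :=
    Integrable.mul_prod (f := fun _ => (1 : ℝ)) (integrable_const _) hg
  obtain ⟨C, hC⟩ := (isCompact_Icc.prod isCompact_Icc : IsCompact (Icc c x ×ˢ Icc c x)).exists_bound_of_continuousOn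
    hh.continuousOn
  refine (h1.bdd_mul (c := C) hh.aestronglyMeasurable ?_).congr ?_
  · rw [Measure.prod_restrict, ae_restrict_iff' (measurableSet_Ioc.prod measurableSet_Ioc)]
    refine .of_forall fun p hp => hC p ⟨Ioc_subset_Icc_self hp.1, Ioc_subset_Icc_self hp.2⟩
  · exact .of_forall fun p => by simp [Function.uncurry]

theorem integrable_prod_of_continuous {h : ℝ → ℝ → ℝ} (hh : Continuous (Function.uncurry h))
    {c x : ℝ} :
    Integrable (Function.uncurry h)
      ((volume.restrict (Ioc c x)).prod (volume.restrict (Ioc c x))) := by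
  simpa using integrable_prod_of_continuous_mul hh (g := fun _ => (1 : ℝ)) (c := c) (x := x)
    (integrable_const _)

/-- Products of absolutely continuous functions are absolutely continuous and obey the product rule
almost everywhere. Most integrations by parts below use this form, in which `p` and `q` need only be
integrable, so that L² derivatives are covered. -/
theorem primitive_mul_primitive {p q : ℝ → ℝ} {c d : ℝ} (f₀ h₀ : ℝ)
    (hp : IntervalIntegrable p volume c d) (hq : IntervalIntegrable q volume c d) :
    (f₀ + ∫ s in c..d, p s) * (h₀ + ∫ s in c..d, q s) - f₀ * h₀
      = ∫ s in c..d, (p s * (h₀ + ∫ r in c..s, q r) + (f₀ + ∫ r in c..s, p r) * q s) := by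
  have hc : c ∈ uIcc c d := left_mem_uIcc
  have A := (hp.absolutelyContinuousOnInterval_intervalIntegral hc)
  have B := (hq.absolutelyContinuousOnInterval_intervalIntegral hc)
  have hA : ∀ (r : ℝ) (P : ℝ → ℝ), AbsolutelyContinuousOnInterval P c d →
      AbsolutelyContinuousOnInterval (fun x => r + P x) c d := by
    intro r P hP
    refine AbsolutelyContinuousOnInterval.add (f := fun _ => r) ?_ hP
    exact (LipschitzWith.const r).lipschitzOnWith.absolutelyContinuousOnInterval
  have key := (hA f₀ _ A).integral_deriv_mul_eq_sub (hA h₀ _ B)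
  simp only [intervalIntegral.integral_same, add_zero] at key
  rw [← key]
  refine intervalIntegral.integral_congr_ae ?_
  filter_upwards [hp.ae_hasDerivAt_integral, hq.ae_hasDerivAt_integral] with x h1 h2 h3
  have h4 := uIoc_subset_uIcc h3
  rw [((h1 h4 c hc).const_add f₀).deriv, ((h2 h4 c hc).const_add h₀).deriv]

theorem Icc_of_tsupport_subset_Ioo {φ : ℝ → ℝ} {c d : ℝ} (hcd : c < d) (hφ : HasCompactSupport φ)
    (hs : tsupport φ ⊆ Ioo c d) : ∃ a b, c < a ∧ a < b ∧ b < d ∧ tsupport φ ⊆ Icc a b := by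
  rcases (tsupport φ).eq_empty_or_nonempty with h0 | hne
  · exact ⟨c + (d - c) / 3, c + 2 * (d - c) / 3, by linarith, by linarith, by linarith, by simp [h0]⟩
  obtain ⟨m, hm, hm'⟩ := hφ.isCompact.exists_isLeast hne
  obtain ⟨M, hM, hM'⟩ := hφ.isCompact.exists_isGreatest hne
  have h1 := hs hm
  have h2 := hs hM
  have h3 : m ≤ M := hm' hM
  refine ⟨(c + m) / 2, (M + d) / 2, by linarith [h1.1], by linarith [h1.1, h2.2],
    by linarith [h2.2], fun x hx => ⟨?_, ?_⟩⟩
  · linarith [hm' hx, h1.1]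
  · linarith [hM' hx, h2.2]

theorem integral_test_mul_deriv {φ g : ℝ → ℝ} {c d : ℝ} (hcd : c < d) (hφ : ContDiff ℝ ∞ φ)
    (hs : tsupport φ ⊆ Ioo c d) (hg : IntegrableOn g (Ioo c d)) (f₀ : ℝ) :
    ∫ x in Ioo c d, (f₀ + ∫ s in c..x, g s) * deriv φ x = - ∫ x in Ioo c d, g x * φ x := by
  have hg' : IntervalIntegrable g volume c d := by
    rw [intervalIntegrable_iff_integrableOn_Ioo_of_le hcd.le]; exact hg
  have hφ' : Continuous (deriv φ) := hφ.continuous_deriv (by simp)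
  have key := primitive_mul_primitive f₀ (φ c) hg' (hφ'.intervalIntegrable c d)
  have hF : ∀ s, ∫ r in c..s, deriv φ r = φ s - φ c := fun s =>
    intervalIntegral.integral_deriv_eq_sub (fun x _ => (hφ.differentiable (by simp)) x)
      (hφ'.intervalIntegrable _ _)
  simp only [hF, add_sub_cancel] at key
  have hz : ∀ z, z ∉ Ioo c d → φ z = 0 := fun z hz => image_eq_zero_of_notMem_tsupport fun h => hz (hs h)
  rw [hz c (by simp), hz d (by simp)] at key
  have hcont : ContinuousOn (fun x => f₀ + ∫ s in c..x, g s) (uIcc c d) :=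
    continuousOn_const.add (intervalIntegral.continuousOn_primitive_interval' hg' left_mem_uIcc)
  rw [intervalIntegral.integral_add (hg'.mul_continuousOn hφ.continuous.continuousOn)
    ((hφ'.intervalIntegrable c d).continuousOn_mul hcont)] at key
  simp only [intervalIntegral.integral_of_le hcd.le, integral_Ioc_eq_integral_Ioo] at key
  linarith

/-- The lemma of du Bois-Reymond. Subtracting from a test function φ a multiple of a fixed bump η
makes its integral vanish; its primitive is then again a test function. So F is orthogonal to φ − rη
for every φ, which says that F equals its η-weighted mean `m`. -/
theorem eq_const_of_integral_mul_deriv_eq_zero {F : ℝ → ℝ} {c d : ℝ} (hcd : c < d)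
    (hF : ContinuousOn F (Icc c d))
    (h : ∀ φ : ℝ → ℝ, ContDiff ℝ ∞ φ → HasCompactSupport φ → tsupport φ ⊆ Ioo c d →
      ∫ x in Ioo c d, F x * deriv φ x = 0) : ∀ x ∈ Icc c d, F x = F c := by
  obtain ⟨η, hηs, hηc, hη, hηr, hηm⟩ := exists_contDiff_tsupport_subset (n := ⊤)
    (Ioo_mem_nhds (show c < (c + d) / 2 by linarith) (show (c + d) / 2 < d by linarith))
  have hη0 : ∀ x, 0 ≤ η x := fun x => (hηr (mem_range_self x)).1
  have hFi : ∀ ψ : ℝ → ℝ, Continuous ψ → IntegrableOn (fun x => F x * ψ x) (Ioo c d) := fun ψ hψ =>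
    ((hF.mul hψ.continuousOn).integrableOn_compact isCompact_Icc).mono_set Ioo_subset_Icc_self
  set I := ∫ x in c..d, η x with hI
  have hIpos : 0 < I := by
    refine intervalIntegral.integral_pos hcd hη.continuous.continuousOn (fun x _ => hη0 x)
      ⟨(c + d) / 2, ⟨by linarith, by linarith⟩, by rw [hηm]; norm_num⟩
  set m := (∫ x in Ioo c d, F x * η x) / I with hm
  have hae : ∀ᵐ x, x ∈ Ioo c d → F x - m = 0 := by
    refine isOpen_Ioo.ae_eq_zero_of_integral_contDiff_smul_eq_zero
      (((hF.sub continuousOn_const).integrableOn_compact isCompact_Icc).mono_set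
        Ioo_subset_Icc_self).locallyIntegrableOn ?_
    intro φ hφ hφc hφs
    set r := (∫ x in c..d, φ x) / I with hr
    set ψ := fun x => φ x - r * η x with hψ
    have hψd : ContDiff ℝ ∞ ψ := hφ.sub (contDiff_const.mul hη)
    have hψ0 : ∫ x in c..d, ψ x = 0 := by
      simp only [hψ]
      rw [intervalIntegral.integral_sub (hφ.continuous.intervalIntegrable _ _)
        ((hη.continuous.const_mul r |>.intervalIntegrable _ _)),
        intervalIntegral.integral_const_mul, hr, ← hI]
      field_simp; simp
    have hψts : tsupport ψ ⊆ Ioo c d := by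
      have : tsupport ψ ⊆ tsupport φ ∪ tsupport η := by
        refine closure_minimal ?_ ((isClosed_tsupport _).union (isClosed_tsupport _))
        intro x hx
        by_contra hcon
        simp only [mem_union, not_or] at hcon
        exact hx (by simp [hψ, image_eq_zero_of_notMem_tsupport hcon.1,
          image_eq_zero_of_notMem_tsupport hcon.2])
      exact this.trans (union_subset hφs hηs)
    have hψc : HasCompactSupport ψ := hφc.sub (hηc.mul_left)
    obtain ⟨a, b, hca, hab, hbd, hsub⟩ := Icc_of_tsupport_subset_Ioo hcd hψc hψts
    set χ := fun x => ∫ s in c..x, ψ s with hχ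
    have hχ' : ∀ x, HasDerivAt χ (ψ x) x := fun x =>
      hψd.continuous.integral_hasStrictDerivAt c x |>.hasDerivAt
    have hχd : deriv χ = ψ := funext fun x => (hχ' x).deriv
    have hχC : ContDiff ℝ ∞ χ := by
      rw [contDiff_infty_iff_deriv]
      exact ⟨fun x => (hχ' x).differentiableAt, hχd ▸ hψd⟩
    have hψz : ∀ x, x ∉ Icc a b → ψ x = 0 := fun x hx =>
      image_eq_zero_of_notMem_tsupport fun h => hx (hsub h)
    -- To the left of the support of ψ the primitive is trivially zero, to the right because the
    -- total integral of ψ is zero.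
    have hχs : tsupport χ ⊆ Icc a b := by
      refine closure_minimal ?_ isClosed_Icc
      intro x hx
      by_contra hcon
      apply hx
      rcases lt_or_ge x a with hxa | hxa
      · refine intervalIntegral.integral_zero_ae (.of_forall fun s hs => hψz s fun h => ?_)
        rcases le_total c x with hcx | hcx
        · rw [uIoc_of_le hcx] at hs; linarith [hs.2, h.1]
        · rw [uIoc_of_ge hcx] at hs; linarith [hs.2, h.1]
      · have hbx : b < x := by
          by_contra hh; exact hcon ⟨hxa, not_lt.1 hh⟩
        have h1 : χ x = (∫ s in c..d, ψ s) + ∫ s in d..x, ψ s :=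
          (intervalIntegral.integral_add_adjacent_intervals (hψd.continuous.intervalIntegrable _ _)
            (hψd.continuous.intervalIntegrable _ _)).symm
        rw [h1, hψ0, zero_add]
        refine intervalIntegral.integral_zero_ae (.of_forall fun s hs => hψz s fun h => ?_)
        rcases le_total d x with hcx | hcx
        · rw [uIoc_of_le hcx] at hs; linarith [hs.1, h.2]
        · rw [uIoc_of_ge hcx] at hs; linarith [hs.1, h.2]
    have := h χ hχC (isCompact_Icc.of_isClosed_subset (isClosed_tsupport _) hχs)
      (hχs.trans fun x hx => ⟨hca.trans_le hx.1, hx.2.trans_lt hbd⟩)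
    rw [hχd] at this
    have h2 : ∫ x in Ioo c d, (F x * φ x - r * (F x * η x)) = 0 := by
      rw [← this]; congr 1; ext x; simp only [hψ]; ring
    rw [integral_sub (hFi _ hφ.continuous) ((hFi _ hη.continuous).const_mul r),
      integral_const_mul] at h2
    have h3 : ∫ x, φ x • (F x - m) = ∫ x in Ioo c d, (F x * φ x - m * φ x) := by
      rw [← setIntegral_eq_integral_of_forall_compl_eq_zero (s := Ioo c d)]
      · congr 1; ext x; simp only [smul_eq_mul]; ring
      · intro x hx
        rw [image_eq_zero_of_notMem_tsupport fun h => hx (hφs h), zero_smul]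
    rw [h3, integral_sub (hFi _ hφ.continuous)
      ((hφ.continuous.const_mul m |>.integrableOn_Icc (a := c) (b := d)).mono_set
        Ioo_subset_Icc_self), integral_const_mul]
    rw [← integral_Ioc_eq_integral_Ioo (f := φ), ← intervalIntegral.integral_of_le hcd.le]
    have h4 : m * ∫ x in c..d, φ x = r * ∫ x in Ioo c d, F x * η x := by
      rw [hm, hr]; ring
    rw [h4]; exact h2
  have hF0 : ∀ x ∈ Icc c d, F x = m := by
    have h1 : EqOn F (fun _ => m) (Icc c d) := by
      have h0 : (fun x => F x) =ᵐ[volume.restrict (Icc c d)] fun _ => m := by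
        rw [← restrict_Ioo_eq_restrict_Icc]
        rw [EventuallyEq, ae_restrict_iff' measurableSet_Ioo]
        filter_upwards [hae] with x hx h using sub_eq_zero.1 (hx h)
      exact Measure.eqOn_Icc_of_ae_eq volume hcd.ne h0 hF continuousOn_const
    exact h1
  intro x hx
  rw [hF0 x hx, hF0 c ⟨le_rfl, hcd.le⟩]

/-- The difference of `f` and the primitive of `g` has weak derivative zero, hence is constant. The
interval is general because this serves both in space on (0,1) and in time on (0,τ). -/
theorem eq_primitive_of_weakDeriv {f g : ℝ → ℝ} {c d : ℝ} (hcd : c < d)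
    (hf : ContinuousOn f (Icc c d)) (hg : IntegrableOn g (Ioo c d))
    (h : ∀ φ : ℝ → ℝ, ContDiff ℝ ∞ φ → HasCompactSupport φ → tsupport φ ⊆ Ioo c d →
      ∫ x in Ioo c d, f x * deriv φ x = - ∫ x in Ioo c d, g x * φ x) :
    ∀ x ∈ Icc c d, f x = f c + ∫ s in c..x, g s := by
  have hg' : IntervalIntegrable g volume c d := by
    rw [intervalIntegrable_iff_integrableOn_Ioo_of_le hcd.le]; exact hg
  have hG : ContinuousOn (fun x => 0 + ∫ s in c..x, g s) (Icc c d) := by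
    rw [← uIcc_of_le hcd.le]
    exact continuousOn_const.add
      (intervalIntegral.continuousOn_primitive_interval' hg' left_mem_uIcc)
  have key := eq_const_of_integral_mul_deriv_eq_zero hcd (hf.sub hG) fun φ hφ hφc hφs => by
    have hφ' : Continuous (deriv φ) := hφ.continuous_deriv (by simp)
    have hi : ∀ u : ℝ → ℝ, ContinuousOn u (Icc c d) →
        IntegrableOn (fun x => u x * deriv φ x) (Ioo c d) := fun u hu =>
      ((hu.mul hφ'.continuousOn).integrableOn_compact isCompact_Icc).mono_set Ioo_subset_Icc_self
    have := integral_test_mul_deriv hcd hφ hφs hg 0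
    simp only [Pi.sub_apply, sub_mul]
    rw [integral_sub (hi f hf) (hi _ hG), this, h φ hφ hφc hφs, sub_self]
  intro x hx
  have := key x hx
  simp only [Pi.sub_apply, intervalIntegral.integral_same] at this
  linarith

/-! ### The space H¹(0,1) described by primitives -/

theorem HasH1Deriv.integrableOn {f g : ℝ → ℝ} (h : HasH1Deriv f g) :
    IntegrableOn g (Ioo (0 : ℝ) 1) := h.2.1.integrable one_le_two

theorem HasH1Deriv.intervalIntegrable {f g : ℝ → ℝ} (h : HasH1Deriv f g) :
    IntervalIntegrable g volume 0 1 := by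
  rw [intervalIntegrable_iff_integrableOn_Ioo_of_le zero_le_one]; exact h.integrableOn

theorem HasH1Deriv.eq_primitive {f g : ℝ → ℝ} (h : HasH1Deriv f g) :
    ∀ x ∈ Icc (0 : ℝ) 1, f x = f 0 + ∫ s in (0 : ℝ)..x, g s :=
  eq_primitive_of_weakDeriv zero_lt_one h.1 h.integrableOn h.2.2

theorem hasH1Deriv_of_eq_primitive {f g : ℝ → ℝ}
    (hg : MemLp g 2 (volume.restrict (Ioo (0 : ℝ) 1)))
    (h : ∀ x ∈ Icc (0 : ℝ) 1, f x = f 0 + ∫ s in (0 : ℝ)..x, g s) : HasH1Deriv f g := by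
  have hi : IntegrableOn g (Ioo (0 : ℝ) 1) := hg.integrable one_le_two
  have hg' : IntervalIntegrable g volume 0 1 := by
    rw [intervalIntegrable_iff_integrableOn_Ioo_of_le zero_le_one]; exact hi
  refine ⟨?_, hg, fun φ hφ _ hφs => ?_⟩
  · refine ContinuousOn.congr (f := fun x => f 0 + ∫ s in (0 : ℝ)..x, g s) ?_ h
    have := intervalIntegral.continuousOn_primitive_interval' hg' left_mem_uIcc
    rw [uIcc_of_le zero_le_one] at this
    exact continuousOn_const.add this
  · rw [← integral_test_mul_deriv zero_lt_one hφ hφs hi (f 0)]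
    refine setIntegral_congr_fun measurableSet_Ioo fun x hx => ?_
    simp only [← h x (Ioo_subset_Icc_self hx)]

theorem ae_eq_of_hasWeakDeriv {f g₁ g₂ : ℝ → ℝ} (h₁ : HasH1Deriv f g₁) (h₂ : HasH1Deriv f g₂) :
    g₁ =ᵐ[volume.restrict (Ioo (0 : ℝ) 1)] g₂ := by
  have hi := h₁.integrableOn.sub h₂.integrableOn
  have := isOpen_Ioo.ae_eq_zero_of_integral_contDiff_smul_eq_zero hi.locallyIntegrableOn
    fun φ hφ hφc hφs => by
      have h3 : ∫ x, φ x • (g₁ - g₂) x = ∫ x in Ioo (0 : ℝ) 1, (g₁ x * φ x - g₂ x * φ x) := by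
        rw [← setIntegral_eq_integral_of_forall_compl_eq_zero (s := Ioo (0 : ℝ) 1)]
        · congr 1; ext x; simp only [smul_eq_mul, Pi.sub_apply]; ring
        · intro x hx
          rw [image_eq_zero_of_notMem_tsupport fun h => hx (hφs h), zero_smul]
      obtain ⟨C, hC⟩ := hφ.continuous.bounded_above_of_compact_support hφc
      have hb : ∀ g : ℝ → ℝ, IntegrableOn g (Ioo (0 : ℝ) 1) →
          IntegrableOn (fun x => g x * φ x) (Ioo (0 : ℝ) 1) := fun g hg =>
        hg.mul_bdd hφ.continuous.aestronglyMeasurable (.of_forall hC)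
      rw [h3, integral_sub (hb _ h₁.integrableOn) (hb _ h₂.integrableOn)]
      have a1 := h₁.2.2 φ hφ hφc hφs
      have a2 := h₂.2.2 φ hφ hφc hφs
      linarith
  rw [EventuallyEq, ae_restrict_iff' measurableSet_Ioo]
  filter_upwards [this] with x hx h using sub_eq_zero.1 (hx h)

/-- The norm is defined through a chosen version of the weak derivative; since versions agree almost
everywhere, it can be computed with any of them. -/
theorem HasH1Deriv.h1Norm_eq {f g : ℝ → ℝ} (h : HasH1Deriv f g) :
    h1Norm f = Real.sqrt ((∫ x in Ioo (0 : ℝ) 1, f x ^ 2) + ∫ x in Ioo (0 : ℝ) 1, g x ^ 2) := by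
  have hm : MemH1 f := ⟨g, h⟩
  have : weakDeriv f =ᵐ[volume.restrict (Ioo (0 : ℝ) 1)] g := by
    rw [weakDeriv, dif_pos hm]
    exact ae_eq_of_hasWeakDeriv (Classical.choose_spec hm) h
  rw [h1Norm]
  congr 2
  refine integral_congr_ae ?_
  filter_upwards [this] with x hx using by rw [hx]

/-- The variance of |g| for the uniform probability measure on (0,1) is nonnegative. -/
theorem sq_integral_le_integral_sq {g : ℝ → ℝ} (hg : MemLp g 2 (volume.restrict (Ioo (0 : ℝ) 1))) :
    (∫ x in Ioo (0 : ℝ) 1, |g x|) ^ 2 ≤ ∫ x in Ioo (0 : ℝ) 1, g x ^ 2 := by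
  have hi : IntegrableOn g (Ioo (0 : ℝ) 1) := hg.integrable one_le_two
  have h2 : IntegrableOn (fun x => g x ^ 2) (Ioo (0 : ℝ) 1) := hg.integrable_sq
  set I := ∫ x in Ioo (0 : ℝ) 1, |g x| with hI
  have h3 : 0 ≤ ∫ x in Ioo (0 : ℝ) 1, (|g x| - I) ^ 2 := integral_nonneg fun x => sq_nonneg _
  have h4 : ∫ x in Ioo (0 : ℝ) 1, (|g x| - I) ^ 2
      = (∫ x in Ioo (0 : ℝ) 1, g x ^ 2) - 2 * I * I + I ^ 2 := by
    have : (fun x => (|g x| - I) ^ 2) = fun x => (g x ^ 2 - 2 * I * |g x|) + I ^ 2 := by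
      ext x; rw [sub_sq, sq_abs]; ring
    have hi' : IntegrableOn (fun x => 2 * I * |g x|) (Ioo (0 : ℝ) 1) := hi.abs.const_mul (2 * I)
    have hs : Integrable (fun x => g x ^ 2 - 2 * I * |g x|) (volume.restrict (Ioo (0 : ℝ) 1)) :=
      Integrable.sub h2 hi'
    have h5 : ∫ x in Ioo (0 : ℝ) 1, 2 * I * |g x| = 2 * I * I := by rw [integral_const_mul]
    rw [this, integral_add (f := fun x => g x ^ 2 - 2 * I * |g x|) hs (integrable_const _),
      integral_sub h2 hi', h5]
    simp
  nlinarith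

/-- The embedding of `H¹(0,1)` into the continuous functions. -/
theorem HasH1Deriv.sq_le {f g : ℝ → ℝ} (h : HasH1Deriv f g) {x : ℝ} (hx : x ∈ Icc (0 : ℝ) 1) :
    f x ^ 2 ≤ 2 * ((∫ x in Ioo (0 : ℝ) 1, f x ^ 2) + ∫ x in Ioo (0 : ℝ) 1, g x ^ 2) := by
  set I := ∫ x in Ioo (0 : ℝ) 1, |g x| with hI
  have hI0 : 0 ≤ I := integral_nonneg fun x => abs_nonneg _
  have hg' : IntegrableOn g (Ioc 0 1) := (integrableOn_Ioc_iff_integrableOn_Ioo).2 h.integrableOn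
  have hd : ∀ y ∈ Icc (0 : ℝ) 1, |f x - f y| ≤ I := by
    intro y hy
    have hii : ∀ z ∈ Icc (0 : ℝ) 1, IntervalIntegrable g volume 0 z := fun z hz =>
      h.intervalIntegrable.mono_set (by
        rw [uIcc_of_le hz.1, uIcc_of_le zero_le_one]; exact Icc_subset_Icc le_rfl hz.2)
    have : f x - f y = ∫ s in y..x, g s := by
      rw [h.eq_primitive x hx, h.eq_primitive y hy,
        ← intervalIntegral.integral_interval_sub_left (hii x hx) (hii y hy)]; ring
    rw [this]
    refine (intervalIntegral.norm_integral_le_integral_norm_uIoc (f := g)).trans ?_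
    rw [hI, ← integral_Ioc_eq_integral_Ioo]
    refine setIntegral_mono_set hg'.abs (.of_forall fun _ => abs_nonneg _) (LE.le.eventuallyLE ?_)
    rw [uIoc]
    exact Ioc_subset_Ioc (le_min hy.1 hx.1) (max_le hy.2 hx.2)
  have hfi : IntegrableOn (fun y => f y ^ 2) (Ioo (0 : ℝ) 1) :=
    ((h.1.pow 2).integrableOn_compact isCompact_Icc).mono_set Ioo_subset_Icc_self
  -- `I` bounds the oscillation of `f`, so f(x)² ≤ 2f(y)² + 2I² for every y. Averaging over y is
  -- needed because no boundary value of `f` is prescribed.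
  have h1 : ∫ y in Ioo (0 : ℝ) 1, f x ^ 2 ≤ ∫ y in Ioo (0 : ℝ) 1, (2 * f y ^ 2 + 2 * I ^ 2) := by
    refine setIntegral_mono_on (integrable_const _) ((hfi.const_mul 2).add (integrable_const _))
      measurableSet_Ioo fun y hy => ?_
    have := abs_le.1 (hd y (Ioo_subset_Icc_self hy))
    nlinarith [sq_nonneg (f x - 2 * f y), sq_abs (f x - f y), abs_nonneg (f x - f y),
      hd y (Ioo_subset_Icc_self hy)]
  rw [integral_add (hfi.const_mul 2) (integrable_const _), integral_const_mul] at h1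
  simp only [integral_const, MeasurableSet.univ, measureReal_restrict_apply, univ_inter,
    Real.volume_real_Ioo, sub_zero, smul_eq_mul] at h1
  have := sq_integral_le_integral_sq h.2.1
  norm_num at h1
  linarith

theorem HasH1Deriv.abs_le_h1Norm {f g : ℝ → ℝ} (h : HasH1Deriv f g) {x : ℝ}
    (hx : x ∈ Icc (0 : ℝ) 1) : |f x| ≤ 2 * h1Norm f := by
  rw [h.h1Norm_eq]
  refine abs_le_of_sq_le_sq ?_ (by positivity)
  rw [mul_pow, Real.sq_sqrt (add_nonneg (integral_nonneg fun _ => sq_nonneg _)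
    (integral_nonneg fun _ => sq_nonneg _))]
  have := h.sq_le hx
  have h0 : (0:ℝ) ≤ (∫ x in Ioo (0 : ℝ) 1, f x ^ 2) + ∫ x in Ioo (0 : ℝ) 1, g x ^ 2 :=
    add_nonneg (integral_nonneg fun _ => sq_nonneg _) (integral_nonneg fun _ => sq_nonneg _)
  linarith

/-! ### Integral identities for the kernel at a fixed time -/

/-- The relations, in integrated form, that a solution of the kernel problem satisfies at a fixed
time on the triangle `0 ≤ y ≤ x ≤ 1`; `Q` stands for `k_t + (a + λ) k` and `b` for `a + λ`. -/
structure SpaceKernel (k kx ky Q : ℝ → ℝ → ℝ) (b : ℝ → ℝ) : Prop where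
  cont : Continuous (Function.uncurry k)
  cont_x : Continuous (Function.uncurry kx)
  cont_y : Continuous (Function.uncurry ky)
  cont_Q : Continuous (Function.uncurry Q)
  cont_b : Continuous b
  along_x : ∀ x y, 0 ≤ y → y ≤ x → x ≤ 1 → k x y = k y y + ∫ s in y..x, kx s y
  along_y : ∀ x y, 0 ≤ y → y ≤ x → x ≤ 1 → ∫ s in y..x, ky x s = k x x - k x y
  -- The wave equation integrated along x + y = const, starting on the diagonal. There k_x + k_y =
  -- b/2, because d/dx k(x,x) is itself k_x + k_y and the diagonal condition therefore counts this
  -- sum twice.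
  char : ∀ x y, 0 ≤ y → y ≤ x → x ≤ 1 →
    kx x y + ky x y = b ((x + y) / 2) / 2 + ∫ s in ((x + y) / 2)..x, Q s (x + y - s)
  bottom : ∀ x, 0 ≤ x → x ≤ 1 → ky x 0 = 0
  corner : k 0 0 = 0

theorem intervalIntegral_congr_uIoc {f g : ℝ → ℝ} {a b : ℝ} (h : EqOn f g (uIoc a b)) :
    ∫ x in a..b, f x = ∫ x in a..b, g x :=
  intervalIntegral.integral_congr_ae (.of_forall fun _ hx => h hx)

theorem continuous_uncurry_apply {k : ℝ → ℝ → ℝ} (h : Continuous (Function.uncurry k)) (x : ℝ) :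
    Continuous (k x) := h.comp (Continuous.prodMk_right x)

theorem continuous_intervalIntegral_param {h : ℝ → ℝ → ℝ} (hh : Continuous (Function.uncurry h)) :
    Continuous fun s => ∫ y in (0 : ℝ)..s, h s y := by
  have := intervalIntegral.continuous_parametric_intervalIntegral_of_continuous (μ := volume)
    (f := h) (a₀ := 0) hh continuous_id
  simpa using this

/-- Integration along the characteristics `x + y = const`. -/
theorem integral_eq_of_char {R R₁ : ℝ → ℝ → ℝ} (hR : Continuous (Function.uncurry R))
    (hR₁ : Continuous (Function.uncurry R₁)) 
    (h : ∀ x y, 0 ≤ y → y ≤ x → x ≤ 1 → R x y = R ((x + y) / 2) ((x + y) / 2)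
      + ∫ s in ((x + y) / 2)..x, R₁ s (x + y - s)) {x : ℝ} (hx0 : 0 ≤ x) (hx1 : x ≤ 1) :
    ∫ y in (0 : ℝ)..x, R x y = ∫ s in (0 : ℝ)..x, (2 * R s s - R s 0 + ∫ y in (0 : ℝ)..s, R₁ s y) := by
  have hRd : Continuous fun s => R s s := hR.comp (continuous_id.prodMk continuous_id)
  have hR0 : Continuous fun s => R s 0 := hR.comp (continuous_id.prodMk continuous_const)
  -- Formally R₁ = (∂_x − ∂_y)R, and the claim is d/dx ∫₀ˣ R dy = 2R(x,x) − R(x,0) + ∫₀ˣ R₁ dy,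
  -- integrated. The coordinates are s and m = (x + y)/2, which is constant along a characteristic;
  -- `H` is R₁ at (s, 2m − s), cut off where the characteristic leaves through the bottom y = 0.
  -- Integrating `H` over the triangle in the two possible orders gives the identity.
  set H : ℝ → ℝ → ℝ := fun s m =>
    ({p : ℝ × ℝ | p.1 ≤ 2 * p.2}.indicator fun p => R₁ p.1 (2 * p.2 - p.1)) (s, m) with hH
  have hms : MeasurableSet {p : ℝ × ℝ | p.1 ≤ 2 * p.2} :=
    measurableSet_le measurable_fst (measurable_snd.const_mul 2)
  have hcH : Continuous (Function.uncurry fun s m => R₁ s (2 * m - s)) :=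
    hR₁.comp (continuous_fst.prodMk ((continuous_const.mul continuous_snd).sub continuous_fst))
  have hHi : Integrable (Function.uncurry H)
      ((volume.restrict (Ioc 0 x)).prod (volume.restrict (Ioc 0 x))) :=
    (integrable_prod_of_continuous hcH).indicator hms
  have hsw := integral_triangle_swap hx0 hHi
  -- inner integral in `m`
  have e1 : ∀ s ∈ Icc 0 x, ∫ m in (0 : ℝ)..s, H s m = (1 / 2) * ∫ y in (0 : ℝ)..s, R₁ s y := by
    intro s hs
    have : (fun m => H s m) = (Ici (s / 2)).indicator (fun m => R₁ s (2 * m - s)) := by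
      ext m
      simp only [hH, indicator, mem_ofPred_eq, mem_Ici, div_le_iff₀ (two_pos : (0:ℝ) < 2), mul_comm m 2]
    rw [intervalIntegral.integral_of_le hs.1, this, setIntegral_indicator measurableSet_Ici]
    have h2 : (Ioc 0 s ∩ Ici (s / 2) : Set ℝ) =ᵐ[volume] (Ioc (s / 2) s : Set ℝ) := by
      have : Ioc (s/2) s ⊆ Ioc 0 s ∩ Ici (s / 2) := fun m hm =>
        ⟨⟨by linarith [hs.1, hm.1], hm.2⟩, hm.1.le⟩
      refine (ae_eq_of_ae_subset_of_measure_ge (LE.le.eventuallyLE this) ?_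
        measurableSet_Ioc.nullMeasurableSet ((measure_mono inter_subset_left).trans_lt measure_Ioc_lt_top).ne).symm
      calc volume (Ioc 0 s ∩ Ici (s / 2)) ≤ volume (Icc (s / 2) s) :=
            measure_mono fun m hm => ⟨hm.2, hm.1.2⟩
        _ = volume (Ioc (s / 2) s) := by simp
    rw [setIntegral_congr_set h2, ← intervalIntegral.integral_of_le (by linarith [hs.1])]
    have := intervalIntegral.integral_comp_mul_sub (a := s / 2) (b := s) (R₁ s) (two_ne_zero) s
    rw [this]
    simp only [smul_eq_mul]
    rw [show 2 * (s / 2) - s = 0 by ring, show 2 * s - s = s by ring]; norm_num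
  -- inner integral in `s`
  have e2 : ∀ m ∈ Icc 0 x, (if x ≤ 2 * m then R x (2 * m - x) else R (2 * m) 0)
      = R m m + ∫ s in m..x, H s m := by
    intro m hm
    have key : ∀ z, m ≤ z → z ≤ 2 * m → z ≤ x → R z (2 * m - z) = R m m + ∫ s in m..z, H s m := by
      intro z hz1 hz2 hz3
      have := h z (2 * m - z) (by linarith) (by linarith) (by linarith)
      rw [show (z + (2 * m - z)) / 2 = m by ring] at this
      rw [this]; congr 1
      refine intervalIntegral.integral_congr fun s hs => ?_
      rw [uIcc_of_le hz1] at hs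
      simp only [hH]
      rw [indicator_of_mem (by simp only [mem_ofPred_eq]; linarith [hs.2])]
      congr 1; ring
    split_ifs with hxm
    · exact key x hm.2 hxm le_rfl
    · push Not at hxm
      have h1 := key (2 * m) (by linarith [hm.1]) le_rfl hxm.le
      rw [sub_self] at h1
      rw [h1]; congr 1
      have h3 : ∀ s, 2 * m < s → H s m = 0 := fun s hs => by
        simp only [hH]; exact indicator_of_notMem (by simp only [mem_ofPred_eq]; linarith) _
      have hi : IntervalIntegrable (fun s => H s m) volume m (2 * m) := by
        refine (((continuous_uncurry_apply (k := fun m s => R₁ s (2 * m - s)) (hcH.comp continuous_swap) m).intervalIntegrable m (2*m))).congr ?_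
        intro s hs
        rw [uIoc_of_le (by linarith [hm.1])] at hs
        simp only [hH]
        rw [indicator_of_mem (by simp only [mem_ofPred_eq]; linarith [hs.2])]
      have hi2 : EqOn (fun _ => (0:ℝ)) (fun s => H s m) (uIoc (2 * m) x) := by
        intro s hs
        rw [uIoc_of_le hxm.le] at hs
        exact (h3 s hs.1).symm
      rw [← intervalIntegral.integral_add_adjacent_intervals hi
        ((intervalIntegrable_const (c := (0:ℝ))).congr hi2)]
      have : ∫ s in (2 * m)..x, H s m = 0 := by
        rw [← intervalIntegral_congr_uIoc hi2]; simp
      rw [this, add_zero]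
  -- Characteristics with m ≥ x/2 end on the vertical line at (x, 2m − x), those with m ≤ x/2 on the
  -- bottom at (2m, 0). The substitutions y = 2m − x and s = 2m each contribute a factor 1/2.
  have e3 : ∫ m in (0 : ℝ)..x, (if x ≤ 2 * m then R x (2 * m - x) else R (2 * m) 0)
      = (1 / 2) * (∫ y in (0 : ℝ)..x, R x y) + (1 / 2) * ∫ s in (0 : ℝ)..x, R s 0 := by
    have c1 : Continuous fun m => R x (2 * m - x) :=
      hR.comp (continuous_const.prodMk ((continuous_const.mul continuous_id).sub continuous_const))
    have c2 : Continuous fun m => R (2 * m) 0 := hR0.comp (continuous_const.mul continuous_id)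
    have E1 : EqOn (fun m => R (2 * m) 0) (fun m => (if x ≤ 2 * m then R x (2 * m - x) else R (2 * m) 0)) (uIoc 0 (x / 2)) := by
      intro m hm
      rw [uIoc_of_le (by linarith)] at hm
      simp only
      split_ifs with h1
      · have : 2 * m = x := by linarith [hm.2]
        rw [this]; simp
      · rfl
    have E2 : EqOn (fun m => R x (2 * m - x)) (fun m => (if x ≤ 2 * m then R x (2 * m - x) else R (2 * m) 0)) (uIoc (x / 2) x) := by
      intro m hm
      rw [uIoc_of_le (by linarith)] at hm
      simp only
      rw [if_pos (by linarith [hm.1])]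
    rw [← intervalIntegral.integral_add_adjacent_intervals (b := x / 2)
      ((c2.intervalIntegrable _ _).congr E1) ((c1.intervalIntegrable _ _).congr E2),
      ← intervalIntegral_congr_uIoc E1, ← intervalIntegral_congr_uIoc E2]
    have a1 := intervalIntegral.integral_comp_mul_left (a := 0) (b := x / 2) (fun s => R s 0) (two_ne_zero)
    have a2 := intervalIntegral.integral_comp_mul_sub (a := x / 2) (b := x) (R x) (two_ne_zero) x
    rw [a1, a2]
    simp only [smul_eq_mul]
    rw [show 2 * (x / 2) = x by ring, show x - x = 0 by ring, show 2 * x - x = x by ring, mul_zero]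
    norm_num; ring
  have e4 : ∫ m in (0 : ℝ)..x, (if x ≤ 2 * m then R x (2 * m - x) else R (2 * m) 0)
      = (∫ m in (0 : ℝ)..x, R m m) + ∫ m in (0 : ℝ)..x, ∫ s in m..x, H s m := by
    rw [← intervalIntegral.integral_add (hRd.intervalIntegrable _ _)]
    · refine intervalIntegral.integral_congr fun m hm => ?_
      rw [uIcc_of_le hx0] at hm
      exact e2 m hm
    · have c3 : Continuous fun m => (if x ≤ 2 * m then R x (2 * m - x) else R (2 * m) 0) - R m m := by
        refine Continuous.sub (Continuous.if_le ?_ ?_ continuous_const (by fun_prop) ?_) hRd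
        · exact hR.comp (continuous_const.prodMk (by fun_prop))
        · exact hR0.comp (by fun_prop)
        · intro m hm; rw [← hm]; simp
      refine (c3.intervalIntegrable 0 x).congr fun m hm => ?_
      rw [uIoc_of_le hx0] at hm
      simp only [e2 m (Ioc_subset_Icc_self hm)]; ring
  rw [hsw] at e4
  have e5 : ∫ s in (0 : ℝ)..x, ∫ m in (0 : ℝ)..s, H s m
      = (1 / 2) * ∫ s in (0 : ℝ)..x, ∫ y in (0 : ℝ)..s, R₁ s y := by
    rw [← intervalIntegral.integral_const_mul]
    refine intervalIntegral.integral_congr fun s hs => ?_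
    rw [uIcc_of_le hx0] at hs
    exact e1 s hs
  rw [intervalIntegral.integral_add (((hRd.const_mul 2).fun_sub hR0).intervalIntegrable _ _)
    ((continuous_intervalIntegral_param hR₁).intervalIntegrable _ _),
    intervalIntegral.integral_sub ((hRd.const_mul 2).intervalIntegrable _ _)
    (hR0.intervalIntegrable _ _), intervalIntegral.integral_const_mul]
  rw [e3, e5] at e4
  linarith

namespace SpaceKernel

variable {k kx ky Q : ℝ → ℝ → ℝ} {b : ℝ → ℝ}

/-- The Leibniz rule for x ↦ ∫₀ˣ k(x,y) f(y) dy in integrated form: insert k(x,y) = k(y,y) + ∫ k_x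
and exchange the integrals over the triangle. -/
theorem integral_kernel_mul (h : SpaceKernel k kx ky Q b) {f : ℝ → ℝ} (hf : Continuous f) {x : ℝ}
    (hx0 : 0 ≤ x) (hx1 : x ≤ 1) :
    ∫ y in (0 : ℝ)..x, k x y * f y
      = ∫ s in (0 : ℝ)..x, (k s s * f s + ∫ y in (0 : ℝ)..s, kx s y * f y) := by
  have hc : Continuous (Function.uncurry fun s y => kx s y * f y) :=
    h.cont_x.mul (hf.comp continuous_snd)
  have hd : Continuous fun s => k s s * f s :=
    (h.cont.comp (continuous_id.prodMk continuous_id)).mul hf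
  rw [intervalIntegral.integral_add (hd.intervalIntegrable _ _)
    ((continuous_intervalIntegral_param hc).intervalIntegrable _ _),
    ← integral_triangle_swap (h := fun s y => kx s y * f y) hx0 (integrable_prod_of_continuous hc),
    ← intervalIntegral.integral_add (hd.intervalIntegrable _ _)]
  · refine intervalIntegral.integral_congr fun y hy => ?_
    rw [uIcc_of_le hx0] at hy
    rw [h.along_x x y hy.1 hy.2 hx1, intervalIntegral.integral_mul_const]; ring
  · have hc2 : Continuous fun y => k x y * f y - k y y * f y :=
      ((continuous_uncurry_apply h.cont x).mul hf).sub hd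
    refine (hc2.intervalIntegrable 0 x).congr fun y hy => ?_
    rw [uIoc_of_le hx0] at hy
    rw [h.along_x x y hy.1.le hy.2 hx1, intervalIntegral.integral_mul_const]; ring

/-- Integration by parts in y. Here `g` is merely integrable, because later it is also the second
space derivative of a strong solution. -/
theorem integral_ky_mul_primitive (h : SpaceKernel k kx ky Q b) {g : ℝ → ℝ} {x : ℝ}
    (hx0 : 0 ≤ x) (hx1 : x ≤ 1) (c : ℝ) (hg : IntervalIntegrable g volume 0 x) :
    ∫ y in (0 : ℝ)..x, ky x y * (c + ∫ s in (0 : ℝ)..y, g s)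
      = k x x * (c + ∫ s in (0 : ℝ)..x, g s) - k x 0 * c - ∫ y in (0 : ℝ)..x, k x y * g y := by
  have hcy := continuous_uncurry_apply h.cont_y x
  have hck := continuous_uncurry_apply h.cont x
  have hk : ∀ y ∈ Icc 0 x, k x 0 + ∫ s in (0 : ℝ)..y, ky x s = k x y := by
    intro y hy
    have h1 := h.along_y x 0 le_rfl hx0 hx1
    have h2 := h.along_y x y hy.1 hy.2 hx1
    have h3 := intervalIntegral.integral_add_adjacent_intervals (hcy.intervalIntegrable 0 y (μ := volume))
      (hcy.intervalIntegrable y x)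
    linarith
  have key := primitive_mul_primitive (k x 0) c (hcy.intervalIntegrable 0 x (μ := volume)) hg
  rw [hk x ⟨hx0, le_rfl⟩, intervalIntegral.integral_congr (g := fun y =>
    ky x y * (c + ∫ s in (0 : ℝ)..y, g s) + k x y * g y) (f := fun s => ky x s * (c + ∫ r in (0 : ℝ)..s, g r) +
      (k x 0 + ∫ r in (0 : ℝ)..s, ky x r) * g s)] at key
  · rw [intervalIntegral.integral_add] at key
    · linarith [key]
    · have := intervalIntegral.continuousOn_primitive_interval' hg left_mem_uIcc
      exact (hcy.continuousOn.mul (continuousOn_const.add this)).intervalIntegrable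
    · exact hg.continuousOn_mul hck.continuousOn
  · intro y hy
    rw [uIcc_of_le hx0] at hy
    simp only [hk y hy]

/-- The derivative of `x ↦ ∫₀ˣ k(x,y) f(y) dy` is itself a primitive. -/
theorem deriv_integral_kernel_mul (h : SpaceKernel k kx ky Q b) {f p : ℝ → ℝ} (hf : Continuous f)
    (hp : Continuous p) (hfp : ∀ x ∈ Icc (0 : ℝ) 1, f x = f 0 + ∫ s in (0 : ℝ)..x, p s) {x : ℝ}
    (hx0 : 0 ≤ x) (hx1 : x ≤ 1) :
    k x x * f x + ∫ y in (0 : ℝ)..x, kx x y * f y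
      = ∫ s in (0 : ℝ)..x, (b s * f s + (∫ y in (0 : ℝ)..s, Q s y * f y) + k s s * p s
          - ∫ y in (0 : ℝ)..s, ky s y * p y) := by
  have hcf : ∀ {K : ℝ → ℝ → ℝ}, Continuous (Function.uncurry K) → ∀ {f : ℝ → ℝ}, Continuous f →
      Continuous (Function.uncurry fun s y => K s y * f y) := fun hK f hf =>
    hK.mul (hf.comp continuous_snd)
  have hci : ∀ {K : ℝ → ℝ → ℝ}, Continuous (Function.uncurry K) → ∀ {f : ℝ → ℝ}, Continuous f →
      Continuous fun s => ∫ y in (0 : ℝ)..s, K s y * f y := fun hK f hf =>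
    continuous_intervalIntegral_param (hcf hK hf)
  -- The kernel has no second derivatives, so k_x is written as P − k_y: the part P is
  -- differentiable along the characteristics, and the part k_y disappears by integration by parts
  -- in y.
  set P : ℝ → ℝ → ℝ := fun x y => kx x y + ky x y with hP
  have hPc : Continuous (Function.uncurry P) := h.cont_x.add h.cont_y
  have hdiag : Continuous fun s => k s s := h.cont.comp (continuous_id.prodMk continuous_id)
  -- the characteristic part
  have hA := integral_eq_of_char (R := fun x y => P x y * f y)
    (R₁ := fun x y => Q x y * f y - P x y * p y) (hcf hPc hf) ((hcf h.cont_Q hf).sub (hcf hPc hp))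
    (by
      intro x y hy hyx hx
      set m := (x + y) / 2 with hm
      have hmy : y ≤ m := by rw [hm]; linarith
      have hmx : m ≤ x := by rw [hm]; linarith
      have hxy : x + y = 2 * m := by rw [hm]; ring
      have q1 : Continuous fun s => Q s (2 * m - s) := h.cont_Q.comp (continuous_id.prodMk (continuous_const.sub continuous_id))
      have q2 : Continuous fun s => - p (2 * m - s) := by fun_prop
      have key := primitive_mul_primitive (b m / 2) (f m) (q1.intervalIntegrable m x (μ := volume))
        (q2.intervalIntegrable m x)
      have f1 : ∀ s ∈ Icc m x, b m / 2 + ∫ r in m..s, Q r (2 * m - r) = P s (2 * m - s) := by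
        intro s hs
        have := h.char s (2 * m - s) (by linarith [hs.2]) (by linarith [hs.1]) (by linarith [hs.2])
        rw [show s + (2 * m - s) = 2 * m by ring, show 2 * m / 2 = m by ring] at this
        exact this.symm
      have f2 : ∀ s ∈ Icc m x, f m + ∫ r in m..s, - p (2 * m - r) = f (2 * m - s) := by
        intro s hs
        rw [intervalIntegral.integral_neg, intervalIntegral.integral_comp_sub_left (fun r => p r)]
        rw [hfp m ⟨by linarith, by linarith⟩, hfp (2 * m - s) ⟨by linarith [hs.2], by linarith [hs.1]⟩]
        have := intervalIntegral.integral_add_adjacent_intervals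
          (hp.intervalIntegrable 0 (2 * m - s) (μ := volume)) (hp.intervalIntegrable (2 * m - s) m)
        rw [show 2 * m - m = m by ring]
        linarith
      rw [f1 x ⟨hmx, le_rfl⟩, f2 x ⟨hmx, le_rfl⟩] at key
      have f3 := f1 m ⟨le_rfl, hmx⟩
      rw [intervalIntegral.integral_same, show 2 * m - m = m by ring] at f3
      rw [hxy, show y = 2 * m - x by linarith, ← f3]
      rw [sub_eq_iff_eq_add'] at key
      simp only [add_zero]
      rw [key]
      congr 1
      refine intervalIntegral.integral_congr fun s hs => ?_
      rw [uIcc_of_le hmx] at hs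
      rw [f1 s hs, f2 s hs]; ring) hx0 hx1
  have hB := h.integral_kernel_mul hp hx0 hx1
  have hC := h.integral_ky_mul_primitive hx0 hx1 (f 0) (hp.intervalIntegrable 0 x)
  have hD := h.along_x x 0 le_rfl hx0 hx1
  rw [h.corner, zero_add] at hD
  have hC' : ∫ y in (0 : ℝ)..x, ky x y * (f 0 + ∫ s in (0 : ℝ)..y, p s)
      = ∫ y in (0 : ℝ)..x, ky x y * f y := by
    refine intervalIntegral.integral_congr fun s hs => ?_
    rw [uIcc_of_le hx0] at hs
    rw [← hfp s ⟨hs.1, hs.2.trans hx1⟩]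
  rw [hC', ← hfp x ⟨hx0, hx1⟩] at hC
  have hcs : ∀ {K : ℝ → ℝ → ℝ}, Continuous (Function.uncurry K) → ∀ {f : ℝ → ℝ}, Continuous f → ∀ s,
      IntervalIntegrable (fun y => K s y * f y) volume 0 s := fun hK f hf s =>
    ((continuous_uncurry_apply hK s).mul hf).intervalIntegrable _ _
  have hsum : ∫ y in (0 : ℝ)..x, kx x y * f y
      = (∫ y in (0 : ℝ)..x, P x y * f y) - ∫ y in (0 : ℝ)..x, ky x y * f y := by
    rw [← intervalIntegral.integral_sub (hcs hPc hf x) (hcs h.cont_y hf x)]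
    congr 1; ext y; simp only [hP]; ring
  -- On the diagonal 2P = b, which produces the local term b f. On the bottom P = k_x because k_y =
  -- 0 there, so that the boundary terms at y = 0 cancel.
  have hfin : ∀ s ∈ Icc 0 x, b s * f s + (∫ y in (0 : ℝ)..s, Q s y * f y) + k s s * p s
          - ∫ y in (0 : ℝ)..s, ky s y * p y
      = (2 * (P s s * f s) - P s 0 * f 0 + ∫ y in (0 : ℝ)..s, (Q s y * f y - P s y * p y))
        + (k s s * p s + ∫ y in (0 : ℝ)..s, kx s y * p y) + kx s 0 * f 0 := by
    intro s hs
    rw [intervalIntegral.integral_sub (hcs h.cont_Q hf s) (hcs hPc hp s)]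
    have e1 : ∫ y in (0 : ℝ)..s, P s y * p y
        = (∫ y in (0 : ℝ)..s, kx s y * p y) + ∫ y in (0 : ℝ)..s, ky s y * p y := by
      rw [← intervalIntegral.integral_add (hcs h.cont_x hp s) (hcs h.cont_y hp s)]
      congr 1; ext y; simp only [hP]; ring
    have e2 := h.char s s hs.1 le_rfl (hs.2.trans hx1)
    rw [show (s + s) / 2 = s by ring, intervalIntegral.integral_same, add_zero] at e2
    have e3 := h.bottom s hs.1 (hs.2.trans hx1)
    rw [e1]
    simp only [hP, e2, e3]; ring
  have hP0 : Continuous fun s => P s 0 * f 0 :=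
    (hPc.comp (continuous_id.prodMk continuous_const)).mul continuous_const
  have hPd : Continuous fun s => P s s * f s := (hPc.comp (continuous_id.prodMk continuous_id)).mul hf
  have hx00 : Continuous fun s => kx s 0 := h.cont_x.comp (continuous_id.prodMk continuous_const)
  rw [intervalIntegral.integral_congr (fun s hs => hfin s (by rwa [uIcc_of_le hx0] at hs)),
    intervalIntegral.integral_add, intervalIntegral.integral_add, ← hA, ← hB,
    intervalIntegral.integral_mul_const, ← hD, hsum, hC]
  · ring
  · exact (((hPd.const_mul 2).fun_sub hP0).fun_add (continuous_intervalIntegral_param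
      (h := fun s y => Q s y * f y - P s y * p y) ((hcf h.cont_Q hf).sub (hcf hPc hp)))).intervalIntegrable _ _
  · exact ((hdiag.fun_mul hp).fun_add (hci h.cont_x hp)).intervalIntegrable _ _
  · exact ((((hPd.const_mul 2).fun_sub hP0).fun_add (continuous_intervalIntegral_param
      (h := fun s y => Q s y * f y - P s y * p y) ((hcf h.cont_Q hf).sub (hcf hPc hp)))).fun_add ((hdiag.fun_mul hp).fun_add (hci h.cont_x hp))).intervalIntegrable _ _
  · exact (hx00.mul continuous_const).intervalIntegrable _ _

end SpaceKernel

/-! ### Volterra operators on C([0,1]) and their inverses -/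

/-- The space `C([0,1])`. -/
abbrev UnitFun := C(Icc (0 : ℝ) 1, ℝ)

/-- The space of continuous kernels on the unit square. -/
abbrev KernelFun := C(Icc (0 : ℝ) 1 × Icc (0 : ℝ) 1, ℝ)

/-- The extension of a continuous function on `[0,1]` to the real line. -/
noncomputable def UnitFun.ext (f : UnitFun) : ℝ → ℝ := IccExtend zero_le_one f

/-- The projection of the real line onto `[0,1]`. -/
noncomputable def unitProj (x : ℝ) : Icc (0 : ℝ) 1 := projIcc 0 1 zero_le_one x

theorem continuous_unitProj : Continuous unitProj :=
  continuous_projIcc (h := zero_le_one)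

theorem unitProj_of_mem {x : ℝ} (hx : x ∈ Icc (0 : ℝ) 1) : unitProj x = ⟨x, hx⟩ :=
  projIcc_of_mem _ hx

@[simp] theorem unitProj_coe (x : Icc (0 : ℝ) 1) : unitProj x = x := unitProj_of_mem x.2

theorem UnitFun.ext_apply (f : UnitFun) (x : ℝ) : f.ext x = f (unitProj x) := rfl

theorem UnitFun.continuous_ext (f : UnitFun) : Continuous f.ext := f.continuous.Icc_extend'

theorem UnitFun.abs_ext_le (f : UnitFun) (x : ℝ) : |f.ext x| ≤ ‖f‖ := f.norm_coe_le_norm _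

theorem UnitFun.ext_of_mem (f : UnitFun) {x : ℝ} (hx : x ∈ Icc (0 : ℝ) 1) : f.ext x = f ⟨x, hx⟩ := by
  rw [ext_apply, unitProj_of_mem hx]

theorem continuous_kernel_param (κ : KernelFun) (f : UnitFun) :
    Continuous (Function.uncurry fun x y => κ (unitProj x, unitProj y) * f.ext y) :=
  (κ.continuous.comp ((continuous_unitProj.comp continuous_fst).prodMk
    (continuous_unitProj.comp continuous_snd))).mul (f.continuous_ext.comp continuous_snd)

/-- The Volterra integral of `f` with kernel `κ`. -/
noncomputable def volterraFun (κ : KernelFun) (f : UnitFun) : UnitFun where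
  toFun x := ∫ y in (0 : ℝ)..x, κ (x, unitProj y) * f.ext y
  continuous_toFun := by
    have := (continuous_intervalIntegral_param (continuous_kernel_param κ f)).comp
      (continuous_subtype_val (p := (· ∈ Icc (0 : ℝ) 1)))
    simpa [Function.comp_def] using this

theorem volterraFun_integrable (κ : KernelFun) (f : UnitFun) (x : Icc (0 : ℝ) 1) (a b : ℝ) :
    IntervalIntegrable (fun y => κ (x, unitProj y) * f.ext y) volume a b := by
  refine Continuous.intervalIntegrable ?_ _ _
  exact (κ.continuous.comp (continuous_const.prodMk continuous_unitProj)).mul f.continuous_ext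

/-- The power weight is kept because integrating it gains the factor 1/(n + 1); iterated, these
factors make up the factorial in `norm_volterra_pow_le`. -/
theorem abs_volterraFun_le (κ : KernelFun) (f : UnitFun) (x : Icc (0 : ℝ) 1) {c : ℝ} {n : ℕ}
    (hf : ∀ y, |f y| ≤ c * (y : ℝ) ^ n) :
    |volterraFun κ f x| ≤ ‖κ‖ * c * ((x : ℝ) ^ (n + 1) / (n + 1)) := by
  have h1 : |volterraFun κ f x| ≤ ∫ y in (0 : ℝ)..x, ‖κ‖ * c * y ^ n := by
    refine intervalIntegral.norm_integral_le_of_norm_le (f := fun y => κ (x, unitProj y) * f.ext y)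
      x.2.1 (.of_forall fun y hy => ?_) (Continuous.intervalIntegrable (by fun_prop) _ _)
    rw [norm_mul, mul_assoc]
    have hy' : y ∈ Icc (0 : ℝ) 1 := ⟨hy.1.le, hy.2.trans x.2.2⟩
    refine mul_le_mul (κ.norm_coe_le_norm _) ?_ (norm_nonneg _) (norm_nonneg _)
    rw [f.ext_of_mem hy']
    exact hf ⟨y, hy'⟩
  refine h1.trans (le_of_eq ?_)
  rw [intervalIntegral.integral_const_mul, integral_pow]
  simp

/-- The Volterra integral operator, as a continuous bilinear map of the kernel and the function. -/
noncomputable def volterra : KernelFun →L[ℝ] UnitFun →L[ℝ] UnitFun :=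
  LinearMap.mkContinuous₂ (LinearMap.mk₂ ℝ volterraFun
    (fun κ₁ κ₂ f => by
      ext x
      simp only [volterraFun, ContinuousMap.coe_mk, ContinuousMap.add_apply, add_mul]
      exact intervalIntegral.integral_add (volterraFun_integrable _ _ _ _ _)
        (volterraFun_integrable _ _ _ _ _))
    (fun c κ f => by
      ext x
      simp only [volterraFun, ContinuousMap.coe_mk, ContinuousMap.smul_apply, smul_eq_mul, mul_assoc]
      exact intervalIntegral.integral_const_mul _ _)
    (fun κ f₁ f₂ => by
      ext x
      simp only [volterraFun, ContinuousMap.coe_mk, ContinuousMap.add_apply, UnitFun.ext_apply, mul_add]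
      exact intervalIntegral.integral_add (volterraFun_integrable κ f₁ _ _ _)
        (volterraFun_integrable κ f₂ _ _ _))
    (fun c κ f => by
      ext x
      simp only [volterraFun, ContinuousMap.coe_mk, ContinuousMap.smul_apply, smul_eq_mul,
        UnitFun.ext_apply, mul_left_comm]
      exact intervalIntegral.integral_const_mul _ _)) 1 (by
    intro κ f
    rw [LinearMap.mk₂_apply, one_mul, ContinuousMap.norm_le _ (by positivity)]
    intro x
    refine (abs_volterraFun_le κ f x (c := ‖f‖) (n := 0) fun y => by
      simpa using f.norm_coe_le_norm y).trans ?_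
    have := x.2.2
    have h0 : 0 ≤ ‖κ‖ * ‖f‖ := by positivity
    simp only [zero_add, pow_one, CharP.cast_eq_zero, div_one]
    nlinarith)

theorem volterra_apply (κ : KernelFun) (f : UnitFun) (x : Icc (0 : ℝ) 1) :
    volterra κ f x = ∫ y in (0 : ℝ)..x, κ (x, unitProj y) * f.ext y := rfl

theorem norm_volterra_pow_le (κ : KernelFun) (n : ℕ) :
    ‖(volterra κ) ^ n‖ ≤ ‖κ‖ ^ n / n.factorial := by
  have key : ∀ n (f : UnitFun) (x : Icc (0 : ℝ) 1),
      |((volterra κ) ^ n) f x| ≤ (‖κ‖ ^ n / n.factorial * ‖f‖) * (x : ℝ) ^ n := by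
    intro n
    induction n with
    | zero => intro f x; simpa using f.norm_coe_le_norm x
    | succ n ih =>
      intro f x
      rw [pow_succ']
      refine (abs_volterraFun_le κ (((volterra κ) ^ n) f) x (ih f)).trans (le_of_eq ?_)
      rw [Nat.factorial_succ]
      push_cast
      have : ((n : ℝ) + 1) ≠ 0 := by positivity
      have : (n.factorial : ℝ) ≠ 0 := by positivity
      field_simp
      ring
  refine ContinuousLinearMap.opNorm_le_bound _ (by positivity) fun f => ?_
  rw [ContinuousMap.norm_le _ (by positivity)]
  intro x
  refine (key n f x).trans (mul_le_of_le_one_right (by positivity) (pow_le_one₀ x.2.1 x.2.2))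

/-- With V = −K, some power Vⁿ has norm below 1 by the factorial bound, so 1 − Vⁿ is invertible. It
is the product of the commuting factors 1 − V and 1 + V + … + Vⁿ⁻¹, hence 1 − V is invertible as
well. No smallness of the kernel is needed. -/
theorem isUnit_one_add_volterra (κ : KernelFun) : IsUnit (1 + volterra κ) := by
  obtain ⟨n, hn⟩ := ((FloorSemiring.tendsto_pow_div_factorial_atTop ‖κ‖).eventually
    (gt_mem_nhds zero_lt_one)).exists
  set V : UnitFun →L[ℝ] UnitFun := volterra (-κ) with hV
  have h1 : IsUnit (1 - V ^ n) := by
    refine isUnit_one_sub_of_norm_lt_one (R := UnitFun →L[ℝ] UnitFun) (lt_of_le_of_lt ?_ hn)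
    have := norm_volterra_pow_le (-κ) n
    rwa [norm_neg] at this
  have h2 : 1 + volterra κ = 1 - V := by rw [hV, map_neg, sub_neg_eq_add]
  rw [h2]
  rw [← mul_neg_geom_sum] at h1
  have hc : Commute (1 - V) (∑ i ∈ Finset.range n, V ^ i) := by
    rw [Commute, SemiconjBy, mul_neg_geom_sum, geom_sum_mul_neg]
  exact (hc.isUnit_mul_iff.1 h1).1

/-- The inverse of `f ↦ f + volterra κ f`. -/
noncomputable def volterraInv (κ : KernelFun) : UnitFun →L[ℝ] UnitFun := Ring.inverse (1 + volterra κ)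

theorem volterraInv_add_volterra (κ : KernelFun) (f : UnitFun) :
    volterraInv κ f + volterra κ (volterraInv κ f) = f := by
  have := Ring.mul_inverse_cancel _ (isUnit_one_add_volterra κ)
  have h := congrArg (fun T : UnitFun →L[ℝ] UnitFun => T f) this
  simpa [volterraInv] using h

theorem volterraInv_of_add_volterra (κ : KernelFun) (f : UnitFun) :
    volterraInv κ (f + volterra κ f) = f := by
  have := Ring.inverse_mul_cancel _ (isUnit_one_add_volterra κ)
  have h := congrArg (fun T : UnitFun →L[ℝ] UnitFun => T f) this
  simpa [volterraInv] using h

theorem eq_zero_of_add_volterra_eq_zero {κ : KernelFun} {f : UnitFun} (h : f + volterra κ f = 0) :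
    f = 0 := by
  rw [← volterraInv_of_add_volterra κ f, h, map_zero]

theorem continuous_volterraInv : Continuous volterraInv := by
  rw [continuous_iff_continuousAt]
  intro κ
  obtain ⟨u, hu⟩ := isUnit_one_add_volterra κ
  have h1 : ContinuousAt Ring.inverse (1 + volterra κ) := hu ▸ NormedRing.inverse_continuousAt (R := UnitFun →L[ℝ] UnitFun) u
  exact ContinuousAt.comp (f := fun κ => 1 + volterra κ) h1
    (continuous_const.add volterra.continuous).continuousAt

theorem hasDerivAt_ringInverse_comp {R : Type*} [NormedRing R] [HasSummableGeomSeries R]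
    [NormedAlgebra ℝ R] {c : ℝ → R} {c' : R} {t : ℝ} (hu : IsUnit (c t)) (hc : HasDerivAt c c' t) :
    HasDerivAt (fun s => Ring.inverse (c s)) (-(Ring.inverse (c t) * c' * Ring.inverse (c t))) t := by
  obtain ⟨u, hu⟩ := hu
  have h1 := hasFDerivAt_ringInverse (𝕜 := ℝ) u
  rw [hu] at h1
  refine (h1.comp_hasDerivAt t hc).congr_deriv ?_
  rw [← hu, Ring.inverse_unit]
  simp

/-- Differentiating U + KU = W in time gives (1 + K)U' = W' − K'U. -/
theorem hasDerivAt_volterraInv {κ : ℝ → KernelFun} {κ' : KernelFun} {W : ℝ → UnitFun} {W' : UnitFun}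
    {t : ℝ} (hκ : HasDerivAt κ κ' t) (hW : HasDerivAt W W' t) :
    HasDerivAt (fun s => volterraInv (κ s) (W s))
      (volterraInv (κ t) (W' - volterra κ' (volterraInv (κ t) (W t)))) t := by
  have h2 : HasDerivAt (fun s => 1 + volterra (κ s)) (volterra κ') t :=
    (volterra.hasFDerivAt.comp_hasDerivAt t hκ).const_add (1 : UnitFun →L[ℝ] UnitFun)
  have h3 : HasDerivAt (fun s => volterraInv (κ s))
      (-(volterraInv (κ t) * volterra κ' * volterraInv (κ t))) t :=
    hasDerivAt_ringInverse_comp (R := UnitFun →L[ℝ] UnitFun) (isUnit_one_add_volterra (κ t)) h2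
  refine (h3.clm_apply hW).congr_deriv ?_
  rw [map_sub]
  change - (volterraInv (κ t) (volterra κ' (volterraInv (κ t) (W t)))) + volterraInv (κ t) W' = _
  abel

/-- The mean value inequality at each point `y` gives an error controlled by the variation of `F'`
in the supremum norm, hence uniform in `y`. -/
theorem hasDerivAt_continuousMap {Y : Type*} [TopologicalSpace Y] [CompactSpace Y]
    {F F' : ℝ → C(Y, ℝ)} {a b : ℝ} (hF : ∀ y, ∀ t ∈ Ioo a b, HasDerivAt (fun s => F s y) (F' t y) t)
    (hF' : ContinuousOn F' (Ioo a b)) {t : ℝ} (ht : t ∈ Ioo a b) : HasDerivAt F (F' t) t := by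
  rw [hasDerivAt_iff_isLittleO, Asymptotics.isLittleO_iff]
  intro ε hε
  have h1 : ∀ᶠ s in 𝓝 t, ‖F' s - F' t‖ ≤ ε := by
    have := (hF'.continuousAt (isOpen_Ioo.mem_nhds ht)).tendsto
    rw [tendsto_iff_norm_sub_tendsto_zero] at this
    exact this.eventually_le_const hε
  obtain ⟨δ, hδ, hball⟩ := Metric.eventually_nhds_iff_ball.1 (h1.and (isOpen_Ioo.mem_nhds ht))
  filter_upwards [Metric.ball_mem_nhds t hδ] with s hs
  rw [ContinuousMap.norm_le _ (by positivity)]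
  intro y
  have := (convex_ball t δ).norm_image_sub_le_of_norm_hasDerivWithin_le
    (f := fun r => F r y - r * F' t y) (f' := fun r => F' r y - F' t y) (C := ε) (x := t) (y := s)
    (fun r hr => (((hF y r (hball r hr).2).sub ((hasDerivAt_id r).mul_const (F' t y))).congr_deriv
      (by simp)).hasDerivWithinAt)
    (fun r hr => ((F' r - F' t).norm_coe_le_norm y).trans (hball r hr).1)
    (Metric.mem_ball_self hδ) hs
  refine le_trans (le_of_eq ?_) this
  simp only [ContinuousMap.sub_apply, ContinuousMap.smul_apply, smul_eq_mul]
  congr 1; ring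

/-! ### The kernel domain, and the kernel as a curve in C([0,1]²) -/

theorem convex_kernelDomain : Convex ℝ kernelDomain := by
  rintro ⟨x, y, t⟩ ⟨h1, h2, h3, h4, h5⟩ ⟨x', y', t'⟩ ⟨h1', h2', h3', h4', h5'⟩ r s hr hs hrs
  simp only at h1 h2 h3 h4 h5 h1' h2' h3' h4' h5'
  simp only [kernelDomain, mem_ofPred_eq, Prod.smul_mk, Prod.mk_add_mk, smul_eq_mul]
  have e : s = 1 - r := by linarith
  refine ⟨by positivity, by gcongr, by nlinarith, by positivity, ?_⟩
  rcases hr.lt_or_eq with hr | rfl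
  · nlinarith
  · simp at e; subst e; linarith

theorem interior_kernelDomain_nonempty : (interior kernelDomain).Nonempty := by
  refine ⟨(1 / 2, 1 / 4, 1 / 2), mem_interior.2
    ⟨{p | 0 < p.2.1 ∧ p.2.1 < p.1 ∧ p.1 < 1 ∧ 0 < p.2.2 ∧ p.2.2 < 1}, ?_, ?_, ?_⟩⟩
  · rintro p ⟨h1, h2, h3, h4, h5⟩
    exact ⟨h1.le, h2.le, h3.le, h4.le, h5⟩
  · have c1 : Continuous fun p : ℝ × ℝ × ℝ => p.1 := continuous_fst
    have c2 : Continuous fun p : ℝ × ℝ × ℝ => p.2.1 := by fun_prop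
    have c3 : Continuous fun p : ℝ × ℝ × ℝ => p.2.2 := by fun_prop
    exact (isOpen_lt continuous_const c2).and ((isOpen_lt c2 c1).and
      ((isOpen_lt c1 continuous_const).and ((isOpen_lt continuous_const c3).and
      (isOpen_lt c3 continuous_const))))
  · norm_num

theorem uniqueDiffOn_kernelDomain : UniqueDiffOn ℝ kernelDomain :=
  uniqueDiffOn_convex convex_kernelDomain interior_kernelDomain_nonempty

/-- The retraction of the space onto `{0 ≤ y ≤ x ≤ 1, 0 ≤ t ≤ τ}`. -/
noncomputable def kernelClip (τ : ℝ) (p : ℝ × ℝ × ℝ) : ℝ × ℝ × ℝ :=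
  (max 0 (min p.1 1), max 0 (min p.2.1 (max 0 (min p.1 1))), max 0 (min p.2.2 τ))

theorem continuous_kernelClip (τ : ℝ) : Continuous (kernelClip τ) := by
  unfold kernelClip; fun_prop

theorem kernelClip_mem {τ : ℝ} (hτ : τ ∈ Ico (0 : ℝ) 1) (p : ℝ × ℝ × ℝ) :
    kernelClip τ p ∈ kernelDomain := by
  refine ⟨le_max_left _ _, max_le (le_max_left _ _) (min_le_right _ _),
    max_le zero_le_one (min_le_right _ _), le_max_left _ _, ?_⟩
  exact max_lt zero_lt_one ((min_le_right _ _).trans_lt hτ.2)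

theorem kernelClip_eq {τ x y t : ℝ} (hy : 0 ≤ y) (hyx : y ≤ x) (hx : x ≤ 1)
    (ht : t ∈ Icc 0 τ) : kernelClip τ (x, y, t) = (x, y, t) := by
  have hx0 : 0 ≤ x := hy.trans hyx
  simp only [kernelClip, min_eq_left hx, max_eq_right hx0, min_eq_left hyx, max_eq_right hy,
    min_eq_left ht.2, max_eq_right ht.1]

/-- The extension of a kernel on the unit square to the plane. -/
noncomputable def KernelFun.ext (κ : KernelFun) (x y : ℝ) : ℝ := κ (unitProj x, unitProj y)

theorem KernelFun.continuous_ext (κ : KernelFun) : Continuous (Function.uncurry κ.ext) :=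
  κ.continuous.comp ((continuous_unitProj.comp continuous_fst).prodMk
    (continuous_unitProj.comp continuous_snd))

theorem KernelFun.abs_ext_le (κ : KernelFun) (x y : ℝ) : |κ.ext x y| ≤ ‖κ‖ := κ.norm_coe_le_norm _

theorem volterra_ext (κ : KernelFun) (f : UnitFun) {x : ℝ} (hx : x ∈ Icc (0 : ℝ) 1) :
    (volterra κ f).ext x = ∫ y in (0 : ℝ)..x, κ.ext x y * f.ext y := by
  rw [UnitFun.ext_of_mem _ hx, volterra_apply]
  simp only [KernelFun.ext, unitProj_of_mem hx]

/-- A function on the kernel domain as a continuous curve of kernels on the unit square. -/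
noncomputable def clipCurve {g : ℝ × ℝ × ℝ → ℝ} (hg : ContinuousOn g kernelDomain) {τ : ℝ}
    (hτ : τ ∈ Ico (0 : ℝ) 1) : C(ℝ, KernelFun) :=
  ContinuousMap.curry ⟨fun q : ℝ × (Icc (0 : ℝ) 1 × Icc (0 : ℝ) 1) =>
    g (kernelClip τ (q.2.1, q.2.2, q.1)), by
      refine hg.comp_continuous ((continuous_kernelClip τ).comp (by fun_prop)) fun q =>
        kernelClip_mem hτ _⟩

theorem clipCurve_apply {g : ℝ × ℝ × ℝ → ℝ} (hg : ContinuousOn g kernelDomain) {τ : ℝ}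
    (hτ : τ ∈ Ico (0 : ℝ) 1) (t : ℝ) (p : Icc (0 : ℝ) 1 × Icc (0 : ℝ) 1) :
    clipCurve hg hτ t p = g (kernelClip τ (p.1, p.2, t)) := rfl

theorem clipCurve_ext {g : ℝ × ℝ × ℝ → ℝ} (hg : ContinuousOn g kernelDomain) {τ : ℝ}
    (hτ : τ ∈ Ico (0 : ℝ) 1) {x y t : ℝ} (hy : 0 ≤ y) (hyx : y ≤ x) (hx : x ≤ 1)
    (ht : t ∈ Icc 0 τ) : (clipCurve hg hτ t).ext x y = g (x, y, t) := by
  rw [KernelFun.ext, clipCurve_apply, unitProj_of_mem ⟨hy.trans hyx, hx⟩,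
    unitProj_of_mem ⟨hy, hyx.trans hx⟩, kernelClip_eq hy hyx hx ht]

/-- The cut-off time plays no role before it is reached. This permits one solution on [0,1) although
every estimate is made on a compact interval [0,τ]. -/
theorem clipCurve_congr {g : ℝ × ℝ × ℝ → ℝ} (hg : ContinuousOn g kernelDomain) {τ τ' : ℝ}
    (hτ : τ ∈ Ico (0 : ℝ) 1) (hτ' : τ' ∈ Ico (0 : ℝ) 1) {t : ℝ} (ht : t ≤ τ) (ht' : t ≤ τ') :
    clipCurve hg hτ t = clipCurve hg hτ' t := by
  ext p
  simp only [clipCurve_apply, kernelClip, min_eq_left ht, min_eq_left ht']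

/-- The segment may lie in the boundary of the domain: the derivative within the domain along the
segment is an ordinary derivative of the restriction to it. -/
theorem integral_fderivWithin_line {k : ℝ × ℝ × ℝ → ℝ} (hk : ContDiffOn ℝ 1 k kernelDomain)
    {γ : ℝ → ℝ × ℝ × ℝ} {v : ℝ × ℝ × ℝ} (hγ : ∀ s, HasDerivAt γ v s) {c d : ℝ} (hcd : c ≤ d)
    (hmem : ∀ s ∈ Icc c d, γ s ∈ kernelDomain) :
    ∫ s in c..d, fderivWithin ℝ k kernelDomain (γ s) v = k (γ d) - k (γ c) := by
  have hγc : Continuous γ := continuous_iff_continuousAt.2 fun s => (hγ s).continuousAt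
  refine intervalIntegral.integral_eq_sub_of_hasDerivAt_of_le hcd
    (hk.continuousOn.comp hγc.continuousOn hmem) (fun s hs => ?_) ?_
  · have h1 := (hk.differentiableOn (by norm_num) _ (hmem s (Ioo_subset_Icc_self hs))).hasFDerivWithinAt
    exact (h1.comp_hasDerivWithinAt s (hγ s).hasDerivWithinAt hmem).hasDerivAt (Icc_mem_nhds hs.1 hs.2)
  · refine ContinuousOn.intervalIntegrable ?_
    rw [uIcc_of_le hcd]
    exact ((hk.continuousOn_fderivWithin uniqueDiffOn_kernelDomain le_rfl).comp hγc.continuousOn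
      hmem).clm_apply continuousOn_const

theorem hasDerivAt_line (p v : ℝ × ℝ × ℝ) (s : ℝ) : HasDerivAt (fun s : ℝ => p + s • v) v s := by
  simpa using ((hasDerivAt_id s).smul_const v).const_add p

namespace IsNeumannKernel

variable {a : ℝ → ℝ → ℝ} {lam : ℝ} {k : ℝ × ℝ × ℝ → ℝ}

theorem continuousOn_fderivWithin_apply (h : IsNeumannKernel a lam k) (v : ℝ × ℝ × ℝ) :
    ContinuousOn (fun p => fderivWithin ℝ k kernelDomain p v) kernelDomain :=
  (h.contDiffOn.continuousOn_fderivWithin uniqueDiffOn_kernelDomain le_rfl).clm_apply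
    continuousOn_const

theorem continuousOn (h : IsNeumannKernel a lam k) : ContinuousOn k kernelDomain :=
  h.contDiffOn.continuousOn

theorem continuousOn_dx (h : IsNeumannKernel a lam k) : ContinuousOn (kernelDx k) kernelDomain :=
  h.continuousOn_fderivWithin_apply _

theorem continuousOn_dy (h : IsNeumannKernel a lam k) : ContinuousOn (kernelDy k) kernelDomain :=
  h.continuousOn_fderivWithin_apply _

theorem continuousOn_dt (h : IsNeumannKernel a lam k) : ContinuousOn (kernelDt k) kernelDomain :=
  h.continuousOn_fderivWithin_apply _

/-- By the chain rule d/dx k(x,x,t) = k_x + k_y, so the two contributions in the diagonal condition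
coincide. -/
theorem two_mul_diagonal (h : IsNeumannKernel a lam k) {x t : ℝ} (hx : x ∈ Icc (0 : ℝ) 1)
    (ht : t ∈ Ico (0 : ℝ) 1) : 2 * (kernelDx k (x, x, t) + kernelDy k (x, x, t)) = a x t + lam := by
  have hmem : ∀ s ∈ Icc (0 : ℝ) 1, (s, s, t) ∈ kernelDomain := fun s hs =>
    ⟨hs.1, le_rfl, hs.2, ht.1, ht.2⟩
  have h1 := (h.contDiffOn.differentiableOn (by norm_num) _ (hmem x hx)).hasFDerivWithinAt
  have h2 : HasDerivAt (fun s : ℝ => (s, s, t)) (1, 1, 0) x :=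
    (hasDerivAt_id x).prodMk ((hasDerivAt_id x).prodMk (hasDerivAt_const x t))
  have h3 := (h1.comp_hasDerivWithinAt x h2.hasDerivWithinAt hmem).derivWithin
    (uniqueDiffOn_Icc zero_lt_one x hx)
  have h4 := h.diagonal x hx t ht
  have h5 : fderivWithin ℝ k kernelDomain (x, x, t) (1, 1, 0)
      = kernelDx k (x, x, t) + kernelDy k (x, x, t) := by
    rw [kernelDx, kernelDy, ← map_add]; simp
  have h6 : derivWithin (fun s : ℝ => k (s, s, t)) (Icc (0 : ℝ) 1) x
      = kernelDx k (x, x, t) + kernelDy k (x, x, t) := by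
    rw [← h5, ← h3]; rfl
  rw [h6] at h4
  linarith

/-- The three integral relations are the fundamental theorem of calculus along horizontal, vertical
and characteristic segments of the triangle. -/
theorem spaceKernel (h : IsNeumannKernel a lam k) {τ : ℝ} (hτ : τ ∈ Ico (0 : ℝ) 1) {t : ℝ}
    (ht : t ∈ Icc 0 τ) {A : UnitFun} (hA : ∀ x : Icc (0 : ℝ) 1, A x = a x t) :
    SpaceKernel (clipCurve h.continuousOn hτ t).ext (clipCurve h.continuousOn_dx hτ t).ext
      (clipCurve h.continuousOn_dy hτ t).ext
      (fun x y => (clipCurve h.continuousOn_dt hτ t).ext x y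
        + (A.ext y + lam) * (clipCurve h.continuousOn hτ t).ext x y)
      (fun x => A.ext x + lam) := by
  have ht1 : t ∈ Ico (0 : ℝ) 1 := ⟨ht.1, ht.2.trans_lt hτ.2⟩
  have hmem : ∀ {x y : ℝ}, 0 ≤ y → y ≤ x → x ≤ 1 → (x, y, t) ∈ kernelDomain := fun hy hyx hx =>
    ⟨hy, hyx, hx, ht1.1, ht1.2⟩
  have hAe : ∀ {x : ℝ}, x ∈ Icc (0 : ℝ) 1 → A.ext x = a x t := fun {x} hx => by
    rw [A.ext_of_mem hx, hA]
  refine ⟨KernelFun.continuous_ext _, KernelFun.continuous_ext _, KernelFun.continuous_ext _, ?_, ?_,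
    ?_, ?_, ?_, ?_, ?_⟩
  · exact (KernelFun.continuous_ext _).fun_add ((((A.continuous_ext).comp continuous_snd).fun_add
      continuous_const).fun_mul (KernelFun.continuous_ext _))
  · exact A.continuous_ext.fun_add continuous_const
  · intro x y hy hyx hx
    rw [clipCurve_ext _ hτ hy hyx hx ht, clipCurve_ext _ hτ hy le_rfl (hyx.trans hx) ht]
    have := integral_fderivWithin_line h.contDiffOn (γ := fun s => (0, y, t) + s • (1, 0, 0))
      (hasDerivAt_line _ _) hyx (fun s hs => by simpa using hmem hy hs.1 (hs.2.trans hx))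
    simp only [Prod.smul_mk, smul_eq_mul, mul_one, mul_zero, Prod.mk_add_mk, zero_add, add_zero] at this
    rw [intervalIntegral.integral_congr (g := fun s => fderivWithin ℝ k kernelDomain (s, y, t) (1, 0, 0)),
      this]
    · ring
    · intro s hs
      rw [uIcc_of_le hyx] at hs
      simp only
      rw [clipCurve_ext _ hτ hy hs.1 (hs.2.trans hx) ht, kernelDx]
  · intro x y hy hyx hx
    have hx0 := hy.trans hyx
    rw [clipCurve_ext _ hτ hy hyx hx ht, clipCurve_ext _ hτ hx0 le_rfl hx ht]
    have := integral_fderivWithin_line h.contDiffOn (γ := fun s => (x, 0, t) + s • (0, 1, 0))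
      (hasDerivAt_line _ _) hyx (fun s hs => by simpa using hmem (hy.trans hs.1) hs.2 hx)
    simp only [Prod.smul_mk, smul_eq_mul, mul_one, mul_zero, Prod.mk_add_mk, zero_add, add_zero] at this
    rw [intervalIntegral.integral_congr (g := fun s => fderivWithin ℝ k kernelDomain (x, s, t) (0, 1, 0)),
      this]
    intro s hs
    rw [uIcc_of_le hyx] at hs
    simp only
    rw [clipCurve_ext _ hτ (hy.trans hs.1) hs.2 hx ht, kernelDy]
  · intro x y hy hyx hx
    set m := (x + y) / 2 with hm
    have hym : y ≤ m := by rw [hm]; linarith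
    have hmx : m ≤ x := by rw [hm]; linarith
    have hxy : x + y = 2 * m := by rw [hm]; ring
    have hm0 : m ∈ Icc (0 : ℝ) 1 := ⟨hy.trans hym, hmx.trans hx⟩
    rw [clipCurve_ext _ hτ hy hyx hx ht, clipCurve_ext _ hτ hy hyx hx ht, hAe hm0,
      ← h.two_mul_diagonal hm0 ht1]
    set F : ℝ → ℝ := fun s => kernelDx k (s, 2 * m - s, t) + kernelDy k (s, 2 * m - s, t) with hF
    have hpath : ∀ s ∈ Icc m x, (s, 2 * m - s, t) ∈ kernelDomain := fun s hs =>
      hmem (by linarith [hs.2]) (by linarith [hs.1]) (hs.2.trans hx)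
    have hpc : ContinuousOn (fun s : ℝ => (s, 2 * m - s, t)) (Icc m x) := by fun_prop
    -- The wave equation is only given for 0 < y < x < 1. The open characteristic segment lies in
    -- that set, and at its end points continuity of k_x + k_y is enough.
    have key := intervalIntegral.integral_eq_sub_of_hasDerivAt_of_le (f := F)
      (f' := fun s => kernelDt k (s, 2 * m - s, t) + (a (2 * m - s) t + lam) * k (s, 2 * m - s, t))
      hmx ((h.continuousOn_dx.comp hpc hpath).fun_add (h.continuousOn_dy.comp hpc hpath)) ?_ ?_
    · have hint : ∫ s in m..x, (clipCurve h.continuousOn_dt hτ t).ext s (x + y - s)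
          + (A.ext (x + y - s) + lam) * (clipCurve h.continuousOn hτ t).ext s (x + y - s)
          = ∫ s in m..x, kernelDt k (s, 2 * m - s, t)
            + (a (2 * m - s) t + lam) * k (s, 2 * m - s, t) := by
        refine intervalIntegral.integral_congr fun s hs => ?_
        rw [uIcc_of_le hmx] at hs
        have e1 : 0 ≤ 2 * m - s := by linarith [hs.2]
        have e2 : 2 * m - s ≤ s := by linarith [hs.1]
        rw [hxy, clipCurve_ext _ hτ e1 e2 (hs.2.trans hx) ht, clipCurve_ext _ hτ e1 e2 (hs.2.trans hx) ht,
          hAe ⟨e1, e2.trans (hs.2.trans hx)⟩]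
      rw [hint, key]
      simp only [hF]
      rw [show 2 * m - x = y by linarith, show 2 * m - m = m by ring]
      ring
    · intro s hs
      have h1 := h.wave s (2 * m - s) t (by linarith [hs.2]) (by linarith [hs.1])
        (hs.2.trans_le hx) ht1
      have h2 : HasDerivAt (fun r => F (s + r)) (kernelDt k (s, 2 * m - s, t)
          + (a (2 * m - s) t + lam) * k (s, 2 * m - s, t)) 0 := by
        refine h1.congr_of_eventuallyEq (.of_forall fun r => ?_)
        simp only [hF]
        rw [show 2 * m - (s + r) = 2 * m - s - r by ring]
      have h3 := HasDerivAt.comp_sub_const (f := fun r => F (s + r)) s s (by rwa [sub_self])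
      simpa using h3
    · refine ContinuousOn.intervalIntegrable ?_
      rw [uIcc_of_le hmx]
      refine (h.continuousOn_dt.comp hpc hpath).fun_add (ContinuousOn.fun_mul ?_
        (h.continuousOn.comp hpc hpath))
      have : ContinuousOn (fun s => A.ext (2 * m - s) + lam) (Icc m x) :=
        ((A.continuous_ext.comp (by fun_prop)).fun_add continuous_const).continuousOn
      refine this.congr fun s hs => ?_
      simp only
      rw [hAe ⟨by linarith [hs.2], by linarith [hs.1]⟩]
  · intro x hx0 hx1
    rw [clipCurve_ext _ hτ le_rfl hx0 hx1 ht, h.bottom x ⟨hx0, hx1⟩ t ht1]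
  · rw [clipCurve_ext _ hτ le_rfl le_rfl zero_le_one ht, h.corner t ht1]

theorem hasDerivAt_clipCurve (h : IsNeumannKernel a lam k) {τ : ℝ} (hτ : τ ∈ Ico (0 : ℝ) 1) {t : ℝ}
    (ht : t ∈ Ioo 0 τ) :
    HasDerivAt (clipCurve h.continuousOn hτ) (clipCurve h.continuousOn_dt hτ t) t := by
  refine hasDerivAt_continuousMap (F := clipCurve h.continuousOn hτ)
    (F' := clipCurve h.continuousOn_dt hτ) (fun p t ht => ?_)
    (clipCurve h.continuousOn_dt hτ).continuous.continuousOn ht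
  -- For times in [0,τ] clipping changes only the space variables, so the curve at a fixed point of
  -- the square is `k` along a line parallel to the time axis.
  obtain ⟨q, hq⟩ : ∃ q : ℝ × ℝ, ∀ s ∈ Icc 0 τ, kernelClip τ (p.1, p.2, s) = (q.1, q.2, s) :=
    ⟨(max 0 (min (p.1 : ℝ) 1), max 0 (min (p.2 : ℝ) (max 0 (min (p.1 : ℝ) 1)))), fun s hs => by
      simp only [kernelClip, min_eq_left hs.2, max_eq_right hs.1]⟩
  have hmem : ∀ s ∈ Icc 0 τ, (q.1, q.2, s) ∈ kernelDomain := fun s hs => by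
    rw [← hq s hs]; exact kernelClip_mem hτ _
  have ht' := Ioo_subset_Icc_self ht
  have h1 := (h.contDiffOn.differentiableOn (by norm_num) _ (hmem t ht')).hasFDerivWithinAt
  have h2 : HasDerivAt (fun s : ℝ => (q.1, q.2, s)) (0, 0, 1) t :=
    (hasDerivAt_const t _).prodMk ((hasDerivAt_const t _).prodMk (hasDerivAt_id t))
  have h3 := (h1.comp_hasDerivWithinAt t h2.hasDerivWithinAt hmem).hasDerivAt (Icc_mem_nhds ht.1 ht.2)
  rw [clipCurve_apply, hq t ht', kernelDt]
  refine h3.congr_of_eventuallyEq ?_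
  filter_upwards [Icc_mem_nhds ht.1 ht.2] with s hs
  rw [clipCurve_apply, hq s hs, Function.comp_apply]

end IsNeumannKernel

/-- A kernel that varies in time, with the properties of a solution of the kernel problem on the
time interval `[0,τ]`. -/
structure TimeKernel (lam τ : ℝ) (A : ℝ → UnitFun) (κ κx κy κt : ℝ → KernelFun) : Prop where
  pos : 0 < τ
  cont : Continuous κ
  cont_x : Continuous κx
  cont_y : Continuous κy
  cont_t : Continuous κt
  cont_A : Continuous A
  hasDerivAt : ∀ t ∈ Ioo 0 τ, HasDerivAt κ (κt t) t
  space : ∀ t ∈ Icc 0 τ, SpaceKernel (κ t).ext (κx t).ext (κy t).ext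
      (fun x y => (κt t).ext x y + ((A t).ext y + lam) * (κ t).ext x y) (fun x => (A t).ext x + lam)

/-- The coefficient `a` on `[0,1] × [0,τ]` as a continuous curve in `C([0,1])`. -/
noncomputable def coeffCurve {a : ℝ → ℝ → ℝ}
    (ha : ContinuousOn (Function.uncurry a) (Icc (0 : ℝ) 1 ×ˢ Ico (0 : ℝ) 1)) {τ : ℝ}
    (hτ : τ ∈ Ico (0 : ℝ) 1) : C(ℝ, UnitFun) :=
  ContinuousMap.curry ⟨fun q : ℝ × Icc (0 : ℝ) 1 => a q.2 (max 0 (min q.1 τ)), by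
      refine ha.comp_continuous (f := fun q : ℝ × Icc (0 : ℝ) 1 => ((q.2 : ℝ), max 0 (min q.1 τ)))
        (by fun_prop) fun q => ⟨q.2.2, le_max_left _ _, ?_⟩
      exact max_lt zero_lt_one ((min_le_right _ _).trans_lt hτ.2)⟩

theorem coeffCurve_apply {a : ℝ → ℝ → ℝ}
    (ha : ContinuousOn (Function.uncurry a) (Icc (0 : ℝ) 1 ×ˢ Ico (0 : ℝ) 1)) {τ : ℝ}
    (hτ : τ ∈ Ico (0 : ℝ) 1) {t : ℝ} (ht : t ∈ Icc 0 τ) (x : Icc (0 : ℝ) 1) :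
    coeffCurve ha hτ t x = a x t := by
  change a x (max 0 (min t τ)) = a x t
  rw [min_eq_left ht.2, max_eq_right ht.1]

theorem IsNeumannKernel.timeKernel {a : ℝ → ℝ → ℝ} {lam : ℝ} {k : ℝ × ℝ × ℝ → ℝ}
    (h : IsNeumannKernel a lam k)
    (ha : ContinuousOn (Function.uncurry a) (Icc (0 : ℝ) 1 ×ˢ Ico (0 : ℝ) 1)) {τ : ℝ}
    (hτ : τ ∈ Ioo (0 : ℝ) 1) :
    TimeKernel lam τ (coeffCurve ha (Ioo_subset_Ico_self hτ))
      (clipCurve h.continuousOn (Ioo_subset_Ico_self hτ))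
      (clipCurve h.continuousOn_dx (Ioo_subset_Ico_self hτ))
      (clipCurve h.continuousOn_dy (Ioo_subset_Ico_self hτ))
      (clipCurve h.continuousOn_dt (Ioo_subset_Ico_self hτ)) where
  pos := hτ.1
  cont := ContinuousMap.continuous _
  cont_x := ContinuousMap.continuous _
  cont_y := ContinuousMap.continuous _
  cont_t := ContinuousMap.continuous _
  cont_A := ContinuousMap.continuous _
  hasDerivAt _ ht := h.hasDerivAt_clipCurve _ ht
  space _ ht := h.spaceKernel _ ht fun x => coeffCurve_apply ha _ ht x

/-! ### Cosine modes: completeness, orthogonality, Parseval's identity -/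

/-- Frequencies `ν n` for which the functions `cos (ν n x)` are a complete orthogonal family of
eigenfunctions of the second derivative with a Neumann condition at `0` and either a Neumann or a
Dirichlet condition at `1`. -/
structure CosModes (ν : ℕ → ℝ) : Prop where
  le : ∀ n : ℕ, (n : ℝ) ≤ ν n
  inj : Function.Injective ν
  bc : (∀ n, Real.sin (ν n) = 0) ∨ ∀ n, Real.cos (ν n) = 0
  complete : ∀ f : ℝ → ℝ, ContinuousOn f (Icc (0 : ℝ) 1) →
    (∀ n, ∫ x in (0 : ℝ)..1, f x * Real.cos (ν n * x) = 0) → ∀ x ∈ Icc (0 : ℝ) 1, f x = 0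

theorem eq_zero_of_integral_sq_eq_zero {f : ℝ → ℝ} (hf : ContinuousOn f (Icc (0 : ℝ) 1))
    (h : ∫ x in (0 : ℝ)..1, f x ^ 2 ≤ 0) : ∀ x ∈ Icc (0 : ℝ) 1, f x = 0 := by
  intro x hx
  by_contra hne
  have := intervalIntegral.integral_pos zero_lt_one (f := fun x => f x ^ 2) (hf.pow 2)
    (fun _ _ => sq_nonneg _) ⟨x, hx, by positivity⟩
  linarith

/-- One more factor cos(πx) is absorbed by cos((n+1)θ) cos θ = ½(cos((n+2)θ) + cos(nθ)), which keeps
the frequencies in the family. -/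
theorem integral_mul_cos_pow {f : ℝ → ℝ} (hf : ContinuousOn f (Icc (0 : ℝ) 1))
    (h : ∀ n : ℕ, ∫ x in (0 : ℝ)..1, f x * Real.cos (n * Real.pi * x) = 0) (j : ℕ) :
    ∀ n : ℕ, ∫ x in (0 : ℝ)..1, f x * Real.cos (n * Real.pi * x) * Real.cos (Real.pi * x) ^ j = 0 := by
  have hi : ∀ g : ℝ → ℝ, Continuous g → IntervalIntegrable (fun x => f x * g x) volume 0 1 := by
    intro g hg
    refine ContinuousOn.intervalIntegrable ?_
    rw [uIcc_of_le zero_le_one]; exact hf.mul hg.continuousOn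
  induction j with
  | zero => simpa using h
  | succ j ih =>
    have hstep : ∀ n : ℕ, ∫ x in (0 : ℝ)..1,
        f x * Real.cos ((n + 1 : ℕ) * Real.pi * x) * Real.cos (Real.pi * x) ^ (j + 1)
        = (1 / 2) * ((∫ x in (0 : ℝ)..1, f x * Real.cos ((n + 2 : ℕ) * Real.pi * x) * Real.cos (Real.pi * x) ^ j)
          + ∫ x in (0 : ℝ)..1, f x * Real.cos ((n : ℕ) * Real.pi * x) * Real.cos (Real.pi * x) ^ j) := by
      intro n
      simp only [mul_assoc (f _)]
      rw [← intervalIntegral.integral_add (hi _ (by fun_prop)) (hi _ (by fun_prop)),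
        ← intervalIntegral.integral_const_mul]
      congr 1; ext x
      have h1 : Real.cos ((n + 2 : ℕ) * Real.pi * x) = Real.cos ((n + 1 : ℕ) * Real.pi * x + Real.pi * x) := by
        congr 1; push_cast; ring
      have h2 : Real.cos ((n : ℕ) * Real.pi * x) = Real.cos ((n + 1 : ℕ) * Real.pi * x - Real.pi * x) := by
        congr 1; push_cast; ring
      rw [h1, h2, Real.cos_add, Real.cos_sub]; ring
    intro n
    cases n with
    | zero =>
      -- At frequency 0 one of the factors cos(πx) serves as the mode of frequency 1.
      refine Eq.trans ?_ (ih 1)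
      congr 1; ext x; simp [pow_succ]; ring
    | succ n => rw [hstep, ih, ih]; norm_num

/-- A function orthogonal to all cosines is orthogonal to all polynomials in cos(πx). Since x ↦
cos(πx) maps [0,1] homeomorphically onto [−1,1], Weierstrass approximates `f` uniformly by such
polynomials p, and ∫ f² = ∫ f(f − p) is arbitrarily small. -/
theorem cos_complete {f : ℝ → ℝ} (hf : ContinuousOn f (Icc (0 : ℝ) 1))
    (h : ∀ n : ℕ, ∫ x in (0 : ℝ)..1, f x * Real.cos (n * Real.pi * x) = 0) :
    ∀ x ∈ Icc (0 : ℝ) 1, f x = 0 := by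
  have hi : ∀ g : ℝ → ℝ, Continuous g → IntervalIntegrable (fun x => f x * g x) volume 0 1 := by
    intro g hg
    refine ContinuousOn.intervalIntegrable ?_
    rw [uIcc_of_le zero_le_one]; exact hf.mul hg.continuousOn
  have hpc : ∀ p : Polynomial ℝ, Continuous fun x => p.eval (Real.cos (Real.pi * x)) := fun p =>
    p.continuous.comp (g := fun y => p.eval y) (f := fun x => Real.cos (Real.pi * x)) (by fun_prop)
  have hpoly : ∀ p : Polynomial ℝ, ∫ x in (0 : ℝ)..1, f x * p.eval (Real.cos (Real.pi * x)) = 0 := by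
    intro p
    induction p using Polynomial.induction_on' with
    | add p q hp hq =>
      simp only [Polynomial.eval_add, mul_add]
      rw [intervalIntegral.integral_add (hi _ (hpc p)) (hi _ (hpc q)), hp, hq, add_zero]
    | monomial n c =>
      have := integral_mul_cos_pow hf h n 0
      simp only [Polynomial.eval_monomial]
      simp only [CharP.cast_eq_zero, zero_mul, Real.cos_zero, mul_one] at this
      refine Eq.trans ?_ ((congrArg (c * ·) this).trans (mul_zero c))
      rw [← intervalIntegral.integral_const_mul]
      congr 1; ext x; ring
  refine eq_zero_of_integral_sq_eq_zero hf ?_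
  have hmaps : ∀ y : ℝ, Real.arccos y / Real.pi ∈ Icc (0 : ℝ) 1 := fun y =>
    ⟨div_nonneg (Real.arccos_nonneg _) Real.pi_pos.le, (div_le_one Real.pi_pos).2 (Real.arccos_le_pi _)⟩
  have hg : ContinuousOn (fun y => f (Real.arccos y / Real.pi)) (Icc (-1) 1) :=
    hf.comp (by fun_prop) fun y _ => hmaps y
  obtain ⟨C, hC⟩ := isCompact_Icc.exists_bound_of_continuousOn hf
  have hC0 : 0 ≤ C := (norm_nonneg _).trans (hC 0 (by simp))
  refine le_of_forall_pos_le_add fun ε hε => ?_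
  -- With |f| ≤ C the accuracy ε/(C + 1) makes |f (f − p)| ≤ ε; the summand 1 covers C = 0.
  obtain ⟨p, hp⟩ := exists_polynomial_near_of_continuousOn (-1) 1 _ hg (ε / (C + 1)) (by positivity)
  have e1 : ∫ x in (0 : ℝ)..1, f x ^ 2
      = ∫ x in (0 : ℝ)..1, f x * (f x - p.eval (Real.cos (Real.pi * x))) := by
    have h1 : IntervalIntegrable (fun x => f x ^ 2) volume 0 1 := by
      refine ContinuousOn.intervalIntegrable ?_
      rw [uIcc_of_le zero_le_one]; exact hf.pow 2
    have h2 := intervalIntegral.integral_sub h1 (hi _ (hpc p))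
    rw [hpoly p, sub_zero] at h2
    rw [← h2]
    congr 1; ext x; ring
  rw [e1, zero_add]
  refine (le_abs_self _).trans ?_
  have := intervalIntegral.norm_integral_le_of_norm_le_const (a := 0) (b := 1) (C := ε)
    (f := fun x => f x * (f x - p.eval (Real.cos (Real.pi * x)))) fun x hx => by
      rw [uIoc_of_le zero_le_one] at hx
      have hx' := Ioc_subset_Icc_self hx
      have h1 := hp (Real.cos (Real.pi * x)) ⟨Real.neg_one_le_cos _, Real.cos_le_one _⟩
      rw [Real.arccos_cos (mul_nonneg Real.pi_pos.le hx'.1)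
        (mul_le_of_le_one_right Real.pi_pos.le hx'.2), mul_div_cancel_left₀ _ Real.pi_ne_zero,
        abs_sub_comm] at h1
      rw [norm_mul]
      calc ‖f x‖ * ‖f x - p.eval (Real.cos (Real.pi * x))‖ ≤ C * (ε / (C + 1)) :=
            mul_le_mul (hC x hx') h1.le (norm_nonneg _) hC0
        _ ≤ ε := by
            rw [mul_div_assoc', div_le_iff₀ (by positivity)]; nlinarith
  simpa using this

theorem cosModes_neumann : CosModes fun n : ℕ => n * Real.pi where
  le n := by
    have := Real.pi_gt_three
    have : (0 : ℝ) ≤ n := Nat.cast_nonneg n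
    nlinarith
  inj m n h := by
    have := mul_right_cancel₀ Real.pi_ne_zero h
    exact_mod_cast this
  bc := .inl Real.sin_nat_mul_pi
  complete _ hf h := cos_complete hf h

theorem cosModes_dirichlet : CosModes fun n : ℕ => (n + 1 / 2) * Real.pi where
  le n := by
    have := Real.pi_gt_three
    have : (0 : ℝ) ≤ n := Nat.cast_nonneg n
    nlinarith
  inj m n h := by
    have := mul_right_cancel₀ Real.pi_ne_zero h
    simpa using this
  bc := .inr fun n => by
    rw [add_mul, Real.cos_add, Real.sin_nat_mul_pi, show 1 / 2 * Real.pi = Real.pi / 2 by ring,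
      Real.cos_pi_div_two]
    ring
  complete f hf h := by
    have hcf : ContinuousOn (fun x => f x * Real.cos (Real.pi / 2 * x)) (Icc (0 : ℝ) 1) :=
      hf.mul (by fun_prop)
    have hi : ∀ g : ℝ → ℝ, Continuous g → IntervalIntegrable (fun x => f x * g x) volume 0 1 := by
      intro g hg
      refine ContinuousOn.intervalIntegrable ?_
      rw [uIcc_of_le zero_le_one]; exact hf.mul hg.continuousOn
    -- The half-integer frequencies are reduced to the integer ones: f cos(πx/2) is orthogonal to
    -- every cos(nπx), because the product cos(πx/2) cos((n+1)πx) splits into the frequencies n + ½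
    -- and n + 3/2. So it vanishes, and cos(πx/2) > 0 on [0,1); the end point 1 follows by
    -- continuity.
    have h0 := cos_complete hcf fun n => by
      cases n with
      | zero =>
        refine Eq.trans ?_ (h 0)
        congr 1; ext x
        simp only [CharP.cast_eq_zero, zero_mul, Real.cos_zero, zero_add, mul_one]
        congr 2; ring
      | succ n =>
        have e : ∀ x, f x * Real.cos (Real.pi / 2 * x) * Real.cos ((n + 1 : ℕ) * Real.pi * x)
            = (1 / 2) * (f x * Real.cos (((n + 1 : ℕ) + 1 / 2) * Real.pi * x)
              + f x * Real.cos ((n + 1 / 2) * Real.pi * x)) := by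
          intro x
          have h1 : Real.cos (((n + 1 : ℕ) + 1 / 2) * Real.pi * x)
              = Real.cos ((n + 1 : ℕ) * Real.pi * x + Real.pi / 2 * x) := by congr 1; ring
          have h2 : Real.cos ((n + 1 / 2) * Real.pi * x)
              = Real.cos ((n + 1 : ℕ) * Real.pi * x - Real.pi / 2 * x) := by
            congr 1; push_cast; ring
          rw [h1, h2, Real.cos_add, Real.cos_sub]; ring
        simp only [e]
        rw [intervalIntegral.integral_const_mul, intervalIntegral.integral_add
          (hi _ (by fun_prop)) (hi _ (by fun_prop)), h n]
        have := h (n + 1)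
        rw [this]; norm_num
    have h1 : ∀ x ∈ Ico (0 : ℝ) 1, f x = 0 := by
      intro x hx
      have := h0 x (Ico_subset_Icc_self hx)
      refine (mul_eq_zero.1 this).resolve_right (Real.cos_pos_of_mem_Ioo ⟨?_, ?_⟩).ne'
      · nlinarith [Real.pi_pos, hx.1]
      · nlinarith [Real.pi_pos, hx.2]
    have h2 : EqOn f (fun _ => 0) (Icc (0 : ℝ) 1) := by
      refine EqOn.of_subset_closure h1 hf continuousOn_const Ico_subset_Icc_self ?_
      rw [closure_Ico zero_ne_one]
    exact h2

namespace CosModes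

variable {ν : ℕ → ℝ}

theorem nonneg (h : CosModes ν) (n : ℕ) : 0 ≤ ν n := (Nat.cast_nonneg n).trans (h.le n)

/-- The boundary terms in the orthogonality relations are all of this form, so both kinds of
boundary condition are treated together. -/
theorem cos_mul_sin (h : CosModes ν) (m n : ℕ) : Real.cos (ν m) * Real.sin (ν n) = 0 := by
  rcases h.bc with h | h <;> simp [h]

theorem sq_sub_sq_ne_zero (h : CosModes ν) {m n : ℕ} (hmn : m ≠ n) : ν m ^ 2 - ν n ^ 2 ≠ 0 := by
  intro h0
  have := (sq_eq_sq₀ (h.nonneg m) (h.nonneg n)).1 (sub_eq_zero.1 h0)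
  exact hmn (h.inj this)

theorem hasDerivAt_sin_mul (c x : ℝ) :
    HasDerivAt (fun x => Real.sin (c * x)) (c * Real.cos (c * x)) x := by
  have := ((hasDerivAt_id x).const_mul c).sin
  simpa [mul_comm] using this

theorem hasDerivAt_cos_mul (c x : ℝ) :
    HasDerivAt (fun x => Real.cos (c * x)) (-(c * Real.sin (c * x))) x := by
  have := ((hasDerivAt_id x).const_mul c).cos
  simpa [mul_comm] using this

/-- (ν_m² − ν_n²) cos cos is the derivative of ν_m sin cos − ν_n cos sin, which vanishes at 0 and at
1. -/
theorem integral_cos_mul_cos (h : CosModes ν) {m n : ℕ} (hmn : m ≠ n) :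
    ∫ x in (0 : ℝ)..1, Real.cos (ν m * x) * Real.cos (ν n * x) = 0 := by
  have key : ∫ x in (0 : ℝ)..1, (ν m ^ 2 - ν n ^ 2) * (Real.cos (ν m * x) * Real.cos (ν n * x)) = _ :=
    intervalIntegral.integral_eq_sub_of_hasDerivAt
    (f := fun x => ν m * (Real.sin (ν m * x) * Real.cos (ν n * x))
      - ν n * (Real.cos (ν m * x) * Real.sin (ν n * x))) (fun x _ =>
      ((((hasDerivAt_sin_mul (ν m) x).fun_mul (hasDerivAt_cos_mul (ν n) x)).const_mul (ν m)).fun_sub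
      (((hasDerivAt_cos_mul (ν m) x).fun_mul (hasDerivAt_sin_mul (ν n) x)).const_mul (ν n))).congr_deriv
      (by ring)) (Continuous.intervalIntegrable (by fun_prop) _ _)
  rw [intervalIntegral.integral_const_mul] at key
  have h1 := h.cos_mul_sin m n
  have h2 := h.cos_mul_sin n m
  rw [mul_comm] at h2
  simp only [mul_one, mul_zero, Real.sin_zero, Real.cos_zero, h1, h2, sub_zero] at key
  exact (mul_eq_zero.1 key).resolve_left (h.sq_sub_sq_ne_zero hmn)

theorem integral_sin_mul_sin (h : CosModes ν) {m n : ℕ} (hmn : m ≠ n) :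
    ∫ x in (0 : ℝ)..1, Real.sin (ν m * x) * Real.sin (ν n * x) = 0 := by
  have key : ∫ x in (0 : ℝ)..1, (ν m ^ 2 - ν n ^ 2) * (Real.sin (ν m * x) * Real.sin (ν n * x)) = _ :=
    intervalIntegral.integral_eq_sub_of_hasDerivAt
    (f := fun x => ν n * (Real.sin (ν m * x) * Real.cos (ν n * x))
      - ν m * (Real.cos (ν m * x) * Real.sin (ν n * x))) (fun x _ =>
      ((((hasDerivAt_sin_mul (ν m) x).fun_mul (hasDerivAt_cos_mul (ν n) x)).const_mul (ν n)).fun_sub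
      (((hasDerivAt_cos_mul (ν m) x).fun_mul (hasDerivAt_sin_mul (ν n) x)).const_mul (ν m))).congr_deriv
      (by ring)) (Continuous.intervalIntegrable (by fun_prop) _ _)
  rw [intervalIntegral.integral_const_mul] at key
  have h1 := h.cos_mul_sin m n
  have h2 := h.cos_mul_sin n m
  rw [mul_comm] at h2
  simp only [mul_one, mul_zero, Real.sin_zero, Real.cos_zero, h1, h2, sub_zero] at key
  exact (mul_eq_zero.1 key).resolve_left (h.sq_sub_sq_ne_zero hmn)

theorem integral_sin_sq (h : CosModes ν) {n : ℕ} (hn : ν n ≠ 0) :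
    ∫ x in (0 : ℝ)..1, Real.sin (ν n * x) ^ 2 = 1 / 2 := by
  have key : ∫ x in (0 : ℝ)..1, (2 * ν n) * Real.sin (ν n * x) ^ 2 = _ :=
    intervalIntegral.integral_eq_sub_of_hasDerivAt
    (f := fun x => ν n * x - Real.sin (ν n * x) * Real.cos (ν n * x)) (fun x _ =>
      (((hasDerivAt_id' x).const_mul (ν n)).fun_sub ((hasDerivAt_sin_mul (ν n) x).fun_mul
      (hasDerivAt_cos_mul (ν n) x))).congr_deriv
      (by have := Real.sin_sq_add_cos_sq (ν n * x)
          linear_combination (-ν n) * this)) (Continuous.intervalIntegrable (by fun_prop) _ _)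
  rw [intervalIntegral.integral_const_mul] at key
  have h1 := h.cos_mul_sin n n
  rw [mul_comm] at h1
  simp only [mul_one, mul_zero, Real.sin_zero, h1, zero_mul, sub_zero] at key
  field_simp at key ⊢
  linarith

theorem integral_cos_sq (h : CosModes ν) {n : ℕ} (hn : ν n ≠ 0) :
    ∫ x in (0 : ℝ)..1, Real.cos (ν n * x) ^ 2 = 1 / 2 := by
  have h1 : ∀ x : ℝ, Real.cos (ν n * x) ^ 2 = 1 - Real.sin (ν n * x) ^ 2 := fun x => Real.cos_sq' _
  simp only [h1]
  rw [intervalIntegral.integral_sub (by simp) (Continuous.intervalIntegrable (by fun_prop) _ _),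
    h.integral_sin_sq hn]
  norm_num

theorem half_le_integral_cos_sq (h : CosModes ν) (n : ℕ) :
    1 / 2 ≤ ∫ x in (0 : ℝ)..1, Real.cos (ν n * x) ^ 2 := by
  by_cases hn : ν n = 0
  · simp [hn]; norm_num
  · rw [h.integral_cos_sq hn]

theorem integral_cos_sq_le (h : CosModes ν) (n : ℕ) :
    ∫ x in (0 : ℝ)..1, Real.cos (ν n * x) ^ 2 ≤ 1 := by
  by_cases hn : ν n = 0
  · simp [hn]
  · rw [h.integral_cos_sq hn]; norm_num

/-- If `P` is the primitive of `g`, integration by parts turns orthogonality of `g` to the sines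
into orthogonality of P − c to the cosines, for a suitable constant c: the mean of P if sin ν_n = 0,
which takes care of a zero frequency, and P(1) if cos ν_n = 0, which removes the boundary term. Then
P is constant and g = 0 almost everywhere. -/
theorem sin_complete (h : CosModes ν) {g : ℝ → ℝ}
    (hg : MemLp g 2 (volume.restrict (Ioo (0 : ℝ) 1)))
    (h0 : ∀ n, ∫ x in Ioo (0 : ℝ) 1, g x * Real.sin (ν n * x) = 0) :
    g =ᵐ[volume.restrict (Ioo (0 : ℝ) 1)] 0 := by
  have hi : IntegrableOn g (Ioo (0 : ℝ) 1) := hg.integrable one_le_two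
  have hg' : IntervalIntegrable g volume 0 1 := by
    rw [intervalIntegrable_iff_integrableOn_Ioo_of_le zero_le_one]; exact hi
  set P : ℝ → ℝ := fun x => ∫ s in (0 : ℝ)..x, g s with hP
  have hPc : ContinuousOn P (Icc (0 : ℝ) 1) := by
    have := intervalIntegral.continuousOn_primitive_interval' hg' left_mem_uIcc
    rwa [uIcc_of_le zero_le_one] at this
  have hPi : ∀ q : ℝ → ℝ, Continuous q → IntervalIntegrable (fun x => P x * q x) volume 0 1 := by
    intro q hq
    refine ContinuousOn.intervalIntegrable ?_
    rw [uIcc_of_le zero_le_one]; exact hPc.mul hq.continuousOn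
  have h1 : ∀ (c : ℝ) (n : ℕ), (P 1 - c) * Real.sin (ν n)
      = ν n * ∫ x in (0 : ℝ)..1, (P x - c) * Real.cos (ν n * x) := by
    intro c n
    have hq : ∀ s, 0 + ∫ r in (0 : ℝ)..s, ν n * Real.cos (ν n * r) = Real.sin (ν n * s) := by
      intro s
      rw [intervalIntegral.integral_eq_sub_of_hasDerivAt
        (fun x _ => hasDerivAt_sin_mul (ν n) x) (Continuous.intervalIntegrable (by fun_prop) _ _)]
      simp
    have key := primitive_mul_primitive (-c) 0 hg'
      (Continuous.intervalIntegrable (u := fun r => ν n * Real.cos (ν n * r)) (by fun_prop) 0 1)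
    simp only [hq] at key
    rw [intervalIntegral.integral_add] at key
    · have h2 : ∫ x in (0 : ℝ)..1, g x * Real.sin (ν n * x) = 0 := by
        rw [intervalIntegral.integral_of_le zero_le_one, integral_Ioc_eq_integral_Ioo, h0]
      rw [h2, mul_zero, sub_zero, zero_add, mul_one] at key
      rw [← intervalIntegral.integral_const_mul]
      simp only [← sub_eq_neg_add] at key
      rw [key]
      congr 1; ext x; ring
    · exact hg'.mul_continuousOn (by fun_prop)
    · have hc : Continuous fun s => ν n * Real.cos (ν n * s) := by fun_prop
      refine ((hPi _ hc).add (hc.const_mul (-c) |>.intervalIntegrable 0 1)).congr fun x _ => ?_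
      simp only [hP]; ring
  have hconst : ∃ c, ∀ x ∈ Icc (0 : ℝ) 1, P x - c = 0 := by
    rcases h.bc with hb | hb
    · refine ⟨∫ x in (0 : ℝ)..1, P x, h.complete _ (hPc.sub continuousOn_const) fun n => ?_⟩
      by_cases hn : ν n = 0
      · simp only [hn, zero_mul, Real.cos_zero, mul_one]
        rw [intervalIntegral.integral_sub (by simpa using hPi (fun _ => 1) continuous_const) (by simp)]
        simp
      · have := h1 (∫ x in (0 : ℝ)..1, P x) n
        rw [hb, mul_zero] at this
        exact (mul_eq_zero.1 this.symm).resolve_left hn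
    · refine ⟨P 1, h.complete _ (hPc.sub continuousOn_const) fun n => ?_⟩
      have hn : ν n ≠ 0 := fun h0 => by have := hb n; simp [h0] at this
      have := h1 (P 1) n
      rw [sub_self, zero_mul] at this
      exact (mul_eq_zero.1 this.symm).resolve_left hn
  obtain ⟨c, hc⟩ := hconst
  have hc0 : c = 0 := by
    have := hc 0 (by simp)
    simp only [hP, intervalIntegral.integral_same] at this
    linarith
  have e1 : HasH1Deriv (fun _ => (0 : ℝ)) g := hasH1Deriv_of_eq_primitive hg fun x hx => by
    have := hc x hx
    simp only [hP, hc0] at this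
    linarith
  have e2 : HasH1Deriv (fun _ => (0 : ℝ)) (0 : ℝ → ℝ) :=
    hasH1Deriv_of_eq_primitive MemLp.zero fun x hx => by simp
  exact ae_eq_of_hasWeakDeriv e1 e2

/-- Parseval's identity for the sine series. -/
theorem hasSum_sin (h : CosModes ν) {g : ℝ → ℝ}
    (hg : MemLp g 2 (volume.restrict (Ioo (0 : ℝ) 1))) :
    HasSum (fun n => 2 * (∫ x in Ioo (0 : ℝ) 1, g x * Real.sin (ν n * x)) ^ 2)
      (∫ x in Ioo (0 : ℝ) 1, g x ^ 2) := by
  set μ := volume.restrict (Ioo (0 : ℝ) 1) with hμ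
  have hs : ∀ n, MemLp (fun x => Real.sqrt 2 * Real.sin (ν n * x)) 2 μ := fun n => by
    refine MemLp.of_bound (by fun_prop) (Real.sqrt 2) (.of_forall fun x => ?_)
    rw [norm_mul, Real.norm_of_nonneg (Real.sqrt_nonneg _)]
    exact mul_le_of_le_one_right (Real.sqrt_nonneg _) (Real.abs_sin_le_one _)
  have hinner : ∀ (f : ℝ → ℝ) (hf : MemLp f 2 μ) (n : ℕ),
      inner ℝ (hf.toLp f) ((hs n).toLp _) = Real.sqrt 2 * ∫ x, f x * Real.sin (ν n * x) ∂μ := by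
    intro f hf n
    rw [L2.inner_def, ← integral_const_mul]
    refine integral_congr_ae ?_
    filter_upwards [hf.coeFn_toLp, (hs n).coeFn_toLp] with x h1 h2
    rw [h1, h2]
    simp; ring
  have hint : ∀ f : ℝ → ℝ, ∫ x, f x ∂μ = ∫ x in (0 : ℝ)..1, f x := fun f => by
    rw [intervalIntegral.integral_of_le zero_le_one, integral_Ioc_eq_integral_Ioo]
  have h22 : Real.sqrt 2 * Real.sqrt 2 = 2 := Real.mul_self_sqrt zero_le_two
  -- A zero frequency gives the zero sine function, which cannot belong to an orthonormal family;
  -- its term in the series is zero and is put back at the end.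
  set e : {n // ν n ≠ 0} → Lp ℝ 2 μ := fun n => (hs n).toLp _ with he
  have horth : Orthonormal ℝ e := by
    rw [orthonormal_iff_ite]
    rintro ⟨m, hm⟩ ⟨n, hn⟩
    simp only [he, hinner, hint, Subtype.mk.injEq, mul_assoc]
    rw [intervalIntegral.integral_const_mul, ← mul_assoc, h22]
    split_ifs with hmn
    · subst hmn
      have := h.integral_sin_sq hm
      simp only [← sq, this]; norm_num
    · rw [h.integral_sin_mul_sin hmn, mul_zero]
  have hsp : (Submodule.span ℝ (range e))ᗮ = ⊥ := by
    rw [Submodule.eq_bot_iff]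
    intro f hf
    have hf2 := Lp.memLp f
    rw [Lp.eq_zero_iff_ae_eq_zero]
    refine h.sin_complete hf2 fun n => ?_
    by_cases hn : ν n = 0
    · simp [hn]
    · have h1 := (Submodule.mem_orthogonal' _ _).1 hf _ (Submodule.subset_span ⟨⟨n, hn⟩, rfl⟩)
      have h2 := hinner f hf2 n
      rw [Lp.toLp_coeFn] at h2
      simp only [he] at h1
      rw [h1] at h2
      exact (mul_eq_zero.1 h2.symm).resolve_left (by positivity)
  set B := HilbertBasis.mkOfOrthogonalEqBot horth hsp
  have hsum := B.hasSum_inner_mul_inner (hg.toLp g) (hg.toLp g)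
  simp only [B, HilbertBasis.coe_mkOfOrthogonalEqBot] at hsum
  have e1 : inner ℝ (hg.toLp g) (hg.toLp g) = ∫ x, g x ^ 2 ∂μ := by
    rw [L2.inner_def]
    refine integral_congr_ae ?_
    filter_upwards [hg.coeFn_toLp] with x h1
    rw [h1]; simp [sq]
  rw [e1] at hsum
  have e2 : (fun i : {n // ν n ≠ 0} => inner ℝ (hg.toLp g) (e i) * inner ℝ (e i) (hg.toLp g))
      = (fun n => 2 * (∫ x, g x * Real.sin (ν n * x) ∂μ) ^ 2) ∘ ((↑) : {n // ν n ≠ 0} → ℕ) := by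
    ext ⟨n, hn⟩
    rw [real_inner_comm (hg.toLp g) (e ⟨n, hn⟩)]
    simp only [he, hinner, Function.comp_apply]
    linear_combination (∫ x, g x * Real.sin (ν n * x) ∂μ) ^ 2 * h22
  rw [e2] at hsum
  refine (hasSum_subtype_iff_of_support_subset (s := {n | ν n ≠ 0}) ?_).1 hsum
  intro n hn
  simp only [Function.mem_support] at hn
  intro h0
  apply hn
  have h0' : ν n = 0 := h0
  simp [h0']

end CosModes

/-! ### The target problem: cosine series for w_t = w_xx − λw -/

theorem setIntegral_Ioo_eq_intervalIntegral (f : ℝ → ℝ) :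
    ∫ x in Ioo (0 : ℝ) 1, f x = ∫ x in (0 : ℝ)..1, f x := by
  rw [intervalIntegral.integral_of_le zero_le_one, integral_Ioc_eq_integral_Ioo]

/-- `x ↦ cos (c x)` on `[0,1]`. -/
noncomputable def cosFun (c : ℝ) : UnitFun := ⟨fun x => Real.cos (c * x), by fun_prop⟩

/-- `x ↦ sin (c x)` on `[0,1]`. -/
noncomputable def sinFun (c : ℝ) : UnitFun := ⟨fun x => Real.sin (c * x), by fun_prop⟩

theorem norm_cosFun_le (c : ℝ) : ‖cosFun c‖ ≤ 1 :=
  (ContinuousMap.norm_le _ zero_le_one).2 fun _ => Real.abs_cos_le_one _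

theorem norm_sinFun_le (c : ℝ) : ‖sinFun c‖ ≤ 1 :=
  (ContinuousMap.norm_le _ zero_le_one).2 fun _ => Real.abs_sin_le_one _

theorem cosFun_ext (c : ℝ) {x : ℝ} (hx : x ∈ Icc (0 : ℝ) 1) : (cosFun c).ext x = Real.cos (c * x) :=
  UnitFun.ext_of_mem _ hx

theorem sinFun_ext (c : ℝ) {x : ℝ} (hx : x ∈ Icc (0 : ℝ) 1) : (sinFun c).ext x = Real.sin (c * x) :=
  UnitFun.ext_of_mem _ hx

/-- The functional `f ↦ ∫₀ˣ h f`. -/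
noncomputable def integralAgainst (h : UnitFun) (x : Icc (0 : ℝ) 1) : UnitFun →L[ℝ] ℝ :=
  (ContinuousMap.evalCLM ℝ x).comp (volterra ⟨fun p => h p.2, by fun_prop⟩)

theorem integralAgainst_apply (h f : UnitFun) (x : Icc (0 : ℝ) 1) :
    integralAgainst h x f = ∫ y in (0 : ℝ)..x, h.ext y * f.ext y := rfl

theorem abs_smul_le {a : ℝ} {Φ : UnitFun} (hΦ : ‖Φ‖ ≤ 1) : ‖a • Φ‖ ≤ |a| := by
  rw [norm_smul, Real.norm_eq_abs]
  exact mul_le_of_le_one_right (abs_nonneg _) hΦ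

theorem summable_smul {a : ℕ → ℝ} (ha : Summable fun n => |a n|) {Φ : ℕ → UnitFun}
    (hΦ : ∀ n, ‖Φ n‖ ≤ 1) : Summable fun n => a n • Φ n :=
  Summable.of_norm_bounded ha fun n => abs_smul_le (hΦ n)

theorem map_tsum_smul {a : ℕ → ℝ} (ha : Summable fun n => |a n|) {Φ : ℕ → UnitFun}
    (hΦ : ∀ n, ‖Φ n‖ ≤ 1) (T : UnitFun →L[ℝ] ℝ) :
    T (∑' n, a n • Φ n) = ∑' n, a n * T (Φ n) := by
  rw [T.map_tsum (summable_smul ha hΦ)]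
  simp

theorem summable_mul_functional {a : ℕ → ℝ} (ha : Summable fun n => |a n|) {Φ : ℕ → UnitFun}
    (hΦ : ∀ n, ‖Φ n‖ ≤ 1) (T : UnitFun →L[ℝ] ℝ) : Summable fun n => a n * T (Φ n) := by
  refine ((summable_smul ha hΦ).map T T.continuous).congr fun n => ?_
  simp

/-- The factor `e^{-(λ+ν²)t}`. -/
noncomputable def decay (lam v t : ℝ) : ℝ := Real.exp (-(lam + v ^ 2) * t)

theorem decay_pos (lam v t : ℝ) : 0 < decay lam v t := Real.exp_pos _

theorem decay_le {lam v t : ℝ} (ht : 0 ≤ t) : decay lam v t ≤ Real.exp (-lam * t) :=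
  Real.exp_le_exp.2 (by nlinarith [sq_nonneg v, mul_nonneg (sq_nonneg v) ht])

theorem decay_le_one {lam v t : ℝ} (hlam : 0 ≤ lam) (ht : 0 ≤ t) : decay lam v t ≤ 1 :=
  (decay_le ht).trans (Real.exp_le_one_iff.2 (by nlinarith))

theorem decay_zero (lam v : ℝ) : decay lam v 0 = 1 := by simp [decay]

/-- Parabolic smoothing: s ≤ eˢ for s = (λ + ν²)t. Away from t = 0 a factor ν² costs only 1/ε, so
the differentiated series converge without further assumptions on the coefficients. -/
theorem mul_decay_le {lam v t ε : ℝ} (hlam : 0 ≤ lam) (hε : 0 < ε) (ht : ε ≤ t) :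
    (lam + v ^ 2) * decay lam v t ≤ 1 / ε := by
  have h0 : 0 ≤ lam + v ^ 2 := by positivity
  have h1 : (lam + v ^ 2) * t ≤ Real.exp ((lam + v ^ 2) * t) :=
    (by linarith : (lam + v ^ 2) * t ≤ (lam + v ^ 2) * t + 1).trans (Real.add_one_le_exp _)
  have h2 : decay lam v t * Real.exp ((lam + v ^ 2) * t) = 1 := by
    rw [decay, ← Real.exp_add, neg_mul, neg_add_cancel, Real.exp_zero]
  rw [le_div_iff₀ hε]
  calc (lam + v ^ 2) * decay lam v t * ε ≤ (lam + v ^ 2) * decay lam v t * t := by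
        gcongr; exact mul_nonneg h0 (decay_pos _ _ _).le
    _ = decay lam v t * ((lam + v ^ 2) * t) := by ring
    _ ≤ decay lam v t * Real.exp ((lam + v ^ 2) * t) := by gcongr; exact (decay_pos _ _ _).le
    _ = 1 := h2

theorem sq_mul_decay_le {lam v t ε : ℝ} (hlam : 0 ≤ lam) (hε : 0 < ε) (ht : ε ≤ t) :
    v ^ 2 * decay lam v t ≤ 1 / ε :=
  (mul_le_mul_of_nonneg_right (by linarith) (decay_pos _ _ _).le).trans (mul_decay_le hlam hε ht)

theorem abs_mul_decay_le {lam v t ε : ℝ} (hlam : 0 ≤ lam) (hε : 0 < ε) (ht : ε ≤ t) :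
    |v| * decay lam v t ≤ 1 + 1 / ε := by
  have h1 : |v| ≤ 1 + v ^ 2 := by nlinarith [sq_abs v, sq_nonneg (|v| - 1), abs_nonneg v]
  calc |v| * decay lam v t ≤ (1 + v ^ 2) * decay lam v t := by gcongr; exact (decay_pos _ _ _).le
    _ = decay lam v t + v ^ 2 * decay lam v t := by ring
    _ ≤ 1 + 1 / ε := add_le_add (decay_le_one hlam (hε.le.trans ht)) (sq_mul_decay_le hlam hε ht)

theorem continuous_decay (lam v : ℝ) : Continuous (decay lam v) := by
  unfold decay; fun_prop

theorem hasDerivAt_decay (lam v t : ℝ) :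
    HasDerivAt (decay lam v) (-(lam + v ^ 2) * decay lam v t) t := by
  have := ((hasDerivAt_id' t).const_mul (-(lam + v ^ 2))).exp
  refine this.congr_deriv ?_
  rw [decay]; ring

/-- The cosine coefficients of `f`. -/
noncomputable def cosCoeff (ν : ℕ → ℝ) (f : ℝ → ℝ) (n : ℕ) : ℝ :=
  (∫ x in (0 : ℝ)..1, f x * Real.cos (ν n * x)) / ∫ x in (0 : ℝ)..1, Real.cos (ν n * x) ^ 2

/-- The solution of `w_t = w_xx - λ w` with cosine coefficients `c n` at time `0`. -/
noncomputable def heatSol (lam : ℝ) (ν c : ℕ → ℝ) (t : ℝ) : UnitFun :=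
  ∑' n, (c n * decay lam (ν n) t) • cosFun (ν n)

/-- The first space derivative of `heatSol`. -/
noncomputable def heatSolX (lam : ℝ) (ν c : ℕ → ℝ) (t : ℝ) : UnitFun :=
  ∑' n, (-(c n * ν n) * decay lam (ν n) t) • sinFun (ν n)

/-- The second space derivative of `heatSol`. -/
noncomputable def heatSolXX (lam : ℝ) (ν c : ℕ → ℝ) (t : ℝ) : UnitFun :=
  ∑' n, (-(c n * ν n ^ 2) * decay lam (ν n) t) • cosFun (ν n)

section Series

variable {lam : ℝ} {ν c : ℕ → ℝ}

theorem abs_heat_le (hlam : 0 ≤ lam) {t : ℝ} (ht : 0 ≤ t) (n : ℕ) :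
    |c n * decay lam (ν n) t| ≤ |c n| := by
  rw [abs_mul, abs_of_pos (decay_pos _ _ _)]
  exact mul_le_of_le_one_right (abs_nonneg _) (decay_le_one hlam ht)

theorem abs_heatX_le (hlam : 0 ≤ lam) {t ε : ℝ} (hε : 0 < ε) (ht : ε ≤ t) (n : ℕ) :
    |-(c n * ν n) * decay lam (ν n) t| ≤ |c n| * (1 + 1 / ε) := by
  rw [abs_mul, abs_neg, abs_mul, abs_of_pos (decay_pos _ _ _), mul_assoc]
  exact mul_le_mul_of_nonneg_left (abs_mul_decay_le hlam hε ht) (abs_nonneg _)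

theorem abs_heatXX_le (hlam : 0 ≤ lam) {t ε : ℝ} (hε : 0 < ε) (ht : ε ≤ t) (n : ℕ) :
    |-(c n * ν n ^ 2) * decay lam (ν n) t| ≤ |c n| * (1 / ε) := by
  rw [abs_mul, abs_neg, abs_mul, abs_of_pos (decay_pos _ _ _), mul_assoc, abs_of_nonneg (sq_nonneg (ν n))]
  exact mul_le_mul_of_nonneg_left (sq_mul_decay_le hlam hε ht) (abs_nonneg _)

variable (hc : Summable fun n => |c n|) (hlam : 0 ≤ lam)
include hc hlam

theorem summable_heat {t : ℝ} (ht : 0 ≤ t) : Summable fun n => |c n * decay lam (ν n) t| :=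
  Summable.of_nonneg_of_le (fun _ => abs_nonneg _) (abs_heat_le hlam ht) hc

theorem summable_heatX {t : ℝ} (ht : 0 < t) : Summable fun n => |-(c n * ν n) * decay lam (ν n) t| :=
  Summable.of_nonneg_of_le (fun _ => abs_nonneg _) (abs_heatX_le hlam ht le_rfl) (hc.mul_right _)

theorem summable_heatXX {t : ℝ} (ht : 0 < t) :
    Summable fun n => |-(c n * ν n ^ 2) * decay lam (ν n) t| :=
  Summable.of_nonneg_of_le (fun _ => abs_nonneg _) (abs_heatXX_le hlam ht le_rfl) (hc.mul_right _)

omit hlam in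
theorem norm_heatSol_le {t : ℝ} (ht : 0 ≤ t) :
    ‖heatSol lam ν c t‖ ≤ (∑' n, |c n|) * Real.exp (-lam * t) := by
  rw [← tsum_mul_right]
  refine tsum_of_norm_bounded (hc.mul_right _).hasSum fun n => (abs_smul_le (norm_cosFun_le _)).trans ?_
  rw [abs_mul, abs_of_pos (decay_pos _ _ _)]
  exact mul_le_mul_of_nonneg_left (decay_le ht) (abs_nonneg _)

/-- Absolute summability of the coefficients makes the series itself converge uniformly down to t =
0; the series of the derivatives are controlled only on [ε,∞) for ε > 0. -/
theorem continuousOn_heatSol : ContinuousOn (heatSol lam ν c) (Ici 0) :=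
  continuousOn_tsum (fun _ => ((continuous_const.mul (continuous_decay _ _)).smul
    continuous_const).continuousOn) hc
    fun n _ ht => (abs_smul_le (norm_cosFun_le _)).trans (abs_heat_le hlam ht n)

theorem continuousOn_heatSolX : ContinuousOn (heatSolX lam ν c) (Ioi 0) := by
  intro t ht
  have ht' : 0 < t := ht
  have : ContinuousOn (heatSolX lam ν c) (Ici (t / 2)) :=
    continuousOn_tsum (fun _ => ((continuous_const.mul (continuous_decay _ _)).smul
      continuous_const).continuousOn) (hc.mul_right (1 + 1 / (t / 2)))
      fun n _ hs => (abs_smul_le (norm_sinFun_le _)).trans (abs_heatX_le hlam (half_pos ht') hs n)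
  exact (this.continuousAt (Ici_mem_nhds (by linarith))).continuousWithinAt

theorem continuousOn_heatSolXX : ContinuousOn (heatSolXX lam ν c) (Ioi 0) := by
  intro t ht
  have ht' : 0 < t := ht
  have : ContinuousOn (heatSolXX lam ν c) (Ici (t / 2)) :=
    continuousOn_tsum (fun _ => ((continuous_const.mul (continuous_decay _ _)).smul
      continuous_const).continuousOn) (hc.mul_right (1 / (t / 2)))
      fun n _ hs => (abs_smul_le (norm_cosFun_le _)).trans (abs_heatXX_le hlam (half_pos ht') hs n)
  exact (this.continuousAt (Ici_mem_nhds (by linarith))).continuousWithinAt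

theorem hasDerivAt_heatSol {t : ℝ} (ht : 0 < t) :
    HasDerivAt (heatSol lam ν c) (heatSolXX lam ν c t - lam • heatSol lam ν c t) t := by
  have key := hasDerivAt_tsum_of_isPreconnected (𝕜 := ℝ) (hc.mul_right (1 / (t / 2))) isOpen_Ioi
    isPreconnected_Ioi
    (g := fun n s => (c n * decay lam (ν n) s) • cosFun (ν n))
    (g' := fun n s => (c n * (-(lam + ν n ^ 2) * decay lam (ν n) s)) • cosFun (ν n))
    (y₀ := t) (y := t) (t := Ioi (t / 2))
    (fun n s _ => ((hasDerivAt_decay lam (ν n) s).const_mul (c n)).smul_const (cosFun (ν n)))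
    (fun n s hs => by
      refine (abs_smul_le (norm_cosFun_le _)).trans ?_
      rw [abs_mul, abs_mul, abs_neg, abs_of_pos (decay_pos _ _ _),
        abs_of_nonneg (by positivity : 0 ≤ lam + ν n ^ 2)]
      exact mul_le_mul_of_nonneg_left (mul_decay_le hlam (half_pos ht) (le_of_lt hs)) (abs_nonneg _))
    (by simp [ht]) (summable_smul (summable_heat hc hlam ht.le) fun n => norm_cosFun_le _)
    (by simp [ht])
  refine key.congr_deriv ?_
  rw [heatSol, heatSolXX, ← (summable_smul (summable_heat hc hlam ht.le)
    fun n => norm_cosFun_le (ν n)).tsum_const_smul, ← (summable_smul (summable_heatXX hc hlam ht)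
    fun n => norm_cosFun_le (ν n)).tsum_sub (((summable_smul (summable_heat hc hlam ht.le)
    fun n => norm_cosFun_le (ν n))).const_smul lam)]
  congr 1; ext1 n
  rw [smul_smul, ← sub_smul]
  congr 1; ring

theorem heatSol_eq_primitive {t : ℝ} (ht : 0 < t) {x : ℝ} (hx : x ∈ Icc (0 : ℝ) 1) :
    (heatSol lam ν c t).ext x
      = (heatSol lam ν c t).ext 0 + ∫ y in (0 : ℝ)..x, (heatSolX lam ν c t).ext y := by
  have h1 : ∀ z (hz : z ∈ Icc (0 : ℝ) 1), (heatSol lam ν c t).ext z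
      = ∑' n, (c n * decay lam (ν n) t) * Real.cos (ν n * z) := fun z hz => by
    rw [UnitFun.ext_of_mem _ hz]
    exact map_tsum_smul (summable_heat hc hlam ht.le) (fun n => norm_cosFun_le (ν n))
      (ContinuousMap.evalCLM ℝ ⟨z, hz⟩)
  have hs : ∀ z (hz : z ∈ Icc (0 : ℝ) 1), Summable fun n =>
      (c n * decay lam (ν n) t) * Real.cos (ν n * z) := fun z hz =>
    summable_mul_functional (summable_heat hc hlam ht.le) (fun n => norm_cosFun_le (ν n))
      (ContinuousMap.evalCLM ℝ ⟨z, hz⟩)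
  have h2 := map_tsum_smul (summable_heatX (ν := ν) hc hlam ht) (fun n => norm_sinFun_le (ν n))
    (integralAgainst 1 ⟨x, hx⟩)
  have e1 : ∀ f : UnitFun, integralAgainst 1 ⟨x, hx⟩ f = ∫ y in (0 : ℝ)..x, f.ext y := fun f => by
    rw [integralAgainst_apply]
    congr 1; ext y
    rw [UnitFun.ext_apply, ContinuousMap.one_apply, one_mul]
  rw [e1] at h2
  rw [heatSolX, h2, h1 x hx, h1 0 (by simp), ← sub_eq_iff_eq_add',
    ← (hs x hx).tsum_sub (hs 0 (by simp))]
  congr 1; ext n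
  have e2 : ν n * ∫ y in (0 : ℝ)..x, (sinFun (ν n)).ext y = 1 - Real.cos (ν n * x) := by
    rw [← intervalIntegral.integral_const_mul, intervalIntegral.integral_congr
      (g := fun y => ν n * Real.sin (ν n * y)), intervalIntegral.integral_eq_sub_of_hasDerivAt
      (f := fun y => - Real.cos (ν n * y)) (fun y _ => by
        simpa using (CosModes.hasDerivAt_cos_mul (ν n) y).fun_neg)
        (Continuous.intervalIntegrable (by fun_prop) _ _)]
    · simp; ring
    · intro y hy
      rw [uIcc_of_le hx.1] at hy
      simp only
      rw [sinFun_ext _ ⟨hy.1, hy.2.trans hx.2⟩]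
  rw [e1]
  simp only [mul_zero, Real.cos_zero]
  linear_combination (c n * decay lam (ν n) t) * e2

theorem heatSolX_eq_primitive {t : ℝ} (ht : 0 < t) {x : ℝ} (hx : x ∈ Icc (0 : ℝ) 1) :
    (heatSolX lam ν c t).ext x = ∫ y in (0 : ℝ)..x, (heatSolXX lam ν c t).ext y := by
  have h1 : (heatSolX lam ν c t).ext x
      = ∑' n, (-(c n * ν n) * decay lam (ν n) t) * Real.sin (ν n * x) := by
    rw [UnitFun.ext_of_mem _ hx]
    exact map_tsum_smul (summable_heatX hc hlam ht) (fun n => norm_sinFun_le (ν n))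
      (ContinuousMap.evalCLM ℝ ⟨x, hx⟩)
  have h2 := map_tsum_smul (summable_heatXX (ν := ν) hc hlam ht) (fun n => norm_cosFun_le (ν n))
    (integralAgainst 1 ⟨x, hx⟩)
  have e1 : ∀ f : UnitFun, integralAgainst 1 ⟨x, hx⟩ f = ∫ y in (0 : ℝ)..x, f.ext y := fun f => by
    rw [integralAgainst_apply]
    congr 1; ext y
    rw [UnitFun.ext_apply, ContinuousMap.one_apply, one_mul]
  rw [e1] at h2
  rw [heatSolXX, h2, h1]
  congr 1; ext n
  have e2 : ν n * ∫ y in (0 : ℝ)..x, (cosFun (ν n)).ext y = Real.sin (ν n * x) := by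
    rw [← intervalIntegral.integral_const_mul, intervalIntegral.integral_congr
      (g := fun y => ν n * Real.cos (ν n * y)), intervalIntegral.integral_eq_sub_of_hasDerivAt
      (fun y _ => CosModes.hasDerivAt_sin_mul (ν n) y)
        (Continuous.intervalIntegrable (by fun_prop) _ _)]
    · simp
    · intro y hy
      rw [uIcc_of_le hx.1] at hy
      simp only
      rw [cosFun_ext _ ⟨hy.1, hy.2.trans hx.2⟩]
  rw [e1]
  linear_combination (c n * ν n * decay lam (ν n) t) * e2

theorem heatSol_one_of_cos_eq_zero (hν : ∀ n, Real.cos (ν n) = 0) {t : ℝ} (ht : 0 ≤ t) :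
    (heatSol lam ν c t).ext 1 = 0 := by
  rw [UnitFun.ext_of_mem _ (by simp)]
  have := map_tsum_smul (summable_heat (ν := ν) hc hlam ht) (fun n => norm_cosFun_le (ν n))
    (ContinuousMap.evalCLM ℝ ⟨1, by simp⟩)
  refine this.trans ?_
  simp [cosFun, hν]

theorem heatSolX_one_of_sin_eq_zero (hν : ∀ n, Real.sin (ν n) = 0) {t : ℝ} (ht : 0 < t) :
    (heatSolX lam ν c t).ext 1 = 0 := by
  rw [UnitFun.ext_of_mem _ (by simp)]
  have := map_tsum_smul (summable_heatX (ν := ν) hc hlam ht) (fun n => norm_sinFun_le (ν n))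
    (ContinuousMap.evalCLM ℝ ⟨1, by simp⟩)
  refine this.trans ?_
  simp [sinFun, hν]

theorem integral_heatSolX_mul_sin (h : CosModes ν) {t : ℝ} (ht : 0 < t) (m : ℕ) :
    ∫ x in Ioo (0 : ℝ) 1, (heatSolX lam ν c t).ext x * Real.sin (ν m * x)
      = -(c m * ν m) * decay lam (ν m) t / 2 := by
  have h1 := map_tsum_smul (summable_heatX (ν := ν) hc hlam ht) (fun n => norm_sinFun_le (ν n))
    (integralAgainst (sinFun (ν m)) ⟨1, by simp⟩)
  have e0 : ∀ n, integralAgainst (sinFun (ν m)) ⟨1, by simp⟩ (sinFun (ν n))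
      = ∫ x in (0 : ℝ)..1, Real.sin (ν m * x) * Real.sin (ν n * x) := fun n => by
    rw [integralAgainst_apply]
    refine intervalIntegral.integral_congr fun y hy => ?_
    rw [uIcc_of_le zero_le_one] at hy
    rw [sinFun_ext _ hy, sinFun_ext _ hy]
  rw [setIntegral_Ioo_eq_intervalIntegral]
  have e1 : integralAgainst (sinFun (ν m)) ⟨1, by simp⟩ (heatSolX lam ν c t)
      = ∫ x in (0 : ℝ)..1, (heatSolX lam ν c t).ext x * Real.sin (ν m * x) := by
    rw [integralAgainst_apply]
    refine intervalIntegral.integral_congr fun y hy => ?_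
    rw [uIcc_of_le zero_le_one] at hy
    rw [sinFun_ext _ hy, mul_comm]
  rw [← e1, heatSolX, h1, tsum_eq_single m]
  · rw [e0]
    by_cases hm : ν m = 0
    · simp [hm]
    · have := h.integral_sin_sq hm
      simp only [← sq, this]; ring
  · intro n hn
    rw [e0, h.integral_sin_mul_sin hn.symm, mul_zero]

/-- Parseval's identity by expanding one factor of the square at a time; for t > 0 the series
converges uniformly, so no Hilbert space argument is needed. -/
theorem integral_heatSolXX_sq (h : CosModes ν) {t : ℝ} (ht : 0 < t) :
    ∫ x in Ioo (0 : ℝ) 1, (heatSolXX lam ν c t).ext x ^ 2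
      = ∑' n, ((c n * ν n ^ 2) * decay lam (ν n) t) ^ 2
        * ∫ x in (0 : ℝ)..1, Real.cos (ν n * x) ^ 2 := by
  set b : ℕ → ℝ := fun n => -(c n * ν n ^ 2) * decay lam (ν n) t with hb
  have hbs : Summable fun n => |b n| := summable_heatXX hc hlam ht
  set V := heatSolXX lam ν c t with hV
  have hVb : V = ∑' n, b n • cosFun (ν n) := rfl
  have e0 : ∀ m n, integralAgainst (cosFun (ν m)) ⟨1, by simp⟩ (cosFun (ν n))
      = ∫ x in (0 : ℝ)..1, Real.cos (ν m * x) * Real.cos (ν n * x) := fun m n => by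
    rw [integralAgainst_apply]
    refine intervalIntegral.integral_congr fun y hy => ?_
    rw [uIcc_of_le zero_le_one] at hy
    rw [cosFun_ext _ hy, cosFun_ext _ hy]
  have e1 : ∀ m, integralAgainst V ⟨1, by simp⟩ (cosFun (ν m))
      = b m * ∫ x in (0 : ℝ)..1, Real.cos (ν m * x) ^ 2 := fun m => by
    have h1 := map_tsum_smul hbs (fun n => norm_cosFun_le (ν n))
      (integralAgainst (cosFun (ν m)) ⟨1, by simp⟩)
    have h2 : integralAgainst V ⟨1, by simp⟩ (cosFun (ν m))
        = integralAgainst (cosFun (ν m)) ⟨1, by simp⟩ V := by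
      simp only [integralAgainst_apply, mul_comm]
    rw [h2, hVb, h1, tsum_eq_single m]
    · rw [e0]; simp only [sq]
    · intro n hn
      rw [e0, h.integral_cos_mul_cos hn.symm, mul_zero]
  have h3 := map_tsum_smul hbs (fun n => norm_cosFun_le (ν n)) (integralAgainst V ⟨1, by simp⟩)
  rw [← hVb, integralAgainst_apply] at h3
  rw [setIntegral_Ioo_eq_intervalIntegral]
  simp only [sq (V.ext _)]
  rw [h3]
  congr 1; ext n
  rw [e1, hb]; ring

end Series

/-! ### Estimates of the target solution in H¹ and L²(H²) -/

theorem UnitFun.memLp_ext (f : UnitFun) : MemLp f.ext 2 (volume.restrict (Ioo (0 : ℝ) 1)) :=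
  MemLp.of_bound f.continuous_ext.aestronglyMeasurable ‖f‖ (.of_forall f.abs_ext_le)

/-- The space derivative of the target solution; at time `0` the given weak derivative. -/
noncomputable def heatGrad (lam : ℝ) (ν c : ℕ → ℝ) (g₀ : ℝ → ℝ) (t : ℝ) : ℝ → ℝ :=
  if t = 0 then g₀ else (heatSolX lam ν c t).ext

theorem heatGrad_zero (lam : ℝ) (ν c : ℕ → ℝ) (g₀ : ℝ → ℝ) : heatGrad lam ν c g₀ 0 = g₀ := if_pos rfl

theorem heatGrad_of_pos (lam : ℝ) (ν c : ℕ → ℝ) (g₀ : ℝ → ℝ) {t : ℝ} (ht : 0 < t) :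
    heatGrad lam ν c g₀ t = (heatSolX lam ν c t).ext := if_neg ht.ne'

/-- The constant in the bound of the sum of the cosine coefficients by the norm of `H¹`. -/
noncomputable def coeffConst : ℝ := 4 + Real.sqrt (2 * ∑' n : ℕ, 1 / ((n : ℝ) + 1) ^ 2)

theorem summable_one_div_succ_sq : Summable fun n : ℕ => 1 / ((n : ℝ) + 1) ^ 2 := by
  have := (summable_nat_add_iff 1).2 (Real.summable_one_div_nat_pow.2 one_lt_two)
  simpa using this

theorem integral_sq_le_h1Norm_sq {f g : ℝ → ℝ} (h : HasH1Deriv f g) :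
    ∫ x in Ioo (0 : ℝ) 1, g x ^ 2 ≤ h1Norm f ^ 2 := by
  have h1 : (0 : ℝ) ≤ ∫ x in Ioo (0 : ℝ) 1, f x ^ 2 := integral_nonneg fun _ => sq_nonneg _
  have h2 : (0 : ℝ) ≤ ∫ x in Ioo (0 : ℝ) 1, g x ^ 2 := integral_nonneg fun _ => sq_nonneg _
  rw [h.h1Norm_eq, Real.sq_sqrt (by linarith)]
  linarith

theorem h1Norm_nonneg (f : ℝ → ℝ) : 0 ≤ h1Norm f := Real.sqrt_nonneg _

namespace CosModes

variable {ν : ℕ → ℝ} {w₀ g₀ : ℝ → ℝ} {lam : ℝ}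

/-- Integration by parts. The boundary term at 1 is where the compatibility of the initial value
enters: for the Dirichlet modes w₀(1) = 0 is required, for the Neumann modes sin ν_n = 0 makes the
condition automatic. -/
theorem integral_deriv_mul_sin (h : CosModes ν) (H : HasH1Deriv w₀ g₀)
    (hbc : ∀ n, w₀ 1 * Real.sin (ν n) = 0) (m : ℕ) :
    ∫ x in Ioo (0 : ℝ) 1, g₀ x * Real.sin (ν m * x) = -(cosCoeff ν w₀ m * ν m) / 2 := by
  have hq : ∀ s, 0 + ∫ r in (0 : ℝ)..s, ν m * Real.cos (ν m * r) = Real.sin (ν m * s) := by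
    intro s
    rw [intervalIntegral.integral_eq_sub_of_hasDerivAt
      (fun x _ => hasDerivAt_sin_mul (ν m) x) (Continuous.intervalIntegrable (by fun_prop) _ _)]
    simp
  have key := primitive_mul_primitive (w₀ 0) 0 H.intervalIntegrable
    (Continuous.intervalIntegrable (u := fun r => ν m * Real.cos (ν m * r)) (by fun_prop) 0 1)
  simp only [hq] at key
  rw [← H.eq_primitive 1 (by simp), mul_one, hbc, mul_zero, sub_zero,
    intervalIntegral.integral_congr (g := fun x => g₀ x * Real.sin (ν m * x)
      + ν m * (w₀ x * Real.cos (ν m * x))) (fun x hx => by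
        rw [uIcc_of_le zero_le_one] at hx
        simp only
        rw [← H.eq_primitive x hx]; ring), intervalIntegral.integral_add,
    intervalIntegral.integral_const_mul] at key
  · rw [setIntegral_Ioo_eq_intervalIntegral]
    by_cases hm : ν m = 0
    · simp [hm]
    · rw [cosCoeff, h.integral_cos_sq hm]
      field_simp
      linarith
  · exact H.intervalIntegrable.mul_continuousOn (by fun_prop)
  · refine ContinuousOn.intervalIntegrable ?_
    rw [uIcc_of_le zero_le_one]
    exact continuousOn_const.fun_mul (H.1.fun_mul (by fun_prop))

theorem hasSum_deriv_sq (h : CosModes ν) (H : HasH1Deriv w₀ g₀)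
    (hbc : ∀ n, w₀ 1 * Real.sin (ν n) = 0) :
    HasSum (fun n => (cosCoeff ν w₀ n * ν n) ^ 2 / 2) (∫ x in Ioo (0 : ℝ) 1, g₀ x ^ 2) := by
  have := h.hasSum_sin H.2.1
  simp only [h.integral_deriv_mul_sin H hbc] at this
  refine this.congr_fun ?_
  intro n
  ring

theorem abs_cosCoeff_zero_le (h : CosModes ν) (H : HasH1Deriv w₀ g₀) (n : ℕ) :
    |cosCoeff ν w₀ n| ≤ 4 * h1Norm w₀ := by
  have h1 := h.half_le_integral_cos_sq n
  have h2 : |∫ x in (0 : ℝ)..1, w₀ x * Real.cos (ν n * x)| ≤ 2 * h1Norm w₀ := by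
    have := intervalIntegral.norm_integral_le_of_norm_le_const (a := 0) (b := 1)
      (C := 2 * h1Norm w₀) (f := fun x => w₀ x * Real.cos (ν n * x)) fun x hx => by
        rw [uIoc_of_le zero_le_one] at hx
        rw [norm_mul]
        exact (mul_le_of_le_one_right (norm_nonneg _) (Real.abs_cos_le_one _)).trans
          (H.abs_le_h1Norm (Ioc_subset_Icc_self hx))
    simpa using this
  rw [cosCoeff, abs_div, abs_of_pos (show (0:ℝ) < ∫ x in (0 : ℝ)..1, Real.cos (ν n * x) ^ 2 by linarith),
    div_le_iff₀ (by linarith)]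
  nlinarith [h1Norm_nonneg w₀]

/-- The mode n = 0, whose frequency may be zero, is bounded by 4 times the norm. For the others
Cauchy–Schwarz is applied to |c_n ν_n| and 1/ν_n ≤ 1/n, the former being square summable by
Parseval's identity for the derivative. These are the two summands of `coeffConst`. -/
theorem summable_cosCoeff_and_le (h : CosModes ν) (H : HasH1Deriv w₀ g₀)
    (hbc : ∀ n, w₀ 1 * Real.sin (ν n) = 0) :
    (Summable fun n => |cosCoeff ν w₀ n|) ∧ ∑' n, |cosCoeff ν w₀ n| ≤ coeffConst * h1Norm w₀ := by
  set c := cosCoeff ν w₀ with hc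
  set Z := ∑' n : ℕ, 1 / ((n : ℝ) + 1) ^ 2 with hZ
  have hZ0 : 0 ≤ Z := tsum_nonneg fun n => by positivity
  have hD := h.hasSum_deriv_sq H hbc
  have hpart : ∀ N, ∑ n ∈ Finset.range N, |c (n + 1)| ≤ Real.sqrt (2 * Z) * h1Norm w₀ := by
    intro N
    have h1 : ∑ n ∈ Finset.range N, |c (n + 1)|
        ≤ ∑ n ∈ Finset.range N, |c (n + 1) * ν (n + 1)| * (1 / ((n : ℝ) + 1)) := by
      refine Finset.sum_le_sum fun n _ => ?_
      have h2 : (n : ℝ) + 1 ≤ ν (n + 1) := by simpa using h.le (n + 1)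
      rw [abs_mul, abs_of_nonneg (h.nonneg _), mul_one_div, le_div_iff₀ (by positivity)]
      gcongr
    refine h1.trans (abs_le_of_sq_le_sq' ?_ (mul_nonneg (Real.sqrt_nonneg _) (h1Norm_nonneg _))).2
    refine (Finset.sum_mul_sq_le_sq_mul_sq _ _ _).trans ?_
    rw [mul_pow, Real.sq_sqrt (by positivity)]
    have h3 : ∑ n ∈ Finset.range N, |c (n + 1) * ν (n + 1)| ^ 2 ≤ 2 * h1Norm w₀ ^ 2 := by
      have h4 := (summable_nat_add_iff 1).2 hD.summable
      have h5 := h4.sum_le_tsum (Finset.range N) (fun n _ => by positivity)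
      have h6 := hD.summable.sum_add_tsum_nat_add 1
      rw [hD.tsum_eq] at h6
      have h7 := integral_sq_le_h1Norm_sq H
      have h8 : ∑ n ∈ Finset.range N, |c (n + 1) * ν (n + 1)| ^ 2
          = 2 * ∑ n ∈ Finset.range N, (c (n + 1) * ν (n + 1)) ^ 2 / 2 := by
        rw [Finset.mul_sum]
        refine Finset.sum_congr rfl fun n _ => ?_
        rw [sq_abs]; ring
      simp only [Finset.range_one, Finset.sum_singleton] at h6
      have h9 : 0 ≤ (c 0 * ν 0) ^ 2 / 2 := by positivity
      rw [h8]
      linarith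
    have h10 : ∑ n ∈ Finset.range N, (1 / ((n : ℝ) + 1)) ^ 2 ≤ Z := by
      simp only [div_pow, one_pow]
      exact summable_one_div_succ_sq.sum_le_tsum _ fun n _ => by positivity
    calc _ ≤ 2 * h1Norm w₀ ^ 2 * Z := mul_le_mul h3 h10 (by positivity) (by positivity)
      _ = 2 * Z * h1Norm w₀ ^ 2 := by ring
  have hs : Summable fun n => |c (n + 1)| := summable_of_sum_range_le (fun _ => abs_nonneg _) hpart
  have hs' : Summable fun n => |c n| := (summable_nat_add_iff 1).1 hs
  refine ⟨hs', ?_⟩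
  rw [← hs'.sum_add_tsum_nat_add 1, coeffConst, add_mul]
  refine add_le_add ?_ (Real.tsum_le_of_sum_range_le (fun _ => abs_nonneg _) hpart)
  simpa using h.abs_cosCoeff_zero_le H 0

/-- By uniform convergence the series at time 0 has the cosine coefficients of `w₀`; completeness
identifies the two continuous functions. -/
theorem heatSol_zero (h : CosModes ν) (H : HasH1Deriv w₀ g₀)
    (hbc : ∀ n, w₀ 1 * Real.sin (ν n) = 0) (hlam : 0 ≤ lam) {x : ℝ} (hx : x ∈ Icc (0 : ℝ) 1) :
    (heatSol lam ν (cosCoeff ν w₀) 0).ext x = w₀ x := by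
  have hc := (h.summable_cosCoeff_and_le H hbc).1
  have hs := summable_heat (ν := ν) hc hlam (le_refl 0)
  set V := heatSol lam ν (cosCoeff ν w₀) 0 with hV
  refine sub_eq_zero.1 (h.complete (fun x => V.ext x - w₀ x)
    (V.continuous_ext.continuousOn.sub H.1) (fun m => ?_) x hx)
  have h1 := map_tsum_smul hs (fun n => norm_cosFun_le (ν n))
    (integralAgainst (cosFun (ν m)) ⟨1, by simp⟩)
  have e0 : ∀ n, integralAgainst (cosFun (ν m)) ⟨1, by simp⟩ (cosFun (ν n))
      = ∫ x in (0 : ℝ)..1, Real.cos (ν m * x) * Real.cos (ν n * x) := fun n => by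
    rw [integralAgainst_apply]
    refine intervalIntegral.integral_congr fun y hy => ?_
    rw [uIcc_of_le zero_le_one] at hy
    rw [cosFun_ext _ hy, cosFun_ext _ hy]
  have e1 : integralAgainst (cosFun (ν m)) ⟨1, by simp⟩ V
      = ∫ x in (0 : ℝ)..1, V.ext x * Real.cos (ν m * x) := by
    rw [integralAgainst_apply]
    refine intervalIntegral.integral_congr fun y hy => ?_
    rw [uIcc_of_le zero_le_one] at hy
    rw [cosFun_ext _ hy, mul_comm]
  have e2 : ∫ x in (0 : ℝ)..1, V.ext x * Real.cos (ν m * x)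
      = ∫ x in (0 : ℝ)..1, w₀ x * Real.cos (ν m * x) := by
    rw [← e1, hV, heatSol, h1, tsum_eq_single m]
    · rw [e0, decay_zero, mul_one, cosCoeff]
      simp only [← sq]
      have := h.half_le_integral_cos_sq m
      rw [div_mul_cancel₀ _ (by linarith)]
    · intro n hn
      rw [e0, h.integral_cos_mul_cos hn.symm, mul_zero]
  simp only [sub_mul]
  rw [intervalIntegral.integral_sub, e2, sub_self]
  · exact (V.continuous_ext.fun_mul (by fun_prop)).intervalIntegrable _ _
  · refine ContinuousOn.intervalIntegrable ?_
    rw [uIcc_of_le zero_le_one]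
    exact H.1.fun_mul (by fun_prop)

theorem memLp_heatGrad (H : HasH1Deriv w₀ g₀) (c : ℕ → ℝ) (t : ℝ) :
    MemLp (heatGrad lam ν c g₀ t) 2 (volume.restrict (Ioo (0 : ℝ) 1)) := by
  rw [heatGrad]
  split_ifs
  · exact H.2.1
  · exact UnitFun.memLp_ext _

theorem integral_heatGrad_mul_sin (h : CosModes ν) (H : HasH1Deriv w₀ g₀)
    (hbc : ∀ n, w₀ 1 * Real.sin (ν n) = 0) (hlam : 0 ≤ lam) {t : ℝ} (ht : 0 ≤ t) (m : ℕ) :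
    ∫ x in Ioo (0 : ℝ) 1, heatGrad lam ν (cosCoeff ν w₀) g₀ t x * Real.sin (ν m * x)
      = -(cosCoeff ν w₀ m * ν m) * decay lam (ν m) t / 2 := by
  rcases ht.eq_or_lt with rfl | ht
  · rw [heatGrad_zero, decay_zero, mul_one, h.integral_deriv_mul_sin H hbc]
  · rw [heatGrad_of_pos _ _ _ _ ht,
      integral_heatSolX_mul_sin (h.summable_cosCoeff_and_le H hbc).1 hlam h ht]

theorem hasSum_heatGrad_sub_sq (h : CosModes ν) (H : HasH1Deriv w₀ g₀)
    (hbc : ∀ n, w₀ 1 * Real.sin (ν n) = 0) (hlam : 0 ≤ lam) {t s : ℝ} (ht : 0 ≤ t) (hs : 0 ≤ s) :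
    HasSum (fun n => (cosCoeff ν w₀ n * ν n) ^ 2 / 2 * (decay lam (ν n) t - decay lam (ν n) s) ^ 2)
      (∫ x in Ioo (0 : ℝ) 1, (heatGrad lam ν (cosCoeff ν w₀) g₀ t x
        - heatGrad lam ν (cosCoeff ν w₀) g₀ s x) ^ 2) := by
  have m1 := memLp_heatGrad (lam := lam) (ν := ν) H (cosCoeff ν w₀) t
  have m2 := memLp_heatGrad (lam := lam) (ν := ν) H (cosCoeff ν w₀) s
  have key := h.hasSum_sin (m1.sub m2)
  simp only [Pi.sub_apply] at key
  refine key.congr_fun fun n => ?_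
  have hb : ∀ q : ℝ → ℝ, MemLp q 2 (volume.restrict (Ioo (0 : ℝ) 1)) →
      IntegrableOn (fun x => q x * Real.sin (ν n * x)) (Ioo (0 : ℝ) 1) := fun q hq =>
    (hq.integrable one_le_two).mul_bdd (c := 1) (by fun_prop)
      (.of_forall fun x => Real.abs_sin_le_one _)
  simp only [sub_mul]
  rw [integral_sub (hb _ m1) (hb _ m2), h.integral_heatGrad_mul_sin H hbc hlam ht,
    h.integral_heatGrad_mul_sin H hbc hlam hs]
  ring

theorem hasSum_heatGrad_sq (h : CosModes ν) (H : HasH1Deriv w₀ g₀)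
    (hbc : ∀ n, w₀ 1 * Real.sin (ν n) = 0) (hlam : 0 ≤ lam) {t : ℝ} (ht : 0 ≤ t) :
    HasSum (fun n => (cosCoeff ν w₀ n * ν n) ^ 2 / 2 * decay lam (ν n) t ^ 2)
      (∫ x in Ioo (0 : ℝ) 1, heatGrad lam ν (cosCoeff ν w₀) g₀ t x ^ 2) := by
  refine (h.hasSum_sin (memLp_heatGrad H (cosCoeff ν w₀) t)).congr_fun fun n => ?_
  rw [h.integral_heatGrad_mul_sin H hbc hlam ht]
  ring

theorem integral_heatGrad_sq_le (h : CosModes ν) (H : HasH1Deriv w₀ g₀)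
    (hbc : ∀ n, w₀ 1 * Real.sin (ν n) = 0) (hlam : 0 ≤ lam) {t : ℝ} (ht : 0 ≤ t) :
    ∫ x in Ioo (0 : ℝ) 1, heatGrad lam ν (cosCoeff ν w₀) g₀ t x ^ 2
      ≤ (h1Norm w₀ * Real.exp (-lam * t)) ^ 2 := by
  rw [mul_pow]
  refine le_trans ?_ (mul_le_mul_of_nonneg_right (integral_sq_le_h1Norm_sq H) (sq_nonneg _))
  refine hasSum_le (fun n => ?_) (h.hasSum_heatGrad_sq H hbc hlam ht)
    ((h.hasSum_deriv_sq H hbc).mul_right _)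
  have := decay_le (lam := lam) (v := ν n) ht
  have := (decay_pos lam (ν n) t).le
  gcongr

/-- Parseval's identity turns continuity in L² of the gradient into dominated convergence of a
numerical series, with dominating series Σ (c_n ν_n)²/2. This includes the time 0, where the
gradient is only in L². -/
theorem tendsto_heatGrad (h : CosModes ν) (H : HasH1Deriv w₀ g₀)
    (hbc : ∀ n, w₀ 1 * Real.sin (ν n) = 0) (hlam : 0 ≤ lam) {s : ℝ} (hs : 0 ≤ s) :
    Tendsto (fun t => ∫ x in Ioo (0 : ℝ) 1, (heatGrad lam ν (cosCoeff ν w₀) g₀ t x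
        - heatGrad lam ν (cosCoeff ν w₀) g₀ s x) ^ 2) (𝓝[Ici 0] s) (𝓝 0) := by
  have h1 : Tendsto (fun t => ∑' n, (cosCoeff ν w₀ n * ν n) ^ 2 / 2
      * (decay lam (ν n) t - decay lam (ν n) s) ^ 2) (𝓝[Ici 0] s) (𝓝 (∑' _ : ℕ, (0 : ℝ))) := by
    refine tendsto_tsum_of_dominated_convergence (h.hasSum_deriv_sq H hbc).summable (fun n => ?_) ?_
    · have h2 : Continuous fun t => (cosCoeff ν w₀ n * ν n) ^ 2 / 2
          * (decay lam (ν n) t - decay lam (ν n) s) ^ 2 :=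
        continuous_const.mul (((continuous_decay _ _).sub continuous_const).pow 2)
      have h3 := (h2.tendsto s).mono_left (nhdsWithin_le_nhds (s := Ici 0))
      simpa using h3
    · filter_upwards [self_mem_nhdsWithin] with t ht n
      have a1 := decay_le_one (v := ν n) hlam ht
      have a2 := decay_le_one (v := ν n) hlam hs
      have a3 := decay_pos lam (ν n) t
      have a4 := decay_pos lam (ν n) s
      rw [norm_mul, Real.norm_of_nonneg (by positivity), Real.norm_of_nonneg (sq_nonneg _)]
      refine mul_le_of_le_one_right (by positivity) ?_
      rw [sq_le_one_iff_abs_le_one, abs_le]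
      constructor <;> linarith
  rw [tsum_zero] at h1
  refine h1.congr' ?_
  filter_upwards [self_mem_nhdsWithin] with t ht
  exact (h.hasSum_heatGrad_sub_sq H hbc hlam ht hs).tsum_eq

theorem heatSol_eq_primitive_heatGrad (h : CosModes ν) (H : HasH1Deriv w₀ g₀)
    (hbc : ∀ n, w₀ 1 * Real.sin (ν n) = 0) (hlam : 0 ≤ lam) {t : ℝ} (ht : 0 ≤ t) {x : ℝ}
    (hx : x ∈ Icc (0 : ℝ) 1) :
    (heatSol lam ν (cosCoeff ν w₀) t).ext x = (heatSol lam ν (cosCoeff ν w₀) t).ext 0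
      + ∫ y in (0 : ℝ)..x, heatGrad lam ν (cosCoeff ν w₀) g₀ t y := by
  rcases ht.eq_or_lt with rfl | ht
  · rw [heatGrad_zero, h.heatSol_zero H hbc hlam hx, h.heatSol_zero H hbc hlam (by simp),
      ← H.eq_primitive x hx]
  · rw [heatGrad_of_pos _ _ _ _ ht,
      ← heatSol_eq_primitive (h.summable_cosCoeff_and_le H hbc).1 hlam ht hx]

/-- The energy estimate. The function ∫ w_xx² of time is the derivative of the sum of the `G n`,
with `G n` = −(c_n ν_n)²/2 · ν_n²/(λ + ν_n²) · ∫ cos² · e^{−2(λ+ν_n²)t}. That sum converges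
uniformly on [0,τ], hence is continuous up to t = 0, and a nonnegative derivative of such a function
is integrable. Positivity of λ keeps the denominators positive at zero frequency. -/
theorem integrableOn_heatSolXX_sq (h : CosModes ν) (H : HasH1Deriv w₀ g₀)
    (hbc : ∀ n, w₀ 1 * Real.sin (ν n) = 0) (hlam : 0 < lam) {τ : ℝ} :
    IntegrableOn (fun t => ∫ x in Ioo (0 : ℝ) 1, (heatSolXX lam ν (cosCoeff ν w₀) t).ext x ^ 2)
      (Ioo 0 τ) := by
  set c := cosCoeff ν w₀ with hc
  have hcs := (h.summable_cosCoeff_and_le H hbc).1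
  have hD := (h.hasSum_deriv_sq H hbc).summable
  set N : ℕ → ℝ := fun n => ∫ x in (0 : ℝ)..1, Real.cos (ν n * x) ^ 2 with hN
  have hN0 : ∀ n, 0 ≤ N n := fun n => by linarith [h.half_le_integral_cos_sq n]
  have hN1 : ∀ n, N n ≤ 1 := h.integral_cos_sq_le
  have hp : ∀ n, 0 < lam + ν n ^ 2 := fun n => by positivity
  set G : ℕ → ℝ → ℝ := fun n t => -((c n * ν n) ^ 2 / 2 * (ν n ^ 2 / (lam + ν n ^ 2) * N n))
    * decay lam (ν n) t ^ 2 with hG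
  set G' : ℕ → ℝ → ℝ := fun n t => (c n * ν n ^ 2 * decay lam (ν n) t) ^ 2 * N n with hG'
  have hcoef : ∀ n, 0 ≤ ν n ^ 2 / (lam + ν n ^ 2) * N n ∧ ν n ^ 2 / (lam + ν n ^ 2) * N n ≤ 1 := by
    intro n
    have h1 : ν n ^ 2 / (lam + ν n ^ 2) ≤ 1 := (div_le_one (hp n)).2 (by linarith)
    have h0 : 0 ≤ ν n ^ 2 / (lam + ν n ^ 2) := div_nonneg (sq_nonneg _) (hp n).le
    exact ⟨mul_nonneg h0 (hN0 n), mul_le_one₀ h1 (hN0 n) (hN1 n)⟩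
  have hGb : ∀ n, ∀ t, 0 ≤ t → ‖G n t‖ ≤ (c n * ν n) ^ 2 / 2 := by
    intro n t ht
    have h1 := decay_le_one (v := ν n) hlam.le ht
    have h2 := decay_pos lam (ν n) t
    simp only [hG]
    rw [norm_mul, norm_neg, norm_mul, Real.norm_of_nonneg (by positivity),
      Real.norm_of_nonneg (hcoef n).1, Real.norm_of_nonneg (sq_nonneg _), mul_assoc]
    refine mul_le_of_le_one_right (by positivity) ?_
    exact mul_le_one₀ (hcoef n).2 (sq_nonneg _) (pow_le_one₀ h2.le h1)
  have hGc : ContinuousOn (fun t => ∑' n, G n t) (Icc 0 τ) :=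
    continuousOn_tsum (fun n => (continuous_const.mul ((continuous_decay _ _).pow 2)).continuousOn) hD
      fun n t ht => hGb n t ht.1
  have hGd : ∀ t ∈ Ioo 0 τ, HasDerivAt (fun t => ∑' n, G n t) (∑' n, G' n t) t := by
    intro t ht
    refine hasDerivAt_tsum_of_isPreconnected (𝕜 := ℝ) (hD.mul_right (2 * (1 / (t / 2)))) isOpen_Ioi
      isPreconnected_Ioi (t := Ioi (t / 2)) (y₀ := t) (fun n s _ => ?_) (fun n s hs => ?_)
      (by simp [ht.1]) (Summable.of_norm_bounded hD fun n => hGb n t ht.1.le) (by simp [ht.1])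
    · have h1 := ((hasDerivAt_decay lam (ν n) s).fun_pow 2).const_mul
        (-((c n * ν n) ^ 2 / 2 * (ν n ^ 2 / (lam + ν n ^ 2) * N n)))
      refine h1.congr_deriv ?_
      have := (hp n).ne'
      simp only [hG']
      field_simp
      ring
    · have h1 := sq_mul_decay_le (v := ν n) hlam.le (half_pos ht.1) (le_of_lt hs)
      have h2 := decay_le_one (v := ν n) hlam.le ((half_pos ht.1).le.trans (le_of_lt hs))
      have h3 := (decay_pos lam (ν n) s).le
      simp only [hG']
      rw [Real.norm_of_nonneg (mul_nonneg (sq_nonneg _) (hN0 n))]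
      have h4 : (c n * ν n ^ 2 * decay lam (ν n) s) ^ 2 * N n
          = (c n * ν n) ^ 2 / 2 * (2 * ((ν n ^ 2 * decay lam (ν n) s) * (decay lam (ν n) s * N n))) := by
        ring
      rw [h4]
      refine mul_le_mul_of_nonneg_left (mul_le_mul_of_nonneg_left ?_ zero_le_two) (by positivity)
      refine (mul_le_mul h1 (mul_le_one₀ h2 (hN0 n) (hN1 n)) (mul_nonneg h3 (hN0 n)) ?_).trans
        (mul_one _).le
      have := ht.1
      positivity
  have key := intervalIntegral.integrableOn_deriv_of_nonneg hGc hGd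
    (fun t _ => tsum_nonneg fun n => mul_nonneg (sq_nonneg _) (hN0 n))
  refine (key.mono_set Ioo_subset_Ioc_self).congr_fun (fun t ht => ?_) measurableSet_Ioo
  exact (integral_heatSolXX_sq hcs hlam.le h ht.1).symm

end CosModes

/-! ### The transformation 1 + K on H¹ and H² -/

/-- The values of a kernel on the diagonal. -/
noncomputable def KernelFun.diag (κ : KernelFun) : UnitFun := ⟨fun x => κ (x, x), by fun_prop⟩

theorem KernelFun.diag_ext (κ : KernelFun) (x : ℝ) : κ.diag.ext x = κ.ext x x := rfl

theorem KernelFun.continuous_diag : Continuous KernelFun.diag :=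
  ContinuousMap.continuous_precomp (⟨fun x => (x, x), by fun_prop⟩ :
    C(Icc (0 : ℝ) 1, Icc (0 : ℝ) 1 × Icc (0 : ℝ) 1))

/-- The derivative of `x ↦ ∫₀ˣ k(x,y) f(y) dy`, where `κx` stands for `k_x`. -/
noncomputable def kernelGrad (κ κx : KernelFun) (f : UnitFun) : UnitFun := κ.diag * f + volterra κx f

theorem kernelGrad_ext (κ κx : KernelFun) (f : UnitFun) {x : ℝ} (hx : x ∈ Icc (0 : ℝ) 1) :
    (kernelGrad κ κx f).ext x = κ.ext x x * f.ext x + ∫ y in (0 : ℝ)..x, κx.ext x y * f.ext y := by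
  rw [← volterra_ext κx f hx]; rfl

theorem KernelFun.norm_diag_le (κ : KernelFun) : ‖κ.diag‖ ≤ ‖κ‖ :=
  (ContinuousMap.norm_le _ (norm_nonneg _)).2 fun x => κ.norm_coe_le_norm (x, x)

theorem norm_volterra_apply_le (κ : KernelFun) (f : UnitFun) : ‖volterra κ f‖ ≤ ‖κ‖ * ‖f‖ := by
  refine (ContinuousLinearMap.le_opNorm _ _).trans (mul_le_mul_of_nonneg_right ?_ (norm_nonneg _))
  simpa using norm_volterra_pow_le κ 1

theorem norm_kernelGrad_le (κ κx : KernelFun) (f : UnitFun) :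
    ‖kernelGrad κ κx f‖ ≤ (‖κ‖ + ‖κx‖) * ‖f‖ := by
  rw [add_mul]
  refine (norm_add_le _ _).trans (add_le_add ((norm_mul_le _ _).trans ?_) (norm_volterra_apply_le _ _))
  exact mul_le_mul_of_nonneg_right κ.norm_diag_le (norm_nonneg _)

theorem ContinuousOn.volterra {K : ℝ → KernelFun} {f : ℝ → UnitFun} {s : Set ℝ}
    (hK : ContinuousOn K s) (hf : ContinuousOn f s) :
    ContinuousOn (fun t => _root_.volterra (K t) (f t)) s :=
  (_root_.volterra.continuous.comp_continuousOn hK).clm_apply hf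

theorem ContinuousOn.volterraInv {K : ℝ → KernelFun} {f : ℝ → UnitFun} {s : Set ℝ}
    (hK : ContinuousOn K s) (hf : ContinuousOn f s) :
    ContinuousOn (fun t => _root_.volterraInv (K t) (f t)) s :=
  (continuous_volterraInv.comp_continuousOn hK).clm_apply hf

theorem ContinuousOn.kernelGrad {K Kx : ℝ → KernelFun} {f : ℝ → UnitFun} {s : Set ℝ}
    (hK : ContinuousOn K s) (hKx : ContinuousOn Kx s) (hf : ContinuousOn f s) :
    ContinuousOn (fun t => _root_.kernelGrad (K t) (Kx t) (f t)) s :=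
  ((KernelFun.continuous_diag.comp_continuousOn hK).mul hf).add (hKx.volterra hf)

/-- A bound of a continuous curve on a compact interval. -/
theorem exists_norm_le_on_Icc {E : Type*} [SeminormedAddCommGroup E] {F : ℝ → E} {τ : ℝ}
    (hF : ContinuousOn F (Icc 0 τ)) : ∃ C, 0 ≤ C ∧ ∀ t ∈ Icc 0 τ, ‖F t‖ ≤ C := by
  obtain ⟨C, hC⟩ := isCompact_Icc.exists_bound_of_continuousOn hF
  exact ⟨max C 0, le_max_right _ _, fun t ht => (hC t ht).trans (le_max_left _ _)⟩

theorem UnitFun.integral_ext_sq_le (f : UnitFun) : ∫ x in Ioo (0 : ℝ) 1, f.ext x ^ 2 ≤ ‖f‖ ^ 2 := by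
  rw [setIntegral_Ioo_eq_intervalIntegral]
  calc ∫ x in (0 : ℝ)..1, f.ext x ^ 2 ≤ ∫ _ in (0 : ℝ)..1, ‖f‖ ^ 2 := by
        refine intervalIntegral.integral_mono_on zero_le_one
          ((f.continuous_ext.pow 2).intervalIntegrable _ _) (by simp) fun x _ => ?_
        rw [← sq_abs]
        exact pow_le_pow_left₀ (abs_nonneg _) (f.abs_ext_le x) 2
    _ = _ := by simp

theorem volterra_ext_eq_integral_kernelGrad {κ κx κy : KernelFun} {Q : ℝ → ℝ → ℝ} {b : ℝ → ℝ}
    (S : SpaceKernel κ.ext κx.ext κy.ext Q b) (f : UnitFun) {x : ℝ} (hx : x ∈ Icc (0 : ℝ) 1) :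
    (volterra κ f).ext x = ∫ y in (0 : ℝ)..x, (kernelGrad κ κx f).ext y := by
  rw [volterra_ext κ f hx, S.integral_kernel_mul f.continuous_ext hx.1 hx.2]
  refine intervalIntegral.integral_congr fun s hs => ?_
  rw [uIcc_of_le hx.1] at hs
  exact (kernelGrad_ext _ _ _ ⟨hs.1, hs.2.trans hx.2⟩).symm

/-- `f + K f` inherits `H¹` from `f`. -/
theorem HasH1Deriv.add_volterra {κ κx κy : KernelFun} {Q : ℝ → ℝ → ℝ} {b : ℝ → ℝ}
    (S : SpaceKernel κ.ext κx.ext κy.ext Q b) {f : UnitFun} {p : ℝ → ℝ} (hf : HasH1Deriv f.ext p) :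
    HasH1Deriv (f + volterra κ f).ext (fun x => p x + (kernelGrad κ κx f).ext x) := by
  refine hasH1Deriv_of_eq_primitive (hf.2.1.add (UnitFun.memLp_ext _)) fun x hx => ?_
  have e : ∀ y, (f + volterra κ f).ext y = f.ext y + (volterra κ f).ext y := fun y => rfl
  have hx' : ∀ y ∈ uIcc 0 x, y ∈ Icc (0 : ℝ) 1 := fun y hy => by
    rw [uIcc_of_le hx.1] at hy; exact ⟨hy.1, hy.2.trans hx.2⟩
  rw [e, e, intervalIntegral.integral_add
    (hf.intervalIntegrable.mono_set (by
      rw [uIcc_of_le zero_le_one]; exact fun y hy => hx' y hy))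
    ((UnitFun.continuous_ext _).intervalIntegrable _ _),
    volterra_ext_eq_integral_kernelGrad S f hx, volterra_ext κ f (x := 0) (by simp),
    intervalIntegral.integral_same, hf.eq_primitive x hx]
  ring

/-- `f` inherits `H¹` from `f + K f`. -/
theorem hasH1Deriv_of_add_volterra {κ κx κy : KernelFun} {Q : ℝ → ℝ → ℝ} {b : ℝ → ℝ}
    (S : SpaceKernel κ.ext κx.ext κy.ext Q b) {f : UnitFun} {p : ℝ → ℝ}
    (hp : MemLp p 2 (volume.restrict (Ioo (0 : ℝ) 1)))
    (hf : ∀ x ∈ Icc (0 : ℝ) 1, (f + volterra κ f).ext x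
      = (f + volterra κ f).ext 0 + ∫ y in (0 : ℝ)..x, p y) :
    HasH1Deriv f.ext (fun x => p x - (kernelGrad κ κx f).ext x) := by
  have h0 := hasH1Deriv_of_eq_primitive hp hf
  refine hasH1Deriv_of_eq_primitive (hp.sub (UnitFun.memLp_ext _)) fun x hx => ?_
  have e : ∀ y, (f + volterra κ f).ext y = f.ext y + (volterra κ f).ext y := fun y => rfl
  have hx' : ∀ y ∈ uIcc 0 x, y ∈ Icc (0 : ℝ) 1 := fun y hy => by
    rw [uIcc_of_le hx.1] at hy; exact ⟨hy.1, hy.2.trans hx.2⟩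
  have h1 := hf x hx
  rw [e, e, volterra_ext_eq_integral_kernelGrad S f hx, volterra_ext κ f (x := 0) (by simp),
    intervalIntegral.integral_same] at h1
  rw [intervalIntegral.integral_sub
    (h0.intervalIntegrable.mono_set (by
      rw [uIcc_of_le zero_le_one]; exact fun y hy => hx' y hy))
    ((UnitFun.continuous_ext _).intervalIntegrable _ _)]
  linarith

/-- The second derivative of `f` in terms of that of `f + K f`. -/
theorem grad_eq_primitive_of_add_volterra {κ κx κy κt : KernelFun} {A : UnitFun} {lam : ℝ}
    (S : SpaceKernel κ.ext κx.ext κy.ext (fun x y => κt.ext x y + (A.ext y + lam) * κ.ext x y)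
      (fun x => A.ext x + lam)) {f p w G : UnitFun}
    (hfp : ∀ x ∈ Icc (0 : ℝ) 1, f.ext x = f.ext 0 + ∫ y in (0 : ℝ)..x, p.ext y)
    (hw : ∀ x ∈ Icc (0 : ℝ) 1, (p + kernelGrad κ κx f).ext x = ∫ y in (0 : ℝ)..x, w.ext y)
    (hG : G + volterra κ G = w - lam • (f + volterra κ f) - volterra κt f) :
    G - A * f = w - ((A * f + lam • f) + volterra κt f + volterra κ (A * f + lam • f) + κ.diag * p
        - volterra κy p) ∧
    ∀ x ∈ Icc (0 : ℝ) 1, p.ext x = ∫ y in (0 : ℝ)..x, (G - A * f).ext y := by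
  -- `E` is the second derivative of Kf as given by `SpaceKernel.deriv_integral_kernel_mul`; hence
  -- the derivative of `p` is w − E.
  set E : UnitFun := (A * f + lam • f) + volterra κt f + volterra κ (A * f + lam • f) + κ.diag * p
        - volterra κy p with hE
  have hAf : ∀ y, (A * f + lam • f).ext y = (A.ext y + lam) * f.ext y := fun y => by
    simp only [UnitFun.ext_apply, ContinuousMap.add_apply, ContinuousMap.mul_apply,
      ContinuousMap.smul_apply, smul_eq_mul]
    ring
  have hEx : ∀ x ∈ Icc (0 : ℝ) 1, E.ext x = (A.ext x + lam) * f.ext x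
      + (∫ y in (0 : ℝ)..x, (κt.ext x y + (A.ext y + lam) * κ.ext x y) * f.ext y)
      + κ.ext x x * p.ext x - ∫ y in (0 : ℝ)..x, κy.ext x y * p.ext y := by
    intro x hx
    have e : E.ext x = (A * f + lam • f).ext x + (volterra κt f).ext x
      + (volterra κ (A * f + lam • f)).ext x + κ.diag.ext x * p.ext x - (volterra κy p).ext x := rfl
    have c1 : Continuous fun y => κt.ext x y * f.ext y :=
      (continuous_uncurry_apply κt.continuous_ext x).mul f.continuous_ext
    have c2 : Continuous fun y => κ.ext x y * (A * f + lam • f).ext y :=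
      (continuous_uncurry_apply κ.continuous_ext x).mul (UnitFun.continuous_ext _)
    rw [e, volterra_ext _ _ hx, volterra_ext _ _ hx, volterra_ext _ _ hx, hAf, κ.diag_ext,
      add_assoc ((A.ext x + lam) * f.ext x), ← intervalIntegral.integral_add
        (c1.intervalIntegrable _ _) (c2.intervalIntegrable _ _)]
    congr 4
    ext y
    rw [hAf]; ring
  have hp : ∀ x ∈ Icc (0 : ℝ) 1, p.ext x = ∫ y in (0 : ℝ)..x, (w - E).ext y := by
    intro x hx
    have hx' : ∀ y ∈ uIcc 0 x, y ∈ Icc (0 : ℝ) 1 := fun y hy => by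
      rw [uIcc_of_le hx.1] at hy; exact ⟨hy.1, hy.2.trans hx.2⟩
    have e1 : (p + kernelGrad κ κx f).ext x = p.ext x + (kernelGrad κ κx f).ext x := rfl
    have e2 : ∀ y, (w - E).ext y = w.ext y - E.ext y := fun y => rfl
    have h1 := hw x hx
    rw [e1, kernelGrad_ext _ _ _ hx, S.deriv_integral_kernel_mul f.continuous_ext p.continuous_ext
      hfp hx.1 hx.2, ← intervalIntegral.integral_congr fun y hy => hEx y (hx' y hy)] at h1
    simp only [e2]
    rw [intervalIntegral.integral_sub (w.continuous_ext.intervalIntegrable _ _)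
      (E.continuous_ext.intervalIntegrable _ _)]
    linarith
  -- Integration by parts in y gives K(w − E) = k(x,x)p − ∫ k_y p, and this cancels the terms of `E`
  -- that contain `p`. What is left is (1 + K)(G − Af) by the hypothesis on `G`, and injectivity of
  -- 1 + K yields G − Af = w − E.
  have key : (w - E) + volterra κ (w - E) = w - (A * f + lam • f) - volterra κt f
      - volterra κ (A * f + lam • f) := by
    have h2 : volterra κ (w - E) = κ.diag * p - volterra κy p := by
      ext ⟨x, hx⟩
      have h3 := S.integral_ky_mul_primitive hx.1 hx.2 0
        ((UnitFun.continuous_ext (w - E)).intervalIntegrable (μ := volume) _ _)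
      rw [zero_add, ← hp x hx, intervalIntegral.integral_congr (g := fun y => κy.ext x y * p.ext y),
        mul_zero, sub_zero] at h3
      · rw [← UnitFun.ext_of_mem _ hx, ← UnitFun.ext_of_mem _ hx, volterra_ext _ _ hx]
        have e : (κ.diag * p - volterra κy p).ext x = κ.diag.ext x * p.ext x - (volterra κy p).ext x := rfl
        rw [e, volterra_ext _ _ hx, κ.diag_ext, h3]; ring
      · intro y hy
        rw [uIcc_of_le hx.1] at hy
        simp only
        rw [zero_add, ← hp y ⟨hy.1, hy.2.trans hx.2⟩]
    rw [h2, hE]; abel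
  have hGw : G - A * f = w - E := by
    have : (G - A * f - (w - E)) + volterra κ (G - A * f - (w - E)) = 0 := by
      have e : (G - A * f - (w - E)) + volterra κ (G - A * f - (w - E))
        = (G + volterra κ G) - (A * f + volterra κ (A * f)) - ((w - E) + volterra κ (w - E)) := by
        simp only [map_sub]; abel
      rw [e, key, hG]
      simp only [map_add, map_smul, smul_add]
      abel
    exact sub_eq_zero.1 (eq_zero_of_add_volterra_eq_zero this)
  exact ⟨hGw, fun x hx => by rw [hGw]; exact hp x hx⟩

/-! ### The solution of the closed loop: regularity and exponential bound -/

/-- The solution of the closed loop problem, obtained from the target solution `heatSol` by the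
inverse transformation. -/
noncomputable def plantSol (lam : ℝ) (ν c : ℕ → ℝ) (κ : ℝ → KernelFun) (t : ℝ) : UnitFun :=
  volterraInv (κ t) (heatSol lam ν c t)

/-- The time derivative of `plantSol`. -/
noncomputable def plantSolT (lam : ℝ) (ν c : ℕ → ℝ) (κ κt : ℝ → KernelFun) (t : ℝ) : UnitFun :=
  volterraInv (κ t) (heatSolXX lam ν c t - lam • heatSol lam ν c t
    - volterra (κt t) (plantSol lam ν c κ t))

/-- The space derivative of `plantSol`. -/
noncomputable def plantSolX (lam : ℝ) (ν c : ℕ → ℝ) (g₀ : ℝ → ℝ) (κ κx : ℝ → KernelFun) (t x : ℝ) : ℝ :=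
  heatGrad lam ν c g₀ t x - (kernelGrad (κ t) (κx t) (plantSol lam ν c κ t)).ext x

/-- Square integrability on a rectangle of a curve of continuous functions. -/
theorem memLp_two_curve {F : ℝ → UnitFun} {τ : ℝ} (hF : ContinuousOn F (Ioo 0 τ)) {q : ℝ → ℝ}
    (hq : IntegrableOn q (Ioo 0 τ))
    (hle : ∀ t ∈ Ioo 0 τ, ∫ x in Ioo (0 : ℝ) 1, (F t).ext x ^ 2 ≤ q t) :
    MemLp (fun p : ℝ × ℝ => (F p.2).ext p.1) 2
      (volume.restrict (Ioo (0 : ℝ) 1 ×ˢ Ioo (0 : ℝ) τ)) := by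
  have hcont : ContinuousOn (fun p : ℝ × ℝ => (F p.2).ext p.1) (Ioo (0 : ℝ) 1 ×ˢ Ioo (0 : ℝ) τ) := by
    have h1 : ContinuousOn (fun p : ℝ × ℝ => (F p.2, unitProj p.1)) (Ioo (0 : ℝ) 1 ×ˢ Ioo (0 : ℝ) τ) :=
      (hF.comp continuousOn_snd fun p hp => hp.2).prodMk
        (continuous_unitProj.comp continuous_fst).continuousOn
    exact ContinuousEval.continuous_eval.comp_continuousOn h1
  have hm := hcont.aestronglyMeasurable (μ := volume) (measurableSet_Ioo.prod measurableSet_Ioo)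
  rw [memLp_two_iff_integrable_sq hm]
  have hμ : (volume : Measure (ℝ × ℝ)).restrict (Ioo (0 : ℝ) 1 ×ˢ Ioo (0 : ℝ) τ)
      = (volume.restrict (Ioo (0 : ℝ) 1)).prod (volume.restrict (Ioo (0 : ℝ) τ)) := by
    rw [Measure.prod_restrict]; rfl
  rw [hμ] at hm ⊢
  have hm2 : AEStronglyMeasurable (fun p : ℝ × ℝ => (F p.2).ext p.1 ^ 2)
      ((volume.restrict (Ioo (0 : ℝ) 1)).prod (volume.restrict (Ioo (0 : ℝ) τ))) := hm.pow 2
  rw [integrable_prod_iff' hm2]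
  constructor
  · exact .of_forall fun t => ((F t).continuous_ext.pow 2).integrableOn_Icc.mono_set Ioo_subset_Icc_self
  · refine hq.mono' (hm2.norm.prod_swap.integral_prod_right') ?_
    filter_upwards [ae_restrict_mem measurableSet_Ioo] with t ht
    rw [Real.norm_of_nonneg (integral_nonneg fun _ => norm_nonneg _)]
    refine le_trans (le_of_eq ?_) (hle t ht)
    exact integral_congr_ae (.of_forall fun x => by simp)

/-- A curve of continuous functions with a classical derivative in time has it as weak derivative. -/
theorem integral_curve_mul_time_deriv {F F' : ℝ → UnitFun} {τ : ℝ} (hτ : 0 < τ)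
    (hF : ContinuousOn F (Icc 0 τ)) (hF' : ∀ t ∈ Ioo 0 τ, HasDerivAt F (F' t) t)
    (hm : MemLp (fun p : ℝ × ℝ => (F' p.2).ext p.1) 2
      (volume.restrict (Ioo (0 : ℝ) 1 ×ˢ Ioo (0 : ℝ) τ)))
    {φ : ℝ × ℝ → ℝ} (hφ : ContDiff ℝ ∞ φ) (hφc : HasCompactSupport φ)
    (hφs : tsupport φ ⊆ Ioo (0 : ℝ) 1 ×ˢ Ioo (0 : ℝ) τ) :
    ∫ p in Ioo (0 : ℝ) 1 ×ˢ Ioo (0 : ℝ) τ, (F p.2).ext p.1 * fderiv ℝ φ p (0, 1)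
      = - ∫ p in Ioo (0 : ℝ) 1 ×ˢ Ioo (0 : ℝ) τ, (F' p.2).ext p.1 * φ p := by
  have hμ : (volume : Measure (ℝ × ℝ)).restrict (Ioo (0 : ℝ) 1 ×ˢ Ioo (0 : ℝ) τ)
      = (volume.restrict (Ioo (0 : ℝ) 1)).prod (volume.restrict (Ioo (0 : ℝ) τ)) := by
    rw [Measure.prod_restrict]; rfl
  have hD : Continuous fun p => fderiv ℝ φ p (0, 1) :=
    (hφ.continuous_fderiv (by simp)).clm_apply continuous_const
  have hDφ : ∀ x t, HasDerivAt (fun t => φ (x, t)) (fderiv ℝ φ (x, t) (0, 1)) t := fun x t => by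
    have h1 := ((hφ.differentiable (by simp)) (x, t)).hasFDerivAt
    exact h1.comp_hasDerivAt (f := fun t => (x, t)) t ((hasDerivAt_const t x).prodMk (hasDerivAt_id t))
  have i1 : IntegrableOn (fun p : ℝ × ℝ => (F p.2).ext p.1 * fderiv ℝ φ p (0, 1))
      (Ioo (0 : ℝ) 1 ×ˢ Ioo (0 : ℝ) τ) := by
    have h1 : ContinuousOn (fun p : ℝ × ℝ => (F p.2, unitProj p.1)) (Icc (0 : ℝ) 1 ×ˢ Icc (0 : ℝ) τ) :=
      (hF.comp continuousOn_snd fun p hp => hp.2).prodMk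
        (continuous_unitProj.comp continuous_fst).continuousOn
    have h2 : ContinuousOn (fun p : ℝ × ℝ => (F p.2).ext p.1) (Icc (0 : ℝ) 1 ×ˢ Icc (0 : ℝ) τ) :=
      ContinuousEval.continuous_eval.comp_continuousOn h1
    exact ((h2.mul hD.continuousOn).integrableOn_compact (isCompact_Icc.prod isCompact_Icc)).mono_set
      (prod_mono Ioo_subset_Icc_self Ioo_subset_Icc_self)
  have hfin : IsFiniteMeasure ((volume : Measure (ℝ × ℝ)).restrict (Ioo (0 : ℝ) 1 ×ˢ Ioo (0 : ℝ) τ)) := by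
    rw [hμ]; infer_instance
  have i2 : IntegrableOn (fun p : ℝ × ℝ => (F' p.2).ext p.1 * φ p) (Ioo (0 : ℝ) 1 ×ˢ Ioo (0 : ℝ) τ) := by
    obtain ⟨C, hC⟩ := hφc.exists_bound_of_continuous hφ.continuous
    exact (hm.integrable (by norm_num)).mul_bdd hφ.continuous.aestronglyMeasurable (.of_forall hC)
  rw [eq_neg_iff_add_eq_zero, ← integral_add i1 i2]
  have i3 : IntegrableOn (fun p : ℝ × ℝ => (F p.2).ext p.1 * fderiv ℝ φ p (0, 1) + (F' p.2).ext p.1 * φ p)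
      (Ioo (0 : ℝ) 1 ×ˢ Ioo (0 : ℝ) τ) := i1.add i2
  rw [IntegrableOn, hμ] at i3
  rw [hμ, integral_prod _ i3]
  refine integral_eq_zero_of_ae ?_
  filter_upwards [i3.prod_right_ae] with x hx
  have hbd : ∀ t ∉ Ioo 0 τ, φ (x, t) = 0 := fun t ht =>
    image_eq_zero_of_notMem_tsupport fun h => ht (hφs h).2
  have hFx : ContinuousOn (fun t => (F t).ext x) (Icc 0 τ) :=
    (ContinuousMap.evalCLM ℝ (unitProj x)).continuous.comp_continuousOn hF
  have hFT := intervalIntegral.integral_eq_sub_of_hasDerivAt_of_le hτ.le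
    (f := fun t => (F t).ext x * φ (x, t))
    (f' := fun t => (F t).ext x * fderiv ℝ φ (x, t) (0, 1) + (F' t).ext x * φ (x, t))
    (hFx.mul (hφ.continuous.comp (Continuous.prodMk_right x)).continuousOn)
    (fun t ht => by
      have h1 := (ContinuousMap.evalCLM ℝ (unitProj x)).hasFDerivAt.comp_hasDerivAt t (hF' t ht)
      exact (h1.fun_mul (hDφ x t)).congr_deriv (add_comm _ _))
    ((intervalIntegrable_iff_integrableOn_Ioo_of_le hτ.le).2 hx)
  rw [hbd 0 (by simp), hbd τ (by simp), mul_zero, mul_zero, sub_zero,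
    intervalIntegral.integral_of_le hτ.le, integral_Ioc_eq_integral_Ioo] at hFT
  exact hFT

section PlantSol

variable {lam τ : ℝ} {A : ℝ → UnitFun} {κ κx κy κt : ℝ → KernelFun} {ν c : ℕ → ℝ} {w₀ g₀ : ℝ → ℝ}

theorem plantSol_add_volterra (t : ℝ) :
    plantSol lam ν c κ t + volterra (κ t) (plantSol lam ν c κ t) = heatSol lam ν c t :=
  volterraInv_add_volterra _ _

theorem continuousOn_plantSol (hκ : Continuous κ) (hc : Summable fun n => |c n|) (hlam : 0 ≤ lam) :
    ContinuousOn (plantSol lam ν c κ) (Ici 0) :=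
  hκ.continuousOn.volterraInv (continuousOn_heatSol hc hlam)

theorem TimeKernel.hasDerivAt_plantSol (T : TimeKernel lam τ A κ κx κy κt)
    (hc : Summable fun n => |c n|) (hlam : 0 ≤ lam) {t : ℝ} (ht : t ∈ Ioo 0 τ) :
    HasDerivAt (plantSol lam ν c κ) (plantSolT lam ν c κ κt t) t :=
  hasDerivAt_volterraInv (T.hasDerivAt t ht) (hasDerivAt_heatSol hc hlam ht.1)

theorem TimeKernel.hasH1Deriv_plantSol (T : TimeKernel lam τ A κ κx κy κt) (h : CosModes ν)
    (H : HasH1Deriv w₀ g₀) (hbc : ∀ n, w₀ 1 * Real.sin (ν n) = 0) (hlam : 0 ≤ lam) {t : ℝ}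
    (ht : t ∈ Icc 0 τ) :
    HasH1Deriv (plantSol lam ν (cosCoeff ν w₀) κ t).ext
      (plantSolX lam ν (cosCoeff ν w₀) g₀ κ κx t) := by
  refine hasH1Deriv_of_add_volterra (T.space t ht) (CosModes.memLp_heatGrad H _ t) fun x hx => ?_
  rw [plantSol_add_volterra]
  exact h.heatSol_eq_primitive_heatGrad H hbc hlam ht.1 hx

/-- At positive times everything is classical and u_t − au is the derivative of u_x. The first
identity displays this derivative as w_xx plus terms in u and u_x only, which is what the L² bound
needs. -/
theorem TimeKernel.plantSolXX (T : TimeKernel lam τ A κ κx κy κt) (hc : Summable fun n => |c n|)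
    (hlam : 0 ≤ lam) {t : ℝ} (ht : t ∈ Ioo 0 τ) {p : UnitFun}
    (hp : p = heatSolX lam ν c t - kernelGrad (κ t) (κx t) (plantSol lam ν c κ t)) :
    plantSolT lam ν c κ κt t - A t * plantSol lam ν c κ t = heatSolXX lam ν c t
      - ((A t * plantSol lam ν c κ t + lam • plantSol lam ν c κ t)
        + volterra (κt t) (plantSol lam ν c κ t)
        + volterra (κ t) (A t * plantSol lam ν c κ t + lam • plantSol lam ν c κ t)
        + (κ t).diag * p - volterra (κy t) p) ∧
    ∀ x ∈ Icc (0 : ℝ) 1, p.ext x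
      = ∫ y in (0 : ℝ)..x, (plantSolT lam ν c κ κt t - A t * plantSol lam ν c κ t).ext y := by
  have S := T.space t (Ioo_subset_Icc_self ht)
  refine grad_eq_primitive_of_add_volterra S ?_ ?_ ?_
  · have h1 := hasH1Deriv_of_add_volterra S (UnitFun.memLp_ext (heatSolX lam ν c t))
      (f := plantSol lam ν c κ t) fun x hx => by
        rw [plantSol_add_volterra]; exact heatSol_eq_primitive hc hlam ht.1 hx
    subst hp
    exact h1.eq_primitive
  · intro x hx
    rw [hp, sub_add_cancel]
    exact heatSolX_eq_primitive hc hlam ht.1 hx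
  · rw [plantSol_add_volterra]
    exact volterraInv_add_volterra _ _

/-- Since w_x vanishes at x = 0, its supremum is at most ∫ |w_xx|, and Cauchy–Schwarz applies. -/
theorem norm_heatSolX_sq_le (hc : Summable fun n => |c n|) (hlam : 0 ≤ lam) {t : ℝ} (ht : 0 < t) :
    ‖heatSolX lam ν c t‖ ^ 2 ≤ ∫ x in Ioo (0 : ℝ) 1, (heatSolXX lam ν c t).ext x ^ 2 := by
  set g := heatSolXX lam ν c t with hg
  set J := ∫ x in Ioo (0 : ℝ) 1, |g.ext x| with hJ
  have hJ0 : 0 ≤ J := integral_nonneg fun _ => abs_nonneg _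
  have h1 : ‖heatSolX lam ν c t‖ ≤ J := by
    refine (ContinuousMap.norm_le _ hJ0).2 fun x => ?_
    rw [← UnitFun.ext_of_mem _ x.2, heatSolX_eq_primitive hc hlam ht x.2, hJ,
      setIntegral_Ioo_eq_intervalIntegral]
    refine (intervalIntegral.norm_integral_le_integral_norm x.2.1).trans ?_
    exact intervalIntegral.integral_mono_interval le_rfl x.2.1 x.2.2 (.of_forall fun _ => abs_nonneg _)
      (g.continuous_ext.abs.intervalIntegrable _ _)
  exact (pow_le_pow_left₀ (norm_nonneg _) h1 2).trans (sq_integral_le_integral_sq (UnitFun.memLp_ext g))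

/-- The second space derivative of `plantSol` is square integrable. -/
theorem TimeKernel.memLp_plantSolXX (T : TimeKernel lam τ A κ κx κy κt) (h : CosModes ν)
    (H : HasH1Deriv w₀ g₀) (hbc : ∀ n, w₀ 1 * Real.sin (ν n) = 0) (hlam : 0 < lam)
    (hcw : c = cosCoeff ν w₀) :
    MemLp (fun p : ℝ × ℝ => (plantSolT lam ν c κ κt p.2 - A p.2 * plantSol lam ν c κ p.2).ext p.1) 2
      (volume.restrict (Ioo (0 : ℝ) 1 ×ˢ Ioo (0 : ℝ) τ)) := by
  have hc : Summable fun n => |c n| := hcw ▸ (h.summable_cosCoeff_and_le H hbc).1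
  have hI : IntegrableOn (fun t => ∫ x in Ioo (0 : ℝ) 1, (heatSolXX lam ν c t).ext x ^ 2) (Ioo 0 τ) :=
    hcw ▸ h.integrableOn_heatSolXX_sq H hbc hlam
  set U := plantSol lam ν c κ with hU
  have hUc : ContinuousOn U (Icc 0 τ) :=
    (continuousOn_plantSol T.cont hc hlam.le).mono Icc_subset_Ici_self
  -- The lower-order terms are split into `B`, which is continuous up to t = 0 and hence bounded,
  -- and the terms with w_x. The latter are controlled near t = 0 only through
  -- `norm_heatSolX_sq_le`, that is, by the already integrable ∫ w_xx².
  set B : ℝ → UnitFun := fun t => (A t * U t + lam • U t) + volterra (κt t) (U t)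
    + volterra (κ t) (A t * U t + lam • U t) - (κ t).diag * kernelGrad (κ t) (κx t) (U t)
    + volterra (κy t) (kernelGrad (κ t) (κx t) (U t)) with hB
  have hAU : ContinuousOn (fun t => A t * U t + lam • U t) (Icc 0 τ) :=
    (T.cont_A.continuousOn.mul hUc).add (hUc.const_smul lam)
  have hgc := T.cont.continuousOn.kernelGrad T.cont_x.continuousOn hUc
  have hBc : ContinuousOn B (Icc 0 τ) :=
    (((hAU.add (T.cont_t.continuousOn.volterra hUc)).add (T.cont.continuousOn.volterra hAU)).sub
      ((KernelFun.continuous_diag.comp T.cont).continuousOn.mul hgc)).add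
        (T.cont_y.continuousOn.volterra hgc)
  obtain ⟨C₁, hC₁, hB₁⟩ := exists_norm_le_on_Icc hBc
  obtain ⟨C₂, hC₂, hB₂⟩ := exists_norm_le_on_Icc (T.cont.continuousOn (s := Icc 0 τ))
  obtain ⟨C₃, hC₃, hB₃⟩ := exists_norm_le_on_Icc (T.cont_y.continuousOn (s := Icc 0 τ))
  set X := heatSolX lam ν c with hX
  set E : ℝ → UnitFun := fun t => B t + (κ t).diag * X t - volterra (κy t) (X t) with hE
  have hEx : ∀ t ∈ Ioo 0 τ, plantSolT lam ν c κ κt t - A t * U t = heatSolXX lam ν c t - E t := by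
    intro t ht
    rw [(T.plantSolXX hc hlam.le ht rfl).1, hE]
    simp only [hB, map_sub, mul_sub]
    abel
  have hEb : ∀ t ∈ Ioo 0 τ, ‖E t‖ ≤ C₁ + (C₂ + C₃) * ‖X t‖ := by
    intro t ht
    have ht' := Ioo_subset_Icc_self ht
    have h1 : ‖(κ t).diag * X t‖ ≤ C₂ * ‖X t‖ := (norm_mul_le _ _).trans
      (mul_le_mul_of_nonneg_right ((KernelFun.norm_diag_le _).trans (hB₂ t ht')) (norm_nonneg _))
    have h2 : ‖volterra (κy t) (X t)‖ ≤ C₃ * ‖X t‖ := (norm_volterra_apply_le _ _).trans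
      (mul_le_mul_of_nonneg_right (hB₃ t ht') (norm_nonneg _))
    have h3 := norm_sub_le (B t + (κ t).diag * X t) (volterra (κy t) (X t))
    have h4 := norm_add_le (B t) ((κ t).diag * X t)
    have h5 := hB₁ t ht'
    rw [add_mul]
    simp only [hE]
    linarith
  have hXXc : ContinuousOn (heatSolXX lam ν c) (Ioo 0 τ) :=
    (continuousOn_heatSolXX hc hlam.le).mono fun t ht => ht.1
  have hXc : ContinuousOn X (Ioo 0 τ) := (continuousOn_heatSolX hc hlam.le).mono fun t ht => ht.1
  have hEc : ContinuousOn E (Ioo 0 τ) :=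
    ((hBc.mono Ioo_subset_Icc_self).add
      ((KernelFun.continuous_diag.comp T.cont).continuousOn.mul hXc)).sub
      (T.cont_y.continuousOn.volterra hXc)
  have m1 := memLp_two_curve hXXc hI fun t _ => le_rfl
  have m2 := memLp_two_curve hEc (q := fun t => 2 * C₁ ^ 2 + 2 * (C₂ + C₃) ^ 2
      * ∫ x in Ioo (0 : ℝ) 1, (heatSolXX lam ν c t).ext x ^ 2)
    ((integrableOn_const (by simp)).add (hI.const_mul _)) fun t ht => by
      have h1 := norm_heatSolX_sq_le (ν := ν) hc hlam.le ht.1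
      have h2 := pow_le_pow_left₀ (norm_nonneg _) (hEb t ht) 2
      have h3 := mul_le_mul_of_nonneg_left h1 (by positivity : 0 ≤ 2 * (C₂ + C₃) ^ 2)
      have h4 := (E t).integral_ext_sq_le
      nlinarith [sq_nonneg (C₁ - (C₂ + C₃) * ‖X t‖)]
  refine (memLp_congr_ae ?_).1 (m1.sub m2)
  filter_upwards [ae_restrict_mem (measurableSet_Ioo.prod measurableSet_Ioo)] with p hp
  rw [hEx p.2 hp.2]
  rfl

/-- `t ↦ plantSol t` is continuous with values in `H¹`. -/
theorem TimeKernel.tendsto_plantSol (T : TimeKernel lam τ A κ κx κy κt) (h : CosModes ν)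
    (H : HasH1Deriv w₀ g₀) (hbc : ∀ n, w₀ 1 * Real.sin (ν n) = 0) (hlam : 0 ≤ lam)
    (hcw : c = cosCoeff ν w₀) {s : ℝ} (hs : s ∈ Icc 0 τ) :
    Tendsto (fun t => ∫ x in Ioo (0 : ℝ) 1, (((plantSol lam ν c κ t).ext x - (plantSol lam ν c κ s).ext x) ^ 2
        + (plantSolX lam ν c g₀ κ κx t x - plantSolX lam ν c g₀ κ κx s x) ^ 2))
      (𝓝[Icc 0 τ] s) (𝓝 0) := by
  have hc : Summable fun n => |c n| := hcw ▸ (h.summable_cosCoeff_and_le H hbc).1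
  have hUc : ContinuousOn (plantSol lam ν c κ) (Icc 0 τ) :=
    (continuousOn_plantSol T.cont hc hlam).mono Icc_subset_Ici_self
  have hgc := T.cont.continuousOn.kernelGrad T.cont_x.continuousOn hUc
  set U := plantSol lam ν c κ with hU
  set G : ℝ → UnitFun := fun t => kernelGrad (κ t) (κx t) (U t) with hG
  set P := heatGrad lam ν c g₀ with hP
  have hgrad : Tendsto (fun t => ∫ x in Ioo (0 : ℝ) 1, (P t x - P s x) ^ 2) (𝓝[Icc 0 τ] s) (𝓝 0) := by
    rw [hP, hcw]
    exact (h.tendsto_heatGrad H hbc hlam hs.1).mono_left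
      (nhdsWithin_mono _ Icc_subset_Ici_self)
  have hUs : Tendsto (fun t => ‖U t - U s‖ ^ 2 + (2 * (∫ x in Ioo (0 : ℝ) 1, (P t x - P s x) ^ 2)
      + 2 * ‖G t - G s‖ ^ 2)) (𝓝[Icc 0 τ] s) (𝓝 0) := by
    have h1 : Tendsto (fun t => ‖U t - U s‖) (𝓝[Icc 0 τ] s) (𝓝 0) :=
      tendsto_iff_norm_sub_tendsto_zero.1 (hUc s hs)
    have h2 : Tendsto (fun t => ‖G t - G s‖) (𝓝[Icc 0 τ] s) (𝓝 0) :=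
      tendsto_iff_norm_sub_tendsto_zero.1 (hgc s hs)
    have := (h1.pow 2).add ((hgrad.const_mul 2).add ((h2.pow 2).const_mul 2))
    simpa using this
  refine squeeze_zero' (.of_forall fun t => integral_nonneg fun x => by positivity) ?_ hUs
  filter_upwards [self_mem_nhdsWithin] with t ht
  have mP := (CosModes.memLp_heatGrad (lam := lam) (ν := ν) H c t).sub (CosModes.memLp_heatGrad (lam := lam) (ν := ν) H c s)
  have mU := UnitFun.memLp_ext (U t - U s)
  have mG := UnitFun.memLp_ext (G t - G s)
  have e1 : ∫ x in Ioo (0 : ℝ) 1, (((U t).ext x - (U s).ext x) ^ 2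
        + (plantSolX lam ν c g₀ κ κx t x - plantSolX lam ν c g₀ κ κx s x) ^ 2)
      ≤ ∫ x in Ioo (0 : ℝ) 1, ((U t - U s).ext x ^ 2 + (2 * (P t x - P s x) ^ 2
        + 2 * (G t - G s).ext x ^ 2)) := by
    refine integral_mono_of_nonneg (.of_forall fun x => by positivity)
      (mU.integrable_sq.add ((mP.integrable_sq.const_mul 2).add (mG.integrable_sq.const_mul 2)))
      (.of_forall fun x => ?_)
    have e : plantSolX lam ν c g₀ κ κx t x - plantSolX lam ν c g₀ κ κx s x
        = (P t x - P s x) - (G t - G s).ext x := by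
      change P t x - (G t).ext x - (P s x - (G s).ext x) = (P t x - P s x) - ((G t).ext x - (G s).ext x)
      ring
    have e' : (U t).ext x - (U s).ext x = (U t - U s).ext x := rfl
    simp only
    rw [e, e']
    nlinarith [sq_nonneg ((P t x - P s x) + (G t - G s).ext x)]
  refine e1.trans ?_
  have iP : Integrable (fun x => 2 * (P t x - P s x) ^ 2) (volume.restrict (Ioo (0 : ℝ) 1)) :=
    mP.integrable_sq.const_mul 2
  have iPG : Integrable (fun x => 2 * (P t x - P s x) ^ 2 + 2 * (G t - G s).ext x ^ 2)
    (volume.restrict (Ioo (0 : ℝ) 1)) := iP.add (mG.integrable_sq.const_mul 2)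
  rw [integral_add mU.integrable_sq iPG, integral_add iP (mG.integrable_sq.const_mul 2),
    integral_const_mul, integral_const_mul]
  have i1 := (U t - U s).integral_ext_sq_le
  have i2 := (G t - G s).integral_ext_sq_le
  linarith

/-- The exponential bound, with a constant that depends only on the kernel. -/
theorem TimeKernel.exists_h1Norm_plantSol_le (T : TimeKernel lam τ A κ κx κy κt) (hlam : 0 ≤ lam) :
    ∃ M, 0 < M ∧ ∀ {ν : ℕ → ℝ} {w₀ g₀ : ℝ → ℝ}, CosModes ν → HasH1Deriv w₀ g₀ →
      (∀ n, w₀ 1 * Real.sin (ν n) = 0) → ∀ t ∈ Icc 0 τ,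
      h1Norm (plantSol lam ν (cosCoeff ν w₀) κ t).ext ≤ M * h1Norm w₀ * Real.exp (-lam * t) := by
  obtain ⟨R, hR, hRb⟩ := exists_norm_le_on_Icc (E := UnitFun →L[ℝ] UnitFun)
    ((continuous_volterraInv.comp T.cont).continuousOn (s := Icc 0 τ))
  obtain ⟨C₁, hC₁, hB₁⟩ := exists_norm_le_on_Icc (T.cont.continuousOn (s := Icc 0 τ))
  obtain ⟨C₂, hC₂, hB₂⟩ := exists_norm_le_on_Icc (T.cont_x.continuousOn (s := Icc 0 τ))
  have hcc : 0 ≤ coeffConst := add_nonneg (by norm_num) (Real.sqrt_nonneg _)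
  set D := R * coeffConst with hD
  have hD0 : 0 ≤ D := mul_nonneg hR hcc
  -- Large enough for D² + 2 + 2((C₁ + C₂)D)² ≤ M²; the three terms come from u, from w_x and from
  -- (Ku)_x in u_x = w_x − (Ku)_x.
  set M := D + 2 * (1 + (C₁ + C₂) * D) with hM
  refine ⟨M, by positivity, fun {ν w₀ g₀} h H hbc t ht => ?_⟩
  set c := cosCoeff ν w₀ with hc
  set U := plantSol lam ν c κ t with hU
  set N := h1Norm w₀ * Real.exp (-lam * t) with hN
  have hN0 : 0 ≤ N := mul_nonneg (h1Norm_nonneg _) (Real.exp_pos _).le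
  have hs := h.summable_cosCoeff_and_le H hbc
  have hUn : ‖U‖ ≤ D * N := by
    calc ‖U‖ ≤ ‖volterraInv (κ t)‖ * ‖heatSol lam ν c t‖ := ContinuousLinearMap.le_opNorm _ _
      _ ≤ R * ((∑' n, |c n|) * Real.exp (-lam * t)) :=
        mul_le_mul (hRb t ht) (norm_heatSol_le hs.1 ht.1) (norm_nonneg _) hR
      _ ≤ R * ((coeffConst * h1Norm w₀) * Real.exp (-lam * t)) := by
        gcongr; exact hs.2
      _ = D * N := by rw [hD, hN]; ring
  set G := kernelGrad (κ t) (κx t) U with hG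
  have hGn : ‖G‖ ≤ (C₁ + C₂) * D * N := by
    calc ‖G‖ ≤ (‖κ t‖ + ‖κx t‖) * ‖U‖ := norm_kernelGrad_le _ _ _
      _ ≤ (C₁ + C₂) * (D * N) :=
        mul_le_mul (add_le_add (hB₁ t ht) (hB₂ t ht)) hUn (norm_nonneg _) (by positivity)
      _ = _ := by ring
  have hUH := T.hasH1Deriv_plantSol h H hbc hlam ht
  rw [mul_assoc, hUH.h1Norm_eq]
  refine Real.sqrt_le_iff.2 ⟨by positivity, ?_⟩
  have m1 := CosModes.memLp_heatGrad (lam := lam) (ν := ν) H c t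
  have m2 := UnitFun.memLp_ext G
  have h1 := U.integral_ext_sq_le
  have h2 := h.integral_heatGrad_sq_le H hbc hlam ht.1
  have h3 := G.integral_ext_sq_le
  have h4 : ∫ x in Ioo (0 : ℝ) 1, plantSolX lam ν c g₀ κ κx t x ^ 2
      ≤ ∫ x in Ioo (0 : ℝ) 1, (2 * heatGrad lam ν c g₀ t x ^ 2 + 2 * G.ext x ^ 2) := by
    refine integral_mono_of_nonneg (.of_forall fun x => by positivity)
      ((m1.integrable_sq.const_mul 2).add (m2.integrable_sq.const_mul 2)) (.of_forall fun x => ?_)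
    change (heatGrad lam ν c g₀ t x - G.ext x) ^ 2 ≤ 2 * heatGrad lam ν c g₀ t x ^ 2 + 2 * G.ext x ^ 2
    nlinarith [sq_nonneg (heatGrad lam ν c g₀ t x + G.ext x)]
  rw [integral_add (m1.integrable_sq.const_mul 2) (m2.integrable_sq.const_mul 2), integral_const_mul,
    integral_const_mul] at h4
  have h5 := pow_le_pow_left₀ (norm_nonneg _) hUn 2
  have h6 := pow_le_pow_left₀ (norm_nonneg _) hGn 2
  set K := (C₁ + C₂) * D with hK
  have hK0 : 0 ≤ K := by positivity
  have h7 : (D * N) ^ 2 + 2 * N ^ 2 + 2 * (K * N) ^ 2 ≤ (M * N) ^ 2 := by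
    have : D ^ 2 + 2 + 2 * K ^ 2 ≤ M ^ 2 := by rw [hM]; nlinarith [mul_nonneg hD0 hK0]
    nlinarith [mul_le_mul_of_nonneg_right this (sq_nonneg N)]
  linarith

end PlantSol

/-! ### Strong solutions built from the target solution -/

/-- The restriction to `[0,1]` of a function continuous there. -/
def unitRestrict {f : ℝ → ℝ} (hf : ContinuousOn f (Icc (0 : ℝ) 1)) : UnitFun := ⟨_, hf.domRestrict⟩

theorem unitRestrict_ext {f : ℝ → ℝ} (hf : ContinuousOn f (Icc (0 : ℝ) 1)) {x : ℝ}
    (hx : x ∈ Icc (0 : ℝ) 1) : (unitRestrict hf).ext x = f x := UnitFun.ext_of_mem _ hx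

theorem HasH1Deriv.congr {f f' g g' : ℝ → ℝ} (h : HasH1Deriv f g)
    (hf : EqOn f' f (Icc (0 : ℝ) 1)) (hg : EqOn g' g (Ioo (0 : ℝ) 1)) : HasH1Deriv f' g' := by
  refine ⟨h.1.congr hf, (memLp_congr_ae ?_).2 h.2.1, fun φ hφ hc hs => ?_⟩
  · filter_upwards [ae_restrict_mem measurableSet_Ioo] with x hx using hg hx
  · rw [setIntegral_congr_fun measurableSet_Ioo fun x hx => by
        rw [hf (Ioo_subset_Icc_self hx)], h.2.2 φ hφ hc hs]
    congr 1
    exact setIntegral_congr_fun measurableSet_Ioo fun x hx => by rw [hg hx]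

theorem h1Norm_congr {f f' g : ℝ → ℝ} (h : HasH1Deriv f g) (hf : EqOn f' f (Icc (0 : ℝ) 1)) :
    h1Norm f' = h1Norm f := by
  rw [h.h1Norm_eq, (h.congr hf fun _ _ => rfl).h1Norm_eq]
  congr 2
  exact setIntegral_congr_fun measurableSet_Ioo fun x hx => by
    rw [hf (Ioo_subset_Icc_self hx)]

theorem norm_le_two_mul_h1Norm {f : UnitFun} {p : ℝ → ℝ} (h : HasH1Deriv f.ext p) :
    ‖f‖ ≤ 2 * h1Norm f.ext := by
  refine (ContinuousMap.norm_le _ (mul_nonneg zero_le_two (h1Norm_nonneg _))).2 fun x => ?_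
  rw [← UnitFun.ext_of_mem _ x.2]
  exact h.abs_le_h1Norm x.2

/-- Boundedness of the direct transformation on H¹, needed to replace the norm of the transformed
initial value by that of u⁰ in the decay estimate. The constant is crude, chosen so that the squares
of the separate bounds add up. -/
theorem h1Norm_add_volterra_le {κ κx κy : KernelFun} {Q : ℝ → ℝ → ℝ} {b : ℝ → ℝ}
    (S : SpaceKernel κ.ext κx.ext κy.ext Q b) {f : UnitFun} {p : ℝ → ℝ} (hf : HasH1Deriv f.ext p) :
    h1Norm (f + volterra κ f).ext ≤ (4 + 6 * (‖κ‖ + ‖κx‖)) * h1Norm f.ext := by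
  set N := h1Norm f.ext with hN
  have hN0 : 0 ≤ N := h1Norm_nonneg _
  set C := ‖κ‖ + ‖κx‖ with hC
  have hκC : ‖κ‖ ≤ C := le_add_of_nonneg_right (norm_nonneg _)
  have hC0 : 0 ≤ C := (norm_nonneg _).trans hκC
  have hn := norm_le_two_mul_h1Norm hf
  rw [(hf.add_volterra S).h1Norm_eq]
  refine Real.sqrt_le_iff.2 ⟨by positivity, ?_⟩
  have h1 : ‖f + volterra κ f‖ ≤ 2 * (1 + C) * N := by
    have := (norm_volterra_apply_le κ f).trans (mul_le_mul_of_nonneg_right hκC (norm_nonneg _))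
    have := norm_add_le f (volterra κ f)
    have := mul_le_mul_of_nonneg_left hn hC0
    linarith
  have h2 : ‖kernelGrad κ κx f‖ ≤ 2 * C * N := by
    have := norm_kernelGrad_le κ κx f
    have := mul_le_mul_of_nonneg_left hn hC0
    linarith
  have m2 := UnitFun.memLp_ext (kernelGrad κ κx f)
  have h3 : ∫ x in Ioo (0 : ℝ) 1, (p x + (kernelGrad κ κx f).ext x) ^ 2
      ≤ ∫ x in Ioo (0 : ℝ) 1, (2 * p x ^ 2 + 2 * (kernelGrad κ κx f).ext x ^ 2) := by
    refine integral_mono_of_nonneg (.of_forall fun x => by positivity)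
      ((hf.2.1.integrable_sq.const_mul 2).add (m2.integrable_sq.const_mul 2)) (.of_forall fun x => ?_)
    simp only
    nlinarith [sq_nonneg (p x - (kernelGrad κ κx f).ext x)]
  rw [integral_add (hf.2.1.integrable_sq.const_mul 2) (m2.integrable_sq.const_mul 2),
    integral_const_mul, integral_const_mul] at h3
  have h4 := (kernelGrad κ κx f).integral_ext_sq_le
  have h5 := (f + volterra κ f).integral_ext_sq_le
  have h6 := integral_sq_le_h1Norm_sq hf
  have h7 := pow_le_pow_left₀ (norm_nonneg _) h1 2
  have h8 := pow_le_pow_left₀ (norm_nonneg _) h2 2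
  have h9 : (2 * (1 + C) * N) ^ 2 + 2 * N ^ 2 + 2 * (2 * C * N) ^ 2 ≤ ((4 + 6 * C) * N) ^ 2 := by
    have : (2 * (1 + C)) ^ 2 + 2 + 2 * (2 * C) ^ 2 ≤ (4 + 6 * C) ^ 2 := by nlinarith
    nlinarith [mul_le_mul_of_nonneg_right this (sq_nonneg N)]
  linarith

section PlantSol

variable {lam τ : ℝ} {A : ℝ → UnitFun} {κ κx κy κt : ℝ → KernelFun} {ν c : ℕ → ℝ} {w₀ g₀ : ℝ → ℝ}

theorem plantSol_zero (h : CosModes ν) {f : UnitFun} (hf : HasH1Deriv (f + volterra (κ 0) f).ext g₀)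
    (hbc : ∀ n, (f + volterra (κ 0) f).ext 1 * Real.sin (ν n) = 0) (hlam : 0 ≤ lam) :
    plantSol lam ν (cosCoeff ν (f + volterra (κ 0) f).ext) κ 0 = f := by
  rw [plantSol]
  convert volterraInv_of_add_volterra (κ 0) f using 2
  ext x
  rw [← UnitFun.ext_of_mem _ x.2, ← UnitFun.ext_of_mem _ x.2]
  exact h.heatSol_zero hf hbc hlam x.2

/-- The feedback law is left abstract; it is only asked to hold for 0 < t < τ, with the classical
derivative u_x = w_x − (Ku)_x. Thus both feedback laws share one proof. -/
theorem TimeKernel.isStrongSolution (T : TimeKernel lam τ A κ κx κy κt) (h : CosModes ν)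
    (H : HasH1Deriv w₀ g₀) (hbc : ∀ n, w₀ 1 * Real.sin (ν n) = 0) (hlam : 0 < lam)
    (hcw : c = cosCoeff ν w₀) {a u : ℝ → ℝ → ℝ} {law : (ℝ → ℝ → ℝ) → (ℝ → ℝ → ℝ) → ℝ → Prop}
    {u₀ : ℝ → ℝ} (ha : ∀ t ∈ Icc 0 τ, ∀ x ∈ Icc (0 : ℝ) 1, (A t).ext x = a x t)
    (hu : ∀ t ∈ Icc 0 τ, ∀ x, u x t = (plantSol lam ν c κ t).ext x)
    (h0 : ∀ x ∈ Icc (0 : ℝ) 1, (plantSol lam ν c κ 0).ext x = u₀ x)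
    (hlaw : ∀ t ∈ Ioo 0 τ, ∀ ux : ℝ → ℝ → ℝ, (∀ x, ux x t
      = (heatSolX lam ν c t).ext x - (kernelGrad (κ t) (κx t) (plantSol lam ν c κ t)).ext x) →
      law u ux t) :
    IsStrongSolution a law u₀ τ u := by
  have hc : Summable fun n => |c n| := hcw ▸ (h.summable_cosCoeff_and_le H hbc).1
  set U := plantSol lam ν c κ with hU
  have hUc : ContinuousOn U (Icc 0 τ) :=
    (continuousOn_plantSol T.cont hc hlam.le).mono Icc_subset_Ici_self
  set Ut := plantSolT lam ν c κ κt with hUt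
  have hX : ∀ t ∈ Ioo 0 τ, plantSolX lam ν c g₀ κ κx t
      = (heatSolX lam ν c t - kernelGrad (κ t) (κx t) (U t)).ext := fun t ht => by
    ext x
    rw [plantSolX, heatGrad_of_pos _ _ _ _ ht.1]
    rfl
  have mXX : MemLp (fun p : ℝ × ℝ => (Ut p.2 - A p.2 * U p.2).ext p.1) 2
      (volume.restrict (Ioo (0 : ℝ) 1 ×ˢ Ioo (0 : ℝ) τ)) := T.memLp_plantSolXX h H hbc hlam hcw
  have hAU : ContinuousOn (fun t => A t * U t) (Icc 0 τ) := T.cont_A.continuousOn.mul hUc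
  obtain ⟨C, hC, hCb⟩ := exists_norm_le_on_Icc hAU
  have mAU : MemLp (fun p : ℝ × ℝ => (A p.2 * U p.2).ext p.1) 2
      (volume.restrict (Ioo (0 : ℝ) 1 ×ˢ Ioo (0 : ℝ) τ)) :=
    memLp_two_curve (hAU.mono Ioo_subset_Icc_self) (q := fun _ => C ^ 2) (integrableOn_const (by simp))
      fun t ht => (UnitFun.integral_ext_sq_le _).trans
        (pow_le_pow_left₀ (norm_nonneg _) (hCb t (Ioo_subset_Icc_self ht)) 2)
  have mT : MemLp (fun p : ℝ × ℝ => (Ut p.2).ext p.1) 2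
      (volume.restrict (Ioo (0 : ℝ) 1 ×ˢ Ioo (0 : ℝ) τ)) := by
    refine (memLp_congr_ae (.of_forall fun p => ?_)).1 (mXX.add mAU)
    change (Ut p.2).ext p.1 - (A p.2 * U p.2).ext p.1 + (A p.2 * U p.2).ext p.1 = _
    ring
  refine ⟨fun x t => plantSolX lam ν c g₀ κ κx t x, fun x t => (Ut t - A t * U t).ext x,
    fun x t => (Ut t).ext x, ?_, ?_, ?_, mXX, mT, ?_, ?_, ?_, ?_, ?_⟩
  · intro t ht
    simp only [hu t ht]
    rw [hU, hcw]
    exact T.hasH1Deriv_plantSol h H hbc hlam.le ht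
  · intro s hs
    refine (T.tendsto_plantSol h H hbc hlam.le hcw hs).congr' ?_
    filter_upwards [self_mem_nhdsWithin] with t ht
    simp only [hu t ht, hu s hs, hU]
  · filter_upwards [ae_restrict_mem measurableSet_Ioo] with t ht
    have h2 := (T.plantSolXX (ν := ν) hc hlam.le ht rfl).2
    rw [← hU, ← hUt] at h2
    simp only [hX t ht]
    refine hasH1Deriv_of_eq_primitive (UnitFun.memLp_ext _) fun x hx => ?_
    rw [h2 x hx, h2 0 (by simp), intervalIntegral.integral_same, zero_add]
  · intro φ hφ hφc hφs
    rw [← integral_curve_mul_time_deriv T.pos hUc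
      (fun t ht => T.hasDerivAt_plantSol hc hlam.le ht) mT hφ hφc hφs]
    refine setIntegral_congr_fun (measurableSet_Ioo.prod measurableSet_Ioo) fun p hp => ?_
    simp only [hu p.2 (Ioo_subset_Icc_self hp.2)]
  · filter_upwards [ae_restrict_mem (measurableSet_Ioo.prod measurableSet_Ioo)] with p hp
    rw [hu p.2 (Ioo_subset_Icc_self hp.2), ← ha p.2 (Ioo_subset_Icc_self hp.2) p.1
      (Ioo_subset_Icc_self hp.1)]
    change _ = (Ut p.2).ext p.1 - (A p.2).ext p.1 * (U p.2).ext p.1 + _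
    ring
  · filter_upwards [ae_restrict_mem measurableSet_Ioo] with t ht
    have h2 := (T.plantSolXX (ν := ν) hc hlam.le ht rfl).2 0 (by simp)
    rw [intervalIntegral.integral_same] at h2
    rw [hX t ht]; exact h2
  · filter_upwards [ae_restrict_mem measurableSet_Ioo] with t ht
    exact hlaw t ht _ fun x => by rw [hX t ht]; rfl
  · intro x hx
    rw [hu 0 ⟨le_rfl, T.pos.le⟩, h0 x hx]

end PlantSol

/-! ### Strong solutions as primitives in time -/

theorem HasH1Deriv.sub {f₁ f₂ g₁ g₂ : ℝ → ℝ} (h₁ : HasH1Deriv f₁ g₁) (h₂ : HasH1Deriv f₂ g₂) :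
    HasH1Deriv (fun x => f₁ x - f₂ x) (fun x => g₁ x - g₂ x) := by
  refine hasH1Deriv_of_eq_primitive (h₁.2.1.sub h₂.2.1) fun x hx => ?_
  have hs : uIcc 0 x ⊆ uIcc 0 1 := by
    rw [uIcc_of_le hx.1, uIcc_of_le zero_le_one]; exact Icc_subset_Icc le_rfl hx.2
  rw [intervalIntegral.integral_sub (h₁.intervalIntegrable.mono_set hs)
    (h₂.intervalIntegrable.mono_set hs), h₁.eq_primitive x hx, h₂.eq_primitive x hx]
  ring

/-- Continuity with values in `H¹` implies uniform continuity in space. -/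
theorem continuousOn_of_tendsto_H1 {v vx : ℝ → ℝ → ℝ} {τ : ℝ}
    (h1 : ∀ t ∈ Icc (0 : ℝ) τ, HasH1Deriv (fun x => v x t) (fun x => vx x t))
    (hc : ∀ s ∈ Icc (0 : ℝ) τ,
      Tendsto (fun t => ∫ x in Ioo (0 : ℝ) 1, ((v x t - v x s) ^ 2 + (vx x t - vx x s) ^ 2))
        (𝓝[Icc (0 : ℝ) τ] s) (𝓝 0)) {V : ℝ → UnitFun}
    (hV : ∀ t ∈ Icc (0 : ℝ) τ, ∀ x ∈ Icc (0 : ℝ) 1, (V t).ext x = v x t) :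
    ContinuousOn V (Icc 0 τ) := by
  intro s hs
  rw [ContinuousWithinAt, tendsto_iff_norm_sub_tendsto_zero]
  have h2 := ((hc s hs).const_mul 2).sqrt
  rw [mul_zero, Real.sqrt_zero] at h2
  refine squeeze_zero' (.of_forall fun _ => norm_nonneg _) ?_ h2
  filter_upwards [self_mem_nhdsWithin] with t ht
  refine (ContinuousMap.norm_le _ (Real.sqrt_nonneg _)).2 fun x => Real.abs_le_sqrt ?_
  have hd := (h1 t ht).sub (h1 s hs)
  have h3 := hd.sq_le x.2
  have i1 : IntegrableOn (fun x => (v x t - v x s) ^ 2) (Ioo 0 1) :=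
    ((hd.1.pow 2).integrableOn_compact isCompact_Icc).mono_set Ioo_subset_Icc_self
  rw [integral_add i1 hd.2.1.integrable_sq]
  rw [ContinuousMap.sub_apply, ← UnitFun.ext_of_mem _ x.2, ← UnitFun.ext_of_mem _ x.2, hV t ht x x.2,
    hV s hs x x.2]
  exact h3

theorem volume_restrict_rectangle (a b c d : ℝ) :
    (volume : Measure (ℝ × ℝ)).restrict (Ioo a b ×ˢ Ioo c d)
      = (volume.restrict (Ioo a b)).prod (volume.restrict (Ioo c d)) := by
  rw [Measure.prod_restrict]; rfl

theorem continuousOn_uncurry_ext {V : ℝ → UnitFun} {s : Set ℝ} (hV : ContinuousOn V s) (r : Set ℝ) :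
    ContinuousOn (fun p : ℝ × ℝ => (V p.2).ext p.1) (r ×ˢ s) :=
  ContinuousEval.continuous_eval.comp_continuousOn
    ((hV.comp continuousOn_snd fun _ hp => hp.2).prodMk
      (continuous_unitProj.comp continuous_fst).continuousOn)

/-- A curve with a weak time derivative is, for almost every point in space, a primitive of it. -/
theorem ae_eq_primitive_of_weak_time_deriv {V : ℝ → UnitFun} {vt : ℝ → ℝ → ℝ} {τ : ℝ} (hτ : 0 < τ)
    (hV : ContinuousOn V (Icc 0 τ))
    (hvt : IntegrableOn (fun p : ℝ × ℝ => vt p.1 p.2) (Ioo (0 : ℝ) 1 ×ˢ Ioo (0 : ℝ) τ))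
    (hw : ∀ φ : ℝ × ℝ → ℝ, ContDiff ℝ ∞ φ → HasCompactSupport φ →
      tsupport φ ⊆ Ioo (0 : ℝ) 1 ×ˢ Ioo (0 : ℝ) τ →
      ∫ p in Ioo (0 : ℝ) 1 ×ˢ Ioo (0 : ℝ) τ, (V p.2).ext p.1 * fderiv ℝ φ p (0, 1)
        = - ∫ p in Ioo (0 : ℝ) 1 ×ˢ Ioo (0 : ℝ) τ, vt p.1 p.2 * φ p) :
    ∀ᵐ y ∂(volume.restrict (Ioo (0 : ℝ) 1)), IntegrableOn (fun r => vt y r) (Ioo 0 τ) ∧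
      ∀ t ∈ Icc 0 τ, (V t).ext y = (V 0).ext y + ∫ r in (0 : ℝ)..t, vt y r := by
  have hvt' : Integrable (fun p : ℝ × ℝ => vt p.1 p.2)
      ((volume.restrict (Ioo (0 : ℝ) 1)).prod (volume.restrict (Ioo (0 : ℝ) τ))) := by
    rw [← volume_restrict_rectangle]; exact hvt
  have hVc := continuousOn_uncurry_ext hV (Icc 0 1)
  -- the identity tested with a function of the space variable
  have htest : ∀ χ : ℝ → ℝ, ContDiff ℝ ∞ χ → HasCompactSupport χ → tsupport χ ⊆ Ioo 0 1 →
      ∀ t ∈ Icc 0 τ, ∫ y in Ioo (0 : ℝ) 1, (V t).ext y * χ y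
        = (∫ y in Ioo (0 : ℝ) 1, (V 0).ext y * χ y)
          + ∫ r in (0 : ℝ)..t, ∫ y in Ioo (0 : ℝ) 1, vt y r * χ y := by
    intro χ hχ hχc hχs
    obtain ⟨C, hC⟩ := hχc.exists_bound_of_continuous hχ.continuous
    have hiχ : Integrable (fun p : ℝ × ℝ => vt p.1 p.2 * χ p.1)
        ((volume.restrict (Ioo (0 : ℝ) 1)).prod (volume.restrict (Ioo (0 : ℝ) τ))) :=
      hvt'.mul_bdd (hχ.continuous.comp continuous_fst).aestronglyMeasurable (.of_forall fun p => hC p.1)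
    have hL : ∃ L : UnitFun →L[ℝ] ℝ, ∀ f : UnitFun, L f = ∫ y in Ioo (0 : ℝ) 1, f.ext y * χ y := by
      refine ⟨integralAgainst ⟨fun x => χ x, by fun_prop⟩ ⟨1, by simp⟩, fun f => ?_⟩
      rw [integralAgainst_apply, setIntegral_Ioo_eq_intervalIntegral]
      refine intervalIntegral.integral_congr fun y hy => ?_
      rw [uIcc_of_le zero_le_one] at hy
      rw [UnitFun.ext_of_mem _ hy, mul_comm]; rfl
    obtain ⟨L, hL⟩ := hL
    have hF : ContinuousOn (fun t => ∫ y in Ioo (0 : ℝ) 1, (V t).ext y * χ y) (Icc 0 τ) := by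
      simp only [← hL]
      exact L.continuous.comp_continuousOn hV
    -- After pairing with χ in space a scalar function of time remains; its weak derivative is found
    -- by testing the weak formulation with products χ(y)θ(t).
    refine eq_primitive_of_weakDeriv hτ hF hiχ.integral_prod_right fun θ hθ hθc hθs => ?_
    have hθ' : Continuous (deriv θ) := hθ.continuous_deriv (by simp)
    obtain ⟨D, hD⟩ := hθc.exists_bound_of_continuous hθ.continuous
    have key := hw (fun p => χ p.1 * θ p.2) ((hχ.comp contDiff_fst).mul (hθ.comp contDiff_snd))
      (by
        refine HasCompactSupport.intro (hχc.isCompact.prod hθc.isCompact) fun p hp => ?_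
        by_cases h1 : p.1 ∈ tsupport χ
        · rw [image_eq_zero_of_notMem_tsupport (f := θ) fun h2 => hp ⟨h1, h2⟩, mul_zero]
        · rw [image_eq_zero_of_notMem_tsupport h1, zero_mul])
      (by
        refine (closure_minimal (t := tsupport χ ×ˢ tsupport θ) ?_
          ((isClosed_tsupport χ).prod (isClosed_tsupport θ))).trans (prod_mono hχs hθs)
        intro p hp
        have hp' : χ p.1 * θ p.2 ≠ 0 := hp
        exact ⟨subset_tsupport _ (left_ne_zero_of_mul hp'), subset_tsupport _ (right_ne_zero_of_mul hp')⟩)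
    have hfd : ∀ p : ℝ × ℝ, fderiv ℝ (fun p : ℝ × ℝ => χ p.1 * θ p.2) p (0, 1) = χ p.1 * deriv θ p.2 := by
      intro p
      have h1 : HasFDerivAt (fun p : ℝ × ℝ => χ p.1 * θ p.2) _ p :=
        (((hχ.differentiable (by simp)) p.1).hasFDerivAt.comp p hasFDerivAt_fst).mul
          (((hθ.differentiable (by simp)) p.2).hasFDerivAt.comp p hasFDerivAt_snd)
      rw [h1.fderiv]
      simp
    simp only [hfd] at key
    have i1 : Integrable (fun p : ℝ × ℝ => (V p.2).ext p.1 * (χ p.1 * deriv θ p.2))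
        ((volume.restrict (Ioo (0 : ℝ) 1)).prod (volume.restrict (Ioo (0 : ℝ) τ))) := by
      rw [← volume_restrict_rectangle]
      refine IntegrableOn.mono_set (ContinuousOn.integrableOn_compact (isCompact_Icc.prod isCompact_Icc)
        (hVc.mul ?_)) (prod_mono Ioo_subset_Icc_self Ioo_subset_Icc_self)
      exact ((hχ.continuous.comp continuous_fst).mul (hθ'.comp continuous_snd)).continuousOn
    have i2 : Integrable (fun p : ℝ × ℝ => vt p.1 p.2 * (χ p.1 * θ p.2))
        ((volume.restrict (Ioo (0 : ℝ) 1)).prod (volume.restrict (Ioo (0 : ℝ) τ))) := by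
      refine (hiχ.mul_bdd (hθ.continuous.comp continuous_snd).aestronglyMeasurable
        (.of_forall fun p => hD p.2)).congr (.of_forall fun p => ?_)
      simp only [Function.comp_apply]; ring
    rw [volume_restrict_rectangle, integral_prod_symm _ i1, integral_prod_symm _ i2] at key
    calc _ = ∫ t in Ioo (0 : ℝ) τ, ∫ y in Ioo (0 : ℝ) 1, (V t).ext y * (χ y * deriv θ t) := by
          refine integral_congr_ae (.of_forall fun t => ?_)
          simp only [← mul_assoc]
          rw [integral_mul_const]
      _ = _ := key
      _ = _ := by
          congr 1
          refine integral_congr_ae (.of_forall fun t => ?_)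
          simp only [← mul_assoc]
          rw [integral_mul_const]
  -- the identity almost everywhere, at a fixed time
  have hfix : ∀ t ∈ Icc 0 τ, ∀ᵐ y ∂(volume.restrict (Ioo (0 : ℝ) 1)),
      (V t).ext y = (V 0).ext y + ∫ r in (0 : ℝ)..t, vt y r := by
    intro t ht
    have hit : Integrable (fun p : ℝ × ℝ => vt p.1 p.2)
        ((volume.restrict (Ioo (0 : ℝ) 1)).prod (volume.restrict (Ioo (0 : ℝ) t))) := by
      rw [← volume_restrict_rectangle]
      exact hvt.mono_set (prod_mono le_rfl (Ioo_subset_Ioo le_rfl ht.2))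
    have hI : ∀ f : ℝ → ℝ, ∫ r in (0 : ℝ)..t, f r = ∫ r in Ioo 0 t, f r := fun f => by
      rw [intervalIntegral.integral_of_le ht.1, integral_Ioc_eq_integral_Ioo]
    have e1 : IntegrableOn (fun y => (V t).ext y - (V 0).ext y) (Ioo 0 1) :=
      (((V t).continuous_ext.sub (V 0).continuous_ext).integrableOn_Icc).mono_set Ioo_subset_Icc_self
    have e2 : IntegrableOn (fun y => ∫ r in Ioo 0 t, vt y r) (Ioo 0 1) := hit.integral_prod_left
    have e3 : IntegrableOn (fun y => (V t).ext y - (V 0).ext y - ∫ r in Ioo 0 t, vt y r) (Ioo 0 1) :=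
      e1.sub e2
    have h0 := isOpen_Ioo.ae_eq_zero_of_integral_contDiff_smul_eq_zero
      (e3.locallyIntegrableOn) fun χ hχ hχc hχs => by
        have hout : ∀ y, y ∉ Ioo (0 : ℝ) 1 →
            χ y • ((V t).ext y - (V 0).ext y - ∫ r in Ioo 0 t, vt y r) = 0 := fun y hy => by
          rw [image_eq_zero_of_notMem_tsupport fun h => hy (hχs h), zero_smul]
        rw [← setIntegral_eq_integral_of_forall_compl_eq_zero hout]
        have h1 := htest χ hχ hχc hχs t ht
        obtain ⟨C, hC⟩ := hχc.exists_bound_of_continuous hχ.continuous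
        have hiχ : Integrable (fun p : ℝ × ℝ => vt p.1 p.2 * χ p.1)
            ((volume.restrict (Ioo (0 : ℝ) 1)).prod (volume.restrict (Ioo (0 : ℝ) t))) :=
          hit.mul_bdd (hχ.continuous.comp continuous_fst).aestronglyMeasurable
            (.of_forall fun p => hC p.1)
        have h2 := integral_integral_swap (f := fun y r => vt y r * χ y) hiχ
        rw [hI, ← h2] at h1
        simp only [integral_mul_const] at h1
        have j : ∀ s, IntegrableOn (fun y => (V s).ext y * χ y) (Ioo 0 1) := fun s =>
          ((V s).continuous_ext.mul hχ.continuous).integrableOn_Icc.mono_set Ioo_subset_Icc_self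
        have j' : IntegrableOn (fun y => (∫ r in Ioo 0 t, vt y r) * χ y) (Ioo 0 1) :=
          Integrable.mul_bdd e2 hχ.continuous.aestronglyMeasurable (.of_forall hC)
        have j'' : IntegrableOn (fun y => (V t).ext y * χ y - (V 0).ext y * χ y) (Ioo 0 1) :=
          (j t).sub (j 0)
        calc _ = ∫ y in Ioo (0 : ℝ) 1, ((V t).ext y * χ y - (V 0).ext y * χ y
              - (∫ r in Ioo 0 t, vt y r) * χ y) := by
              refine integral_congr_ae (.of_forall fun y => ?_)
              simp only [smul_eq_mul]; ring
          _ = 0 := by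
              rw [integral_sub j'' j', integral_sub (j t) (j 0), h1]; ring
    rw [ae_restrict_iff' measurableSet_Ioo]
    filter_upwards [h0] with y hy hy'
    rw [hI]
    linarith [hy hy']
  -- The exceptional null set at a fixed time depends on that time. Taking rational times makes it
  -- countable in number, and continuity in t of both sides then extends the identity to all times.
  have hrat : ∀ᵐ y ∂(volume.restrict (Ioo (0 : ℝ) 1)), ∀ q : ℚ, (q : ℝ) ∈ Icc 0 τ →
      (V q).ext y = (V 0).ext y + ∫ r in (0 : ℝ)..q, vt y r :=
    ae_all_iff.2 fun q => by
      by_cases hq : (q : ℝ) ∈ Icc 0 τ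
      · filter_upwards [hfix q hq] with y hy _ using hy
      · exact .of_forall fun y h => absurd h hq
  filter_upwards [hrat, hvt'.prod_right_ae] with y hy hi
  refine ⟨hi, ?_⟩
  have hii : IntervalIntegrable (fun r => vt y r) volume 0 τ :=
    (intervalIntegrable_iff_integrableOn_Ioo_of_le hτ.le).2 hi
  have c1 : ContinuousOn (fun t => (V t).ext y - ((V 0).ext y + ∫ r in (0 : ℝ)..t, vt y r)) (Icc 0 τ) := by
    have h1 : ContinuousOn (fun t => (V t).ext y) (Icc 0 τ) :=
      (ContinuousMap.evalCLM ℝ (unitProj y)).continuous.comp_continuousOn hV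
    have h2 := intervalIntegral.continuousOn_primitive_interval' hii left_mem_uIcc
    rw [uIcc_of_le hτ.le] at h2
    exact h1.sub (continuousOn_const.add h2)
  have hcl : Icc 0 τ ⊆ closure (Icc 0 τ ∩ range ((↑) : ℚ → ℝ)) := by
    have h1 : Ioo 0 τ ⊆ closure (Ioo 0 τ ∩ range ((↑) : ℚ → ℝ)) :=
      Rat.denseRange_cast.open_subset_closure_inter isOpen_Ioo
    rw [← closure_Ioo hτ.ne]
    refine (closure_mono h1).trans ?_
    rw [closure_closure, closure_Ioo hτ.ne]
    exact closure_mono (inter_subset_inter_left _ Ioo_subset_Icc_self)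
  have h3 : EqOn (fun t => (V t).ext y - ((V 0).ext y + ∫ r in (0 : ℝ)..t, vt y r)) (fun _ => 0)
      (Icc 0 τ) := by
    refine EqOn.of_subset_closure (s := Icc 0 τ ∩ range ((↑) : ℚ → ℝ)) ?_ c1 continuousOn_const
      inter_subset_left hcl
    rintro _ ⟨h4, q, rfl⟩
    exact sub_eq_zero.2 (hy q h4)
  exact fun t ht => sub_eq_zero.1 (h3 ht)

/-! ### The adjoint transformation and uniqueness -/

/-- The integral `∫_y^1 κ(x,y) C(x) dx` as a functional of the kernel `κ`. -/
theorem exists_adjoint_functional {C : ℝ → ℝ} (hC : Continuous C) (y : ℝ) :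
    ∃ L : KernelFun →L[ℝ] ℝ, ∀ κ, L κ = ∫ x in y..1, κ.ext x y * C x := by
  have hi : ∀ κ : KernelFun, Continuous fun x => κ.ext x y * C x := fun κ =>
    (κ.continuous_ext.comp (Continuous.prodMk_left y)).mul hC
  refine ⟨LinearMap.mkContinuous
    { toFun := fun κ => ∫ x in y..1, κ.ext x y * C x
      map_add' := fun κ κ' => ?_
      map_smul' := fun r κ => ?_ } (abs (∫ x in y..1, |C x|)) fun κ => ?_, fun κ => rfl⟩
  · rw [← intervalIntegral.integral_add ((hi κ).intervalIntegrable _ _)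
      ((hi κ').intervalIntegrable _ _)]
    congr 1; ext x
    simp only [KernelFun.ext, ContinuousMap.add_apply]; ring
  · rw [RingHom.id_apply, smul_eq_mul, ← intervalIntegral.integral_const_mul]
    congr 1; ext x
    simp only [KernelFun.ext, ContinuousMap.smul_apply, smul_eq_mul]; ring
  · refine (intervalIntegral.norm_integral_le_abs_of_norm_le (g := fun x => ‖κ‖ * |C x|)
      (.of_forall fun x => ?_) ((continuous_const.mul hC.abs).intervalIntegrable _ _)).trans (le_of_eq ?_)
    · rw [norm_mul]
      exact mul_le_mul_of_nonneg_right (κ.abs_ext_le x y) (norm_nonneg _)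
    · rw [intervalIntegral.integral_const_mul, abs_mul, abs_of_nonneg (norm_nonneg _), mul_comm]

theorem continuous_adjoint {K : ℝ → KernelFun} (hK : Continuous K) {C : ℝ → ℝ} (hC : Continuous C) :
    Continuous (Function.uncurry fun y t => ∫ x in y..1, (K t).ext x y * C x) := by
  have hKc : Continuous fun p : (ℝ × ℝ) × ℝ => (K p.1.2).ext p.2 p.1.1 * C p.2 := by
    refine Continuous.mul (ContinuousEval.continuous_eval.comp
      (f := fun p : (ℝ × ℝ) × ℝ => (K p.1.2, (unitProj p.2, unitProj p.1.1))) ?_) (hC.comp continuous_snd)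
    have := continuous_unitProj
    fun_prop
  have h := intervalIntegral.continuous_parametric_intervalIntegral_of_continuous (μ := volume)
    (f := fun p : ℝ × ℝ => fun x => (K p.2).ext x p.1 * C x) (a₀ := 1) (s := fun p => p.1)
    hKc continuous_fst
  have e : (Function.uncurry fun y t => ∫ x in y..1, (K t).ext x y * C x)
      = fun p : ℝ × ℝ => -∫ x in (1 : ℝ)..p.1, (K p.2).ext x p.1 * C x := by
    ext p
    rw [← intervalIntegral.integral_symm]; rfl
  rw [e]
  exact h.neg

/-- Transposition of `1 + K` on `[0,1]`. -/
theorem integral_mul_adjoint (κ : KernelFun) {C q : ℝ → ℝ} (hC : Continuous C)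
    (hq : IntervalIntegrable q volume 0 1) :
    ∫ y in (0 : ℝ)..1, q y * ∫ x in y..1, κ.ext x y * C x
      = ∫ x in (0 : ℝ)..1, C x * ∫ y in (0 : ℝ)..x, κ.ext x y * q y := by
  have hq' : IntegrableOn q (Ioc 0 1) := (intervalIntegrable_iff_integrableOn_Ioc_of_le zero_le_one).1 hq
  have hh : Continuous (Function.uncurry fun x y => κ.ext x y * C x) :=
    κ.continuous_ext.mul (hC.comp continuous_fst)
  have h := integral_triangle_swap (h := fun x y => κ.ext x y * C x * q y) zero_le_one
    (integrable_prod_of_continuous_mul hh hq')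
  calc _ = ∫ y in (0 : ℝ)..1, ∫ x in y..1, κ.ext x y * C x * q y := by
        refine intervalIntegral.integral_congr fun y _ => ?_
        simp only [intervalIntegral.integral_mul_const]
        ring
    _ = _ := h
    _ = _ := by
        refine intervalIntegral.integral_congr fun x _ => ?_
        rw [← intervalIntegral.integral_const_mul]
        congr 1; ext y; ring

/-- The pairing of a solution with a kernel-transformed test function, differentiated in time. -/
theorem pairing_eq_primitive {V : ℝ → UnitFun} {vt : ℝ → ℝ → ℝ} {τ : ℝ}
    (hV : ContinuousOn V (Icc 0 τ))
    (hvt : IntegrableOn (fun p : ℝ × ℝ => vt p.1 p.2) (Ioo (0 : ℝ) 1 ×ˢ Ioo (0 : ℝ) τ))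
    (hae : ∀ᵐ y ∂(volume.restrict (Ioo (0 : ℝ) 1)), IntegrableOn (fun r => vt y r) (Ioo 0 τ) ∧
      ∀ t ∈ Icc 0 τ, (V t).ext y = (V 0).ext y + ∫ r in (0 : ℝ)..t, vt y r)
    {ψ ψt : ℝ → ℝ → ℝ} (hψ : Continuous (Function.uncurry ψ)) (hψt : Continuous (Function.uncurry ψt))
    (hprim : ∀ y, ∀ t ∈ Icc 0 τ, ψ y t = ψ y 0 + ∫ r in (0 : ℝ)..t, ψt y r) :
    IntegrableOn (fun r => ∫ y in Ioo (0 : ℝ) 1, (vt y r * ψ y r + (V r).ext y * ψt y r)) (Ioo 0 τ) ∧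
    ∀ t ∈ Icc 0 τ, ∫ y in Ioo (0 : ℝ) 1, (V t).ext y * ψ y t
      = (∫ y in Ioo (0 : ℝ) 1, (V 0).ext y * ψ y 0)
        + ∫ r in (0 : ℝ)..t, ∫ y in Ioo (0 : ℝ) 1, (vt y r * ψ y r + (V r).ext y * ψt y r) := by
  have hVc := continuousOn_uncurry_ext hV (Icc 0 1)
  have hi : IntegrableOn (fun p : ℝ × ℝ => vt p.1 p.2 * ψ p.1 p.2 + (V p.2).ext p.1 * ψt p.1 p.2)
      (Ioo (0 : ℝ) 1 ×ˢ Ioo (0 : ℝ) τ) := by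
    refine Integrable.add ?_ ?_
    · obtain ⟨C, hC⟩ := (isCompact_Icc.prod isCompact_Icc :
        IsCompact (Icc (0 : ℝ) 1 ×ˢ Icc (0 : ℝ) τ)).exists_bound_of_continuousOn hψ.continuousOn
      refine Integrable.mul_bdd (c := C) hvt hψ.aestronglyMeasurable ?_
      filter_upwards [ae_restrict_mem (measurableSet_Ioo.prod measurableSet_Ioo)] with p hp
      exact hC p ⟨Ioo_subset_Icc_self hp.1, Ioo_subset_Icc_self hp.2⟩
    · exact ((hVc.mul hψt.continuousOn).integrableOn_compact (isCompact_Icc.prod isCompact_Icc)).mono_set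
        (prod_mono Ioo_subset_Icc_self Ioo_subset_Icc_self)
  have hi' : ∀ t ≤ τ, Integrable
      (Function.uncurry fun y r => vt y r * ψ y r + (V r).ext y * ψt y r)
      ((volume.restrict (Ioo (0 : ℝ) 1)).prod (volume.restrict (Ioo (0 : ℝ) t))) := fun t ht => by
    rw [← volume_restrict_rectangle]
    exact hi.mono_set (prod_mono le_rfl (Ioo_subset_Ioo le_rfl ht))
  refine ⟨(hi' τ le_rfl).integral_prod_right, fun t ht => ?_⟩
  have hI : ∀ f : ℝ → ℝ, ∫ r in (0 : ℝ)..t, f r = ∫ r in Ioo 0 t, f r := fun f => by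
    rw [intervalIntegral.integral_of_le ht.1, integral_Ioc_eq_integral_Ioo]
  rw [hI, ← integral_integral_swap (hi' t ht.2)]
  have j : ∀ s, IntegrableOn (fun y => (V s).ext y * ψ y s) (Ioo 0 1) := fun s =>
    ((V s).continuous_ext.mul (hψ.comp (Continuous.prodMk_left s))).integrableOn_Icc.mono_set
      Ioo_subset_Icc_self
  have jF : IntegrableOn (fun y => ∫ r in Ioo 0 t, (vt y r * ψ y r + (V r).ext y * ψt y r)) (Ioo 0 1) :=
    (hi' t ht.2).integral_prod_left
  rw [← integral_add (j 0) jF]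
  refine integral_congr_ae ?_
  filter_upwards [hae] with y hy
  have hp : IntervalIntegrable (fun r => vt y r) volume 0 t :=
    (intervalIntegrable_iff_integrableOn_Ioo_of_le ht.1).2 (hy.1.mono_set (Ioo_subset_Ioo le_rfl ht.2))
  have hq : IntervalIntegrable (fun r => ψt y r) volume 0 t :=
    (hψt.comp (Continuous.prodMk_right y)).intervalIntegrable _ _
  -- For almost every `y` both factors are primitives in time, so the product rule holds pointwise
  -- in y and is then integrated over y.
  have key := primitive_mul_primitive ((V 0).ext y) (ψ y 0) hp hq
  rw [← hy.2 t ht, ← hprim y t ht, hI] at key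
  rw [sub_eq_iff_eq_add.1 key, add_comm]
  congr 1
  refine setIntegral_congr_fun measurableSet_Ioo fun r hr => ?_
  have hr' : r ∈ Icc 0 τ := ⟨hr.1.le, hr.2.le.trans ht.2⟩
  rw [← hy.2 r hr', ← hprim y r hr']

/-- A continuous function with `Z(t) = Z(0) - μ ∫₀ᵗ Z`. -/
theorem eq_exp_of_eq_integral {Z : ℝ → ℝ} {τ μ : ℝ} (hZ : ContinuousOn Z (Icc 0 τ))
    (h : ∀ t ∈ Icc 0 τ, Z t = Z 0 + ∫ r in (0 : ℝ)..t, -μ * Z r) :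
    ∀ t ∈ Icc 0 τ, Z t = Z 0 * Real.exp (-μ * t) := by
  -- The integrating factor e^{μt} reduces the equation to a function with vanishing right
  -- derivative.
  have hc : ContinuousOn (fun t => Real.exp (μ * t) * Z t) (Icc 0 τ) :=
    ContinuousOn.mul (by fun_prop) hZ
  have key := constant_of_has_deriv_right_zero hc fun t ht => by
    have hs : IntervalIntegrable (fun r => -μ * Z r) volume 0 t :=
      ((continuousOn_const.mul hZ).mono (by
        rw [uIcc_of_le ht.1]; exact Icc_subset_Icc le_rfl ht.2.le)).intervalIntegrable
    have hmem : Icc 0 τ ∈ 𝓝[Ioi t] t :=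
      mem_of_superset (Ioo_mem_nhdsGT ht.2) fun s hs => ⟨ht.1.trans hs.1.le, hs.2.le⟩
    have hmeas : StronglyMeasurableAtFilter (fun r => -μ * Z r) (𝓝[Ioi t] t) :=
      ⟨Icc 0 τ, hmem, (continuousOn_const.mul hZ).aestronglyMeasurable measurableSet_Icc⟩
    have hct : ContinuousWithinAt (fun r => -μ * Z r) (Ioi t) t :=
      ((continuousOn_const.mul hZ) t ⟨ht.1, ht.2.le⟩).mono_of_mem_nhdsWithin hmem
    have h1 : HasDerivWithinAt (fun t => Z 0 + ∫ r in (0 : ℝ)..t, -μ * Z r) (-μ * Z t) (Ici t) t :=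
      (intervalIntegral.integral_hasDerivWithinAt_right hs hmeas hct).const_add _
    have h2 : HasDerivWithinAt Z (-μ * Z t) (Ici t) t := by
      refine h1.congr_of_eventuallyEq ?_ (h t ⟨ht.1, ht.2.le⟩)
      filter_upwards [Icc_mem_nhdsGE ht.2] with s hs using h s ⟨ht.1.trans hs.1, hs.2⟩
    have h3 : HasDerivWithinAt (fun t => Real.exp (μ * t)) (Real.exp (μ * t) * μ) (Ici t) t := by
      have := ((hasDerivAt_id t).const_mul μ).exp
      simpa using this.hasDerivWithinAt
    exact (h3.fun_mul h2).congr_deriv (by ring)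
  intro t ht
  have h1 := key t ht
  simp only [mul_zero, Real.exp_zero, one_mul] at h1
  rw [← h1, neg_mul, Real.exp_neg]
  field_simp

/-- The weak form, at a fixed time, of the equation `z_t = z_xx - λ z` for `z = f + K f`, tested with
a cosine. -/
theorem pairing_identity {κ κx κy κt : KernelFun} {A : UnitFun} {lam ν : ℝ}
    (S : SpaceKernel κ.ext κx.ext κy.ext (fun x y => κt.ext x y + (A.ext y + lam) * κ.ext x y)
      (fun x => A.ext x + lam)) {f p : UnitFun} {g q : ℝ → ℝ}
    (hfp : ∀ x ∈ Icc (0 : ℝ) 1, f.ext x = f.ext 0 + ∫ y in (0 : ℝ)..x, p.ext y)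
    (hg : IntervalIntegrable g volume 0 1)
    (hpg : ∀ x ∈ Icc (0 : ℝ) 1, p.ext x = ∫ y in (0 : ℝ)..x, g y)
    (hq : ∀ᵐ x ∂(volume.restrict (Ioo (0 : ℝ) 1)), q x = g x + A.ext x * f.ext x)
    (hbc : (p + kernelGrad κ κx f).ext 1 * Real.cos ν
      + ν * ((f + volterra κ f).ext 1 * Real.sin ν) = 0) :
    ∫ y in Ioo (0 : ℝ) 1, (q y * (Real.cos (ν * y) + ∫ x in y..1, κ.ext x y * Real.cos (ν * x))
        + f.ext y * ∫ x in y..1, κt.ext x y * Real.cos (ν * x))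
      = -(lam + ν ^ 2) * ∫ y in Ioo (0 : ℝ) 1,
          f.ext y * (Real.cos (ν * y) + ∫ x in y..1, κ.ext x y * Real.cos (ν * x)) := by
  set C : ℝ → ℝ := fun x => Real.cos (ν * x) with hCdef
  have hC : Continuous C := by fun_prop
  have hqe : ∀ᵐ x, x ∈ Ioc (0 : ℝ) 1 → q x = g x + A.ext x * f.ext x :=
    (ae_restrict_iff' measurableSet_Ioc).1 (by rw [← Measure.restrict_congr_set Ioo_ae_eq_Ioc]; exact hq)
  set q' : ℝ → ℝ := fun x => g x + A.ext x * f.ext x with hq'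
  have hAf : Continuous fun x => A.ext x * f.ext x := A.continuous_ext.mul f.continuous_ext
  have hiq : IntervalIntegrable q' volume 0 1 := hg.add (hAf.intervalIntegrable _ _)
  have hif : IntervalIntegrable f.ext volume 0 1 := f.continuous_ext.intervalIntegrable _ _
  have hsub : ∀ x ∈ Icc (0 : ℝ) 1, uIcc 0 x ⊆ uIcc 0 1 := fun x hx => by
    rw [uIcc_of_le hx.1, uIcc_of_le zero_le_one]; exact Icc_subset_Icc le_rfl hx.2
  have hadj : ∀ K : KernelFun, Continuous fun y => ∫ x in y..1, K.ext x y * C x := fun K =>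
    (continuous_adjoint (K := fun _ => K) continuous_const hC).comp (Continuous.prodMk_left (0 : ℝ))
  have hcI : ∀ (K : KernelFun) {h : ℝ → ℝ}, Continuous h →
      Continuous fun x => ∫ y in (0 : ℝ)..x, K.ext x y * h y := fun K h hh =>
    continuous_intervalIntegral_param (K.continuous_ext.mul (hh.comp continuous_snd))
  -- `m` is ∫₀ˢ k g with the merely integrable g = u_xx moved off by parts. In this form it is
  -- continuous and cancels against the same terms in the second derivative of Kf.
  set m : ℝ → ℝ := fun s => κ.ext s s * p.ext s - ∫ y in (0 : ℝ)..s, κy.ext s y * p.ext y with hm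
  set n₁ : ℝ → ℝ := fun s => ∫ y in (0 : ℝ)..s, κt.ext s y * f.ext y with hn₁
  set n₂ : ℝ → ℝ := fun s => ∫ y in (0 : ℝ)..s, κ.ext s y * (A.ext y * f.ext y) with hn₂
  set n₃ : ℝ → ℝ := fun s => ∫ y in (0 : ℝ)..s, κ.ext s y * f.ext y with hn₃
  have cm : Continuous m := ((κ.diag.continuous_ext).mul p.continuous_ext).sub
    (hcI κy p.continuous_ext)
  have c₁ : Continuous n₁ := hcI κt f.continuous_ext
  have c₂ : Continuous n₂ := hcI κ hAf
  have c₃ : Continuous n₃ := hcI κ f.continuous_ext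
  have hmg : ∀ s ∈ Icc (0 : ℝ) 1, ∫ y in (0 : ℝ)..s, κ.ext s y * g y = m s := by
    intro s hs
    have h3 := S.integral_ky_mul_primitive hs.1 hs.2 0 (hg.mono_set (hsub s hs))
    rw [zero_add, ← hpg s hs, mul_zero, sub_zero, intervalIntegral.integral_congr
      (g := fun y => κy.ext s y * p.ext y)] at h3
    · rw [hm]; simp only [h3]; ring
    · intro y hy
      rw [uIcc_of_le hs.1] at hy
      simp only
      rw [zero_add, ← hpg y ⟨hy.1, hy.2.trans hs.2⟩]
  have hκq : ∀ s ∈ Icc (0 : ℝ) 1, ∫ y in (0 : ℝ)..s, κ.ext s y * q' y = m s + n₂ s := by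
    intro s hs
    have hκs := continuous_uncurry_apply κ.continuous_ext s
    have i1 : IntervalIntegrable (fun y => κ.ext s y * g y) volume 0 s :=
      (hg.mono_set (hsub s hs)).continuousOn_mul hκs.continuousOn
    have i2 : Continuous fun y => κ.ext s y * (A.ext y * f.ext y) := hκs.mul hAf
    rw [← hmg s hs, hn₂]
    simp only
    rw [← intervalIntegral.integral_add i1 (i2.intervalIntegrable _ _)]
    congr 1; ext y; rw [hq']; ring
  -- `w` is the second derivative of z = f + Kf, integrable because `g` is and everything else is
  -- continuous.
  set w : ℝ → ℝ := fun s => g s + ((A.ext s + lam) * f.ext s + (n₁ s + n₂ s + lam * n₃ s) + m s) with hw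
  have hAlf : Continuous fun s => (A.ext s + lam) * f.ext s :=
    (A.continuous_ext.add continuous_const).mul f.continuous_ext
  have cw : Continuous fun s => (A.ext s + lam) * f.ext s + (n₁ s + n₂ s + lam * n₃ s) + m s :=
    (hAlf.add ((c₁.add c₂).add (continuous_const.mul c₃))).add cm
  have hiw : IntervalIntegrable w volume 0 1 := hg.add (cw.intervalIntegrable _ _)
  have hzx : ∀ x ∈ Icc (0 : ℝ) 1, (p + kernelGrad κ κx f).ext x = ∫ y in (0 : ℝ)..x, w y := by
    intro x hx
    have e1 : (p + kernelGrad κ κx f).ext x = p.ext x + (kernelGrad κ κx f).ext x := rfl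
    rw [e1, kernelGrad_ext _ _ _ hx, S.deriv_integral_kernel_mul f.continuous_ext p.continuous_ext
      hfp hx.1 hx.2, hpg x hx, hw, intervalIntegral.integral_add (hg.mono_set (hsub x hx))
      (cw.intervalIntegrable _ _)]
    congr 2
    ext s
    have hκs := continuous_uncurry_apply κ.continuous_ext s
    have hκts := continuous_uncurry_apply κt.continuous_ext s
    have e2 : ∫ y in (0 : ℝ)..s, (κt.ext s y + (A.ext y + lam) * κ.ext s y) * f.ext y
        = n₁ s + n₂ s + lam * n₃ s := by
      have i1 : Continuous fun y => κt.ext s y * f.ext y := hκts.mul f.continuous_ext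
      have i2 : Continuous fun y => κ.ext s y * (A.ext y * f.ext y) := hκs.mul hAf
      have i3 : Continuous fun y => lam * (κ.ext s y * f.ext y) :=
        continuous_const.mul (hκs.mul f.continuous_ext)
      simp only [hn₁, hn₂, hn₃]
      rw [← intervalIntegral.integral_const_mul,
        ← intervalIntegral.integral_add (i1.intervalIntegrable _ _) (i2.intervalIntegrable _ _),
        ← intervalIntegral.integral_add ((i1.fun_add i2).intervalIntegrable _ _)
          (i3.intervalIntegrable _ _)]
      congr 1; ext y; ring
    rw [e2, hm]; ring
  have hz := ((hasH1Deriv_of_eq_primitive (UnitFun.memLp_ext p) hfp).add_volterra S).eq_primitive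
  have hzf : ∀ x ∈ Icc (0 : ℝ) 1, (f + volterra κ f).ext x = f.ext x + n₃ x := fun x hx => by
    rw [hn₃]; simp only [← volterra_ext κ f hx]; rfl
  -- the left and the right hand side in terms of the transformed function
  have hP : ∫ y in (0 : ℝ)..1, f.ext y * (C y + ∫ x in y..1, κ.ext x y * C x)
      = ∫ x in (0 : ℝ)..1, C x * (f.ext x + n₃ x) := by
    have h1 := integral_mul_adjoint κ hC hif
    simp only [mul_add]
    rw [intervalIntegral.integral_add ((f.continuous_ext.fun_mul hC).intervalIntegrable _ _)
      ((f.continuous_ext.fun_mul (hadj κ)).intervalIntegrable _ _), h1,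
      intervalIntegral.integral_add ((hC.fun_mul f.continuous_ext).intervalIntegrable _ _)
      ((hC.fun_mul c₃).intervalIntegrable _ _)]
    simp only [mul_comm, hn₃]
  have hL : ∫ y in (0 : ℝ)..1, (q' y * (C y + ∫ x in y..1, κ.ext x y * C x)
      + f.ext y * ∫ x in y..1, κt.ext x y * C x)
      = ∫ x in (0 : ℝ)..1, C x * (q' x + (m x + n₂ x) + n₁ x) := by
    have h1 := integral_mul_adjoint κ hC hiq
    have h2 := integral_mul_adjoint κt hC hif
    have h3 : ∫ x in (0 : ℝ)..1, C x * ∫ y in (0 : ℝ)..x, κ.ext x y * q' y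
        = ∫ x in (0 : ℝ)..1, C x * (m x + n₂ x) := by
      refine intervalIntegral.integral_congr fun x hx => ?_
      rw [uIcc_of_le zero_le_one] at hx
      rw [hκq x hx]
    simp only [mul_add (q' _)]
    have j1 : IntervalIntegrable (fun y => q' y * C y) volume 0 1 := hiq.mul_continuousOn hC.continuousOn
    have j2 : IntervalIntegrable (fun y => q' y * ∫ x in y..1, κ.ext x y * C x) volume 0 1 :=
      hiq.mul_continuousOn (hadj κ).continuousOn
    have j12 : IntervalIntegrable (fun y => q' y * C y + q' y * ∫ x in y..1, κ.ext x y * C x) volume 0 1 :=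
      j1.add j2
    have j3 := (f.continuous_ext.fun_mul (hadj κt)).intervalIntegrable (μ := volume) 0 1
    have j4 : IntervalIntegrable (fun y => C y * q' y) volume 0 1 := hiq.continuousOn_mul hC.continuousOn
    have j5 := (hC.fun_mul (cm.fun_add c₂)).intervalIntegrable (μ := volume) 0 1
    have j45 : IntervalIntegrable (fun y => C y * q' y + C y * (m y + n₂ y)) volume 0 1 := j4.add j5
    have j6 := (hC.fun_mul c₁).intervalIntegrable (μ := volume) 0 1
    rw [intervalIntegral.integral_add j12 j3, intervalIntegral.integral_add j1 j2, h1, h2, h3]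
    simp only [mul_add (C _) _ (n₁ _), mul_add (C _) (q' _)]
    rw [intervalIntegral.integral_add j45 j6, intervalIntegral.integral_add j4 j5]
    simp only [mul_comm, hn₁]
  have hLw : (∫ x in (0 : ℝ)..1, C x * (q' x + (m x + n₂ x) + n₁ x))
      + lam * (∫ x in (0 : ℝ)..1, C x * (f.ext x + n₃ x)) = ∫ x in (0 : ℝ)..1, w x * C x := by
    have j1 : IntervalIntegrable (fun x => C x * (q' x + (m x + n₂ x) + n₁ x)) volume 0 1 :=
      ((hiq.add ((cm.add c₂).intervalIntegrable _ _)).add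
        (c₁.intervalIntegrable _ _)).continuousOn_mul hC.continuousOn
    have j2 : Continuous fun x => lam * (C x * (f.ext x + n₃ x)) :=
      continuous_const.mul (hC.mul (f.continuous_ext.add c₃))
    rw [← intervalIntegral.integral_const_mul, ← intervalIntegral.integral_add j1
      (j2.intervalIntegrable _ _)]
    congr 1; ext x
    rw [hw, hq']; ring
  -- two integrations by parts
  have hcos : ∀ s, 1 + ∫ r in (0 : ℝ)..s, -(ν * Real.sin (ν * r)) = C s := fun s => by
    rw [intervalIntegral.integral_eq_sub_of_hasDerivAt
      (fun x _ => CosModes.hasDerivAt_cos_mul ν x) (Continuous.intervalIntegrable (by fun_prop) _ _)]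
    simp [hCdef]
  have hsin : ∀ s, 0 + ∫ r in (0 : ℝ)..s, ν * Real.cos (ν * r) = Real.sin (ν * s) := fun s => by
    rw [intervalIntegral.integral_eq_sub_of_hasDerivAt
      (fun x _ => CosModes.hasDerivAt_sin_mul ν x) (Continuous.intervalIntegrable (by fun_prop) _ _)]
    simp
  set zx := (p + kernelGrad κ κx f).ext with hzxdef
  have czx : Continuous zx := UnitFun.continuous_ext _
  have hz' : ∀ x ∈ Icc (0 : ℝ) 1, (f + volterra κ f).ext x
      = (f + volterra κ f).ext 0 + ∫ s in (0 : ℝ)..x, zx s := hz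
  have k1 := primitive_mul_primitive 0 1 hiw
    (Continuous.intervalIntegrable (u := fun r => -(ν * Real.sin (ν * r))) (by fun_prop) 0 1)
  have k2 := primitive_mul_primitive ((f + volterra κ f).ext 0) 0
    (czx.intervalIntegrable (μ := volume) 0 1)
    (Continuous.intervalIntegrable (u := fun r => ν * Real.cos (ν * r)) (by fun_prop) 0 1)
  rw [hcos, zero_add, ← hzx 1 (by simp), zero_mul, sub_zero,
    intervalIntegral.integral_congr (g := fun s => w s * C s - ν * (zx s * Real.sin (ν * s)))
    (fun s hs => by
      rw [uIcc_of_le zero_le_one] at hs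
      simp only
      rw [hcos, zero_add, ← hzx s hs]; ring),
    intervalIntegral.integral_sub (hiw.mul_continuousOn hC.continuousOn)
      (Continuous.intervalIntegrable (by fun_prop) _ _), intervalIntegral.integral_const_mul] at k1
  rw [hsin, ← hz' 1 (by simp), mul_zero, sub_zero,
    intervalIntegral.integral_congr (g := fun s => zx s * Real.sin (ν * s) + ν * (C s * (f.ext s + n₃ s)))
    (fun s hs => by
      rw [uIcc_of_le zero_le_one] at hs
      simp only
      rw [hsin, ← hz' s hs, hzf s hs]; ring),
    intervalIntegral.integral_add (Continuous.intervalIntegrable (by fun_prop) _ _)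
      ((continuous_const.fun_mul (hC.fun_mul (f.continuous_ext.fun_add c₃))).intervalIntegrable _ _),
    intervalIntegral.integral_const_mul] at k2
  rw [setIntegral_Ioo_eq_intervalIntegral, setIntegral_Ioo_eq_intervalIntegral, hP]
  have hqq : ∫ y in (0 : ℝ)..1, (q y * (C y + ∫ x in y..1, κ.ext x y * C x)
      + f.ext y * ∫ x in y..1, κt.ext x y * C x)
      = ∫ y in (0 : ℝ)..1, (q' y * (C y + ∫ x in y..1, κ.ext x y * C x)
      + f.ext y * ∫ x in y..1, κt.ext x y * C x) := by
    refine intervalIntegral.integral_congr_ae ?_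
    filter_upwards [hqe] with y hy hy'
    rw [uIoc_of_le zero_le_one] at hy'
    rw [hy hy', hq']
  rw [hqq, hL]
  simp only [mul_one, hCdef] at k1 k2 hbc hLw ⊢
  -- `hLw` says that the left-hand side plus λ∫ z cos is ∫ w cos; `k1` and `k2` integrate by parts
  -- twice, giving −ν²∫ z cos and the boundary terms at x = 1, whose sum is zero by `hbc`.
  linear_combination hLw - k1 - ν * k2 + hbc

theorem integral_mul_test_add_adjoint (κ : KernelFun) (f : UnitFun) {C : ℝ → ℝ} (hC : Continuous C) :
    ∫ y in (0 : ℝ)..1, f.ext y * (C y + ∫ x in y..1, κ.ext x y * C x)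
      = ∫ x in (0 : ℝ)..1, (f + volterra κ f).ext x * C x := by
  have hadj : Continuous fun y => ∫ x in y..1, κ.ext x y * C x :=
    (continuous_adjoint (K := fun _ => κ) continuous_const hC).comp (Continuous.prodMk_left (0 : ℝ))
  have h1 := integral_mul_adjoint κ hC (f.continuous_ext.intervalIntegrable (μ := volume) 0 1)
  have h2 : ∫ x in (0 : ℝ)..1, C x * ∫ y in (0 : ℝ)..x, κ.ext x y * f.ext y
      = ∫ x in (0 : ℝ)..1, (volterra κ f).ext x * C x := by
    refine intervalIntegral.integral_congr fun x hx => ?_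
    rw [uIcc_of_le zero_le_one] at hx
    rw [volterra_ext _ _ hx, mul_comm]
  have e : ∀ x, (f + volterra κ f).ext x * C x = f.ext x * C x + (volterra κ f).ext x * C x :=
    fun x => add_mul _ _ _
  simp only [mul_add, e]
  rw [intervalIntegral.integral_add ((f.continuous_ext.fun_mul hC).intervalIntegrable _ _)
    ((f.continuous_ext.fun_mul hadj).intervalIntegrable _ _), h1, h2,
    intervalIntegral.integral_add ((f.continuous_ext.fun_mul hC).intervalIntegrable _ _)
      (((UnitFun.continuous_ext _).fun_mul hC).intervalIntegrable _ _)]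

section Uniqueness

variable {lam τ : ℝ} {A : ℝ → UnitFun} {κ κx κy κt : ℝ → KernelFun} {a : ℝ → ℝ → ℝ}
  {law : (ℝ → ℝ → ℝ) → (ℝ → ℝ → ℝ) → ℝ → Prop} {u₀ : ℝ → ℝ}

/-- The cosine coefficients of the transformed solution decay exponentially. -/
theorem TimeKernel.integral_mul_cos_eq (T : TimeKernel lam τ A κ κx κy κt) {ν : ℝ}
    {v vx vxx vt : ℝ → ℝ → ℝ} (hs : IsStrongSolutionWith a law u₀ τ v vx vxx vt)
    (ha : ∀ t ∈ Icc 0 τ, ∀ x ∈ Icc (0 : ℝ) 1, (A t).ext x = a x t) {V : ℝ → UnitFun}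
    (hV : ∀ t ∈ Icc (0 : ℝ) τ, ∀ x ∈ Icc (0 : ℝ) 1, (V t).ext x = v x t)
    (hbc : ∀ᵐ t ∂(volume.restrict (Ioo (0 : ℝ) τ)),
      (vx 1 t + (kernelGrad (κ t) (κx t) (V t)).ext 1) * Real.cos ν
        + ν * ((V t + volterra (κ t) (V t)).ext 1 * Real.sin ν) = 0) :
    ∀ t ∈ Icc 0 τ, ∫ x in (0 : ℝ)..1, (V t + volterra (κ t) (V t)).ext x * Real.cos (ν * x)
      = (∫ x in (0 : ℝ)..1, (V 0 + volterra (κ 0) (V 0)).ext x * Real.cos (ν * x))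
        * Real.exp (-(lam + ν ^ 2) * t) := by
  have hVc := continuousOn_of_tendsto_H1 hs.memH1 hs.continuous_H1 hV
  have hfin : IsFiniteMeasure ((volume : Measure (ℝ × ℝ)).restrict (Ioo (0 : ℝ) 1 ×ˢ Ioo (0 : ℝ) τ)) := by
    rw [volume_restrict_rectangle]; infer_instance
  have hvt : IntegrableOn (fun p : ℝ × ℝ => vt p.1 p.2) (Ioo (0 : ℝ) 1 ×ˢ Ioo (0 : ℝ) τ) :=
    hs.ut_memLp.integrable one_le_two
  have hae := ae_eq_primitive_of_weak_time_deriv T.pos hVc hvt fun φ hφ hφc hφs => by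
    rw [← hs.weak_time_deriv φ hφ hφc hφs]
    refine setIntegral_congr_fun (measurableSet_Ioo.prod measurableSet_Ioo) fun p hp => ?_
    rw [hV p.2 (Ioo_subset_Icc_self hp.2) p.1 (Ioo_subset_Icc_self hp.1)]
  set C : ℝ → ℝ := fun x => Real.cos (ν * x) with hCdef
  have hC : Continuous C := by fun_prop
  -- The test function is (1 + K(t))* applied to the cosine, so that ∫ vψ = ∫ (v + Kv) cos. It is C¹
  -- in time, and only v itself has to be differentiated weakly.
  set ψ : ℝ → ℝ → ℝ := fun y t => C y + ∫ x in y..1, (κ t).ext x y * C x with hψ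
  set ψt : ℝ → ℝ → ℝ := fun y t => ∫ x in y..1, (κt t).ext x y * C x with hψt
  have cψ : Continuous (Function.uncurry ψ) :=
    (hC.comp continuous_fst).add (continuous_adjoint T.cont hC)
  have cψt : Continuous (Function.uncurry ψt) := continuous_adjoint T.cont_t hC
  have hprim : ∀ y, ∀ t ∈ Icc 0 τ, ψ y t = ψ y 0 + ∫ r in (0 : ℝ)..t, ψt y r := by
    intro y t ht
    obtain ⟨L, hL⟩ := exists_adjoint_functional hC y
    have h1 := intervalIntegral.integral_eq_sub_of_hasDerivAt_of_le ht.1 (f := fun r => L (κ r))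
      (f' := fun r => L (κt r)) (L.continuous.comp T.cont).continuousOn
      (fun r hr => L.hasFDerivAt.comp_hasDerivAt r (T.hasDerivAt r ⟨hr.1, hr.2.trans_le ht.2⟩))
      ((L.continuous.comp T.cont_t).intervalIntegrable _ _)
    simp only [hL] at h1
    simp only [hψ, hψt, h1]
    ring
  obtain ⟨hYi, hY⟩ := pairing_eq_primitive hVc hvt hae cψ cψt hprim
  set Z : ℝ → ℝ := fun t => ∫ y in Ioo (0 : ℝ) 1, (V t).ext y * ψ y t with hZ
  set Y : ℝ → ℝ := fun r => ∫ y in Ioo (0 : ℝ) 1, (vt y r * ψ y r + (V r).ext y * ψt y r) with hYdef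
  have hZc : ContinuousOn Z (Icc 0 τ) := by
    have hii : IntervalIntegrable Y volume 0 τ :=
      (intervalIntegrable_iff_integrableOn_Ioo_of_le T.pos.le).2 hYi
    have h2 := intervalIntegral.continuousOn_primitive_interval' hii left_mem_uIcc
    rw [uIcc_of_le T.pos.le] at h2
    exact (continuousOn_const.add h2).congr hY
  have heq : ∀ᵐ r ∂(volume.restrict (Ioo (0 : ℝ) τ)), ∀ᵐ x ∂(volume.restrict (Ioo (0 : ℝ) 1)),
      vt x r = vxx x r + a x r * v x r := by
    have h1 := hs.equation
    rw [volume_restrict_rectangle] at h1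
    exact Measure.ae_ae_of_ae_prod
      ((Measure.measurePreserving_swap (μ := volume.restrict (Ioo (0 : ℝ) τ))
        (ν := volume.restrict (Ioo (0 : ℝ) 1))).quasiMeasurePreserving.ae h1)
  have hYZ : ∀ᵐ r ∂(volume.restrict (Ioo (0 : ℝ) τ)), Y r = -(lam + ν ^ 2) * Z r := by
    filter_upwards [heq, hs.memH2, hs.left_boundary, hbc, ae_restrict_mem measurableSet_Ioo]
      with r h1 h2 h3 h4 hr
    have hr' := Ioo_subset_Icc_self hr
    have hp := fun x hx => unitRestrict_ext h2.1 (x := x) hx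
    refine pairing_identity (T.space r hr') (p := unitRestrict h2.1) (g := fun x => vxx x r)
      (q := fun y => vt y r) ?_ h2.intervalIntegrable ?_ ?_ ?_
    · intro x hx
      rw [hV r hr' x hx, hV r hr' 0 (by simp), (hs.memH1 r hr').eq_primitive x hx]
      congr 1
      refine intervalIntegral.integral_congr fun y hy => ?_
      rw [uIcc_of_le hx.1] at hy
      exact (hp y ⟨hy.1, hy.2.trans hx.2⟩).symm
    · intro x hx
      rw [hp x hx, h2.eq_primitive x hx, h3, zero_add]
    · filter_upwards [h1, ae_restrict_mem measurableSet_Ioo] with x hx hx'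
      rw [hx, ha r hr' x (Ioo_subset_Icc_self hx'), hV r hr' x (Ioo_subset_Icc_self hx')]
    · have e : (unitRestrict h2.1 + kernelGrad (κ r) (κx r) (V r)).ext 1
          = (unitRestrict h2.1).ext 1 + (kernelGrad (κ r) (κx r) (V r)).ext 1 := rfl
      rw [e, hp 1 (by simp)]
      exact h4
  have hfinal := eq_exp_of_eq_integral (μ := lam + ν ^ 2) hZc fun t ht => by
    refine (hY t ht).trans ?_
    change Z 0 + _ = _
    congr 1
    rw [intervalIntegral.integral_of_le ht.1, intervalIntegral.integral_of_le ht.1,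
      integral_Ioc_eq_integral_Ioo, integral_Ioc_eq_integral_Ioo]
    exact integral_congr_ae (ae_restrict_of_ae_restrict_of_subset (Ioo_subset_Ioo le_rfl ht.2) hYZ)
  have hZeq : ∀ t, Z t = ∫ x in (0 : ℝ)..1, (V t + volterra (κ t) (V t)).ext x * Real.cos (ν * x) :=
    fun t => by
      rw [hZ, ← integral_mul_test_add_adjoint (κ t) (V t) hC]
      exact setIntegral_Ioo_eq_intervalIntegral _
  intro t ht
  rw [← hZeq, ← hZeq]
  exact hfinal t ht

/-- Strong solutions with the same initial value agree, if the feedback law makes the transformed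
solution satisfy the boundary condition of the modes. -/
theorem TimeKernel.strongSolution_unique (T : TimeKernel lam τ A κ κx κy κt) {ν : ℕ → ℝ}
    (h : CosModes ν) (ha : ∀ t ∈ Icc 0 τ, ∀ x ∈ Icc (0 : ℝ) 1, (A t).ext x = a x t)
    (hlaw : ∀ t ∈ Ioo 0 τ, ∀ (v vx : ℝ → ℝ → ℝ) (f : UnitFun), law v vx t →
      (∀ x ∈ Icc (0 : ℝ) 1, f.ext x = v x t) → ∀ n,
      (vx 1 t + (kernelGrad (κ t) (κx t) f).ext 1) * Real.cos (ν n)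
        + ν n * ((f + volterra (κ t) f).ext 1 * Real.sin (ν n)) = 0)
    {u v : ℝ → ℝ → ℝ} (hu : IsStrongSolution a law u₀ τ u) (hv : IsStrongSolution a law u₀ τ v) :
    ∀ x ∈ Icc (0 : ℝ) 1, ∀ t ∈ Icc 0 τ, v x t = u x t := by
  have hmain : ∀ {w : ℝ → ℝ → ℝ}, IsStrongSolution a law u₀ τ w → ∃ W : ℝ → UnitFun,
      (∀ t ∈ Icc (0 : ℝ) τ, ∀ x ∈ Icc (0 : ℝ) 1, (W t).ext x = w x t) ∧
      ∀ n, ∀ t ∈ Icc 0 τ, ∫ x in (0 : ℝ)..1, (W t + volterra (κ t) (W t)).ext x * Real.cos (ν n * x)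
        = (∫ x in (0 : ℝ)..1, (W 0 + volterra (κ 0) (W 0)).ext x * Real.cos (ν n * x))
          * Real.exp (-(lam + ν n ^ 2) * t) := by
    rintro w ⟨wx, wxx, wt, hw⟩
    classical
    set W : ℝ → UnitFun := fun t => if ht : t ∈ Icc 0 τ then unitRestrict (hw.memH1 t ht).1 else 0 with hW
    have hWe : ∀ t ∈ Icc (0 : ℝ) τ, ∀ x ∈ Icc (0 : ℝ) 1, (W t).ext x = w x t := fun t ht x hx => by
      rw [hW]; simp only [dif_pos ht]
      exact unitRestrict_ext _ hx
    refine ⟨W, hWe, fun n => T.integral_mul_cos_eq hw ha hWe ?_⟩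
    filter_upwards [hw.right_boundary, ae_restrict_mem measurableSet_Ioo] with t h1 ht
    exact hlaw t ht w wx (W t) h1 (hWe t (Ioo_subset_Icc_self ht)) n
  obtain ⟨U, hU, hUn⟩ := hmain hu
  obtain ⟨V, hV, hVn⟩ := hmain hv
  have h0 : U 0 = V 0 := by
    ext x
    have h0' : (0 : ℝ) ∈ Icc 0 τ := ⟨le_rfl, T.pos.le⟩
    obtain ⟨_, _, _, hu'⟩ := hu
    obtain ⟨_, _, _, hv'⟩ := hv
    rw [← UnitFun.ext_of_mem _ x.2, ← UnitFun.ext_of_mem _ x.2, hU 0 h0' x x.2, hV 0 h0' x x.2,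
      hu'.initial x x.2, hv'.initial x x.2]
  intro x hx t ht
  -- All cosine coefficients of the two transformed solutions agree, as they evolve from the same
  -- initial values by the same factors.
  have hz : ∀ y ∈ Icc (0 : ℝ) 1, (V t + volterra (κ t) (V t)).ext y
      - (U t + volterra (κ t) (U t)).ext y = 0 := by
    refine h.complete _ ((UnitFun.continuous_ext _).sub (UnitFun.continuous_ext _)).continuousOn fun n => ?_
    simp only [sub_mul]
    rw [intervalIntegral.integral_sub
      (((UnitFun.continuous_ext _).fun_mul (by fun_prop)).intervalIntegrable _ _)
      (((UnitFun.continuous_ext _).fun_mul (by fun_prop)).intervalIntegrable _ _),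
      hVn n t ht, hUn n t ht, h0, sub_self]
  have hVU : V t = U t := by
    rw [← volterraInv_of_add_volterra (κ t) (V t), ← volterraInv_of_add_volterra (κ t) (U t)]
    congr 1
    ext y
    rw [← UnitFun.ext_of_mem _ y.2, ← UnitFun.ext_of_mem _ y.2]
    exact sub_eq_zero.1 (hz y y.2)
  rw [← hV t ht x hx, ← hU t ht x hx, hVU]

end Uniqueness

/-! ### The closed loop problem for both feedback laws -/

theorem zero_mem_Ico_zero_one : (0 : ℝ) ∈ Ico (0 : ℝ) 1 := ⟨le_rfl, zero_lt_one⟩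

/-- The closed loop problem for a feedback law that, for the transformed solution, is the boundary
condition of the modes. -/
theorem IsNeumannKernel.closedLoop {a : ℝ → ℝ → ℝ} {lam : ℝ} {k : ℝ × ℝ × ℝ → ℝ}
    (hk : IsNeumannKernel a lam k)
    (ha : ContinuousOn (Function.uncurry a) (Icc (0 : ℝ) 1 ×ˢ Ico (0 : ℝ) 1)) (hlam : 0 < lam)
    {ν : ℕ → ℝ} (h : CosModes ν) {law : (ℝ → ℝ → ℝ) → (ℝ → ℝ → ℝ) → ℝ → Prop}
    {adm : (ℝ → ℝ) → Prop}
    -- For each family of modes one of the two conditions is vacuous: cos ν_n = 0 leaves z(1) = 0,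
    -- and sin ν_n = 0 leaves z_x(1) = 0.
    (hlaw : ∀ τ (hτ : τ ∈ Ico (0 : ℝ) 1), ∀ t ∈ Icc 0 τ, ∀ (v vx : ℝ → ℝ → ℝ) (f : UnitFun),
      (∀ x ∈ Icc (0 : ℝ) 1, f.ext x = v x t) → (law v vx t ↔ ∀ n,
        (vx 1 t + (kernelGrad (clipCurve hk.continuousOn hτ t) (clipCurve hk.continuousOn_dx hτ t) f).ext 1)
          * Real.cos (ν n) = 0 ∧
        (f + volterra (clipCurve hk.continuousOn hτ t) f).ext 1 * Real.sin (ν n) = 0))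
    (hadm : ∀ u₀, adm u₀ → ∀ f : UnitFun, (∀ x ∈ Icc (0 : ℝ) 1, f.ext x = u₀ x) → ∀ n,
      (f + volterra (clipCurve hk.continuousOn zero_mem_Ico_zero_one 0) f).ext 1 * Real.sin (ν n) = 0) :
    ∃ M : ℝ → ℝ, (∀ t₀ ∈ Ioo (0 : ℝ) 1, 0 < M t₀) ∧
      ∀ u₀ : ℝ → ℝ, MemH1 u₀ → adm u₀ → ∃ u : ℝ → ℝ → ℝ, ∀ t₀ ∈ Ioo (0 : ℝ) 1,
        IsStrongSolution a law u₀ t₀ u ∧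
        (∀ v : ℝ → ℝ → ℝ, IsStrongSolution a law u₀ t₀ v →
          ∀ x ∈ Icc (0 : ℝ) 1, ∀ t ∈ Icc (0 : ℝ) t₀, v x t = u x t) ∧
        ∀ t ∈ Ioo (0 : ℝ) t₀,
          h1Norm (fun x => u x t) ≤ M t₀ * h1Norm u₀ * Real.exp (-lam * t) := by
  classical
  set K₀ := clipCurve hk.continuousOn zero_mem_Ico_zero_one 0 with hK₀
  set Kx₀ := clipCurve hk.continuousOn_dx zero_mem_Ico_zero_one 0 with hKx₀
  have S₀ := hk.spaceKernel zero_mem_Ico_zero_one (t := 0) (by simp)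
    fun x => coeffCurve_apply ha zero_mem_Ico_zero_one (by simp) x
  -- The constant is fixed before the initial value, the modes and the solution appear, so that it
  -- depends on t₀ only.
  have hM : ∀ t₀ ∈ Ioo (0 : ℝ) 1, ∃ M, 0 < M ∧ ∀ {ν : ℕ → ℝ} {w₀ g₀ : ℝ → ℝ}, CosModes ν →
      HasH1Deriv w₀ g₀ → (∀ n, w₀ 1 * Real.sin (ν n) = 0) → ∀ (h₀ : t₀ ∈ Ico (0 : ℝ) 1), ∀ t ∈ Icc 0 t₀,
      h1Norm (plantSol lam ν (cosCoeff ν w₀) (clipCurve hk.continuousOn h₀) t).ext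
        ≤ M * h1Norm w₀ * Real.exp (-lam * t) := fun t₀ ht₀ => by
    obtain ⟨M, hM, hM'⟩ := (hk.timeKernel ha ht₀).exists_h1Norm_plantSol_le hlam.le
    exact ⟨M, hM, fun h₁ h₂ h₃ _ => hM' h₁ h₂ h₃⟩
  choose! M hMpos hMle using hM
  set D : ℝ := 4 + 6 * (‖K₀‖ + ‖Kx₀‖) with hD
  refine ⟨fun t₀ => M t₀ * D, fun t₀ ht₀ => mul_pos (hMpos t₀ ht₀) (by positivity), ?_⟩
  rintro u₀ ⟨v₀, hu₀⟩ hadm₀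
  set f₀ := unitRestrict hu₀.1 with hf₀
  have hf₀e : EqOn f₀.ext u₀ (Icc 0 1) := fun x hx => unitRestrict_ext hu₀.1 hx
  have hf₀H : HasH1Deriv f₀.ext v₀ := hu₀.congr hf₀e fun _ _ => rfl
  set w₀ := (f₀ + volterra K₀ f₀).ext with hw₀
  have H := hf₀H.add_volterra S₀
  have hbc : ∀ n, w₀ 1 * Real.sin (ν n) = 0 := hadm u₀ hadm₀ f₀ hf₀e
  set c := cosCoeff ν w₀ with hc
  have hcs : Summable fun n => |c n| := (h.summable_cosCoeff_and_le H hbc).1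
  -- At the time t the kernel curve is cut off at t itself, so `u` does not refer to any t₀; on
  -- [0,t₀] it agrees with the solution built for t₀ by `clipCurve_congr`.
  set u : ℝ → ℝ → ℝ := fun x t => if ht : t ∈ Ico (0 : ℝ) 1 then
    (volterraInv (clipCurve hk.continuousOn ht t) (heatSol lam ν c t)).ext x else 0 with hu
  refine ⟨u, fun t₀ ht₀ => ?_⟩
  have ht₀' := Ioo_subset_Ico_self ht₀
  have T := hk.timeKernel ha ht₀
  have hA : ∀ t ∈ Icc 0 t₀, ∀ x ∈ Icc (0 : ℝ) 1, (coeffCurve ha ht₀' t).ext x = a x t :=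
    fun t ht x hx => by rw [UnitFun.ext_of_mem _ hx, coeffCurve_apply ha ht₀' ht]
  set κ := clipCurve hk.continuousOn ht₀' with hκ
  have hue : ∀ t ∈ Icc 0 t₀, ∀ x, u x t = (plantSol lam ν c κ t).ext x := fun t ht x => by
    have ht' : t ∈ Ico (0 : ℝ) 1 := ⟨ht.1, ht.2.trans_lt ht₀.2⟩
    simp only [hu, dif_pos ht']
    rw [plantSol, hκ, clipCurve_congr hk.continuousOn ht' ht₀' le_rfl ht.2]
  have hκ0 : κ 0 = K₀ := clipCurve_congr hk.continuousOn ht₀' zero_mem_Ico_zero_one ht₀.1.le le_rfl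
  have hstrong : IsStrongSolution a law u₀ t₀ u := by
    refine T.isStrongSolution h H hbc hlam hc hA hue (fun x hx => ?_) fun t ht ux hux => ?_
    · rw [hc, hw₀, ← hκ0, plantSol_zero h (by rw [hκ0]; exact H) (by rw [hκ0]; exact hbc) hlam.le]
      exact hf₀e hx
    · rw [hlaw t₀ ht₀' t (Ioo_subset_Icc_self ht) u ux (plantSol lam ν c κ t)
        fun x _ => (hue t (Ioo_subset_Icc_self ht) x).symm]
      intro n
      rw [hux 1, sub_add_cancel, plantSol_add_volterra]
      rcases h.bc with hs | hcos
      · rw [hs n, heatSolX_one_of_sin_eq_zero hcs hlam.le hs ht.1]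
        simp
      · rw [hcos n, heatSol_one_of_cos_eq_zero hcs hlam.le hcos ht.1.le]
        simp
  refine ⟨hstrong, fun v hv => ?_, fun t ht => ?_⟩
  · refine T.strongSolution_unique h hA (fun t ht v vx f hl hf n => ?_) hstrong hv
    obtain ⟨h1, h2⟩ := (hlaw t₀ ht₀' t (Ioo_subset_Icc_self ht) v vx f hf).1 hl n
    rw [h1, h2, mul_zero, add_zero]
  · have ht' := Ioo_subset_Icc_self ht
    have e : (fun x => u x t) = (plantSol lam ν c κ t).ext := funext fun x => hue t ht' x
    rw [e]
    refine (hMle t₀ ht₀ h H hbc ht₀' t ht').trans ?_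
    have h1 := h1Norm_add_volterra_le S₀ hf₀H
    rw [h1Norm_congr hu₀ hf₀e] at h1
    have h2 := mul_le_mul_of_nonneg_left h1 (hMpos t₀ ht₀).le
    refine mul_le_mul_of_nonneg_right (h2.trans (le_of_eq ?_)) (Real.exp_pos _).le
    rw [mul_assoc]

theorem ext_one_add_volterra_clipCurve {g : ℝ × ℝ × ℝ → ℝ} (hg : ContinuousOn g kernelDomain)
    {τ t : ℝ} (hτ : τ ∈ Ico (0 : ℝ) 1) (ht : t ∈ Icc 0 τ) {f : UnitFun} {v : ℝ → ℝ}
    (hf : ∀ x ∈ Icc (0 : ℝ) 1, f.ext x = v x) :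
    ∫ y in (0 : ℝ)..1, (clipCurve hg hτ t).ext 1 y * f.ext y = ∫ y in (0 : ℝ)..1, g (1, y, t) * v y := by
  refine intervalIntegral.integral_congr fun y hy => ?_
  rw [uIcc_of_le zero_le_one] at hy
  rw [hf y hy, clipCurve_ext hg hτ hy.1 hy.2 le_rfl ht]

section Feedback

variable {a : ℝ → ℝ → ℝ} {lam : ℝ} {k : ℝ × ℝ × ℝ → ℝ}

/-- The feedback law is literally z(1,t) = 0 for z = (1 + K)u; in the same way `neumannFeedback_iff`
rewrites the other law as z_x(1,t) = 0. -/
theorem dirichletFeedback_iff (hk : IsNeumannKernel a lam k) {τ t : ℝ} (hτ : τ ∈ Ico (0 : ℝ) 1)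
    (ht : t ∈ Icc 0 τ) {v vx : ℝ → ℝ → ℝ} {f : UnitFun} (hf : ∀ x ∈ Icc (0 : ℝ) 1, f.ext x = v x t) :
    DirichletFeedback k v vx t ↔ (f + volterra (clipCurve hk.continuousOn hτ t) f).ext 1 = 0 := by
  have e : (f + volterra (clipCurve hk.continuousOn hτ t) f).ext 1
    = f.ext 1 + (volterra (clipCurve hk.continuousOn hτ t) f).ext 1 := rfl
  rw [e, volterra_ext _ _ (by simp), ext_one_add_volterra_clipCurve hk.continuousOn hτ ht hf,
    hf 1 (by simp), DirichletFeedback, ← eq_neg_iff_add_eq_zero]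

theorem neumannFeedback_iff (hk : IsNeumannKernel a lam k) {τ t : ℝ} (hτ : τ ∈ Ico (0 : ℝ) 1)
    (ht : t ∈ Icc 0 τ) {v vx : ℝ → ℝ → ℝ} {f : UnitFun} (hf : ∀ x ∈ Icc (0 : ℝ) 1, f.ext x = v x t) :
    NeumannFeedback k v vx t ↔ vx 1 t + (kernelGrad (clipCurve hk.continuousOn hτ t)
      (clipCurve hk.continuousOn_dx hτ t) f).ext 1 = 0 := by
  rw [kernelGrad_ext _ _ _ (by simp), ext_one_add_volterra_clipCurve hk.continuousOn_dx hτ ht hf,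
    hf 1 (by simp), clipCurve_ext hk.continuousOn hτ zero_le_one le_rfl le_rfl ht, NeumannFeedback,
    eq_sub_iff_add_eq]
  constructor <;> intro h <;> linarith

end Feedback

theorem closedLoop_dirichlet {a : ℝ → ℝ → ℝ} {lam : ℝ} {k : ℝ × ℝ × ℝ → ℝ}
    (hk : IsNeumannKernel a lam k)
    (ha : ContinuousOn (Function.uncurry a) (Icc (0 : ℝ) 1 ×ˢ Ico (0 : ℝ) 1)) (hlam : 0 < lam) :
    ∃ M : ℝ → ℝ, (∀ t₀ ∈ Ioo (0 : ℝ) 1, 0 < M t₀) ∧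
      ∀ u₀ : ℝ → ℝ, MemH1 u₀ → u₀ 1 = - ∫ y in (0 : ℝ)..1, k (1, y, 0) * u₀ y →
      ∃ u : ℝ → ℝ → ℝ, ∀ t₀ ∈ Ioo (0 : ℝ) 1,
        IsStrongSolution a (DirichletFeedback k) u₀ t₀ u ∧
        (∀ v : ℝ → ℝ → ℝ, IsStrongSolution a (DirichletFeedback k) u₀ t₀ v →
          ∀ x ∈ Icc (0 : ℝ) 1, ∀ t ∈ Icc (0 : ℝ) t₀, v x t = u x t) ∧
        ∀ t ∈ Ioo (0 : ℝ) t₀,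
          h1Norm (fun x => u x t) ≤ M t₀ * h1Norm u₀ * Real.exp (-lam * t) := by
  have hcos : ∀ n : ℕ, Real.cos ((n + 1 / 2) * Real.pi) = 0 := fun n => by
    exact Real.cos_eq_zero_iff.2 ⟨n, by push_cast; ring⟩
  have hsin : Real.sin (((0 : ℕ) + 1 / 2) * Real.pi) ≠ 0 := by
    rw [show (((0 : ℕ) : ℝ) + 1 / 2) * Real.pi = Real.pi / 2 by push_cast; ring, Real.sin_pi_div_two]
    exact one_ne_zero
  refine hk.closedLoop ha hlam cosModes_dirichlet (fun τ hτ t ht v vx f hf => ?_)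
    fun u₀ h0 f hf n => ?_
  · rw [dirichletFeedback_iff hk hτ ht hf]
    refine ⟨fun h n => ⟨?_, by rw [h, zero_mul]⟩, fun h => ?_⟩
    · rw [hcos, mul_zero]
    · exact (mul_eq_zero.1 (h 0).2).resolve_right hsin
  · have h1 := (dirichletFeedback_iff hk zero_mem_Ico_zero_one (t := 0) (by simp)
      (v := fun x _ => u₀ x) (vx := 0) hf).1 h0
    rw [h1, zero_mul]

theorem closedLoop_neumann {a : ℝ → ℝ → ℝ} {lam : ℝ} {k : ℝ × ℝ × ℝ → ℝ}
    (hk : IsNeumannKernel a lam k)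
    (ha : ContinuousOn (Function.uncurry a) (Icc (0 : ℝ) 1 ×ˢ Ico (0 : ℝ) 1)) (hlam : 0 < lam) :
    ∃ M : ℝ → ℝ, (∀ t₀ ∈ Ioo (0 : ℝ) 1, 0 < M t₀) ∧
      ∀ u₀ : ℝ → ℝ, MemH1 u₀ → ∃ u : ℝ → ℝ → ℝ, ∀ t₀ ∈ Ioo (0 : ℝ) 1,
        IsStrongSolution a (NeumannFeedback k) u₀ t₀ u ∧
        (∀ v : ℝ → ℝ → ℝ, IsStrongSolution a (NeumannFeedback k) u₀ t₀ v →
          ∀ x ∈ Icc (0 : ℝ) 1, ∀ t ∈ Icc (0 : ℝ) t₀, v x t = u x t) ∧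
        ∀ t ∈ Ioo (0 : ℝ) t₀,
          h1Norm (fun x => u x t) ≤ M t₀ * h1Norm u₀ * Real.exp (-lam * t) := by
  have hsin : ∀ n : ℕ, Real.sin (n * Real.pi) = 0 := Real.sin_nat_mul_pi
  obtain ⟨M, hM, hM'⟩ := hk.closedLoop (law := NeumannFeedback k) (adm := fun _ => True) ha hlam
    cosModes_neumann (fun τ hτ t ht v vx f hf => by
      rw [neumannFeedback_iff hk hτ ht hf]
      refine ⟨fun h n => ⟨by rw [h, zero_mul], by rw [hsin, mul_zero]⟩, fun h => ?_⟩
      simpa using (h 0).1)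
    fun u₀ _ f hf n => by rw [hsin, mul_zero]
  exact ⟨M, hM, fun u₀ hu₀ => hM' u₀ hu₀ trivial⟩

/-! ### Taylor coefficients of power series with values in a Banach space -/

section Taylor

variable {F : Type*} [NormedAddCommGroup F] [NormedSpace ℝ F]

/-- The `j`-th Taylor coefficient of `f` at `t`. -/
noncomputable def taylorCoeff (f : ℝ → F) (j : ℕ) (t : ℝ) : F :=
  ((j.factorial : ℝ)⁻¹) • iteratedDeriv j f t

theorem taylorCoeff_zero (f : ℝ → F) (t : ℝ) : taylorCoeff f 0 t = f t := by
  simp [taylorCoeff]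

/-- The `j`-th Taylor coefficient at `τ` of the power series with coefficients `c`. -/
noncomputable def shiftedSeries (c : ℕ → F) (j : ℕ) (τ : ℝ) : F :=
  ∑' n : ℕ, (((n + j).choose j : ℝ) * τ ^ n) • c (n + j)

variable {c : ℕ → F} {ρ C : ℝ}

theorem norm_shiftedSeries_term_le (hρ : 0 < ρ) (hc : ∀ n, ‖c n‖ * ρ ^ n ≤ C) (j n : ℕ) (τ : ℝ) :
    ‖(((n + j).choose j : ℝ) * τ ^ n) • c (n + j)‖
      ≤ C / ρ ^ j * (((n + j).choose j : ℝ) * (|τ| / ρ) ^ n) := by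
  have h1 : ‖c (n + j)‖ ≤ C / ρ ^ (n + j) := (le_div_iff₀ (by positivity)).2 (hc _)
  rw [norm_smul, norm_mul, norm_pow, Real.norm_natCast, Real.norm_eq_abs]
  refine (mul_le_mul_of_nonneg_left h1 (by positivity)).trans (le_of_eq ?_)
  rw [div_pow, pow_add]
  field_simp

theorem summable_choose_mul_pow {r : ℝ} (h0 : 0 ≤ r) (h1 : r < 1) (j : ℕ) :
    Summable fun n : ℕ => ((n + j).choose j : ℝ) * r ^ n :=
  summable_choose_mul_geometric_of_norm_lt_one j (by rwa [Real.norm_of_nonneg h0])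

/-- A Cauchy estimate at half the radius by real means: for r = |τ|/ρ < 1/2 the majorant Σ C(n+j,j)
rⁿ = (1 − r)^{-(j+1)} is at most 2^{j+1}. -/
theorem norm_shiftedSeries_le (hρ : 0 < ρ) (hc : ∀ n, ‖c n‖ * ρ ^ n ≤ C) (j : ℕ) {τ : ℝ}
    (hτ : |τ| < ρ / 2) : ‖shiftedSeries c j τ‖ * (ρ / 2) ^ j ≤ 2 * C := by
  have hC : 0 ≤ C := le_trans (by positivity) (hc 0)
  have hr : |τ| / ρ < 1 / 2 := by rw [div_lt_iff₀ hρ]; linarith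
  have hr0 : 0 ≤ |τ| / ρ := by positivity
  have hs := (hasSum_choose_mul_geometric_of_norm_lt_one j (r := |τ| / ρ)
    (by rw [Real.norm_of_nonneg hr0]; linarith)).mul_left (C / ρ ^ j)
  have h1 := tsum_of_norm_bounded hs fun n => norm_shiftedSeries_term_le hρ hc j n τ
  have h2 : 1 / (1 - |τ| / ρ) ^ (j + 1) ≤ 2 ^ (j + 1) := by
    rw [div_le_iff₀ (by apply pow_pos; linarith), ← mul_pow]
    exact one_le_pow₀ (by linarith)
  calc ‖shiftedSeries c j τ‖ * (ρ / 2) ^ j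
      ≤ (C / ρ ^ j * 2 ^ (j + 1)) * (ρ / 2) ^ j := by
        refine mul_le_mul_of_nonneg_right (h1.trans ?_) (by positivity)
        exact mul_le_mul_of_nonneg_left h2 (by positivity)
    _ = 2 * C := by rw [div_pow, pow_succ]; field_simp

variable [CompleteSpace F]

theorem summable_shiftedSeries (hρ : 0 < ρ) (hc : ∀ n, ‖c n‖ * ρ ^ n ≤ C) (j : ℕ) {τ : ℝ} (hτ : |τ| < ρ) :
    Summable fun n : ℕ => (((n + j).choose j : ℝ) * τ ^ n) • c (n + j) :=
  Summable.of_norm_bounded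
    ((summable_choose_mul_pow (by positivity) ((div_lt_one hρ).2 hτ) j).mul_left _)
    fun n => norm_shiftedSeries_term_le hρ hc j n τ

/-- Termwise differentiation, with (n+1)·C(n+1+j, j) = (j+1)·C(n+1+j, j+1) after the shift of the
index. The common majorant `u` on |τ| < ρ/2 is, up to this shift, the series of the preceding
estimate at r = 1/2. -/
theorem hasDerivAt_shiftedSeries (hρ : 0 < ρ) (hc : ∀ n, ‖c n‖ * ρ ^ n ≤ C) (j : ℕ) {τ : ℝ}
    (hτ : |τ| < ρ / 2) :
    HasDerivAt (shiftedSeries c j) (((j : ℝ) + 1) • shiftedSeries c (j + 1) τ) τ := by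
  have hC : 0 ≤ C := le_trans (by positivity) (hc 0)
  have hchoose : ∀ n : ℕ, ((n + 1 : ℕ) : ℝ) * ((n + 1 + j).choose j : ℝ)
      = ((j : ℝ) + 1) * ((n + (j + 1)).choose (j + 1) : ℝ) := fun n => by
    have := Nat.choose_succ_right_eq (n + (j + 1)) j
    have e : n + (j + 1) - j = n + 1 := by omega
    rw [e, show n + (j + 1) = n + 1 + j by ring] at this
    rw [show n + (j + 1) = n + 1 + j by ring]
    have h2 : (((n + 1 + j).choose (j + 1) * (j + 1) : ℕ) : ℝ) = ((n + 1 + j).choose j * (n + 1) : ℕ) := by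
      rw [this]
    push_cast at h2 ⊢
    linarith
  set u : ℕ → ℝ := fun n => ((n + j).choose j : ℝ) * (n * (ρ / 2) ^ (n - 1)) * (C / ρ ^ (n + j)) with hu
  have husum : Summable u := by
    rw [← summable_nat_add_iff 1]
    refine ((summable_choose_mul_pow (r := 1 / 2) (by norm_num) (by norm_num) (j + 1)).mul_left
      (C / ρ ^ (j + 1) * (j + 1))).congr fun n => ?_
    have := hchoose n
    simp only [hu, Nat.add_sub_cancel]
    calc _ = C / ρ ^ (j + 1) * (1 / 2) ^ n * (((j : ℝ) + 1) * ((n + (j + 1)).choose (j + 1) : ℝ)) := by ring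
      _ = _ := by
        rw [← hchoose n, show n + 1 + j = n + (j + 1) by ring, pow_add ρ n, div_pow, div_pow, one_pow]
        field_simp
  have hder := hasDerivAt_tsum_of_isPreconnected (F := F) (𝕜 := ℝ) (t := Metric.ball (0 : ℝ) (ρ / 2))
    (g := fun n τ => (((n + j).choose j : ℝ) * τ ^ n) • c (n + j))
    (g' := fun n τ => (((n + j).choose j : ℝ) * (n * τ ^ (n - 1))) • c (n + j)) (y₀ := 0) (y := τ)
    husum Metric.isOpen_ball (convex_ball _ _).isPreconnected
    (fun n y _ => ((hasDerivAt_pow n y).const_mul _).smul_const _)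
    (fun n y hy => by
      rw [Metric.mem_ball, dist_zero_right, Real.norm_eq_abs] at hy
      rw [norm_smul, norm_mul, norm_mul, norm_pow, Real.norm_natCast, Real.norm_natCast, Real.norm_eq_abs]
      have h1 : ‖c (n + j)‖ ≤ C / ρ ^ (n + j) := (le_div_iff₀ (by positivity)).2 (hc _)
      simp only [hu]
      gcongr)
    (Metric.mem_ball_self (by positivity)) (summable_shiftedSeries hρ hc j (by simpa using hρ))
    (by rwa [Metric.mem_ball, dist_zero_right, Real.norm_eq_abs])
  refine hder.congr_deriv ?_
  have hs : Summable fun n : ℕ => (((n + j).choose j : ℝ) * (n * τ ^ (n - 1))) • c (n + j) := by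
    refine Summable.of_norm_bounded husum fun n => ?_
    rw [norm_smul, norm_mul, norm_mul, norm_pow, Real.norm_natCast, Real.norm_natCast, Real.norm_eq_abs]
    have h1 : ‖c (n + j)‖ ≤ C / ρ ^ (n + j) := (le_div_iff₀ (by positivity)).2 (hc _)
    simp only [hu]
    gcongr
  rw [hs.tsum_eq_zero_add, shiftedSeries, ← tsum_const_smul'']
  simp only [Nat.cast_zero, zero_mul, mul_zero, zero_smul, zero_add, Nat.add_sub_cancel]
  congr 1; ext n
  rw [smul_smul, ← mul_assoc, ← mul_assoc, ← hchoose n, show n + 1 + j = n + (j + 1) by ring]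
  congr 2; ring

/-- The Taylor coefficients of a function given by a power series near `t₁`. -/
theorem taylorCoeff_eq_shiftedSeries {f : ℝ → F} {t₁ : ℝ} (hρ : 0 < ρ) (hc : ∀ n, ‖c n‖ * ρ ^ n ≤ C)
    (hf : ∀ t, |t - t₁| < ρ → HasSum (fun n : ℕ => (t - t₁) ^ n • c n) (f t)) (j : ℕ) :
    ∀ t, |t - t₁| < ρ / 2 → taylorCoeff f j t = shiftedSeries c j (t - t₁) := by
  have hopen : ∀ t, |t - t₁| < ρ / 2 → ∀ᶠ s in 𝓝 t, |s - t₁| < ρ / 2 := fun t ht =>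
    ((continuous_id.sub continuous_const).abs.tendsto t).eventually_lt_const ht
  have key : ∀ t, |t - t₁| < ρ / 2 → iteratedDeriv j f t
      = (j.factorial : ℝ) • shiftedSeries c j (t - t₁) := by
    induction j with
    | zero =>
      intro t ht
      rw [iteratedDeriv_zero, Nat.factorial_zero, Nat.cast_one, one_smul,
        ← (hf t (ht.trans (by linarith))).tsum_eq, shiftedSeries]
      simp
    | succ j ih =>
      intro t ht
      have h1 : HasDerivAt (fun t => (j.factorial : ℝ) • shiftedSeries c j (t - t₁))
          ((j.factorial : ℝ) • (((j : ℝ) + 1) • shiftedSeries c (j + 1) (t - t₁))) t :=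
        ((hasDerivAt_shiftedSeries hρ hc j ht).comp_sub_const t t₁).const_smul (j.factorial : ℝ)
      have h2 := h1.congr_of_eventuallyEq ((hopen t ht).mono ih)
      rw [iteratedDeriv_succ, h2.deriv, smul_smul, Nat.factorial_succ]
      push_cast
      rw [mul_comm]
  intro t ht
  rw [taylorCoeff, key t ht, smul_smul, inv_mul_cancel₀ (by positivity), one_smul]

theorem hasDerivAt_taylorCoeff {f : ℝ → F} {t₁ : ℝ} (hρ : 0 < ρ) (hc : ∀ n, ‖c n‖ * ρ ^ n ≤ C)
    (hf : ∀ t, |t - t₁| < ρ → HasSum (fun n : ℕ => (t - t₁) ^ n • c n) (f t)) (j : ℕ) {t : ℝ}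
    (ht : |t - t₁| < ρ / 2) :
    HasDerivAt (taylorCoeff f j) (((j : ℝ) + 1) • taylorCoeff f (j + 1) t) t := by
  have h1 := (hasDerivAt_shiftedSeries hρ hc j ht).comp_sub_const t t₁
  rw [← taylorCoeff_eq_shiftedSeries hρ hc hf (j + 1) t ht] at h1
  refine h1.congr_of_eventuallyEq ?_
  filter_upwards [((continuous_id.sub continuous_const).abs.tendsto t).eventually_lt_const ht] with s hs
  exact taylorCoeff_eq_shiftedSeries hρ hc hf j s hs

theorem norm_taylorCoeff_le {f : ℝ → F} {t₁ : ℝ} (hρ : 0 < ρ) (hc : ∀ n, ‖c n‖ * ρ ^ n ≤ C)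
    (hf : ∀ t, |t - t₁| < ρ → HasSum (fun n : ℕ => (t - t₁) ^ n • c n) (f t)) (j : ℕ) {t : ℝ}
    (ht : |t - t₁| < ρ / 2) : ‖taylorCoeff f j t‖ * (ρ / 2) ^ j ≤ 2 * C := by
  rw [taylorCoeff_eq_shiftedSeries hρ hc hf j t ht]
  exact norm_shiftedSeries_le hρ hc j ht

end Taylor

/-! ### The coefficient a(·,t) as an analytic curve in C([0,1]) -/

/-- The coefficients of a power series with uniform bounds inherit the continuity of the sum. -/
theorem continuousOn_coeff_of_hasSum {a : ℝ → ℝ → ℝ} {t₁ ρ C : ℝ} {c : ℕ → ℝ → ℝ}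
    (ha_cont : ∀ t ∈ Ico (0 : ℝ) 1, ContinuousOn (fun x => a x t) (Icc (0 : ℝ) 1))
    (ht₁ : t₁ ∈ Ico (0 : ℝ) 1) (hρ : 0 < ρ)
    (hc : ∀ n, ∀ x ∈ Icc (0 : ℝ) 1, |c n x| * ρ ^ n ≤ C)
    (hs : ∀ x ∈ Icc (0 : ℝ) 1, ∀ t ∈ Ico (0 : ℝ) 1, |t - t₁| < ρ →
      HasSum (fun n : ℕ => c n x * (t - t₁) ^ n) (a x t)) (n : ℕ) :
    ContinuousOn (c n) (Icc (0 : ℝ) 1) := by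
  induction n using Nat.strong_induction_on with
  | _ n ih =>
  have hC : 0 ≤ C := le_trans (by positivity) (hc 0 0 (by simp))
  refine continuousOn_of_uniform_approx_of_continuousOn fun u hu => ?_
  obtain ⟨ε, hε, hεu⟩ := Metric.mem_uniformity_dist.1 hu
  have h1 : Tendsto (fun h : ℝ => 2 * C / ρ ^ (n + 1) * h) (𝓝[>] 0) (𝓝 0) := by
    have : Tendsto (fun h : ℝ => 2 * C / ρ ^ (n + 1) * h) (𝓝 0) (𝓝 (2 * C / ρ ^ (n + 1) * 0)) :=
      (continuous_const.mul continuous_id).tendsto 0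
    rw [mul_zero] at this
    exact this.mono_left nhdsWithin_le_nhds
  have hmin : 0 < min (ρ / 2) (1 - t₁) := lt_min (by positivity) (by linarith [ht₁.2])
  obtain ⟨h, hh1, hh2⟩ := ((h1.eventually_lt_const hε).and (Ioo_mem_nhdsGT hmin)).exists
  have hh0 : 0 < h := hh2.1
  have hhρ : h < ρ / 2 := hh2.2.trans_le (min_le_left _ _)
  have hht : t₁ + h ∈ Ico (0 : ℝ) 1 :=
    ⟨by linarith [ht₁.1], by linarith [hh2.2.trans_le (min_le_right (ρ / 2) (1 - t₁))]⟩
  -- By induction c_n is the uniform limit of these quotients as h tends to 0, with error at most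
  -- 2Ch/ρⁿ⁺¹. Only h > 0 is used, because t₁ may be the end point 0.
  refine ⟨fun x => (a x (t₁ + h) - ∑ i ∈ Finset.range n, c i x * h ^ i) / h ^ n, ?_, fun x hx => hεu ?_⟩
  · refine ((ha_cont _ hht).sub (continuousOn_finsetSum _ fun i hi => ?_)).div_const _
    exact (ih i (Finset.mem_range.1 hi)).mul continuousOn_const
  · have hsum := hs x hx _ hht (by rw [add_sub_cancel_left, abs_of_pos hh0]; linarith)
    rw [add_sub_cancel_left] at hsum
    have htail := (hasSum_nat_add_iff' (n + 1)).2 hsum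
    have hr : h / ρ < 1 / 2 := by rw [div_lt_iff₀ hρ]; linarith
    have hr0 : 0 < h / ρ := by positivity
    have hgeo := (hasSum_geometric_of_lt_one hr0.le (by linarith : h / ρ < 1)).mul_left
      (C * (h / ρ) ^ (n + 1))
    have hbound : ‖a x (t₁ + h) - ∑ i ∈ Finset.range (n + 1), c i x * h ^ i‖
        ≤ C * (h / ρ) ^ (n + 1) * (1 - h / ρ)⁻¹ := by
      rw [← htail.tsum_eq]
      refine tsum_of_norm_bounded hgeo fun i => ?_
      have h2 : |c (i + (n + 1)) x| ≤ C / ρ ^ (i + (n + 1)) :=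
        (le_div_iff₀ (by positivity)).2 (hc _ x hx)
      rw [norm_mul, norm_pow, Real.norm_of_nonneg hh0.le, Real.norm_eq_abs]
      refine (mul_le_mul_of_nonneg_right h2 (by positivity)).trans (le_of_eq ?_)
      rw [div_pow, div_pow, pow_add, pow_add]
      field_simp
      ring
    have hinv : (1 - h / ρ)⁻¹ ≤ 2 := by
      rw [inv_le_comm₀ (by linarith) two_pos]; linarith
    rw [dist_comm, Real.dist_eq]
    have e : (a x (t₁ + h) - ∑ i ∈ Finset.range n, c i x * h ^ i) / h ^ n - c n x
        = (a x (t₁ + h) - ∑ i ∈ Finset.range (n + 1), c i x * h ^ i) / h ^ n := by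
      rw [Finset.sum_range_succ]; field_simp; ring
    rw [e, abs_div, abs_of_pos (pow_pos hh0 n), div_lt_iff₀ (pow_pos hh0 n)]
    calc _ ≤ C * (h / ρ) ^ (n + 1) * (1 - h / ρ)⁻¹ := hbound
      _ ≤ C * (h / ρ) ^ (n + 1) * 2 := by gcongr
      _ = 2 * C / ρ ^ (n + 1) * h * h ^ n := by rw [div_pow, pow_succ h]; field_simp
      _ < ε * h ^ n := by gcongr

/-- A uniformly analytic coefficient as a curve of continuous functions that near every
`t₁ ∈ [0,1)` is given by a power series. -/
theorem AnalyticInTimeUniformly.exists_curve {a : ℝ → ℝ → ℝ}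
    (ha_cont : ∀ t ∈ Ico (0 : ℝ) 1, ContinuousOn (fun x => a x t) (Icc (0 : ℝ) 1))
    (ha : AnalyticInTimeUniformly a) :
    ∃ A : ℝ → UnitFun, (∀ t ∈ Ico (0 : ℝ) 1, ∀ x ∈ Icc (0 : ℝ) 1, (A t).ext x = a x t) ∧
      ∀ t₁ ∈ Ico (0 : ℝ) 1, ∃ ρ > 0, ∃ C : ℝ, ∃ c : ℕ → UnitFun, (∀ n, ‖c n‖ * ρ ^ n ≤ C) ∧
        ∀ t, |t - t₁| < ρ → HasSum (fun n : ℕ => (t - t₁) ^ n • c n) (A t) := by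
  classical
  set B : ℝ → UnitFun := fun t => if ht : t ∈ Ico (0 : ℝ) 1 then unitRestrict (ha_cont t ht) else 0
    with hB
  have hBe : ∀ t ∈ Ico (0 : ℝ) 1, ∀ x ∈ Icc (0 : ℝ) 1, (B t).ext x = a x t := fun t ht x hx => by
    rw [hB]; simp only [dif_pos ht]; exact unitRestrict_ext _ hx
  have hloc : ∀ t₁ ∈ Ico (0 : ℝ) 1, ∃ ρ > 0, ∃ C : ℝ, ∃ c : ℕ → UnitFun, (∀ n, ‖c n‖ * ρ ^ n ≤ C) ∧
      ∀ t ∈ Ico (0 : ℝ) 1, |t - t₁| < ρ → HasSum (fun n : ℕ => (t - t₁) ^ n • c n) (B t) := by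
    intro t₁ ht₁
    obtain ⟨ρ, hρ, C, c, hc, hs⟩ := ha t₁ ht₁
    have hcc := continuousOn_coeff_of_hasSum ha_cont ht₁ hρ hc hs
    have hC : 0 ≤ C := le_trans (by positivity) (hc 0 0 (by simp))
    have hn : ∀ n, ‖unitRestrict (hcc n)‖ ≤ C / ρ ^ n := fun n =>
      (ContinuousMap.norm_le _ (by positivity)).2 fun x =>
        (le_div_iff₀ (by positivity)).2 (hc n x x.2)
    refine ⟨ρ, hρ, C, fun n => unitRestrict (hcc n), fun n => ?_, fun t ht htρ => ?_⟩
    · exact (le_div_iff₀ (by positivity)).1 (hn n)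
    · have hsum : Summable fun n : ℕ => (t - t₁) ^ n • unitRestrict (hcc n) := by
        refine Summable.of_norm_bounded ((summable_geometric_of_lt_one (by positivity)
          ((div_lt_one hρ).2 htρ)).mul_left C) fun n => ?_
        rw [norm_smul, norm_pow, Real.norm_eq_abs]
        refine (mul_le_mul_of_nonneg_left (hn n) (by positivity)).trans (le_of_eq ?_)
        rw [div_pow]; ring
      convert! hsum.hasSum using 1
      ext x
      have h1 := hsum.hasSum.mapL (ContinuousMap.evalCLM ℝ x)
      have h2 := hs x x.2 t ht htρ
      rw [← UnitFun.ext_of_mem _ x.2, hBe t ht x x.2]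
      refine h2.unique ?_
      convert! h1 using 2 with n
      rw [mul_comm]; rfl
  -- Nothing is known for t < 0, so there the curve is continued by its own power series at 0. Then
  -- every t₁ in [0,1) has a full two-sided neighbourhood on which the curve is a power series; for
  -- t₁ > 0 the radius is shrunk to stay inside (0,1).
  obtain ⟨ρ₀, hρ₀, C₀, c₀, hc₀, hs₀⟩ := hloc 0 zero_mem_Ico_zero_one
  set A : ℝ → UnitFun := fun t => if t < 0 then ∑' n : ℕ, t ^ n • c₀ n else B t with hA
  have hAB : ∀ t, 0 ≤ t → A t = B t := fun t ht => if_neg (not_lt.2 ht)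
  refine ⟨A, fun t ht x hx => by rw [hAB t ht.1, hBe t ht x hx], fun t₁ ht₁ => ?_⟩
  have hpos : ∀ {c : ℕ → UnitFun} {ρ ρ' C : ℝ}, 0 < ρ' → ρ' ≤ ρ → (∀ n, ‖c n‖ * ρ ^ n ≤ C) →
      ∀ n, ‖c n‖ * ρ' ^ n ≤ C := fun h0 h1 h2 n =>
    (mul_le_mul_of_nonneg_left (pow_le_pow_left₀ h0.le h1 n) (norm_nonneg _)).trans (h2 n)
  rcases ht₁.1.eq_or_lt with rfl | h0
  · have hm : 0 < min ρ₀ 1 := lt_min hρ₀ one_pos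
    refine ⟨min ρ₀ 1, hm, C₀, c₀, hpos hm (min_le_left _ _) hc₀, fun t ht => ?_⟩
    rcases lt_or_ge t 0 with h | h
    · have hC : 0 ≤ C₀ := le_trans (by positivity) (hc₀ 0)
      have htρ : |t| < ρ₀ := by simpa using ht.trans_le (min_le_left _ _)
      have hsum : Summable fun n : ℕ => t ^ n • c₀ n := by
        have := summable_shiftedSeries hρ₀ hc₀ 0 htρ
        simpa using this
      rw [sub_zero, hA]; simp only [if_pos h]
      exact hsum.hasSum
    · rw [hAB t h]
      refine hs₀ t ⟨h, ?_⟩ (ht.trans_le (min_le_left _ _))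
      have := (le_abs_self _).trans_lt (ht.trans_le (min_le_right _ _))
      linarith
  · obtain ⟨ρ, hρ, C, c, hc, hs⟩ := hloc t₁ ht₁
    have hm : 0 < min ρ (min t₁ (1 - t₁)) := lt_min hρ (lt_min h0 (by linarith [ht₁.2]))
    refine ⟨_, hm, C, c, hpos hm (min_le_left _ _) hc, fun t ht => ?_⟩
    obtain ⟨h1, h2, h3⟩ := lt_min_iff.1 ht |>.imp_right lt_min_iff.1
    have h4 := abs_lt.1 h2
    have h5 := abs_lt.1 h3
    rw [hAB t (by linarith)]
    exact hs t ⟨by linarith, by linarith⟩ h1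

/-- Near each time the curve is a power series in the supremum norm, hence continuous in it; the
separate assumptions on x and t thus give joint continuity. -/
theorem AnalyticInTimeUniformly.continuousOn_uncurry {a : ℝ → ℝ → ℝ}
    (ha_cont : ∀ t ∈ Ico (0 : ℝ) 1, ContinuousOn (fun x => a x t) (Icc (0 : ℝ) 1))
    (ha : AnalyticInTimeUniformly a) :
    ContinuousOn (Function.uncurry a) (Icc (0 : ℝ) 1 ×ˢ Ico (0 : ℝ) 1) := by
  obtain ⟨A, hA, hloc⟩ := ha.exists_curve ha_cont
  have hc : ContinuousOn A (Ico 0 1) := fun t₁ ht₁ => by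
    obtain ⟨ρ, hρ, C, c, hc, hs⟩ := hloc t₁ ht₁
    have h1 := hasDerivAt_taylorCoeff hρ hc hs 0 (t := t₁) (by simpa using by positivity)
    have e : taylorCoeff A 0 = A := funext (taylorCoeff_zero A)
    rw [e] at h1
    exact h1.continuousAt.continuousWithinAt
  refine (continuousOn_uncurry_ext hc (Icc 0 1)).congr fun p hp => ?_
  exact (hA p.2 hp.2 p.1 hp.1).symm

/-! ### Integral operators of the Goursat problem on a square -/

/-- The space `C([-3,3]²)`. -/
abbrev SquareFun := C(Icc (-3 : ℝ) 3 × Icc (-3 : ℝ) 3, ℝ)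

/-- The projection of the real line onto `[-3,3]`. -/
noncomputable def sideProj (x : ℝ) : Icc (-3 : ℝ) 3 := projIcc (-3) 3 (by norm_num) x

theorem continuous_sideProj : Continuous sideProj := continuous_projIcc (h := by norm_num)

theorem sideProj_of_mem {x : ℝ} (hx : x ∈ Icc (-3 : ℝ) 3) : sideProj x = ⟨x, hx⟩ :=
  projIcc_of_mem _ hx

@[simp] theorem sideProj_coe (x : Icc (-3 : ℝ) 3) : sideProj x = x := sideProj_of_mem x.2

namespace SquareFun

/-- The extension of a continuous function on `[-3,3]²` to the plane. -/
noncomputable def ext (g : SquareFun) (ξ η : ℝ) : ℝ := g (sideProj ξ, sideProj η)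

theorem ext_coe (g : SquareFun) (p : Icc (-3 : ℝ) 3 × Icc (-3 : ℝ) 3) : g.ext p.1 p.2 = g p := by
  simp [ext]

@[fun_prop]
theorem continuous_ext (g : SquareFun) {X : Type*} [TopologicalSpace X] {u v : X → ℝ}
    (hu : Continuous u) (hv : Continuous v) : Continuous fun x => g.ext (u x) (v x) :=
  g.continuous.comp ((continuous_sideProj.comp hu).prodMk (continuous_sideProj.comp hv))

theorem abs_ext_le (g : SquareFun) (ξ η : ℝ) : |g.ext ξ η| ≤ ‖g‖ := g.norm_coe_le_norm _

theorem ext_add (f g : SquareFun) (ξ η : ℝ) : (f + g).ext ξ η = f.ext ξ η + g.ext ξ η := rfl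

theorem ext_mul (f g : SquareFun) (ξ η : ℝ) : (f * g).ext ξ η = f.ext ξ η * g.ext ξ η := rfl

theorem ext_smul (c : ℝ) (g : SquareFun) (ξ η : ℝ) : (c • g).ext ξ η = c * g.ext ξ η := rfl

theorem continuous_inner_integral (g : SquareFun) :
    Continuous fun p : ℝ × ℝ => ∫ τ in (0 : ℝ)..p.2, g.ext p.1 τ :=
  intervalIntegral.continuous_parametric_intervalIntegral_of_continuous
    (f := fun (p : ℝ × ℝ) τ => g.ext p.1 τ) (by unfold Function.uncurry; fun_prop) continuous_snd

theorem continuous_double_integral (g : SquareFun) :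
    Continuous fun p : ℝ × ℝ => ∫ σ in (0 : ℝ)..p.1, ∫ τ in (0 : ℝ)..p.2, g.ext σ τ :=
  intervalIntegral.continuous_parametric_intervalIntegral_of_continuous
    (f := fun (p : ℝ × ℝ) σ => ∫ τ in (0 : ℝ)..p.2, g.ext σ τ)
    (g.continuous_inner_integral.comp (f := fun q : (ℝ × ℝ) × ℝ => (q.2, q.1.2)) (by fun_prop))
    continuous_fst

/-- The operator `g ↦ ¼ ∫₀^ξ ∫₀^η g`. -/
noncomputable def goursatFun (g : SquareFun) : SquareFun where
  toFun p := 1 / 4 * ∫ σ in (0 : ℝ)..p.1, ∫ τ in (0 : ℝ)..p.2, g.ext σ τ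
  continuous_toFun := continuous_const.mul (g.continuous_double_integral.comp
    (f := fun p : Icc (-3 : ℝ) 3 × Icc (-3 : ℝ) 3 => ((p.1 : ℝ), (p.2 : ℝ))) (by fun_prop))

/-- The operator `g ↦ ¼ ∫₀^ξ g(σ,0) dσ + ¼ ∫₀^η g(0,τ) dτ`. -/
noncomputable def edgeFun (g : SquareFun) : SquareFun where
  toFun p := 1 / 4 * (∫ σ in (0 : ℝ)..p.1, g.ext σ 0) + 1 / 4 * ∫ τ in (0 : ℝ)..p.2, g.ext 0 τ
  continuous_toFun := by
    have h1 : Continuous fun x : ℝ => ∫ σ in (0 : ℝ)..x, g.ext σ 0 :=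
      intervalIntegral.continuous_primitive
        (fun a b => Continuous.intervalIntegrable (by fun_prop) a b) 0
    have h2 : Continuous fun x : ℝ => ∫ τ in (0 : ℝ)..x, g.ext 0 τ :=
      intervalIntegral.continuous_primitive
        (fun a b => Continuous.intervalIntegrable (by fun_prop) a b) 0
    exact (continuous_const.mul (h1.comp (by fun_prop))).add
      (continuous_const.mul (h2.comp (by fun_prop)))

theorem abs_coe_le (x : Icc (-3 : ℝ) 3) : |(x : ℝ)| ≤ 3 := abs_le.2 x.2

theorem abs_integral_le {f : ℝ → ℝ} {C : ℝ} (hf : ∀ s, |f s| ≤ C) (x : Icc (-3 : ℝ) 3) :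
    |∫ s in (0 : ℝ)..x, f s| ≤ 3 * C := by
  have hC : 0 ≤ C := (abs_nonneg _).trans (hf 0)
  have := intervalIntegral.norm_integral_le_of_norm_le_const (f := f) (a := 0) (b := x) fun s _ => hf s
  rw [Real.norm_eq_abs, sub_zero] at this
  nlinarith [abs_coe_le x]

theorem integrable_fst (g : SquareFun) (η a b : ℝ) :
    IntervalIntegrable (fun σ => g.ext σ η) volume a b :=
  Continuous.intervalIntegrable (by fun_prop) _ _

theorem integrable_snd (g : SquareFun) (ξ a b : ℝ) :
    IntervalIntegrable (fun τ => g.ext ξ τ) volume a b :=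
  Continuous.intervalIntegrable (by fun_prop) _ _

theorem continuous_inner_integral_fst (g : SquareFun) (η : ℝ) :
    Continuous fun σ => ∫ τ in (0 : ℝ)..η, g.ext σ τ :=
  g.continuous_inner_integral.comp (f := fun σ : ℝ => (σ, η)) (by fun_prop)

/-- `goursatFun` as a continuous linear map. -/
noncomputable def goursat : SquareFun →L[ℝ] SquareFun :=
  LinearMap.mkContinuous
    { toFun := goursatFun
      map_add' := fun f g => by
        ext p
        change goursatFun _ p = goursatFun _ p + goursatFun _ p
        simp only [goursatFun, ContinuousMap.coe_mk]
        simp only [ext_add]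
        rw [← mul_add, ← intervalIntegral.integral_add
          ((f.continuous_inner_integral_fst _).intervalIntegrable _ _)
          ((g.continuous_inner_integral_fst _).intervalIntegrable _ _)]
        congr 2; ext σ
        exact intervalIntegral.integral_add (f.integrable_snd _ _ _) (g.integrable_snd _ _ _)
      map_smul' := fun c g => by
        ext p
        change goursatFun _ p = c * goursatFun _ p
        simp only [goursatFun, ContinuousMap.coe_mk]
        simp only [ext_smul, intervalIntegral.integral_const_mul]
        ring }
    (9 / 4) fun g => by
      refine (ContinuousMap.norm_le _ (by positivity)).2 fun p => ?_
      change ‖goursatFun g p‖ ≤ _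
      simp only [goursatFun, ContinuousMap.coe_mk]
      have h1 : ∀ σ : ℝ, |∫ τ in (0 : ℝ)..p.2, g.ext σ τ| ≤ 3 * ‖g‖ := fun σ =>
        abs_integral_le (fun τ => g.abs_ext_le σ τ) p.2
      have h2 := abs_integral_le h1 p.1
      rw [norm_mul, Real.norm_eq_abs (∫ _ in _.._, _), Real.norm_of_nonneg (by norm_num)]
      linarith

/-- `edgeFun` as a continuous linear map. -/
noncomputable def edge : SquareFun →L[ℝ] SquareFun :=
  LinearMap.mkContinuous
    { toFun := edgeFun
      map_add' := fun f g => by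
        ext p
        change edgeFun _ p = edgeFun _ p + edgeFun _ p
        simp only [edgeFun, ContinuousMap.coe_mk]
        simp only [ext_add]
        rw [intervalIntegral.integral_add (f.integrable_fst _ _ _) (g.integrable_fst _ _ _),
          intervalIntegral.integral_add (f.integrable_snd _ _ _) (g.integrable_snd _ _ _)]
        ring
      map_smul' := fun c g => by
        ext p
        change edgeFun _ p = c * edgeFun _ p
        simp only [edgeFun, ContinuousMap.coe_mk]
        simp only [ext_smul, intervalIntegral.integral_const_mul]
        ring }
    (3 / 2) fun g => by
      refine (ContinuousMap.norm_le _ (by positivity)).2 fun p => ?_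
      change ‖edgeFun g p‖ ≤ _
      simp only [edgeFun, ContinuousMap.coe_mk]
      have h1 := abs_integral_le (fun σ => g.abs_ext_le σ 0) p.1
      have h2 := abs_integral_le (fun τ => g.abs_ext_le 0 τ) p.2
      refine (norm_add_le _ _).trans ?_
      rw [norm_mul, norm_mul, Real.norm_eq_abs (∫ _ in _.._, _), Real.norm_eq_abs (∫ _ in _.._, _),
        Real.norm_of_nonneg (by norm_num)]
      linarith

theorem goursat_ext (g : SquareFun) {ξ η : ℝ} (hξ : ξ ∈ Icc (-3 : ℝ) 3) (hη : η ∈ Icc (-3 : ℝ) 3) :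
    (goursat g).ext ξ η = 1 / 4 * ∫ σ in (0 : ℝ)..ξ, ∫ τ in (0 : ℝ)..η, g.ext σ τ := by
  rw [ext, sideProj_of_mem hξ, sideProj_of_mem hη]; rfl

theorem edge_ext (g : SquareFun) {ξ η : ℝ} (hξ : ξ ∈ Icc (-3 : ℝ) 3) (hη : η ∈ Icc (-3 : ℝ) 3) :
    (edge g).ext ξ η
      = 1 / 4 * (∫ σ in (0 : ℝ)..ξ, g.ext σ 0) + 1 / 4 * ∫ τ in (0 : ℝ)..η, g.ext 0 τ := by
  rw [ext, sideProj_of_mem hξ, sideProj_of_mem hη]; rfl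

theorem norm_edge_le (g : SquareFun) : ‖edge g‖ ≤ 3 / 2 * ‖g‖ :=
  edge.le_of_opNorm_le (LinearMap.mkContinuous_norm_le _ (by norm_num) _) g

/-- Invariance under the exchange of the two variables. -/
def IsSymm (g : SquareFun) : Prop := ∀ ξ η, g.ext ξ η = g.ext η ξ

theorem isSymm_of_mem {g : SquareFun}
    (h : ∀ ξ ∈ Icc (-3 : ℝ) 3, ∀ η ∈ Icc (-3 : ℝ) 3, g.ext ξ η = g.ext η ξ) : g.IsSymm := by
  intro ξ η
  have h1 := h _ (sideProj ξ).2 _ (sideProj η).2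
  simpa [ext] using h1

theorem IsSymm.edge {g : SquareFun} (h : g.IsSymm) : (edge g).IsSymm :=
  isSymm_of_mem fun ξ hξ η hη => by
    rw [edge_ext g hξ hη, edge_ext g hη hξ, add_comm]
    simp only [h _ 0]

/-- Fubini: exchanging the variables exchanges the order of the two integrations. -/
theorem IsSymm.goursat {g : SquareFun} (h : g.IsSymm) : (goursat g).IsSymm :=
  isSymm_of_mem fun ξ hξ η hη => by
    rw [goursat_ext g hξ hη, goursat_ext g hη hξ, intervalIntegral_intervalIntegral_swap]
    · simp only [h _ _]
    · have hc : Continuous fun p : ℝ × ℝ => g.ext p.1 p.2 := by fun_prop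
      exact (hc.continuousOn.integrableOn_compact (isCompact_uIcc.prod isCompact_uIcc)).mono_set
        (prod_mono uIoc_subset_uIcc uIoc_subset_uIcc)

theorem IsSymm.add {f g : SquareFun} (hf : f.IsSymm) (hg : g.IsSymm) : (f + g).IsSymm :=
  fun ξ η => by rw [ext_add, ext_add, hf, hg]

theorem IsSymm.mul {f g : SquareFun} (hf : f.IsSymm) (hg : g.IsSymm) : (f * g).IsSymm :=
  fun ξ η => by rw [ext_mul, ext_mul, hf, hg]

theorem IsSymm.smul {g : SquareFun} (hg : g.IsSymm) (c : ℝ) : (c • g).IsSymm :=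
  fun ξ η => by rw [ext_smul, ext_smul, hg]

theorem IsSymm.zero : (0 : SquareFun).IsSymm := fun _ _ => rfl

theorem IsSymm.sum {ι : Type*} {f : ι → SquareFun} (s : Finset ι) (hf : ∀ i ∈ s, (f i).IsSymm) :
    (∑ i ∈ s, f i).IsSymm :=
  Finset.sum_induction _ IsSymm (fun _ _ => IsSymm.add) IsSymm.zero hf

/-- Evaluation at a point as a continuous linear map. -/
noncomputable def evalCLM (ξ η : ℝ) : SquareFun →L[ℝ] ℝ :=
  ContinuousMap.evalCLM ℝ (sideProj ξ, sideProj η)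

theorem evalCLM_apply (ξ η : ℝ) (g : SquareFun) : evalCLM ξ η g = g.ext ξ η := rfl

theorem IsSymm.tsum {f : ℕ → SquareFun} (hf : ∀ i, (f i).IsSymm) (hs : Summable f) :
    (∑' i, f i).IsSymm := fun ξ η => by
  rw [← evalCLM_apply, ← evalCLM_apply, ContinuousLinearMap.map_tsum _ hs,
    ContinuousLinearMap.map_tsum _ hs]
  congr 1; ext i
  exact hf i ξ η

/-- The operator `f ↦ f(|ξ - η| / 2)`. -/
noncomputable def ofDiff : UnitFun →L[ℝ] SquareFun :=
  ContinuousMap.compCLM ℝ ℝ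
    (⟨fun p => unitProj (|(p.1 : ℝ) - p.2| / 2), continuous_unitProj.comp (by fun_prop)⟩ :
      C(Icc (-3 : ℝ) 3 × Icc (-3 : ℝ) 3, Icc (0 : ℝ) 1))

theorem ofDiff_ext (f : UnitFun) {ξ η : ℝ} (hξ : ξ ∈ Icc (-3 : ℝ) 3) (hη : η ∈ Icc (-3 : ℝ) 3) :
    (ofDiff f).ext ξ η = f.ext (|ξ - η| / 2) := by
  rw [ext, sideProj_of_mem hξ, sideProj_of_mem hη]; rfl

theorem norm_ofDiff_le (f : UnitFun) : ‖ofDiff f‖ ≤ ‖f‖ :=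
  (ContinuousMap.norm_le _ (norm_nonneg _)).2 fun _ => f.norm_coe_le_norm _

theorem isSymm_ofDiff (f : UnitFun) : (ofDiff f).IsSymm :=
  isSymm_of_mem fun ξ hξ η hη => by rw [ofDiff_ext f hξ hη, ofDiff_ext f hη hξ, abs_sub_comm]

end SquareFun

/-! ### Successive approximation with shrinking radius of analyticity -/

/-- The Leibniz rule for coefficients of a product of power series. -/
theorem sum_antidiagonal_leibniz {R : Type*} [CommRing R] [Algebra ℝ R] (b d : ℕ → R) (m : ℕ) :
    ∑ p ∈ Finset.HasAntidiagonal.antidiagonal m, ((((p.1 : ℝ) + 1) • b (p.1 + 1)) * d p.2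
        + b p.1 * (((p.2 : ℝ) + 1) • d (p.2 + 1)))
      = ((m : ℝ) + 1) • ∑ p ∈ Finset.HasAntidiagonal.antidiagonal (m + 1), b p.1 * d p.2 := by
  -- The formal derivative is a derivation of the power series ring; the identity is the coefficient
  -- of order m of its Leibniz rule.
  have h := congrArg (PowerSeries.coeff m)
    (Derivation.leibniz (PowerSeries.derivative R) (PowerSeries.mk b) (PowerSeries.mk d))
  rw [PowerSeries.coeff_derivative, PowerSeries.coeff_mul, map_add, smul_eq_mul, smul_eq_mul,
    PowerSeries.coeff_mul, mul_comm (PowerSeries.mk d), PowerSeries.coeff_mul,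
    ← Finset.sum_add_distrib] at h
  simp only [PowerSeries.coeff_mk, PowerSeries.coeff_derivative] at h
  have e : ∀ (n : ℕ) (x : R), ((n : ℝ) + 1) • x = x * ((n : R) + 1) := fun n x => by
    rw [Algebra.smul_def, mul_comm]; simp
  simp only [e]
  rw [h]
  exact Finset.sum_congr rfl fun p _ => by ring

/-- An integral over `[0,ξ]` against a majorant with a known primitive. -/
theorem abs_integral_le_of_abs_le_deriv {f w w' : ℝ → ℝ} {ξ s₀ K S : ℝ} (hf : Continuous f)
    (hK : 0 ≤ K) (hs₀ : 0 ≤ s₀) (hS : |ξ| + s₀ ≤ S) (hw : ∀ s ∈ Icc 0 S, HasDerivAt w (w' s) s)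
    (hw' : ContinuousOn w' (Icc 0 S)) (hw0 : 0 ≤ w s₀)
    (hfw : ∀ σ, |σ| ≤ |ξ| → |f σ| ≤ K * w' (|σ| + s₀)) :
    |∫ σ in (0 : ℝ)..ξ, f σ| ≤ K * w (|ξ| + s₀) := by
  -- This settles nonnegative end points, where the lower boundary value of `w` is dropped as
  -- nonnegative; a negative `ξ` is reflected.
  have key : ∀ g : ℝ → ℝ, Continuous g → (∀ σ ∈ Icc 0 |ξ|, |g σ| ≤ K * w' (σ + s₀)) →
      |∫ σ in (0 : ℝ)..|ξ|, g σ| ≤ K * w (|ξ| + s₀) := by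
    intro g hg hgw
    have hmem : ∀ σ ∈ Icc 0 |ξ|, σ + s₀ ∈ Icc 0 S := fun σ hσ =>
      ⟨by linarith [hσ.1], by linarith [hσ.2]⟩
    have hc : ContinuousOn (fun σ => w' (σ + s₀)) (Icc 0 |ξ|) :=
      hw'.comp (by fun_prop) hmem
    have hi : IntervalIntegrable (fun σ => w' (σ + s₀)) volume 0 |ξ| := by
      rw [← uIcc_of_le (abs_nonneg ξ)] at hc
      exact hc.intervalIntegrable
    have h1 : |∫ σ in (0 : ℝ)..|ξ|, g σ| ≤ ∫ σ in (0 : ℝ)..|ξ|, K * w' (σ + s₀) :=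
      intervalIntegral.norm_integral_le_of_norm_le (f := g) (abs_nonneg _)
        (.of_forall fun σ hσ => hgw σ ⟨hσ.1.le, hσ.2⟩) (hi.const_mul K)
    have h2 : ∫ σ in (0 : ℝ)..|ξ|, w' (σ + s₀) = w (|ξ| + s₀) - w (0 + s₀) :=
      intervalIntegral.integral_eq_sub_of_hasDerivAt (f := fun σ => w (σ + s₀)) (fun σ hσ => by
        rw [uIcc_of_le (abs_nonneg ξ)] at hσ
        exact (hw _ (hmem σ hσ)).comp_add_const σ s₀) hi
    rw [intervalIntegral.integral_const_mul, h2, zero_add] at h1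
    nlinarith
  rcases le_total 0 ξ with h | h
  · have := key f hf fun σ hσ => by
      have := hfw σ (by rw [abs_of_nonneg hσ.1]; exact hσ.2)
      rwa [abs_of_nonneg hσ.1] at this
    rwa [abs_of_nonneg h] at this ⊢
  · have := key (fun σ => f (-σ)) (by fun_prop) fun σ hσ => by
      have := hfw (-σ) (by rw [abs_neg, abs_of_nonneg hσ.1]; exact hσ.2)
      rwa [abs_neg, abs_of_nonneg hσ.1] at this
    rw [intervalIntegral.integral_comp_neg, neg_zero, abs_of_nonpos h, neg_neg,
      intervalIntegral.integral_symm, abs_neg] at this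
    rwa [abs_of_nonpos h]

namespace SquareFun

/-- The source term of the `m`-th Taylor coefficient of the Goursat problem. -/
noncomputable def goursatSource (β : ℕ → ℝ → SquareFun) (D : ℕ → ℝ → SquareFun) (m : ℕ) (t : ℝ) :
    SquareFun :=
  ((m : ℝ) + 1) • D (m + 1) t + ∑ p ∈ Finset.HasAntidiagonal.antidiagonal m, β p.1 t * D p.2 t

/-- The increments of the successive approximations of the Taylor coefficients in `t` of the
solution of the Goursat problem with coefficient `β 0`. -/
noncomputable def goursatIter (β : ℕ → ℝ → SquareFun) : ℕ → ℕ → ℝ → SquareFun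
  | 0, m, t => edge (β m t)
  | n + 1, m, t => goursat (goursatSource β (goursatIter β n) m t)

variable {β : ℕ → ℝ → SquareFun}

theorem isSymm_goursatIter (hβ : ∀ m t, (β m t).IsSymm) (n m : ℕ) (t : ℝ) :
    (goursatIter β n m t).IsSymm := by
  induction n generalizing m with
  | zero => exact (hβ m t).edge
  | succ n ih =>
    exact (((ih _).smul _).add (.sum _ fun p _ => (hβ _ _).mul (ih _))).goursat

/-- The index `m` stands for ∂_tᵐ/m!. The rule that relates consecutive Taylor coefficients passes
through the recursion, since the operators are linear and independent of t and the convolution obeys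
the Leibniz rule. -/
theorem hasDerivAt_goursatIter {t : ℝ}
    (hβ : ∀ m : ℕ, HasDerivAt (β m) (((m : ℝ) + 1) • β (m + 1) t) t) (n m : ℕ) :
    HasDerivAt (goursatIter β n m) (((m : ℝ) + 1) • goursatIter β n (m + 1) t) t := by
  induction n generalizing m with
  | zero =>
    have := edge.hasFDerivAt.comp_hasDerivAt t (hβ m)
    rw [map_smul] at this
    exact this
  | succ n ih =>
    have h1 : HasDerivAt (goursatSource β (goursatIter β n) m)
        (((m : ℝ) + 1) • goursatSource β (goursatIter β n) (m + 1) t) t := by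
      have h2 := ((ih (m + 1)).const_smul ((m : ℝ) + 1)).add
        (HasDerivAt.fun_sum fun p (_ : p ∈ Finset.HasAntidiagonal.antidiagonal m) => (hβ p.1).mul (ih p.2))
      rw [sum_antidiagonal_leibniz (fun i => β i t) (fun i => goursatIter β n i t), ← smul_add] at h2
      exact h2
    have := goursat.hasFDerivAt.comp_hasDerivAt t h1
    rw [map_smul] at this
    exact this

/-- The weights for the Taylor coefficients: `e^{γ s} r(s)^{-m}`, where `r` decreases linearly
from `ρ/2` at `0` to `ρ/4` at `6`. -/
noncomputable def goursatWeight (ρ γ : ℝ) (m : ℕ) (s : ℝ) : ℝ :=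
  Real.exp (γ * s) / (ρ * (1 / 2 - s / 24)) ^ m

variable {ρ γ : ℝ}

theorem goursatWeight_nonneg (hρ : 0 < ρ) (m : ℕ) {s : ℝ} (hs : s ∈ Icc (0 : ℝ) 6) :
    0 ≤ goursatWeight ρ γ m s := by
  have : 0 < 1 / 2 - s / 24 := by linarith [hs.2]
  unfold goursatWeight; positivity

theorem goursatWeight_succ (m : ℕ) (s : ℝ) :
    goursatWeight ρ γ (m + 1) s = goursatWeight ρ γ m s / (ρ * (1 / 2 - s / 24)) := by
  rw [goursatWeight, goursatWeight, pow_succ, div_div]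

/-- The derivative of the weight. -/
noncomputable def goursatWeightDeriv (ρ γ : ℝ) (m : ℕ) (s : ℝ) : ℝ :=
  (γ + m * (ρ / 24) / (ρ * (1 / 2 - s / 24))) * goursatWeight ρ γ m s

theorem hasDerivAt_goursatWeight (hρ : 0 < ρ) (m : ℕ) {s : ℝ} (hs : s ∈ Icc (0 : ℝ) 6) :
    HasDerivAt (goursatWeight ρ γ m) (goursatWeightDeriv ρ γ m s) s := by
  have hr : 0 < 1 / 2 - s / 24 := by linarith [hs.2]
  have h1 : HasDerivAt (fun s : ℝ => Real.exp (γ * s)) (Real.exp (γ * s) * (γ * 1)) s :=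
    ((hasDerivAt_id s).const_mul γ).exp
  have h2 : HasDerivAt (fun s : ℝ => ρ * (1 / 2 - s / 24)) (ρ * (0 - 1 / 24)) s :=
    ((hasDerivAt_const s (1 / 2 : ℝ)).sub ((hasDerivAt_id s).div_const 24)).const_mul ρ
  set R := ρ * (1 / 2 - s / 24) with hR
  have hR0 : 0 < R := mul_pos hρ hr
  have h3 : HasDerivAt (fun s : ℝ => Real.exp (γ * s) / (ρ * (1 / 2 - s / 24)) ^ m)
      ((Real.exp (γ * s) * (γ * 1) * R ^ m
        - Real.exp (γ * s) * ((m : ℝ) * R ^ (m - 1) * (ρ * (0 - 1 / 24)))) / (R ^ m) ^ 2) s :=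
    h1.div (h2.pow m) (pow_pos hR0 m).ne'
  refine h3.congr_deriv ?_
  rw [goursatWeightDeriv, goursatWeight, ← hR]
  clear_value R
  rcases m with _ | m
  · simp; ring
  · rw [Nat.add_sub_cancel]
    field_simp
    ring

theorem continuousOn_goursatWeightDeriv (hρ : 0 < ρ) (m : ℕ) :
    ContinuousOn (goursatWeightDeriv ρ γ m) (Icc (0 : ℝ) 6) := by
  unfold goursatWeightDeriv goursatWeight
  have h : ∀ s ∈ Icc (0 : ℝ) 6, ρ * (1 / 2 - s / 24) ≠ 0 := fun s hs =>
    (mul_pos hρ (by linarith [hs.2])).ne'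
  refine ContinuousOn.mul (continuousOn_const.add (ContinuousOn.div (by fun_prop) (by fun_prop) h))
    (ContinuousOn.div (by fun_prop) (by fun_prop) fun s hs => pow_ne_zero _ (h s hs))


/-- Of the two integrations the inner one turns the derivative of the weight back into the weight,
and the outer one gains 1/γ because γ times the weight is at most its derivative. -/
theorem abs_goursat_le {f : SquareFun} {K : ℝ} {m : ℕ} (hρ : 0 < ρ) (hγ : 0 < γ) (hK : 0 ≤ K)
    (hf : ∀ ξ ∈ Icc (-3 : ℝ) 3, ∀ η ∈ Icc (-3 : ℝ) 3,
      |f.ext ξ η| ≤ K * goursatWeightDeriv ρ γ m (|ξ| + |η|))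
    {ξ η : ℝ} (hξ : ξ ∈ Icc (-3 : ℝ) 3) (hη : η ∈ Icc (-3 : ℝ) 3) :
    |(goursat f).ext ξ η| ≤ K / (4 * γ) * goursatWeight ρ γ m (|ξ| + |η|) := by
  have hmem : ∀ {x y z : ℝ}, x ∈ Icc (-3 : ℝ) 3 → |y| ≤ |x| → y ∈ Icc (-3 : ℝ) 3 := fun hx hy =>
    abs_le.1 (hy.trans (abs_le.2 hx))
  have hsum : ∀ {x y : ℝ}, x ∈ Icc (-3 : ℝ) 3 → y ∈ Icc (-3 : ℝ) 3 → |x| + |y| ∈ Icc (0 : ℝ) 6 :=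
    fun hx hy => ⟨by positivity, by linarith [abs_le.2 hx, abs_le.2 hy]⟩
  have h1 : ∀ σ ∈ Icc (-3 : ℝ) 3, |∫ τ in (0 : ℝ)..η, f.ext σ τ|
      ≤ K * goursatWeight ρ γ m (|σ| + |η|) := fun σ hσ => by
    rw [add_comm]
    refine abs_integral_le_of_abs_le_deriv (S := 6) (by fun_prop) hK (abs_nonneg σ)
      (by rw [add_comm]; exact (hsum hσ hη).2) (fun s hs => hasDerivAt_goursatWeight hρ m hs)
      (continuousOn_goursatWeightDeriv hρ m)
      (goursatWeight_nonneg hρ m ⟨abs_nonneg σ, by linarith [abs_le.2 hσ]⟩) fun τ hτ => ?_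
    rw [add_comm]
    exact hf σ hσ τ (abs_le.1 (hτ.trans (abs_le.2 hη)))
  have h2 : |∫ σ in (0 : ℝ)..ξ, ∫ τ in (0 : ℝ)..η, f.ext σ τ|
      ≤ K / γ * goursatWeight ρ γ m (|ξ| + |η|) := by
    refine abs_integral_le_of_abs_le_deriv (S := 6) (f.continuous_inner_integral_fst η)
      (by positivity) (abs_nonneg η)
      (hsum hξ hη).2 (fun s hs => hasDerivAt_goursatWeight hρ m hs)
      (continuousOn_goursatWeightDeriv hρ m)
      (goursatWeight_nonneg hρ m ⟨abs_nonneg η, by linarith [abs_le.2 hη]⟩) fun σ hσ => ?_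
    have hσ' : σ ∈ Icc (-3 : ℝ) 3 := abs_le.1 (hσ.trans (abs_le.2 hξ))
    have hs := hsum hσ' hη
    refine (h1 σ hσ').trans ?_
    have hr : 0 < 1 / 2 - (|σ| + |η|) / 24 := by linarith [hs.2]
    rw [div_mul_eq_mul_div, mul_div_assoc]
    refine mul_le_mul_of_nonneg_left ?_ hK
    rw [le_div_iff₀ hγ, goursatWeightDeriv, mul_comm]
    exact mul_le_mul_of_nonneg_right (le_add_of_nonneg_right (by positivity))
      (goursatWeight_nonneg hρ m hs)
  rw [goursat_ext f hξ hη, abs_mul, abs_of_pos (by norm_num : (0 : ℝ) < 1 / 4)]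
  refine (mul_le_mul_of_nonneg_left h2 (by norm_num)).trans (le_of_eq ?_)
  field_simp

theorem sum_antidiagonal_half_pow_le (m : ℕ) :
    ∑ p ∈ Finset.HasAntidiagonal.antidiagonal m, (1 / 2 : ℝ) ^ p.1 ≤ 2 := by
  rw [Finset.Nat.sum_antidiagonal_eq_sum_range_succ (fun i _ => (1 / 2 : ℝ) ^ i)]
  exact (summable_geometric_two.sum_le_tsum _ fun _ _ => by positivity).trans_eq tsum_geometric_two

/-- The heart of the existence proof. With s = |ξ| + |η| and R = ρ(1/2 − s/24), the lost time
derivative costs (m+1)/R times the weight of index m, which is unbounded in m. The derivative of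
R^{-m} in s contains exactly m(ρ/24)/R, so the shrinking radius pays for m/R; the rest 1/R + 2C is
independent of m and is absorbed by γ. Each step then halves the bound, for all m simultaneously. -/
theorem abs_goursatIter_le {C t : ℝ} (hρ : 0 < ρ) (hC : ∀ m, ‖β m t‖ * ρ ^ m ≤ C)
    (hγ₁ : 12 / ρ ≤ γ) (hγ₂ : ρ / 24 * (4 / ρ + 2 * C) ≤ γ) (n m : ℕ) {ξ η : ℝ}
    (hξ : ξ ∈ Icc (-3 : ℝ) 3) (hη : η ∈ Icc (-3 : ℝ) 3) :
    |(goursatIter β n m t).ext ξ η| ≤ 2 * C * (1 / 2) ^ n * goursatWeight ρ γ m (|ξ| + |η|) := by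
  have hC0 : 0 ≤ C := le_trans (by positivity) (hC 0)
  have hγ : 0 < γ := lt_of_lt_of_le (by positivity) hγ₁
  have hsum : ∀ {x y : ℝ}, x ∈ Icc (-3 : ℝ) 3 → y ∈ Icc (-3 : ℝ) 3 → |x| + |y| ∈ Icc (0 : ℝ) 6 :=
    fun hx hy => ⟨by positivity, by linarith [abs_le.2 hx, abs_le.2 hy]⟩
  have hβ : ∀ m, ‖β m t‖ ≤ C / ρ ^ m := fun m => (le_div_iff₀ (by positivity)).2 (hC m)
  induction n generalizing m ξ η with
  | zero =>
    have hs := hsum hξ hη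
    have hr : 0 < 1 / 2 - (|ξ| + |η|) / 24 := by linarith [hs.2]
    have h1 : 1 / ρ ^ m ≤ goursatWeight ρ γ m (|ξ| + |η|) := by
      refine div_le_div₀ (Real.exp_nonneg _) (Real.one_le_exp (mul_nonneg hγ.le hs.1))
        (by positivity) (pow_le_pow_left₀ (by positivity) ?_ m)
      nlinarith [hs.1]
    calc |(goursatIter β 0 m t).ext ξ η| ≤ 3 / 2 * ‖β m t‖ :=
          (abs_ext_le _ _ _).trans (norm_edge_le _)
      _ ≤ 2 * (C / ρ ^ m) := by
        have := hβ m
        have := norm_nonneg (β m t)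
        linarith
      _ = 2 * C * (1 / 2) ^ 0 * (1 / ρ ^ m) := by ring
      _ ≤ _ := mul_le_mul_of_nonneg_left h1 (by positivity)
  | succ n ih =>
    set X := 2 * C * (1 / 2) ^ n with hX
    have hX0 : 0 ≤ X := by positivity
    have hsrc : ∀ ξ ∈ Icc (-3 : ℝ) 3, ∀ η ∈ Icc (-3 : ℝ) 3,
        |(goursatSource β (goursatIter β n) m t).ext ξ η|
          ≤ 24 / ρ * X * goursatWeightDeriv ρ γ m (|ξ| + |η|) := by
      intro ξ hξ η hη
      have hs := hsum hξ hη
      have hr : 0 < 1 / 2 - (|ξ| + |η|) / 24 := by linarith [hs.2]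
      set R := ρ * (1 / 2 - (|ξ| + |η|) / 24) with hR
      set W := goursatWeight ρ γ m (|ξ| + |η|) with hW
      have hW0 : 0 ≤ W := goursatWeight_nonneg hρ m hs
      have hR0 : 0 < R := mul_pos hρ hr
      have h1 : |(((m : ℝ) + 1) • goursatIter β n (m + 1) t).ext ξ η| ≤ (m + 1) * (X * (W / R)) := by
        rw [ext_smul, abs_mul, abs_of_pos (by positivity), ← goursatWeight_succ]
        exact mul_le_mul_of_nonneg_left (ih (m + 1) hξ hη) (by positivity)
      have h2 : |(∑ p ∈ Finset.HasAntidiagonal.antidiagonal m,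
          β p.1 t * goursatIter β n p.2 t).ext ξ η| ≤ 2 * C * X * W := by
        rw [← evalCLM_apply, map_sum]
        refine (Finset.abs_sum_le_sum_abs _ _).trans ?_
        have h3 : ∀ p ∈ Finset.HasAntidiagonal.antidiagonal m,
            |evalCLM ξ η (β p.1 t * goursatIter β n p.2 t)| ≤ C * X * W * (1 / 2) ^ p.1 := by
          intro p hp
          rw [evalCLM_apply, ext_mul, abs_mul]
          have h4 := ((β p.1 t).abs_ext_le ξ η).trans (hβ p.1)
          refine (mul_le_mul h4 (ih p.2 hξ hη) (abs_nonneg _) (by positivity)).trans ?_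
          -- Starting the weights at the radius ρ/2 gives R ≤ ρ/2. This surplus makes the
          -- convolution with the coefficients a geometric sum of ratio 1/2, bounded by 2 uniformly
          -- in m.
          have h5 : 1 / ρ ^ p.1 ≤ (1 / 2) ^ p.1 / R ^ p.1 := by
            rw [← one_div_pow, ← div_pow]
            refine pow_le_pow_left₀ (by positivity) ?_ _
            rw [div_le_div_iff₀ hρ hR0]
            nlinarith [hs.1]
          have h6 : W = goursatWeight ρ γ p.2 (|ξ| + |η|) / R ^ p.1 := by
            rw [hW, goursatWeight, goursatWeight, div_div, ← pow_add, add_comm p.2,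
              Finset.HasAntidiagonal.mem_antidiagonal.1 hp]
          have h7 : 0 ≤ goursatWeight ρ γ p.2 (|ξ| + |η|) := goursatWeight_nonneg hρ _ hs
          calc C / ρ ^ p.1 * (X * goursatWeight ρ γ p.2 (|ξ| + |η|))
              = C * X * goursatWeight ρ γ p.2 (|ξ| + |η|) * (1 / ρ ^ p.1) := by ring
            _ ≤ C * X * goursatWeight ρ γ p.2 (|ξ| + |η|) * ((1 / 2) ^ p.1 / R ^ p.1) := by gcongr
            _ = C * X * W * (1 / 2) ^ p.1 := by rw [h6]; ring
        refine (Finset.sum_le_sum h3).trans ?_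
        rw [← Finset.mul_sum]
        calc _ ≤ C * X * W * 2 :=
              mul_le_mul_of_nonneg_left (sum_antidiagonal_half_pow_le m) (by positivity)
          _ = _ := by ring
      rw [goursatSource, ext_add, goursatWeightDeriv, ← hW, ← hR]
      refine (abs_add_le _ _).trans ((add_le_add h1 h2).trans ?_)
      have h8 : 1 / R ≤ 4 / ρ := by
        rw [div_le_div_iff₀ hR0 hρ]
        nlinarith [hs.2]
      have h9 : 1 / R + 2 * C ≤ 24 / ρ * γ := by
        have := mul_le_mul_of_nonneg_left hγ₂ (by positivity : 0 ≤ 24 / ρ)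
        have e : 24 / ρ * (ρ / 24 * (4 / ρ + 2 * C)) = 4 / ρ + 2 * C := by field_simp
        linarith
      calc (m + 1) * (X * (W / R)) + 2 * C * X * W = X * W * (m / R + (1 / R + 2 * C)) := by ring
        _ ≤ X * W * (m / R + 24 / ρ * γ) := by gcongr
        _ = 24 / ρ * X * ((γ + m * (ρ / 24) / R) * W) := by field_simp; ring
    -- The integrations contribute 1/(4γ), and 24/ρ divided by 4γ is at most 1/2 by `hγ₁`.
    refine (abs_goursat_le hρ hγ (by positivity) hsrc hξ hη).trans ?_
    refine mul_le_mul_of_nonneg_right ?_ (goursatWeight_nonneg hρ m (hsum hξ hη))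
    have e : 2 * C * (1 / 2) ^ (n + 1) = X * (1 / 2) := by rw [hX, pow_succ, mul_assoc (2 * C)]
    rw [e, div_le_iff₀ (by positivity)]
    have h10 : 12 / ρ * X ≤ γ * X := mul_le_mul_of_nonneg_right hγ₁ hX0
    calc 24 / ρ * X = 2 * (12 / ρ * X) := by ring
      _ ≤ 2 * (γ * X) := by linarith
      _ = _ := by ring

/-- Geometric decay of the iterates, uniformly in a neighbourhood of a time. -/
theorem norm_goursatIter_le {C t : ℝ} (hρ : 0 < ρ) (hC : ∀ m, ‖β m t‖ * ρ ^ m ≤ C)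
    (hγ₁ : 12 / ρ ≤ γ) (hγ₂ : ρ / 24 * (4 / ρ + 2 * C) ≤ γ) (n m : ℕ) :
    ‖goursatIter β n m t‖ ≤ 2 * C * (Real.exp (γ * 6) * (4 / ρ) ^ m) * (1 / 2) ^ n := by
  have hC0 : 0 ≤ C := le_trans (by positivity) (hC 0)
  have hγ : 0 < γ := lt_of_lt_of_le (by positivity) hγ₁
  refine (ContinuousMap.norm_le _ (by positivity)).2 fun p => ?_
  rw [← ext_coe, Real.norm_eq_abs]
  refine (abs_goursatIter_le hρ hC hγ₁ hγ₂ n m p.1.2 p.2.2).trans ?_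
  have h1 := abs_coe_le p.1
  have h2 := abs_coe_le p.2
  have hs : |(p.1 : ℝ)| + |(p.2 : ℝ)| ≤ 6 := by linarith
  have h3 : goursatWeight ρ γ m (|(p.1 : ℝ)| + |(p.2 : ℝ)|) ≤ Real.exp (γ * 6) * (4 / ρ) ^ m := by
    have e : Real.exp (γ * 6) * (4 / ρ) ^ m = Real.exp (γ * 6) / (ρ / 4) ^ m := by
      rw [div_pow, div_pow]; field_simp
    rw [goursatWeight, e]
    gcongr
    nlinarith
  calc _ ≤ 2 * C * (1 / 2) ^ n * (Real.exp (γ * 6) * (4 / ρ) ^ m) := by gcongr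
    _ = _ := by ring

end SquareFun

/-! ### The sum of the approximations solves the Goursat problem -/

namespace SquareFun

variable {β : ℕ → ℝ → SquareFun} {ρ C t₁ δ : ℝ}

/-- The Taylor coefficients in `t` of the solution of the Goursat problem. -/
noncomputable def goursatSum (β : ℕ → ℝ → SquareFun) (m : ℕ) (t : ℝ) : SquareFun :=
  ∑' n, goursatIter β n m t

/-- γ is the larger of the two lower bounds in the estimate. It depends on ρ and C only, so M is the
same for all n and all admissible t, which permits termwise differentiation in time. -/
theorem exists_norm_goursatIter_le (hρ : 0 < ρ) (C : ℝ) (m : ℕ) : ∃ M : ℝ, ∀ n t,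
    (∀ m, ‖β m t‖ * ρ ^ m ≤ C) → ‖goursatIter β n m t‖ ≤ M * (1 / 2) ^ n :=
  ⟨_, fun n _ hC => norm_goursatIter_le hρ hC (le_max_left _ _) (le_max_right _ _) n m⟩

theorem summable_goursatIter {t : ℝ} (hρ : 0 < ρ) (hC : ∀ m, ‖β m t‖ * ρ ^ m ≤ C) (m : ℕ) :
    Summable fun n => goursatIter β n m t := by
  obtain ⟨M, hM⟩ := exists_norm_goursatIter_le (β := β) hρ C m
  exact Summable.of_norm_bounded (summable_geometric_two.mul_left M) fun n => hM n t hC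

theorem isSymm_goursatSum {t : ℝ} (hρ : 0 < ρ) (hC : ∀ m, ‖β m t‖ * ρ ^ m ≤ C)
    (hβ : ∀ m t, (β m t).IsSymm) (m : ℕ) : (goursatSum β m t).IsSymm :=
  IsSymm.tsum (fun n => isSymm_goursatIter hβ n m t) (summable_goursatIter hρ hC m)

/-- Summing the recursion at m = 0, whose source is the coefficient of order one plus b times the
coefficient of order zero; the former is the time derivative of the latter. -/
theorem goursatSum_eq {t : ℝ} (hρ : 0 < ρ) (hC : ∀ m, ‖β m t‖ * ρ ^ m ≤ C) :
    goursatSum β 0 t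
      = edge (β 0 t) + goursat (goursatSum β 1 t + β 0 t * goursatSum β 0 t) := by
  have h0 := summable_goursatIter hρ hC 0
  have h1 := summable_goursatIter hρ hC 1
  have e : goursat (goursatSum β 1 t + β 0 t * goursatSum β 0 t) = ∑' n, goursatIter β (n + 1) 0 t := by
    rw [goursatSum, goursatSum, ← h0.tsum_mul_left, ← h1.tsum_add (h0.mul_left _),
      goursat.map_tsum (h1.add (h0.mul_left _))]
    refine tsum_congr fun n => ?_
    simp [goursatIter, goursatSource]
  rw [e, goursatSum, h0.tsum_eq_zero_add]
  rfl

theorem hasDerivAt_goursatSum (hρ : 0 < ρ)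
    (hC : ∀ t, |t - t₁| < δ → ∀ m, ‖β m t‖ * ρ ^ m ≤ C)
    (hβ : ∀ t, |t - t₁| < δ → ∀ m : ℕ, HasDerivAt (β m) (((m : ℝ) + 1) • β (m + 1) t) t)
    (m : ℕ) {t : ℝ} (ht : |t - t₁| < δ) :
    HasDerivAt (goursatSum β m) (((m : ℝ) + 1) • goursatSum β (m + 1) t) t := by
  obtain ⟨M, hM⟩ := exists_norm_goursatIter_le (β := β) hρ C (m + 1)
  have hball : ∀ {s}, s ∈ Metric.ball t₁ δ ↔ |s - t₁| < δ := by simp [Real.dist_eq]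
  have h := hasDerivAt_tsum_of_isPreconnected (𝕜 := ℝ) (t := Metric.ball t₁ δ)
    (g := fun n => goursatIter β n m)
    (g' := fun n s => ((m : ℝ) + 1) • goursatIter β n (m + 1) s)
    (u := fun n => ((m : ℝ) + 1) * (M * (1 / 2) ^ n)) (y₀ := t) (y := t)
    ((summable_geometric_two.mul_left M).mul_left _) Metric.isOpen_ball
    (convex_ball _ _).isPreconnected
    (fun n s hs => hasDerivAt_goursatIter (hβ s (hball.1 hs)) n m)
    (fun n s hs => by
      rw [norm_smul, Real.norm_of_nonneg (by positivity)]
      exact mul_le_mul_of_nonneg_left (hM n s (hC s (hball.1 hs))) (by positivity))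
    (hball.2 ht) (summable_goursatIter hρ (hC t ht) m) (hball.2 ht)
  rwa [tsum_const_smul''] at h

/-- The function `¼ g(ξ,0)`. -/
noncomputable def edgeDeriv : SquareFun →L[ℝ] SquareFun :=
  (1 / 4 : ℝ) • ContinuousMap.compCLM ℝ ℝ
    (⟨fun p => (p.1, sideProj 0), by fun_prop⟩ :
      C(Icc (-3 : ℝ) 3 × Icc (-3 : ℝ) 3, Icc (-3 : ℝ) 3 × Icc (-3 : ℝ) 3))

theorem edgeDeriv_ext (g : SquareFun) (ξ η : ℝ) : (edgeDeriv g).ext ξ η = 1 / 4 * g.ext ξ 0 := rfl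

/-- The function `¼ ∫₀^η g(ξ,τ) dτ`. -/
noncomputable def goursatDeriv : SquareFun →L[ℝ] SquareFun :=
  LinearMap.mkContinuous
    { toFun := fun g => ⟨fun p => 1 / 4 * ∫ τ in (0 : ℝ)..p.2, g.ext p.1 τ,
        continuous_const.mul (g.continuous_inner_integral.comp
          (f := fun p : Icc (-3 : ℝ) 3 × Icc (-3 : ℝ) 3 => ((p.1 : ℝ), (p.2 : ℝ))) (by fun_prop))⟩
      map_add' := fun f g => by
        ext p
        simp only [ContinuousMap.coe_mk, ContinuousMap.add_apply, ext_add]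
        rw [intervalIntegral.integral_add (f.integrable_snd _ _ _) (g.integrable_snd _ _ _), mul_add]
      map_smul' := fun c g => by
        ext p
        simp only [ContinuousMap.coe_mk, ContinuousMap.smul_apply, ext_smul, RingHom.id_apply,
          intervalIntegral.integral_const_mul, smul_eq_mul]
        ring }
    (3 / 4) fun g => by
      refine (ContinuousMap.norm_le _ (by positivity)).2 fun p => ?_
      have h1 := abs_integral_le (fun τ => g.abs_ext_le p.1 τ) p.2
      simp only [LinearMap.coe_mk, AddHom.coe_mk, ContinuousMap.coe_mk]
      rw [norm_mul, Real.norm_eq_abs (∫ _ in _.._, _), Real.norm_of_nonneg (by norm_num)]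
      linarith

theorem goursatDeriv_ext (g : SquareFun) {ξ η : ℝ} (hξ : ξ ∈ Icc (-3 : ℝ) 3)
    (hη : η ∈ Icc (-3 : ℝ) 3) :
    (goursatDeriv g).ext ξ η = 1 / 4 * ∫ τ in (0 : ℝ)..η, g.ext ξ τ := by
  rw [ext, sideProj_of_mem hξ, sideProj_of_mem hη]; rfl

/-- The mixed derivative exists when G_ξ is differentiated in η, by the fundamental theorem of
calculus for a continuous integrand. A second derivative in ξ is not available, which is why the
wave operator is read as (∂_x − ∂_y)(k_x + k_y). -/
theorem hasDerivAt_goursatDeriv_snd (g : SquareFun) {ξ η : ℝ} (hξ : ξ ∈ Icc (-3 : ℝ) 3)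
    (hη : η ∈ Ioo (-3 : ℝ) 3) :
    HasDerivAt (fun η => (goursatDeriv g).ext ξ η) (1 / 4 * g.ext ξ η) η := by
  have h1 : HasDerivAt (fun η => 1 / 4 * ∫ τ in (0 : ℝ)..η, g.ext ξ τ) (1 / 4 * g.ext ξ η) η :=
    ((show Continuous fun τ => g.ext ξ τ by fun_prop).integral_hasStrictDerivAt 0 η).hasDerivAt.const_mul _
  refine h1.congr_of_eventuallyEq ?_
  filter_upwards [isOpen_Ioo.mem_nhds hη] with s hs
  exact goursatDeriv_ext g hξ (Ioo_subset_Icc_self hs)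

theorem hasDerivAt_goursat_fst (b g : SquareFun) {ξ η : ℝ} (hξ : ξ ∈ Ioo (-3 : ℝ) 3)
    (hη : η ∈ Icc (-3 : ℝ) 3) :
    HasDerivAt (fun ξ => (edge b + goursat g).ext ξ η) ((edgeDeriv b + goursatDeriv g).ext ξ η) ξ := by
  have h1 : HasDerivAt (fun ξ => ∫ σ in (0 : ℝ)..ξ, b.ext σ 0) (b.ext ξ 0) ξ :=
    (show Continuous fun σ => b.ext σ 0 by fun_prop).integral_hasStrictDerivAt 0 ξ |>.hasDerivAt
  have h2 := ((g.continuous_inner_integral_fst η).integral_hasStrictDerivAt 0 ξ).hasDerivAt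
  have h3 := (((h1.const_mul (1 / 4)).add_const (1 / 4 * ∫ τ in (0 : ℝ)..η, b.ext 0 τ)).add
    (h2.const_mul (1 / 4)))
  rw [ext_add, edgeDeriv_ext, goursatDeriv_ext g (Ioo_subset_Icc_self hξ) hη]
  refine h3.congr_of_eventuallyEq ?_
  filter_upwards [isOpen_Ioo.mem_nhds hξ] with s hs
  rw [ext_add, edge_ext b (Ioo_subset_Icc_self hs) hη, goursat_ext g (Ioo_subset_Icc_self hs) hη]
  rfl

theorem continuousAt_ext {X : Type*} [TopologicalSpace X] {G : X → SquareFun} {u v : X → ℝ} {x : X}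
    (hG : ContinuousAt G x) (hu : ContinuousAt u x) (hv : ContinuousAt v x) :
    ContinuousAt (fun x => (G x).ext (u x) (v x)) x :=
  (ContinuousEval.continuous_eval (F := SquareFun)).continuousAt.comp (f := fun x =>
    (G x, (sideProj (u x), sideProj (v x))))
    (hG.prodMk ((continuous_sideProj.continuousAt.comp hu).prodMk
      (continuous_sideProj.continuousAt.comp hv)))

end SquareFun

/-! ### From the Goursat problem back to the kernel problem -/

/-- A function of three variables with continuous partial derivatives is differentiable. -/
theorem hasFDerivAt_of_continuous_partials {f p q r : ℝ × ℝ × ℝ → ℝ} {O : Set (ℝ × ℝ × ℝ)}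
    (hO : IsOpen O)
    (hp : ∀ v ∈ O, HasDerivAt (fun s => f (s, v.2.1, v.2.2)) (p v) v.1)
    (hq : ∀ v ∈ O, HasDerivAt (fun s => f (v.1, s, v.2.2)) (q v) v.2.1)
    (hr : ∀ v ∈ O, HasDerivAt (fun s => f (v.1, v.2.1, s)) (r v) v.2.2)
    (cp : ∀ v ∈ O, ContinuousAt p v) (cq : ∀ v ∈ O, ContinuousAt q v)
    (cr : ∀ v ∈ O, ContinuousAt r v) {v : ℝ × ℝ × ℝ} (hv : v ∈ O) :
    HasFDerivAt f ((ContinuousLinearMap.toSpanSingleton ℝ (p v)).coprod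
      ((ContinuousLinearMap.toSpanSingleton ℝ (q v)).coprod
        (ContinuousLinearMap.toSpanSingleton ℝ (r v)))) v := by
  have hL : Continuous fun c : ℝ => ContinuousLinearMap.toSpanSingleton ℝ c :=
    (ContinuousLinearMap.toSpanSingletonCLE (𝕜 := ℝ) (E := ℝ)).continuous
  have inner : ∀ v ∈ O, HasFDerivAt (fun w : ℝ × ℝ => f (v.1, w))
      ((ContinuousLinearMap.toSpanSingleton ℝ (q v)).coprod
        (ContinuousLinearMap.toSpanSingleton ℝ (r v))) v.2 := by
    intro v hv
    have hnear : ∀ᶠ w in 𝓝 v.2, (v.1, w) ∈ O :=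
      (Continuous.prodMk_right v.1).continuousAt (x := v.2) (hO.mem_nhds hv)
    exact (hasStrictFDerivAt_uncurry_coprod (𝕜 := ℝ) (u := v.2) (f := fun y t => f (v.1, y, t))
      (f₁ := fun y t => ContinuousLinearMap.toSpanSingleton ℝ (q (v.1, y, t)))
      (f₂ := fun y t => ContinuousLinearMap.toSpanSingleton ℝ (r (v.1, y, t)))
      (hnear.mono fun w hw => (hq _ hw).hasFDerivAt) (hnear.mono fun w hw => (hr _ hw).hasFDerivAt)
      (hL.continuousAt.comp ((cq v hv).comp (f := fun w : ℝ × ℝ => (v.1, w))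
        (Continuous.prodMk_right v.1).continuousAt))
      (hL.continuousAt.comp ((cr v hv).comp (f := fun w : ℝ × ℝ => (v.1, w))
        (Continuous.prodMk_right v.1).continuousAt))).hasFDerivAt
  have hnear : ∀ᶠ w in 𝓝 v, w ∈ O := hO.mem_nhds hv
  have hco : Continuous fun c : ℝ × ℝ => (ContinuousLinearMap.toSpanSingleton ℝ c.1).coprod
      (ContinuousLinearMap.toSpanSingleton ℝ c.2) := by
    simp only [← ContinuousLinearMap.comp_fst_add_comp_snd]
    exact ((hL.comp continuous_fst).clm_comp continuous_const).add
      ((hL.comp continuous_snd).clm_comp continuous_const)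
  exact (hasStrictFDerivAt_uncurry_coprod (𝕜 := ℝ) (u := v) (f := fun x w => f (x, w))
      (f₁ := fun x w => ContinuousLinearMap.toSpanSingleton ℝ (p (x, w)))
      (f₂ := fun x w => (ContinuousLinearMap.toSpanSingleton ℝ (q (x, w))).coprod
        (ContinuousLinearMap.toSpanSingleton ℝ (r (x, w))))
      (hnear.mono fun w hw => (hp _ hw).hasFDerivAt) (hnear.mono fun w hw => inner _ hw)
      (hL.continuousAt.comp (cp v hv))
      (hco.continuousAt.comp (f := fun w => (q w, r w)) ((cq v hv).prodMk (cr v hv)))).hasFDerivAt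

namespace SquareFun

/-- The curve `G` solves, at the time `t`, the integral form of the Goursat problem
`4 G_ξη = G_t + b G` with derivative `G' = G_t`. -/
structure IsGoursatSolutionAt (b G G' : ℝ → SquareFun) (t : ℝ) : Prop where
  hasDerivAt : HasDerivAt G (G' t) t
  continuousAt_deriv : ContinuousAt G' t
  continuousAt_coeff : ContinuousAt b t
  isSymm : (G t).IsSymm
  eq : G t = edge (b t) + goursat (G' t + b t * G t)

theorem isGoursatSolutionAt_goursatSum {β : ℕ → ℝ → SquareFun} {ρ C t₁ δ : ℝ} (hρ : 0 < ρ)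
    (hC : ∀ t, |t - t₁| < δ → ∀ m, ‖β m t‖ * ρ ^ m ≤ C)
    (hβ : ∀ t, |t - t₁| < δ → ∀ m : ℕ, HasDerivAt (β m) (((m : ℝ) + 1) • β (m + 1) t) t)
    (hs : ∀ m t, (β m t).IsSymm) {t : ℝ} (ht : |t - t₁| < δ) :
    IsGoursatSolutionAt (β 0) (goursatSum β 0) (goursatSum β 1) t where
  hasDerivAt := by simpa using hasDerivAt_goursatSum hρ hC hβ 0 ht
  continuousAt_deriv := (hasDerivAt_goursatSum hρ hC hβ 1 ht).continuousAt
  continuousAt_coeff := (hβ t ht 0).continuousAt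
  isSymm := isSymm_goursatSum hρ (hC t ht) hs 0
  eq := goursatSum_eq hρ (hC t ht)

/-- The coefficient of the Goursat problem and its Taylor coefficients. -/
noncomputable def goursatCoeff (lam : ℝ) (A : ℝ → UnitFun) (m : ℕ) (t : ℝ) : SquareFun :=
  ofDiff (taylorCoeff A m t) + if m = 0 then lam • 1 else 0

theorem isSymm_goursatCoeff (lam : ℝ) (A : ℝ → UnitFun) (m : ℕ) (t : ℝ) :
    (goursatCoeff lam A m t).IsSymm := by
  refine (isSymm_ofDiff _).add ?_
  split_ifs
  exacts [fun _ _ => rfl, .zero]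

/-- The Taylor coefficients of `A`, and with them the series for G, are defined at every t without
reference to a centre. The expansions around the various t₁ only supply local bounds, so nothing has
to be glued. The set `T` is an open neighbourhood of [0,1), so time derivatives are two-sided even
at t = 0. -/
theorem exists_isGoursatSolutionAt {lam : ℝ} {a : ℝ → ℝ → ℝ}
    (ha_cont : ∀ t ∈ Ico (0 : ℝ) 1, ContinuousOn (fun x => a x t) (Icc (0 : ℝ) 1))
    (ha : AnalyticInTimeUniformly a) :
    ∃ (b G G' : ℝ → SquareFun) (T : Set ℝ), IsOpen T ∧ Ico 0 1 ⊆ T ∧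
      (∀ t ∈ T, IsGoursatSolutionAt b G G' t) ∧
      ∀ t ∈ Ico (0 : ℝ) 1, ∀ ξ ∈ Icc (-3 : ℝ) 3, ∀ η ∈ Icc (-3 : ℝ) 3, |ξ - η| / 2 ≤ 1 →
        (b t).ext ξ η = a (|ξ - η| / 2) t + lam := by
  obtain ⟨A, hA, hloc⟩ := ha.exists_curve ha_cont
  have hev : ∀ᶠ t in 𝓝ˢ (Ico (0 : ℝ) 1), IsGoursatSolutionAt (goursatCoeff lam A 0)
      (goursatSum (goursatCoeff lam A) 0) (goursatSum (goursatCoeff lam A) 1) t := by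
    rw [eventually_nhdsSet_iff_forall]
    intro t₁ ht₁
    obtain ⟨ρ, hρ, C, c, hc, hs⟩ := hloc t₁ ht₁
    filter_upwards [Metric.ball_mem_nhds t₁ (half_pos hρ)] with t ht
    refine isGoursatSolutionAt_goursatSum (half_pos hρ) (C := 2 * C + |lam|)
      (fun s hs' m => ?_) (fun s hs' m => ?_) (isSymm_goursatCoeff lam A) ht
    · have h1 := norm_taylorCoeff_le hρ hc hs m hs'
      have h2 : ‖(if m = 0 then lam • 1 else 0 : SquareFun)‖ * (ρ / 2) ^ m ≤ |lam| := by
        split_ifs with hm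
        · rw [hm, pow_zero, mul_one, norm_smul, Real.norm_eq_abs]
          exact mul_le_of_le_one_right (abs_nonneg _)
            ((ContinuousMap.norm_le _ zero_le_one).2 fun _ => by simp)
        · simp
      calc ‖goursatCoeff lam A m s‖ * (ρ / 2) ^ m
          ≤ (‖taylorCoeff A m s‖ + ‖(if m = 0 then lam • 1 else 0 : SquareFun)‖) * (ρ / 2) ^ m := by
            refine mul_le_mul_of_nonneg_right ((norm_add_le _ _).trans ?_) (by positivity)
            exact add_le_add_left (norm_ofDiff_le _) _
        _ ≤ 2 * C + |lam| := by rw [add_mul]; exact add_le_add h1 h2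
    · have h1 := (ofDiff.hasFDerivAt.comp_hasDerivAt s
        (hasDerivAt_taylorCoeff hρ hc hs m hs')).add_const (if m = 0 then lam • 1 else 0)
      refine h1.congr_deriv ?_
      simp [goursatCoeff]
  obtain ⟨T, hT, hsub, hsol⟩ := eventually_nhdsSet_iff_exists.1 hev
  refine ⟨_, _, _, T, hT, hsub, hsol, fun t ht ξ hξ η hη h => ?_⟩
  rw [goursatCoeff, ext_add, ofDiff_ext _ hξ hη, taylorCoeff_zero,
    hA t ht _ ⟨by positivity, h⟩]
  simp [ext]

section Kernel

variable {b G G' : ℝ → SquareFun}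

/-- The partial derivative in `ξ` of the solution of the Goursat problem. -/
noncomputable def goursatDx (b G G' : ℝ → SquareFun) (t : ℝ) : SquareFun :=
  edgeDeriv (b t) + goursatDeriv (G' t + b t * G t)

theorem IsGoursatSolutionAt.continuousAt_goursatDx {t : ℝ} (h : IsGoursatSolutionAt b G G' t) :
    ContinuousAt (goursatDx b G G') t :=
  (edgeDeriv.continuous.continuousAt.comp h.continuousAt_coeff).add
    (goursatDeriv.continuous.continuousAt.comp
      (h.continuousAt_deriv.add (h.continuousAt_coeff.mul h.hasDerivAt.continuousAt)))

theorem IsGoursatSolutionAt.hasDerivAt_fst {t ξ η : ℝ} (h : IsGoursatSolutionAt b G G' t)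
    (hξ : ξ ∈ Ioo (-3 : ℝ) 3) (hη : η ∈ Icc (-3 : ℝ) 3) :
    HasDerivAt (fun ξ => (G t).ext ξ η) ((goursatDx b G G' t).ext ξ η) ξ := by
  have := hasDerivAt_goursat_fst (b t) (G' t + b t * G t) hξ hη
  rwa [← h.eq] at this

/-- Symmetry of G gives G_η(ξ,η) = G_ξ(η,ξ). -/
theorem IsGoursatSolutionAt.hasDerivAt_snd {t ξ η : ℝ} (h : IsGoursatSolutionAt b G G' t)
    (hξ : ξ ∈ Icc (-3 : ℝ) 3) (hη : η ∈ Ioo (-3 : ℝ) 3) :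
    HasDerivAt (fun η => (G t).ext ξ η) ((goursatDx b G G' t).ext η ξ) η := by
  have := h.hasDerivAt_fst hη hξ
  simpa only [h.isSymm _ ξ] using this

/-- The derivative of the solution of the Goursat problem. -/
noncomputable def goursatFDeriv (b G G' : ℝ → SquareFun) (v : ℝ × ℝ × ℝ) : ℝ × ℝ × ℝ →L[ℝ] ℝ :=
  (ContinuousLinearMap.toSpanSingleton ℝ ((goursatDx b G G' v.2.2).ext v.1 v.2.1)).coprod
    ((ContinuousLinearMap.toSpanSingleton ℝ ((goursatDx b G G' v.2.2).ext v.2.1 v.1)).coprod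
      (ContinuousLinearMap.toSpanSingleton ℝ ((G' v.2.2).ext v.1 v.2.1)))

theorem hasFDerivAt_goursat {T : Set ℝ} (hT : IsOpen T) (h : ∀ t ∈ T, IsGoursatSolutionAt b G G' t)
    {v : ℝ × ℝ × ℝ} (hv : v ∈ Ioo (-3 : ℝ) 3 ×ˢ Ioo (-3 : ℝ) 3 ×ˢ T) :
    HasFDerivAt (fun v : ℝ × ℝ × ℝ => (G v.2.2).ext v.1 v.2.1) (goursatFDeriv b G G' v) v := by
  have h2 : ∀ v : ℝ × ℝ × ℝ, ContinuousAt (fun v : ℝ × ℝ × ℝ => v.2.2) v := fun v => by fun_prop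
  refine hasFDerivAt_of_continuous_partials (O := Ioo (-3 : ℝ) 3 ×ˢ Ioo (-3 : ℝ) 3 ×ˢ T)
    (p := fun v => (goursatDx b G G' v.2.2).ext v.1 v.2.1)
    (q := fun v => (goursatDx b G G' v.2.2).ext v.2.1 v.1)
    (r := fun v => (G' v.2.2).ext v.1 v.2.1)
    (isOpen_Ioo.prod (isOpen_Ioo.prod hT))
    (fun v hv => (h _ hv.2.2).hasDerivAt_fst hv.1 (Ioo_subset_Icc_self hv.2.1))
    (fun v hv => (h _ hv.2.2).hasDerivAt_snd (Ioo_subset_Icc_self hv.1) hv.2.1)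
    (fun v hv => (evalCLM v.1 v.2.1).hasFDerivAt.comp_hasDerivAt _ (h _ hv.2.2).hasDerivAt)
    (fun v hv => continuousAt_ext ((h _ hv.2.2).continuousAt_goursatDx.comp (f := fun v : ℝ × ℝ × ℝ => v.2.2) (h2 v))
      (by fun_prop) (by fun_prop))
    (fun v hv => continuousAt_ext ((h _ hv.2.2).continuousAt_goursatDx.comp (f := fun v : ℝ × ℝ × ℝ => v.2.2) (h2 v))
      (by fun_prop) (by fun_prop))
    (fun v hv => continuousAt_ext ((h _ hv.2.2).continuousAt_deriv.comp (f := fun v : ℝ × ℝ × ℝ => v.2.2) (h2 v))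
      (by fun_prop) (by fun_prop)) hv

theorem continuousAt_goursatFDeriv {T : Set ℝ} (h : ∀ t ∈ T, IsGoursatSolutionAt b G G' t)
    {v : ℝ × ℝ × ℝ} (hv : v.2.2 ∈ T) : ContinuousAt (goursatFDeriv b G G') v := by
  have h2 : ContinuousAt (fun v : ℝ × ℝ × ℝ => v.2.2) v := by fun_prop
  have hL : Continuous fun c : ℝ => ContinuousLinearMap.toSpanSingleton ℝ c :=
    (ContinuousLinearMap.toSpanSingletonCLE (𝕜 := ℝ) (E := ℝ)).continuous
  unfold goursatFDeriv
  simp only [← ContinuousLinearMap.comp_fst_add_comp_snd]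
  have c1 := hL.continuousAt.comp (continuousAt_ext (((h _ hv).continuousAt_goursatDx).comp (f := fun v : ℝ × ℝ × ℝ => v.2.2) h2)
    continuousAt_fst (continuousAt_snd.fst))
  have c2 := hL.continuousAt.comp (continuousAt_ext (((h _ hv).continuousAt_goursatDx).comp (f := fun v : ℝ × ℝ × ℝ => v.2.2) h2)
    (continuousAt_snd.fst) continuousAt_fst)
  have c3 := hL.continuousAt.comp (continuousAt_ext (((h _ hv).continuousAt_deriv).comp (f := fun v : ℝ × ℝ × ℝ => v.2.2) h2)
    continuousAt_fst (continuousAt_snd.fst))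
  exact (c1.clm_comp continuousAt_const).add
    (((c2.clm_comp continuousAt_const).add (c3.clm_comp continuousAt_const)).clm_comp
      continuousAt_const)

end Kernel

end SquareFun

/-- The characteristic coordinates `(x + y, x - y, t)`. -/
def characteristicCoord : ℝ × ℝ × ℝ →L[ℝ] ℝ × ℝ × ℝ :=
  (ContinuousLinearMap.fst ℝ ℝ (ℝ × ℝ) + (ContinuousLinearMap.fst ℝ ℝ ℝ).comp
      (ContinuousLinearMap.snd ℝ ℝ (ℝ × ℝ))).prod
    ((ContinuousLinearMap.fst ℝ ℝ (ℝ × ℝ) - (ContinuousLinearMap.fst ℝ ℝ ℝ).comp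
      (ContinuousLinearMap.snd ℝ ℝ (ℝ × ℝ))).prod
      ((ContinuousLinearMap.snd ℝ ℝ ℝ).comp (ContinuousLinearMap.snd ℝ ℝ (ℝ × ℝ))))

-- Take k(x,y,t) = G(x+y, x−y, t). Then k_x + k_y = 2G_ξ and ∂_x − ∂_y = 2∂_η, so the wave operator
-- is 4G_ξη. On y = 0 the derivative k_y = G_ξ − G_η vanishes by symmetry, and at the corner both
-- integrals that define G are empty.
open SquareFun in
theorem exists_isNeumannKernel {lam : ℝ} {a : ℝ → ℝ → ℝ}
    (ha_cont : ∀ t ∈ Ico (0 : ℝ) 1, ContinuousOn (fun x => a x t) (Icc (0 : ℝ) 1))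
    (ha : AnalyticInTimeUniformly a) : ∃ k : ℝ × ℝ × ℝ → ℝ, IsNeumannKernel a lam k := by
  obtain ⟨b, G, G', T, hT, hsub, hsol, hb⟩ := exists_isGoursatSolutionAt (lam := lam) ha_cont ha
  set k : ℝ × ℝ × ℝ → ℝ := fun p => (G p.2.2).ext (p.1 + p.2.1) (p.1 - p.2.1) with hk
  -- On the domain x + y and x − y lie in [0,2], strictly inside the square (−3,3)². So k is
  -- differentiable in a full neighbourhood and its one-sided derivatives are ordinary ones.
  have hmem : ∀ p ∈ kernelDomain,
      characteristicCoord p ∈ Ioo (-3 : ℝ) 3 ×ˢ Ioo (-3 : ℝ) 3 ×ˢ T := by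
    rintro ⟨x, y, t⟩ ⟨h1, h2, h3, h4, h5⟩
    simp only at h1 h2 h3 h4 h5
    exact ⟨⟨by simp [characteristicCoord]; linarith, by simp [characteristicCoord]; linarith⟩,
      ⟨by simp [characteristicCoord]; linarith, by simp [characteristicCoord]; linarith⟩,
      hsub ⟨h4, h5⟩⟩
  have hder : ∀ p ∈ kernelDomain, HasFDerivAt k
      ((goursatFDeriv b G G' (characteristicCoord p)).comp characteristicCoord) p := fun p hp =>
    (hasFDerivAt_goursat hT hsol (hmem p hp)).comp p characteristicCoord.hasFDerivAt
  have hfd : ∀ p ∈ kernelDomain, fderivWithin ℝ k kernelDomain p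
      = (goursatFDeriv b G G' (characteristicCoord p)).comp characteristicCoord := fun p hp =>
    (hder p hp).hasFDerivWithinAt.fderivWithin (uniqueDiffOn_kernelDomain p hp)
  set P := goursatDx b G G' with hP
  have hdx : ∀ x y t, (x, y, t) ∈ kernelDomain →
      kernelDx k (x, y, t) = (P t).ext (x + y) (x - y) + (P t).ext (x - y) (x + y) := fun x y t hp => by
    simp [kernelDx, hfd _ hp, goursatFDeriv, characteristicCoord, hP]
  have hdy : ∀ x y t, (x, y, t) ∈ kernelDomain →
      kernelDy k (x, y, t) = (P t).ext (x + y) (x - y) - (P t).ext (x - y) (x + y) := fun x y t hp => by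
    simp [kernelDy, hfd _ hp, goursatFDeriv, characteristicCoord, hP, sub_eq_add_neg]
  have hdt : ∀ x y t, (x, y, t) ∈ kernelDomain →
      kernelDt k (x, y, t) = (G' t).ext (x + y) (x - y) := fun x y t hp => by
    simp [kernelDt, hfd _ hp, goursatFDeriv, characteristicCoord]
  -- On the diagonal η = 0, where the double integral does not contribute to G_ξ, and |ξ − η|/2 = x.
  have hdiag : ∀ x ∈ Icc (0 : ℝ) 1, ∀ t ∈ Ico (0 : ℝ) 1,
      4 * (P t).ext (x + x) 0 = a x t + lam := fun x hx t ht => by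
    have h1 : x + x ∈ Icc (-3 : ℝ) 3 := ⟨by linarith [hx.1], by linarith [hx.2]⟩
    have h2 : |x + x - 0| / 2 = x := by rw [sub_zero, abs_of_nonneg (by linarith [hx.1])]; ring
    rw [hP, goursatDx, ext_add, edgeDeriv_ext, goursatDeriv_ext _ h1 (by norm_num),
      hb t ht _ h1 0 (by norm_num) (h2.trans_le hx.2), h2]
    simp
  refine ⟨k, ?_, ?_, ?_, ?_, ?_⟩
  · rw [show (1 : WithTop ℕ∞) = 0 + 1 from rfl,
      contDiffOn_succ_iff_fderivWithin uniqueDiffOn_kernelDomain, contDiffOn_zero]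
    refine ⟨fun p hp => (hder p hp).differentiableAt.differentiableWithinAt, by simp, ?_⟩
    refine ContinuousOn.congr (fun p hp => ?_) hfd
    refine ContinuousAt.continuousWithinAt ?_
    exact ((continuousAt_goursatFDeriv hsol (hmem p hp).2.2).comp
      characteristicCoord.continuous.continuousAt).clm_comp continuousAt_const
  · intro x y t hy hyx hx ht
    have hp : (x, y, t) ∈ kernelDomain := ⟨hy.le, hyx.le, hx.le, ht.1, ht.2⟩
    have hη : x - y ∈ Ioo (-3 : ℝ) 3 := ⟨by linarith, by linarith⟩
    have hξ : x + y ∈ Icc (-3 : ℝ) 3 := ⟨by linarith, by linarith⟩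
    -- Only the integral part of G_ξ depends on η.
    have h1 : HasDerivAt (fun η => (P t).ext (x + y) η)
        (1 / 4 * (G' t + b t * G t).ext (x + y) (x - y)) (x - y) := by
      have h2 := (hasDerivAt_goursatDeriv_snd (G' t + b t * G t) hξ hη).const_add
        (1 / 4 * (b t).ext (x + y) 0)
      exact h2
    have h3 : HasDerivAt (fun s : ℝ => x - y + 2 * s) 2 0 := by
      simpa using ((hasDerivAt_id (0 : ℝ)).const_mul 2).const_add (x - y)
    have h4 : HasDerivAt (fun s : ℝ => 2 * (P t).ext (x + y) (x - y + 2 * s))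
        (2 * (1 / 4 * (G' t + b t * G t).ext (x + y) (x - y) * 2)) 0 :=
      (HasDerivAt.comp (h := fun s : ℝ => x - y + 2 * s)
        (h₂ := fun η => (P t).ext (x + y) η) 0 (by simpa using h1) h3).const_mul 2
    have hval : kernelDt k (x, y, t) + (a y t + lam) * k (x, y, t)
        = 2 * (1 / 4 * (G' t + b t * G t).ext (x + y) (x - y) * 2) := by
      have h5 : |x + y - (x - y)| / 2 = y := by
        rw [show x + y - (x - y) = 2 * y by ring, abs_of_pos (by linarith)]; ring
      have h6 := hb t ht _ hξ _ (Ioo_subset_Icc_self hη) (by rw [h5]; linarith)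
      rw [h5] at h6
      rw [hdt x y t hp, ext_add, ext_mul, h6, hk]
      ring
    rw [hval]
    refine h4.congr_of_eventuallyEq ?_
    have hnear : ∀ᶠ s : ℝ in 𝓝 0, 0 < y - s ∧ y - s < x + s ∧ x + s < 1 := by
      refine (Filter.Tendsto.eventually_const_lt (u := 0) (v := y) hy ?_).and
        ((Filter.Tendsto.eventually_lt (y := y) (z := x) ?_ ?_ hyx).and
          (Filter.Tendsto.eventually_lt_const (v := x) hx ?_))
      all_goals exact Continuous.tendsto' (by fun_prop) _ _ (by simp)
    filter_upwards [hnear] with s ⟨hs1, hs2, hs3⟩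
    have hps : (x + s, y - s, t) ∈ kernelDomain := ⟨hs1.le, hs2.le, hs3.le, ht.1, ht.2⟩
    rw [hdx _ _ _ hps, hdy _ _ _ hps, show x + s + (y - s) = x + y by ring,
      show x + s - (y - s) = x - y + 2 * s by ring]
    ring
  · intro x hx t ht
    rw [hdy x 0 t ⟨le_rfl, hx.1, hx.2, ht.1, ht.2⟩]
    simp
  · intro x hx t ht
    have hp : (x, x, t) ∈ kernelDomain := ⟨hx.1, le_rfl, hx.2, ht.1, ht.2⟩
    have h1 : HasDerivAt (fun ξ => (G t).ext ξ 0) ((P t).ext (x + x) 0) (x + x) :=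
      (hsol t (hsub ht)).hasDerivAt_fst ⟨by linarith [hx.1], by linarith [hx.2]⟩ (by norm_num)
    have h2 : HasDerivAt (fun s : ℝ => k (s, s, t)) ((P t).ext (x + x) 0 * (1 + 1)) x := by
      have := h1.comp (h := fun s : ℝ => s + s) x ((hasDerivAt_id x).add (hasDerivAt_id x))
      simpa [hk, Function.comp_def] using this
    rw [h2.hasDerivWithinAt.derivWithin (uniqueDiffOn_Icc zero_lt_one x hx), hdx x x t hp,
      hdy x x t hp, sub_self, ← hdiag x hx t ht]
    ring
  · intro t ht
    have h0 : (0 : ℝ) ∈ Icc (-3 : ℝ) 3 := by norm_num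
    rw [hk]
    simp only [add_zero, sub_zero]
    rw [(hsol t (hsub ht)).eq, ext_add, edge_ext _ h0 h0, goursat_ext _ h0 h0]
    simp

theorem theorem3p1 (lam : ℝ) (hlam : 0 < lam) (a : ℝ → ℝ → ℝ)
    (ha_cont : ∀ t ∈ Ico (0 : ℝ) 1, ContinuousOn (fun x => a x t) (Icc (0 : ℝ) 1))
    (ha_analytic : AnalyticInTimeUniformly a) :
    (∃ k : ℝ × ℝ × ℝ → ℝ, IsNeumannKernel a lam k) ∧
    ∀ k : ℝ × ℝ × ℝ → ℝ, IsNeumannKernel a lam k →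
      (∃ M : ℝ → ℝ, (∀ t₀ ∈ Ioo (0 : ℝ) 1, 0 < M t₀) ∧
        ∀ u₀ : ℝ → ℝ, MemH1 u₀ → u₀ 1 = - ∫ y in (0 : ℝ)..1, k (1, y, 0) * u₀ y →
          ∃ u : ℝ → ℝ → ℝ, ∀ t₀ ∈ Ioo (0 : ℝ) 1,
            IsStrongSolution a (DirichletFeedback k) u₀ t₀ u ∧
            (∀ v : ℝ → ℝ → ℝ, IsStrongSolution a (DirichletFeedback k) u₀ t₀ v →
              ∀ x ∈ Icc (0 : ℝ) 1, ∀ t ∈ Icc (0 : ℝ) t₀, v x t = u x t) ∧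
            ∀ t ∈ Ioo (0 : ℝ) t₀,
              h1Norm (fun x => u x t) ≤ M t₀ * h1Norm u₀ * Real.exp (-lam * t)) ∧
      (∃ M : ℝ → ℝ, (∀ t₀ ∈ Ioo (0 : ℝ) 1, 0 < M t₀) ∧
        ∀ u₀ : ℝ → ℝ, MemH1 u₀ →
          ∃ u : ℝ → ℝ → ℝ, ∀ t₀ ∈ Ioo (0 : ℝ) 1,
            IsStrongSolution a (NeumannFeedback k) u₀ t₀ u ∧
            (∀ v : ℝ → ℝ → ℝ, IsStrongSolution a (NeumannFeedback k) u₀ t₀ v →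
              ∀ x ∈ Icc (0 : ℝ) 1, ∀ t ∈ Icc (0 : ℝ) t₀, v x t = u x t) ∧
            ∀ t ∈ Ioo (0 : ℝ) t₀,
              h1Norm (fun x => u x t) ≤ M t₀ * h1Norm u₀ * Real.exp (-lam * t)) := by
  have ha := ha_analytic.continuousOn_uncurry ha_cont
  exact ⟨exists_isNeumannKernel ha_cont ha_analytic, fun k hk =>
    ⟨closedLoop_dirichlet hk ha hlam, closedLoop_neumann hk ha hlam⟩⟩
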